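/- Computational model. Algorithms are deterministic and run on a word RAM (unit-cost arithmetic, comparisons, bitwise operations, shifts and indirect addressing; memory initially zero) with words of $O(\log n)$ bits, where $n$ is the number of nodes; for a dynamic algorithm that processes $T$ operations on a graph with $N$ nodes the words have $O(\log(N+T))$ bits. Edge weights are integers bounded in absolute value by an arbitrary fixed power of the number of nodes. That a problem is solved within a bound means that it is solved for every such power, where the program and the constants hidden in $O(\cdot)$ may depend on the power. APSP conjecture. For no $\varepsilon>0$ can the all pairs shortest path distances of weighted directed $n$-node graphs (weights of either sign, no negative cycles) be computed in time $O(n^{3-\varepsilon})$. Dynamic problems. A plane graph $H$ with $N$ nodes (given with its crossing-free straight-line drawing with integer coordinates of polynomial size) and two of its nodes $s,t$ are fixed in advance. The dynamic graph $G$ always consists of some of the edges of $H$, with nonnegative integer weights, so that its planar embedding never changes. Initially $G$ has no edges. An update inserts an absent edge of $H$ with a given weight, or deletes a present edge. A query asks for the current value of one quantity, namely, for one of three problems: the length of a shortest $s,t$-path in the undirected graph $G$ ($s,t$-shortest path); the least weight of a directed cycle, where every edge of $H$ has a fixed direction (directed girth); or the largest shortest path distance between two nodes of the undirected graph $G$ (diameter).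 The answer is $\infty$ if there is no such path, no cycle, or if $G$ is disconnected, respectively. An algorithm has amortized update time $u(N)$ and amortized query time $q(N)$ if there is a constant $a$, independent of the bound on the weights and coordinates, such that it processes every sequence of $U$ updates and $Q$ queries online in total time $O(N^a+U\cdot u(N)+Q\cdot q(N))$; that is, polynomial-time preprocessing is allowed. Theorem. Assume the APSP conjecture. Let some algorithm solve the dynamic $s,t$-shortest path problem, the dynamic directed girth problem, or the dynamic diameter problem, as above, with amortized update time $u(N)$ and amortized query time $q(N)$. Then for every $\varepsilon>0$ it is not the case that $\max(q(N),u(N))=O(N^{1/2-\varepsilon})$. Furthermore, if $q(N)\ge u(N)$ for all sufficiently large $N$, then for every $\varepsilon>0$ it is not the case that $q(N)\cdot u(N)=O(N^{1-\varepsilon})$. -/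

import Mathlib

/-! ## The word RAM

Programs are structured programs over finitely many zero-initialised memory banks (arrays), each
indexed by words.  A scalar variable is a cell with a constant address.  Every word that occurs in a
computation has to be smaller than the bound `B`, so with `B` polynomial in the input size this is
the word RAM with words of logarithmically many bits and unit-cost arithmetic, comparisons,
bitwise operations, shifts and indirect addressing. -/

namespace WordRAM

/-- The contents of the memory: bank, then address. -/
abbrev State := ℕ → ℕ → ℕ

/-- The unit-cost operations on words. -/
inductive BinOp
  | add | sub | mul | div | mod | land | lor | xor | shl | shr | lt | eq

/-- The (unbounded) result of an operation; subtraction is truncated, comparisons give 0 or 1. -/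
def BinOp.apply : BinOp → ℕ → ℕ → ℕ
  | .add, a, b => a + b
  | .sub, a, b => a - b
  | .mul, a, b => a * b
  | .div, a, b => a / b
  | .mod, a, b => a % b
  | .land, a, b => a &&& b
  | .lor, a, b => a ||| b
  | .xor, a, b => a ^^^ b
  | .shl, a, b => a <<< b
  | .shr, a, b => a >>> b
  | .lt, a, b => if a < b then 1 else 0
  | .eq, a, b => if a = b then 1 else 0

/-- Expressions: constants, memory reads (at a computed address of a fixed bank), operations. -/
inductive Expr
  | lit (v : ℕ)
  | read (bank : ℕ) (addr : Expr)
  | op (o : BinOp) (e₁ e₂ : Expr)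

/-- A value that is a word, i.e. that is smaller than `B`. -/
def word (B v : ℕ) : Option ℕ := if v < B then some v else none

/-- Evaluation of an expression; `none` if some intermediate value is not a word. -/
def Expr.eval (B : ℕ) (σ : State) : Expr → Option ℕ
  | .lit v => word B v
  | .read b e => (e.eval B σ).bind fun a => word B (σ b a)
  | .op o e₁ e₂ => (e₁.eval B σ).bind fun x => (e₂.eval B σ).bind fun y => word B (o.apply x y)

/-- The number of steps needed to evaluate an expression. -/
def Expr.cost : Expr → ℕ
  | .lit _ => 1
  | .read _ e => e.cost + 1
  | .op _ e₁ e₂ => e₁.cost + e₂.cost + 1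

/-- Structured programs. -/
inductive Prog
  | skip
  | assign (bank : ℕ) (addr val : Expr)
  | seq (p₁ p₂ : Prog)
  | ite (cond : Expr) (p₁ p₂ : Prog)
  | loop (cond : Expr) (body : Prog)

/-- Write the value `v` to the address `a` of the bank `b`. -/
def State.write (σ : State) (b a v : ℕ) : State :=
  Function.update σ b (Function.update (σ b) a v)

/-- `Exec B p σ t σ'`: started in `σ`, the program `p` halts after exactly `t` steps in `σ'`, and all
words that occur are smaller than `B`.  `loop e p` repeats `p` as long as `e` is nonzero. -/
inductive Exec (B : ℕ) : Prog → State → ℕ → State → Prop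
  | skip (σ : State) : Exec B .skip σ 1 σ
  | assign {b a v : ℕ} {e₁ e₂ : Expr} {σ : State}
      (h₁ : e₁.eval B σ = some a) (h₂ : e₂.eval B σ = some v) :
      Exec B (.assign b e₁ e₂) σ (e₁.cost + e₂.cost + 1) (σ.write b a v)
  | seq {p₁ p₂ : Prog} {σ σ' σ'' : State} {t₁ t₂ : ℕ}
      (h₁ : Exec B p₁ σ t₁ σ') (h₂ : Exec B p₂ σ' t₂ σ'') :
      Exec B (.seq p₁ p₂) σ (t₁ + t₂) σ''
  | iteTrue {e : Expr} {p₁ p₂ : Prog} {σ σ' : State} {v t : ℕ}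
      (he : e.eval B σ = some v) (hv : v ≠ 0) (h : Exec B p₁ σ t σ') :
      Exec B (.ite e p₁ p₂) σ (e.cost + 1 + t) σ'
  | iteFalse {e : Expr} {p₁ p₂ : Prog} {σ σ' : State} {t : ℕ}
      (he : e.eval B σ = some 0) (h : Exec B p₂ σ t σ') :
      Exec B (.ite e p₁ p₂) σ (e.cost + 1 + t) σ'
  | loopTrue {e : Expr} {p : Prog} {σ σ' σ'' : State} {v t₁ t₂ : ℕ}
      (he : e.eval B σ = some v) (hv : v ≠ 0) (h₁ : Exec B p σ t₁ σ')
      (h₂ : Exec B (.loop e p) σ' t₂ σ'') :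
      Exec B (.loop e p) σ (e.cost + 1 + t₁ + t₂) σ''
  | loopFalse {e : Expr} {p : Prog} {σ : State} (he : e.eval B σ = some 0) :
      Exec B (.loop e p) σ (e.cost + 1) σ

/-- The bank that holds the finite sequence `f`, followed by zeros. -/
def bankOf {m : ℕ} (f : Fin m → ℕ) : ℕ → ℕ := fun a => if h : a < m then f ⟨a, h⟩ else 0

end WordRAM

/-! ## Weighted directed graphs

A weighted directed graph on `V` is a function `w : V → V → α`, where `α` has a top element and
`w a b = ⊤` means that there is no arc from `a` to `b`.  Undirected graphs are symmetric. -/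

/-- The weight of the walk that starts at the given vertex and then visits the vertices of the list
in turn (`⊤` if one of the arcs does not exist). -/
def walkWeight {V α : Type} [AddMonoid α] (w : V → V → α) : V → List V → α
  | _, [] => 0
  | a, b :: l => w a b + walkWeight w b l

/-! ## All pairs shortest paths -/

/-- The set of the weights of all walks from `a` to `b`. -/
def walkWeights {V α : Type} [AddMonoid α] (w : V → V → α) (a b : V) : Set α :=
  {x | ∃ l : List V, (a :: l).getLast (List.cons_ne_nil a l) = b ∧ x = walkWeight w a l}

/-- No closed walk has negative weight. -/
def NoNegativeCycle {V : Type} (w : V → V → WithTop ℤ) : Prop :=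
  ∀ (v : V) (l : List V), 0 ≤ walkWeight w v (l ++ [v])

/-- Code of an extended integer, first word: 0 for `⊤`, 1 for `≥ 0`, 2 for `< 0`. -/
def signCode : WithTop ℤ → ℕ
  | ⊤ => 0
  | (z : ℤ) => if 0 ≤ z then 1 else 2

/-- Code of an extended integer, second word: the absolute value (0 for `⊤`). -/
def absCode : WithTop ℤ → ℕ
  | ⊤ => 0
  | (z : ℤ) => z.natAbs

/-- The memory that holds the `n × n` weight matrix `w`: bank 0 holds `n`; banks 1 and 2 hold the
codes of the entries in row-major order. -/
def apspInput {n : ℕ} (w : Fin n → Fin n → WithTop ℤ) : WordRAM.State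
  | 0 => WordRAM.bankOf ![n]
  | 1 => WordRAM.bankOf fun a : Fin (n * n) => signCode (w a.divNat a.modNat)
  | 2 => WordRAM.bankOf fun a : Fin (n * n) => absCode (w a.divNat a.modNat)
  | _ => fun _ => 0

/-- Banks 3 and 4 hold, in row-major order, the codes of the shortest path distances of `w`. -/
def apspOutput {n : ℕ} (w : Fin n → Fin n → WithTop ℤ) (σ : WordRAM.State) : Prop :=
  ∀ i j : Fin n, ∃ d : WithTop ℤ, IsLeast (walkWeights w i j) d ∧
    σ 3 (i * n + j) = signCode d ∧ σ 4 (i * n + j) = absCode d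

/-- APSP in general weighted directed graphs on `n` nodes, with integer weights of polynomial
size (of either sign, but without negative cycles), can be solved in time `O(T(n))` on a word RAM
with words of `O(log n)` bits. -/
def APSPSolvableIn (T : ℕ → ℝ) : Prop :=
  ∀ c : ℕ, ∃ (P : WordRAM.Prog) (k C : ℕ), ∀ n : ℕ, 1 ≤ n →
    ∀ w : Fin n → Fin n → WithTop ℤ,
      (∀ i j, ∀ z : ℤ, w i j = (z : WithTop ℤ) → |z| ≤ (n : ℤ) ^ c) → NoNegativeCycle w →
      ∃ (t : ℕ) (σ : WordRAM.State),
        WordRAM.Exec ((n + 2) ^ k) P (apspInput w) t σ ∧ apspOutput w σ ∧ (t : ℝ) ≤ C * T n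

/-- The APSP conjecture: for no `ε > 0` can APSP be solved in time `O(n ^ (3 - ε))`. -/
def APSPConjecture : Prop :=
  ∀ ε : ℝ, 0 < ε → ¬ APSPSolvableIn fun n => (n : ℝ) ^ (3 - ε)

/-! ## Dynamic problems on graphs with a fixed planar embedding -/

/-- A plane graph with `N` nodes and `m` edges: a crossing-free straight-line drawing with integer
coordinates.  (Every planar graph has such a drawing, even on a grid of linear size.)  It is the
fixed embedding in which a dynamic graph lives: the current graph always consists of some of these
edges.  Edges have an orientation, which is used in directed problems only.  The nodes `s`, `t` are
used in the `s,t`-shortest path problem only. -/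
structure PlaneGraph (N m : ℕ) where
  x : Fin N → ℕ
  y : Fin N → ℕ
  src : Fin m → Fin N
  tgt : Fin m → Fin N
  s : Fin N
  t : Fin N
  pos_injective : Function.Injective fun v => (x v, y v)
  src_ne_tgt : ∀ e, src e ≠ tgt e
  /-- No node lies in the interior of an edge. -/
  node_notMem : ∀ v e, ((x v : ℝ), (y v : ℝ)) ∉
    openSegment ℝ ((x (src e) : ℝ), (y (src e) : ℝ)) ((x (tgt e) : ℝ), (y (tgt e) : ℝ))
  /-- Different edges do not meet, except at common end nodes. -/
  edges_disjoint : ∀ e f, e ≠ f → Disjoint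
    (openSegment ℝ ((x (src e) : ℝ), (y (src e) : ℝ)) ((x (tgt e) : ℝ), (y (tgt e) : ℝ)))
    (openSegment ℝ ((x (src f) : ℝ), (y (src f) : ℝ)) ((x (tgt f) : ℝ), (y (tgt f) : ℝ)))

/-- The three problems. -/
inductive PlanarProblem
  | stShortestPath
  | directedGirth
  | diameter

namespace PlaneGraph

variable {N m : ℕ} (G : PlaneGraph N m)

/-- The current directed graph, when the present edges `e` are those with `cur e ≠ ⊤`, and `cur e`
is their weight. -/
noncomputable def arcs (cur : Fin m → ℕ∞) (a b : Fin N) : ℕ∞ :=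
  ⨅ (e : Fin m) (_ : G.src e = a ∧ G.tgt e = b), cur e

/-- The current undirected graph. -/
noncomputable def edges (cur : Fin m → ℕ∞) (a b : Fin N) : ℕ∞ :=
  min (G.arcs cur a b) (G.arcs cur b a)

/-- The quantity that has to be maintained: the length of a shortest `s,t`-path, the least weight of
a directed cycle, the largest shortest path distance (`⊤` if there is no such path, no cycle, or a
pair of nodes without a connecting path). -/
noncomputable def value (cur : Fin m → ℕ∞) : PlanarProblem → ℕ∞
  | .stShortestPath => sInf (walkWeights (G.edges cur) G.s G.t)
  | .directedGirth => ⨅ (v : Fin N) (l : List (Fin N)) (_ : (v :: l).Nodup),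
      walkWeight (G.arcs cur) v (l ++ [v])
  | .diameter => ⨆ (a : Fin N) (b : Fin N), sInf (walkWeights (G.edges cur) a b)

/-- The memory in which preprocessing starts: bank 0 holds `N, m, s, t`, banks 1 to 4 hold the
coordinates of the nodes and the end nodes of the edges. -/
def input : WordRAM.State
  | 0 => WordRAM.bankOf ![N, m, (G.s : ℕ), (G.t : ℕ)]
  | 1 => WordRAM.bankOf G.x
  | 2 => WordRAM.bankOf G.y
  | 3 => WordRAM.bankOf fun e => (G.src e : ℕ)
  | 4 => WordRAM.bankOf fun e => (G.tgt e : ℕ)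
  | _ => fun _ => 0

end PlaneGraph

/-- The operations: insert the edge `e` with weight `w`, delete the edge `e`, ask for the current
value. -/
inductive DynOp (m : ℕ)
  | insert (e : Fin m) (w : ℕ)
  | delete (e : Fin m)
  | query

/-- Is the operation a query? (The others are updates.) -/
def DynOp.isQuery {m : ℕ} : DynOp m → Bool
  | .query => true
  | _ => false

/-- A sequence of operations that is admissible when the current edges are given by `cur`: only
absent edges are inserted, with weights at most `W`, and only present edges are deleted. -/
def ValidOps {m : ℕ} (W : ℕ) : (Fin m → ℕ∞) → List (DynOp m) → Prop
  | _, [] => True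
  | cur, .insert e w :: ops => cur e = ⊤ ∧ w ≤ W ∧ ValidOps W (Function.update cur e w) ops
  | cur, .delete e :: ops => cur e ≠ ⊤ ∧ ValidOps W (Function.update cur e ⊤) ops
  | cur, .query :: ops => ValidOps W cur ops

/-- A dynamic algorithm: programs for preprocessing, the two kinds of updates, and queries, which
work on a common memory. -/
structure DynAlg where
  init : WordRAM.Prog
  insert : WordRAM.Prog
  delete : WordRAM.Prog
  query : WordRAM.Prog

/-- Code of an answer: 0 for `⊤`, and `d + 1` for `d`. -/
def answerCode : ℕ∞ → ℕ
  | ⊤ => 0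
  | (d : ℕ) => d + 1

/-- `Serves G p D B cur σ ops t`: with the edges `cur` present and the memory `σ`, the algorithm `D`
processes the operations `ops` one after the other in `t` steps altogether, and answers all queries
correctly.  The arguments of an update are put into bank 5 (the edge at address 0, the weight at
address 1); the answer to a query is left at address 0 of bank 6. -/
inductive Serves {N m : ℕ} (G : PlaneGraph N m) (p : PlanarProblem) (D : DynAlg) (B : ℕ) :
    (Fin m → ℕ∞) → WordRAM.State → List (DynOp m) → ℕ → Prop
  | nil (cur : Fin m → ℕ∞) (σ : WordRAM.State) : Serves G p D B cur σ [] 0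
  | insert {cur : Fin m → ℕ∞} {σ σ' : WordRAM.State} {e : Fin m} {w : ℕ} {ops : List (DynOp m)}
      {t₁ t₂ : ℕ} (h₁ : WordRAM.Exec B D.insert ((σ.write 5 0 e).write 5 1 w) t₁ σ')
      (h₂ : Serves G p D B (Function.update cur e w) σ' ops t₂) :
      Serves G p D B cur σ (.insert e w :: ops) (t₁ + t₂)
  | delete {cur : Fin m → ℕ∞} {σ σ' : WordRAM.State} {e : Fin m} {ops : List (DynOp m)}
      {t₁ t₂ : ℕ} (h₁ : WordRAM.Exec B D.delete (σ.write 5 0 e) t₁ σ')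
      (h₂ : Serves G p D B (Function.update cur e ⊤) σ' ops t₂) :
      Serves G p D B cur σ (.delete e :: ops) (t₁ + t₂)
  | query {cur : Fin m → ℕ∞} {σ σ' : WordRAM.State} {ops : List (DynOp m)}
      {t₁ t₂ : ℕ} (h₁ : WordRAM.Exec B D.query σ t₁ σ')
      (ha : σ' 6 0 = answerCode (G.value cur p))
      (h₂ : Serves G p D B cur σ' ops t₂) :
      Serves G p D B cur σ (.query :: ops) (t₁ + t₂)

/-- The dynamic problem `p` on plane graphs with `N` nodes, whose embedding never changes and is
known in advance, with edge weights of polynomial size, can be solved with amortized update time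
`O(u(N))` and amortized query time `O(q(N))` after preprocessing the edgeless graph in polynomial
time: every sequence of `U` updates and `Q` queries is processed, online, in total time
`O(N ^ a + U * u(N) + Q * q(N))`, on a word RAM with words of `O(log (N + U + Q))` bits. -/
def DynSolvableIn (p : PlanarProblem) (u q : ℕ → ℝ) : Prop :=
  ∃ a : ℕ, ∀ c : ℕ, ∃ (D : DynAlg) (k C : ℕ), ∀ (N m : ℕ) (G : PlaneGraph N m),
    (∀ v, G.x v ≤ N ^ c ∧ G.y v ≤ N ^ c) →
    ∀ ops : List (DynOp m), ValidOps (N ^ c) (fun _ => ⊤) ops →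
      ∃ (t₀ t : ℕ) (σ : WordRAM.State),
        WordRAM.Exec ((N + ops.length + 2) ^ k) D.init G.input t₀ σ ∧
        Serves G p D ((N + ops.length + 2) ^ k) (fun _ => ⊤) σ ops t ∧
        ((t₀ + t : ℕ) : ℝ) ≤ C * ((N : ℝ) ^ a + (ops.countP fun o => !o.isQuery) * u N +
          (ops.countP fun o => o.isQuery) * q N)

/-! # Lower bounds for dynamic planar graph problems

A dynamic algorithm for one of the three problems is turned into an algorithm for all pairs shortest
paths.  The min-plus product of two matrices is cut into blocks.  A block of the right factor is
encoded in the weights of a planar grid, and a row of a block of the left factor in the weights of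
the middle column; opening two vertical edges and asking one query yields an entry of the product.
The number of rows and columns of the grid is balanced according to the ratio of the update and the
query time; as this ratio is unknown, the programs for finitely many shapes run in parallel. -/

namespace WordRAM

/-! ### Basic facts on executions -/

/-! All pairs shortest paths reduce to logarithmically many squarings of a matrix in the (min, +)
semiring, so it suffices to square a matrix in time n³ divided by a small power of n. The squaring
is done by queries to the dynamic algorithm on a grid whose edge weights encode parts of the two
factors.

Encoding. Let `b` be an `n₂ × n₃` block of the right factor and `a` the matching `n₂` entries of a
row of the left factor, all at most `S`. The main part of the grid has inner rows 1, ..., `n₂` and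
middle column `n₃ + 1`. Query `j` opens column `n₃ + 1 - j` in the top layer and column `n₃ + 1 + j`
in the bottom layer, so a cheap path goes down at the first, crosses to the right, and goes down at
the second. A horizontal step in row y has the basic weight `(n₂ + 1 - y) * (2 * S)` left of the
middle and `y * (2 * S)` right of it. Crossing in a single row i therefore costs the same basic
weight for every i; on top come `a i`, on the edge that enters the middle column, and differences of
`b` that telescope to `b i j`. Going down during the crossing raises the basic weight by at least `2
* S`, which the entries cannot make up for, and going up costs `drop`, more than it can save. So the
distance is a known constant plus the minimum of `a i + b i j`. An explicit path (`reach_st`) gives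
the upper bound; the potential `pot` (`pot_hor`, `pot_ver`) gives the lower bound.

One grid serves the three problems. An additional first column contains the terminals `s` and `t`,
attached by edges of weight `pend`. Since `pend` exceeds all distances inside the main part, `s` and
`t` are at largest distance, which settles the diameter. The edges are directed so that every
directed cycle uses the one edge of weight `far` that leads up from `t`, which settles the girth.

Cost. Let Z be the order of the padded matrix. The right block is written once for each of the Z² /
(n₂ n₃) blocks. For each block and each of the Z rows of the left factor, about n₂ updates write the
row and n₃ queries, each surrounded by constantly many updates, read the results. A squaring thus
takes about Z³ (1/n₂ + 1/n₃) updates and Z³ / n₂ queries, besides the rewriting of the blocks. With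
`n₂` about `r ^ (K - j)` and `n₃` about `r ^ j`, the grid has `16 * r ^ K` nodes for every shape j
(`nodes_eq`), so u and q are taken at a single argument N.

Balancing. K is so large that `r ^ 3` is at most the ε-th power of N. If q u is at most a constant
times N to the power 1 - ε, some shape j makes both the update and the query part at most n³ / r up
to constants and logarithms (`exists_balanced`, `time_le`). The functions u and q need not be
computable, so the right j is unknown; all K + 1 shapes are run in parallel until one halts
(`exists_race`). Here r is about the E-th root of n with E = K (a + 1), so that the preprocessing,
of order N to the power a, stays linear in n. As E depends on a and the weights in the grid depend
on E, it matters that a does not depend on the bound on the weights.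

The statement on the maximum is the product statement for the two equal functions max(q, u), and in
the second part q may be replaced by max(q, u). -/

theorem word_eq_some {B v x : ℕ} : word B v = some x ↔ v < B ∧ v = x := by
  unfold word; split_ifs <;> simp_all

theorem Expr.eval_mono {B B' : ℕ} (h : B ≤ B') {σ : State} :
    ∀ {e : Expr} {v : ℕ}, e.eval B σ = some v → e.eval B' σ = some v := by
  intro e
  induction e with
  | lit w => intro v hv; simp only [Expr.eval, word_eq_some] at hv ⊢; omega
  | read b e ih =>
    intro v hv
    simp only [Expr.eval, Option.bind_eq_some_iff] at hv ⊢
    obtain ⟨a, ha, hv⟩ := hv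
    refine ⟨a, ih ha, ?_⟩
    simp only [word_eq_some] at hv ⊢; omega
  | op o e₁ e₂ ih₁ ih₂ =>
    intro v hv
    simp only [Expr.eval, Option.bind_eq_some_iff] at hv ⊢
    obtain ⟨a, ha, b, hb, hv⟩ := hv
    refine ⟨a, ih₁ ha, b, ih₂ hb, ?_⟩
    simp only [word_eq_some] at hv ⊢; omega

theorem Exec.mono {B B' : ℕ} (h : B ≤ B') {p : Prog} {σ σ' : State} {t : ℕ}
    (hp : Exec B p σ t σ') : Exec B' p σ t σ' := by
  induction hp with
  | skip σ => exact .skip σ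
  | assign h₁ h₂ => exact .assign (Expr.eval_mono h h₁) (Expr.eval_mono h h₂)
  | seq _ _ ih₁ ih₂ => exact .seq ih₁ ih₂
  | iteTrue he hv _ ih => exact .iteTrue (Expr.eval_mono h he) hv ih
  | iteFalse he _ ih => exact .iteFalse (Expr.eval_mono h he) ih
  | loopTrue he hv _ _ ih₁ ih₂ => exact .loopTrue (Expr.eval_mono h he) hv ih₁ ih₂
  | loopFalse he => exact .loopFalse (Expr.eval_mono h he)

theorem Expr.one_le_cost (e : Expr) : 1 ≤ e.cost := by
  cases e <;> simp [Expr.cost]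

theorem Exec.one_le {B : ℕ} {p : Prog} {σ σ' : State} {t : ℕ} (h : Exec B p σ t σ') : 1 ≤ t := by
  induction h with
  | skip => rfl
  | assign => omega
  | seq => omega
  | iteTrue => omega
  | iteFalse => omega
  | loopTrue => omega
  | loopFalse => omega

@[simp] theorem State.write_apply (σ : State) (b a v b' a' : ℕ) :
    σ.write b a v b' a' = if b' = b ∧ a' = a then v else σ b' a' := by
  unfold State.write
  by_cases hb : b' = b
  · subst hb; by_cases ha : a' = a <;> simp [ha]
  · simp [hb]

theorem State.write_of_ne (σ : State) {b b' : ℕ} (a v : ℕ) (h : b' ≠ b) :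
    σ.write b a v b' = σ b' := by
  funext a'; simp [h]

/-! ### Renaming banks -/

/-- Rename the banks in an expression. -/
def Expr.map (f : ℕ → ℕ) : Expr → Expr
  | .lit v => .lit v
  | .read b e => .read (f b) (e.map f)
  | .op o e₁ e₂ => .op o (e₁.map f) (e₂.map f)

/-- Rename the banks in a program. -/
def Prog.map (f : ℕ → ℕ) : Prog → Prog
  | .skip => .skip
  | .assign b e₁ e₂ => .assign (f b) (e₁.map f) (e₂.map f)
  | .seq p q => .seq (p.map f) (q.map f)
  | .ite e p q => .ite (e.map f) (p.map f) (q.map f)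
  | .loop e p => .loop (e.map f) (p.map f)

theorem Expr.cost_map (f : ℕ → ℕ) (e : Expr) : (e.map f).cost = e.cost := by
  induction e <;> simp_all [Expr.map, Expr.cost]

theorem Expr.eval_map {B : ℕ} {f : ℕ → ℕ} {σ τ : State} (h : ∀ b, τ (f b) = σ b) (e : Expr) :
    (e.map f).eval B τ = e.eval B σ := by
  induction e <;> simp_all [Expr.map, Expr.eval]

theorem State.write_map {f : ℕ → ℕ} (hf : f.Injective) {σ τ : State} (h : ∀ b, τ (f b) = σ b)
    (b a v : ℕ) : ∀ b', τ.write (f b) a v (f b') = σ.write b a v b' := by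
  intro b'; funext a'
  simp [h, hf.eq_iff]

/-- Banks are named by constants of the program, so injective renaming commutes with every step. The
last clause says that banks outside the range keep their contents; this is what lets several
programs share one memory. -/
theorem Exec.map {B : ℕ} {f : ℕ → ℕ} (hf : f.Injective) {p : Prog} {σ σ' : State} {t : ℕ}
    (hp : Exec B p σ t σ') : ∀ τ : State, (∀ b, τ (f b) = σ b) →
      ∃ τ', Exec B (p.map f) τ t τ' ∧ (∀ b, τ' (f b) = σ' b) ∧
        ∀ b, b ∉ Set.range f → τ' b = τ b := by
  induction hp with
  | skip σ => exact fun τ h => ⟨τ, .skip τ, h, fun _ _ => rfl⟩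
  | @assign b a v e₁ e₂ σ h₁ h₂ =>
    intro τ h
    refine ⟨τ.write (f b) a v, ?_, State.write_map hf h b a v, fun b' hb' => ?_⟩
    · rw [← Expr.cost_map f e₁, ← Expr.cost_map f e₂]
      exact .assign (by rw [Expr.eval_map h, h₁]) (by rw [Expr.eval_map h, h₂])
    · exact State.write_of_ne _ _ _ (fun hh => hb' ⟨b, hh.symm⟩)
  | seq _ _ ih₁ ih₂ =>
    intro τ h
    obtain ⟨τ₁, e₁, h₁, f₁⟩ := ih₁ τ h
    obtain ⟨τ₂, e₂, h₂, f₂⟩ := ih₂ τ₁ h₁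
    exact ⟨τ₂, .seq e₁ e₂, h₂, fun b hb => (f₂ b hb).trans (f₁ b hb)⟩
  | @iteTrue e _ _ _ _ _ _ he hv _ ih =>
    intro τ h
    obtain ⟨τ₁, e₁, h₁, f₁⟩ := ih τ h
    refine ⟨τ₁, ?_, h₁, f₁⟩
    rw [← Expr.cost_map f e]
    exact .iteTrue (by rw [Expr.eval_map h, he]) hv e₁
  | @iteFalse e _ _ _ _ _ he _ ih =>
    intro τ h
    obtain ⟨τ₁, e₁, h₁, f₁⟩ := ih τ h
    refine ⟨τ₁, ?_, h₁, f₁⟩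
    rw [← Expr.cost_map f e]
    exact .iteFalse (by rw [Expr.eval_map h, he]) e₁
  | @loopTrue e _ _ _ _ _ _ _ he hv _ _ ih₁ ih₂ =>
    intro τ h
    obtain ⟨τ₁, e₁, h₁, f₁⟩ := ih₁ τ h
    obtain ⟨τ₂, e₂, h₂, f₂⟩ := ih₂ τ₁ h₁
    refine ⟨τ₂, ?_, h₂, fun b hb => (f₂ b hb).trans (f₁ b hb)⟩
    rw [← Expr.cost_map f e]
    exact .loopTrue (by rw [Expr.eval_map h, he]) hv e₁ e₂
  | @loopFalse e _ _ he =>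
    intro τ h
    refine ⟨τ, ?_, h, fun _ _ => rfl⟩
    rw [← Expr.cost_map f e]
    exact .loopFalse (by rw [Expr.eval_map h, he])

/-! ### Evaluation without a bound on the words -/

/-- The value of an expression when words are unbounded. -/
def Expr.val (σ : State) : Expr → ℕ
  | .lit v => v
  | .read b e => σ b (e.val σ)
  | .op o e₁ e₂ => o.apply (e₁.val σ) (e₂.val σ)

/-- A bound on the cost and on the growth of an expression. -/
def Expr.size : Expr → ℕ
  | .lit v => v + 1
  | .read _ e => e.size + 1
  | .op _ e₁ e₂ => e₁.size + e₂.size + 1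

/-- The arithmetic operations and comparisons. -/
def BinOp.Arith : BinOp → Prop
  | .add | .sub | .mul | .div | .mod | .lt | .eq => True
  | _ => False

/-- The expression reads banks below `lim` only, and uses no bitwise operations. -/
def Expr.Within (lim : ℕ) : Expr → Prop
  | .lit _ => True
  | .read b e => b < lim ∧ e.Within lim
  | .op o e₁ e₂ => o.Arith ∧ e₁.Within lim ∧ e₂.Within lim

instance (n : ℕ) : OfNat Expr n := ⟨.lit n⟩
instance : Add Expr := ⟨.op .add⟩
instance : Sub Expr := ⟨.op .sub⟩
instance : Mul Expr := ⟨.op .mul⟩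
instance : Div Expr := ⟨.op .div⟩
instance : Mod Expr := ⟨.op .mod⟩

/-- Comparison. -/
def Expr.lt (e₁ e₂ : Expr) : Expr := .op .lt e₁ e₂
/-- Equality test. -/
def Expr.eq (e₁ e₂ : Expr) : Expr := .op .eq e₁ e₂
/-- A scalar variable: the cell with address 0 of a bank. -/
def Expr.var (b : ℕ) : Expr := .read b (.lit 0)
/-- A fixed power. -/
def Expr.pow (e : Expr) : ℕ → Expr
  | 0 => 1
  | k + 1 => e.pow k * e

section simp
variable (σ : State) (a b : Expr) (n lim : ℕ)

@[simp] theorem Expr.val_lit : (Expr.lit n).val σ = n := rfl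
@[simp] theorem Expr.val_ofNat : (ofNat(n) : Expr).val σ = n := rfl
@[simp] theorem Expr.val_zero : (0 : Expr).val σ = 0 := rfl
@[simp] theorem Expr.val_one : (1 : Expr).val σ = 1 := rfl
@[simp] theorem Expr.val_add : (a + b).val σ = a.val σ + b.val σ := rfl
@[simp] theorem Expr.val_sub : (a - b).val σ = a.val σ - b.val σ := rfl
@[simp] theorem Expr.val_mul : (a * b).val σ = a.val σ * b.val σ := rfl
@[simp] theorem Expr.val_div : (a / b).val σ = a.val σ / b.val σ := rfl
@[simp] theorem Expr.val_mod : (a % b).val σ = a.val σ % b.val σ := rfl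
@[simp] theorem Expr.val_lt : (a.lt b).val σ = if a.val σ < b.val σ then 1 else 0 := rfl
@[simp] theorem Expr.val_eq : (a.eq b).val σ = if a.val σ = b.val σ then 1 else 0 := rfl
@[simp] theorem Expr.val_var : (Expr.var n).val σ = σ n 0 := rfl
@[simp] theorem Expr.val_read : (Expr.read n a).val σ = σ n (a.val σ) := rfl
@[simp] theorem Expr.val_pow : (a.pow n).val σ = (a.val σ) ^ n := by
  induction n with
  | zero => rfl
  | succ k ih => simp [Expr.pow, ih, pow_succ]

@[simp] theorem Expr.within_lit : (Expr.lit n).Within lim := trivial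
@[simp] theorem Expr.within_ofNat : (ofNat(n) : Expr).Within lim := trivial
@[simp] theorem Expr.within_zero : (0 : Expr).Within lim := trivial
@[simp] theorem Expr.within_one : (1 : Expr).Within lim := trivial
@[simp] theorem Expr.within_add : (a + b).Within lim ↔ a.Within lim ∧ b.Within lim :=
  ⟨fun h => h.2, fun h => ⟨trivial, h⟩⟩
@[simp] theorem Expr.within_sub : (a - b).Within lim ↔ a.Within lim ∧ b.Within lim :=
  ⟨fun h => h.2, fun h => ⟨trivial, h⟩⟩
@[simp] theorem Expr.within_mul : (a * b).Within lim ↔ a.Within lim ∧ b.Within lim :=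
  ⟨fun h => h.2, fun h => ⟨trivial, h⟩⟩
@[simp] theorem Expr.within_div : (a / b).Within lim ↔ a.Within lim ∧ b.Within lim :=
  ⟨fun h => h.2, fun h => ⟨trivial, h⟩⟩
@[simp] theorem Expr.within_mod : (a % b).Within lim ↔ a.Within lim ∧ b.Within lim :=
  ⟨fun h => h.2, fun h => ⟨trivial, h⟩⟩
@[simp] theorem Expr.within_lt : (a.lt b).Within lim ↔ a.Within lim ∧ b.Within lim :=
  ⟨fun h => h.2, fun h => ⟨trivial, h⟩⟩
@[simp] theorem Expr.within_eq : (a.eq b).Within lim ↔ a.Within lim ∧ b.Within lim :=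
  ⟨fun h => h.2, fun h => ⟨trivial, h⟩⟩
@[simp] theorem Expr.within_var : (Expr.var n).Within lim ↔ n < lim :=
  ⟨fun h => h.1, fun h => ⟨h, trivial⟩⟩
@[simp] theorem Expr.within_read : (Expr.read n a).Within lim ↔ n < lim ∧ a.Within lim := Iff.rfl
theorem Expr.within_pow (h : a.Within lim) : (a.pow n).Within lim := by
  induction n with
  | zero => simp [Expr.pow]
  | succ k ih => simp [Expr.pow, ih, h]

end simp

theorem Expr.one_le_size (e : Expr) : 1 ≤ e.size := by
  cases e <;> simp [Expr.size]

theorem Expr.cost_le_size (e : Expr) : e.cost ≤ e.size := by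
  induction e <;> simp [Expr.size, Expr.cost] <;> omega

/-- All words in the banks below `lim` are at most `V`. -/
def State.BoundedBy (V lim : ℕ) (σ : State) : Prop := ∀ b < lim, ∀ a, σ b a ≤ V

/-- Sums and products of numbers below V^s and V^t are below V^(s+t+1), since 2 ≤ V; a literal v is
below 2^v, which explains the size `v + 1` of a literal. Shifts, which could raise the exponent
exponentially, are excluded by `Within`. -/
theorem Expr.val_lt_pow {V lim : ℕ} (hV : 2 ≤ V) {σ : State} (hσ : σ.BoundedBy V lim) :
    ∀ e : Expr, e.Within lim → e.val σ < V ^ e.size := by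
  intro e
  induction e with
  | lit v =>
    intro _
    calc v < 2 ^ v := Nat.lt_two_pow_self
      _ ≤ V ^ v := Nat.pow_le_pow_left hV v
      _ ≤ V ^ (v + 1) := Nat.pow_le_pow_right (by omega) (by omega)
  | read b e ih =>
    intro h
    have h1 := hσ b h.1 (e.val σ)
    have h2 := e.one_le_size
    calc σ b (e.val σ) ≤ V := h1
      _ = V ^ 1 := (pow_one V).symm
      _ < V ^ (e.size + 1) := Nat.pow_lt_pow_right (by omega) (by omega)
  | op o a b iha ihb =>
    intro h
    have ha := iha h.2.1
    have hb := ihb h.2.2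
    have pa : 0 < V ^ a.size := by positivity
    have pb : 0 < V ^ b.size := by positivity
    have e1 : V ^ (a.size + b.size + 1) = V ^ a.size * V ^ b.size * V := by ring
    have hprod : V ^ a.size * 1 ≤ V ^ a.size * V ^ b.size := Nat.mul_le_mul_left _ pb
    have hprod' : 1 * V ^ b.size ≤ V ^ a.size * V ^ b.size := Nat.mul_le_mul_right _ pa
    have h3 : V ^ a.size * V ^ b.size * 2 ≤ V ^ a.size * V ^ b.size * V :=
      Nat.mul_le_mul_left _ hV
    show o.apply (a.val σ) (b.val σ) < V ^ (a.size + b.size + 1)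
    rw [e1]
    have hmul : a.val σ * b.val σ ≤ V ^ a.size * V ^ b.size :=
      Nat.mul_le_mul ha.le hb.le
    have hd := Nat.div_le_self (a.val σ) (b.val σ)
    have hm := Nat.mod_le (a.val σ) (b.val σ)
    have ho := h.1
    cases o <;> simp only [BinOp.apply, BinOp.Arith] at ho ⊢ <;>
      first | omega | (split_ifs <;> omega)

/-- Here `τ` is the actual memory, which also contains the banks of the dynamic algorithm; only the
banks of the caller have to agree with `σ`. -/
theorem Expr.eval_eq_val {V lim B : ℕ} (hV : 2 ≤ V) {σ τ : State} (hσ : σ.BoundedBy V lim)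
    (hτ : ∀ b < lim, τ b = σ b) :
    ∀ e : Expr, e.Within lim → V ^ e.size ≤ B → e.eval B τ = some (e.val σ) := by
  intro e
  induction e with
  | lit v =>
    intro h hB
    have := Expr.val_lt_pow hV hσ _ h
    simp only [Expr.eval, word_eq_some]
    exact ⟨this.trans_le hB, rfl⟩
  | read b e ih =>
    intro h hB
    have := Expr.val_lt_pow hV hσ _ h
    have hle : V ^ e.size ≤ V ^ (e.size + 1) := Nat.pow_le_pow_right (by omega) (by omega)
    simp only [Expr.eval, ih h.2 (hle.trans hB), Option.bind_some, word_eq_some, hτ b h.1]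
    exact ⟨this.trans_le hB, rfl⟩
  | op o a b iha ihb =>
    intro h hB
    have := Expr.val_lt_pow hV hσ _ h
    have h1 : V ^ a.size ≤ V ^ (a.size + b.size + 1) :=
      Nat.pow_le_pow_right (by omega) (by omega)
    have h2 : V ^ b.size ≤ V ^ (a.size + b.size + 1) :=
      Nat.pow_le_pow_right (by omega) (by omega)
    simp only [Expr.eval, iha h.2.1 (h1.trans hB), ihb h.2.2 (h2.trans hB), Option.bind_some,
      word_eq_some]
    exact ⟨this.trans_le hB, rfl⟩

/-! ### Programs with calls of a dynamic algorithm -/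

/-- Programs that may call the operations of a dynamic algorithm: insert an edge, change the weight
of an edge, ask for the current value. -/
inductive Cmd
  | skip
  | assign (b : ℕ) (e₁ e₂ : Expr)
  | seq (c₁ c₂ : Cmd)
  | ite (e : Expr) (c₁ c₂ : Cmd)
  | loop (e : Expr) (c : Cmd)
  | insert (e w : Expr)
  | set (e w : Expr)
  | query (b : ℕ)

namespace Cmd

/-- The idealised semantics: the state of the calling program, the current edges, the list of the
operations that are called, and the number of steps. -/
inductive Run {m : ℕ} (val : (Fin m → ℕ∞) → ℕ∞) (V W : ℕ) :
    Cmd → State → (Fin m → ℕ∞) → List (DynOp m) → ℕ → State → (Fin m → ℕ∞) → Prop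
  | skip (σ : State) (cur : Fin m → ℕ∞) : Run val V W .skip σ cur [] 1 σ cur
  | assign {b : ℕ} {e₁ e₂ : Expr} {σ : State} {cur : Fin m → ℕ∞} (h : e₂.val σ ≤ V) :
      Run val V W (.assign b e₁ e₂) σ cur [] 1 (σ.write b (e₁.val σ) (e₂.val σ)) cur
  | seq {c₁ c₂ : Cmd} {σ σ' σ'' : State} {cur cur' cur'' : Fin m → ℕ∞} {l₁ l₂ : List (DynOp m)}
      {t₁ t₂ : ℕ} (h₁ : Run val V W c₁ σ cur l₁ t₁ σ' cur')
      (h₂ : Run val V W c₂ σ' cur' l₂ t₂ σ'' cur'') :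
      Run val V W (.seq c₁ c₂) σ cur (l₁ ++ l₂) (t₁ + t₂) σ'' cur''
  | iteTrue {e : Expr} {c₁ c₂ : Cmd} {σ σ' : State} {cur cur' : Fin m → ℕ∞}
      {l : List (DynOp m)} {t : ℕ} (he : e.val σ ≠ 0) (h : Run val V W c₁ σ cur l t σ' cur') :
      Run val V W (.ite e c₁ c₂) σ cur l (t + 1) σ' cur'
  | iteFalse {e : Expr} {c₁ c₂ : Cmd} {σ σ' : State} {cur cur' : Fin m → ℕ∞}
      {l : List (DynOp m)} {t : ℕ} (he : e.val σ = 0) (h : Run val V W c₂ σ cur l t σ' cur') :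
      Run val V W (.ite e c₁ c₂) σ cur l (t + 1) σ' cur'
  | loopTrue {e : Expr} {c : Cmd} {σ σ' σ'' : State} {cur cur' cur'' : Fin m → ℕ∞}
      {l₁ l₂ : List (DynOp m)} {t₁ t₂ : ℕ} (he : e.val σ ≠ 0)
      (h₁ : Run val V W c σ cur l₁ t₁ σ' cur')
      (h₂ : Run val V W (.loop e c) σ' cur' l₂ t₂ σ'' cur'') :
      Run val V W (.loop e c) σ cur (l₁ ++ l₂) (t₁ + t₂ + 1) σ'' cur''
  | loopFalse {e : Expr} {c : Cmd} {σ : State} {cur : Fin m → ℕ∞} (he : e.val σ = 0) :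
      Run val V W (.loop e c) σ cur [] 1 σ cur
  | insert {e w : Expr} {σ : State} {cur : Fin m → ℕ∞} (h : e.val σ < m)
      (hcur : cur ⟨_, h⟩ = ⊤) (hw : w.val σ ≤ W) :
      Run val V W (.insert e w) σ cur [.insert ⟨_, h⟩ (w.val σ)] 1 σ
        (Function.update cur ⟨_, h⟩ (w.val σ))
  | set {e w : Expr} {σ : State} {cur : Fin m → ℕ∞} (h : e.val σ < m)
      (hcur : cur ⟨_, h⟩ ≠ ⊤) (hw : w.val σ ≤ W) :
      Run val V W (.set e w) σ cur [.delete ⟨_, h⟩, .insert ⟨_, h⟩ (w.val σ)] 1 σ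
        (Function.update cur ⟨_, h⟩ (w.val σ))
  | query {b : ℕ} {σ : State} {cur : Fin m → ℕ∞} (hV : answerCode (val cur) ≤ V) :
      Run val V W (.query b) σ cur [.query] 1 (σ.write b 0 (answerCode (val cur))) cur

/-- The banks that a program modifies. -/
def mods : Cmd → List ℕ
  | .assign b _ _ => [b]
  | .seq c₁ c₂ => c₁.mods ++ c₂.mods
  | .ite _ c₁ c₂ => c₁.mods ++ c₂.mods
  | .loop _ c => c.mods
  | .query b => [b]
  | _ => []

/-- The program uses banks below `lim` only. -/
def Within (lim : ℕ) : Cmd → Prop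
  | .skip => True
  | .assign b e₁ e₂ => b < lim ∧ e₁.Within lim ∧ e₂.Within lim
  | .seq c₁ c₂ => c₁.Within lim ∧ c₂.Within lim
  | .ite e c₁ c₂ => e.Within lim ∧ c₁.Within lim ∧ c₂.Within lim
  | .loop e c => e.Within lim ∧ c.Within lim
  | .insert e w => e.Within lim ∧ w.Within lim
  | .set e w => e.Within lim ∧ w.Within lim
  | .query b => b < lim

/-- A bound on the size of expressions and on the cost of single steps. -/
def size : Cmd → ℕ
  | .skip => 1
  | .assign _ e₁ e₂ => e₁.size + e₂.size + 1
  | .seq c₁ c₂ => c₁.size + c₂.size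
  | .ite e c₁ c₂ => e.size + c₁.size + c₂.size + 1
  | .loop e c => e.size + c.size + 1
  | .insert e w => e.size + w.size + 10
  | .set e w => e.size + e.size + w.size + 10
  | .query _ => 10

/-- The program on the word RAM; the dynamic algorithm works on the banks from `lim` on. -/
def toProg (D : DynAlg) (lim : ℕ) : Cmd → Prog
  | .skip => .skip
  | .assign b e₁ e₂ => .assign b e₁ e₂
  | .seq c₁ c₂ => .seq (c₁.toProg D lim) (c₂.toProg D lim)
  | .ite e c₁ c₂ => .ite e (c₁.toProg D lim) (c₂.toProg D lim)
  | .loop e c => .loop e (c.toProg D lim)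
  | .insert e w => .seq (.seq (.assign (5 + lim) (.lit 0) e) (.assign (5 + lim) (.lit 1) w))
      (D.insert.map (· + lim))
  | .set e w => .seq (.seq (.assign (5 + lim) (.lit 0) e) (D.delete.map (· + lim)))
      (.seq (.seq (.assign (5 + lim) (.lit 0) e) (.assign (5 + lim) (.lit 1) w))
        (D.insert.map (· + lim)))
  | .query b => .seq (D.query.map (· + lim)) (.assign b (.lit 0) (.read (6 + lim) (.lit 0)))

variable {m : ℕ} {val : (Fin m → ℕ∞) → ℕ∞} {V W : ℕ}

theorem Run.frame {c : Cmd} {σ σ' : State} {cur cur' : Fin m → ℕ∞} {l : List (DynOp m)} {t : ℕ}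
    (h : Run val V W c σ cur l t σ' cur') : ∀ b, b ∉ c.mods → σ' b = σ b := by
  induction h with
  | skip => exact fun _ _ => rfl
  | assign => intro b hb; exact State.write_of_ne _ _ _ (by simpa [mods] using hb)
  | seq _ _ ih₁ ih₂ =>
    intro b hb
    simp only [mods, List.mem_append, not_or] at hb
    rw [ih₂ b hb.2, ih₁ b hb.1]
  | iteTrue _ _ ih =>
    intro b hb
    simp only [mods, List.mem_append, not_or] at hb
    exact ih b hb.1
  | iteFalse _ _ ih =>
    intro b hb
    simp only [mods, List.mem_append, not_or] at hb
    exact ih b hb.2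
  | loopTrue _ _ _ ih₁ ih₂ => intro b hb; rw [ih₂ b hb, ih₁ b hb]
  | loopFalse => exact fun _ _ => rfl
  | insert => exact fun _ _ => rfl
  | set => exact fun _ _ => rfl
  | query => intro b hb; exact State.write_of_ne _ _ _ (by simpa [mods] using hb)

theorem Run.bounded {c : Cmd} {σ σ' : State} {cur cur' : Fin m → ℕ∞} {l : List (DynOp m)} {t : ℕ}
    (h : Run val V W c σ cur l t σ' cur') {lim : ℕ} (hσ : σ.BoundedBy V lim) :
    σ'.BoundedBy V lim := by
  induction h with
  | skip => exact hσ
  | assign h =>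
    intro b hb a
    rw [State.write_apply]; split_ifs
    · exact h
    · exact hσ b hb a
  | seq _ _ ih₁ ih₂ => exact ih₂ (ih₁ hσ)
  | iteTrue _ _ ih => exact ih hσ
  | iteFalse _ _ ih => exact ih hσ
  | loopTrue _ _ _ ih₁ ih₂ => exact ih₂ (ih₁ hσ)
  | loopFalse => exact hσ
  | insert => exact hσ
  | set => exact hσ
  | query h =>
    intro b hb a
    rw [State.write_apply]; split_ifs
    · exact h
    · exact hσ b hb a

/-- An arbitrary continuation `r` is carried along so that sequential composition is a plain append.
-/
theorem Run.validOps {c : Cmd} {σ σ' : State} {cur cur' : Fin m → ℕ∞} {l : List (DynOp m)} {t : ℕ}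
    (h : Run val V W c σ cur l t σ' cur') :
    ∀ r, ValidOps W cur' r → ValidOps W cur (l ++ r) := by
  induction h with
  | skip => exact fun r h => h
  | assign => exact fun r h => h
  | seq _ _ ih₁ ih₂ => intro r h; rw [List.append_assoc]; exact ih₁ _ (ih₂ _ h)
  | iteTrue _ _ ih => exact ih
  | iteFalse _ _ ih => exact ih
  | loopTrue _ _ _ ih₁ ih₂ => intro r h; rw [List.append_assoc]; exact ih₁ _ (ih₂ _ h)
  | loopFalse => exact fun r h => h
  | insert h hcur hw => exact fun r h => ⟨hcur, hw, h⟩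
  | set h hcur hw =>
    refine fun r h => ⟨hcur, by simp, hw, ?_⟩
    rwa [Function.update_idem]
  | query => exact fun r h => h

/-- The factor 2 comes from `set`, a single step that issues a deletion and an insertion. -/
theorem Run.length_le {c : Cmd} {σ σ' : State} {cur cur' : Fin m → ℕ∞} {l : List (DynOp m)} {t : ℕ}
    (h : Run val V W c σ cur l t σ' cur') : l.length ≤ 2 * t := by
  induction h <;>
    (try simp only [List.length_append, List.length_nil, List.length_cons]) <;> omega

end Cmd
end WordRAM

/-! ### Simulation of calling programs on the word RAM -/

namespace WordRAM
namespace Cmd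

variable {m : ℕ} {val : (Fin m → ℕ∞) → ℕ∞} {V W : ℕ}

theorem one_le_size (c : Cmd) : 1 ≤ c.size := by
  induction c <;> simp only [size] <;> omega

end Cmd

theorem add_notMem_range {lim b : ℕ} (h : b < lim) : b ∉ Set.range (· + lim) := by
  rintro ⟨x, hx⟩
  simp only at hx
  omega

/-- A call of a program of the dynamic algorithm does not touch the banks of the caller. -/
theorem Exec.shift {B lim : ℕ} {p : Prog} {τ δ δ' : State} {t : ℕ} (hp : Exec B p δ t δ')
    (h : ∀ b, τ (b + lim) = δ b) :
    ∃ τ', Exec B (p.map (· + lim)) τ t τ' ∧ (∀ b, τ' (b + lim) = δ' b) ∧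
      ∀ b < lim, τ' b = τ b := by
  obtain ⟨τ', h₁, h₂, h₃⟩ := hp.map (add_left_injective lim) τ h
  exact ⟨τ', h₁, h₂, fun b hb => h₃ b (add_notMem_range hb)⟩

theorem Exec.storeArg {B lim V : ℕ} (hV : 2 ≤ V) {e : Expr} {σ τ : State}
    (hσ : σ.BoundedBy V lim) (hτ : ∀ b < lim, τ b = σ b) (he : e.Within lim) {s : ℕ}
    (hs : e.size + 2 ≤ s) (hB : V ^ s ≤ B) (a : ℕ) (ha : a < 2) :
    Exec B (.assign (5 + lim) (.lit a) e) τ (e.cost + 2) (τ.write (5 + lim) a (e.val σ)) := by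
  have hB' : V ^ e.size ≤ B := (Nat.pow_le_pow_right (by omega) (by omega)).trans hB
  have hB2 : V ^ 1 ≤ B := (Nat.pow_le_pow_right (by omega) (by omega)).trans hB
  have h1 : (Expr.lit a).eval B τ = some a := by
    rw [pow_one] at hB2
    simp only [Expr.eval, word_eq_some]; simp; omega
  have := Exec.assign (b := 5 + lim) h1 (Expr.eval_eq_val hV hσ hτ e he hB')
  rwa [Expr.cost, show 1 + e.cost + 1 = e.cost + 2 by ring] at this

namespace Cmd

variable {m : ℕ} {V W : ℕ}

-- The memory splits into the banks below `lim`, which follow the idealised run, and the banks from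
-- `lim` on, which follow the dynamic algorithm. A single step of the caller costs at most `s`,
-- apart from the time `tD₁` spent in calls; these calls are the front part of the list served, and
-- `r` with time `tD₂` is what remains. The bound `V ^ s ≤ B` keeps all intermediate values of
-- expressions words. The last clause is used for programs without calls, where the upper banks stay
-- as they are.
open Function in
theorem Run.simulate {N : ℕ} {G : PlaneGraph N m} {p : PlanarProblem} {D : DynAlg} {B lim : ℕ}
    (hV : 2 ≤ V) {c : Cmd} {σ σ' : State} {cur cur' : Fin m → ℕ∞} {l : List (DynOp m)} {t : ℕ}
    (h : Run (fun cur => G.value cur p) V W c σ cur l t σ' cur') :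
    ∀ {s : ℕ}, c.Within lim → σ.BoundedBy V lim → c.size ≤ s → V ^ s ≤ B →
    ∀ (τ δ : State) (r : List (DynOp m)) (tD : ℕ), (∀ b < lim, τ b = σ b) →
      (∀ b, τ (b + lim) = δ b) → Serves G p D B cur δ (l ++ r) tD →
      ∃ (τ' δ' : State) (t' tD₁ tD₂ : ℕ), Exec B (c.toProg D lim) τ t' τ' ∧
        t' ≤ s * t + tD₁ ∧ tD = tD₁ + tD₂ ∧ (∀ b < lim, τ' b = σ' b) ∧
        (∀ b, τ' (b + lim) = δ' b) ∧ Serves G p D B cur' δ' r tD₂ ∧ (l = [] → δ' = δ) := by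
  induction h with
  | skip σ cur =>
    intro s hc hσ hs hB τ δ r tD h₁ h₂ h₃
    simp only [size] at hs
    exact ⟨τ, δ, 1, 0, tD, .skip τ, by omega, by simp, h₁, h₂, h₃, fun _ => rfl⟩
  | @assign b e₁ e₂ σ cur h =>
    intro s hc hσ hs hB τ δ r tD h₁ h₂ h₃
    simp only [size] at hs
    have a1 := e₁.cost_le_size
    have a2 := e₂.cost_le_size
    refine ⟨τ.write b (e₁.val σ) (e₂.val σ), δ, _, 0, tD, .assign
      (Expr.eval_eq_val hV hσ h₁ _ hc.2.1 ((Nat.pow_le_pow_right (by omega) (by omega)).trans hB))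
      (Expr.eval_eq_val hV hσ h₁ _ hc.2.2 ((Nat.pow_le_pow_right (by omega) (by omega)).trans hB)),
      by omega, by simp, ?_, ?_, h₃, fun _ => rfl⟩
    · intro b' hb'
      funext a'
      simp [h₁ b' hb']
    · intro b'
      rw [State.write_of_ne _ _ _ (by have := hc.1; omega), h₂]
  | @seq c₁ c₂ σ σ' σ'' cur cur' cur'' l₁ l₂ t₁ t₂ r₁ r₂ ih₁ ih₂ =>
    intro s hc hσ hs hB τ δ r tD h₁ h₂ h₃
    simp only [size] at hs
    rw [List.append_assoc] at h₃
    obtain ⟨τ₁, δ₁, u₁, d₁, d₂, x₁, le₁, rfl, g₁, k₁, s₁, n₁⟩ :=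
      ih₁ hc.1 hσ (by omega) hB τ δ _ tD h₁ h₂ h₃
    obtain ⟨τ₂, δ₂, u₂, d₃, d₄, x₂, le₂, rfl, g₂, k₂, s₂, n₂⟩ :=
      ih₂ hc.2 (r₁.bounded hσ) (by omega) hB τ₁ δ₁ _ d₂ g₁ k₁ s₁
    refine ⟨τ₂, δ₂, u₁ + u₂, d₁ + d₃, d₄, .seq x₁ x₂, by rw [mul_add]; omega, by omega, g₂, k₂,
      s₂, fun hl => ?_⟩
    obtain ⟨rfl, rfl⟩ := List.append_eq_nil_iff.1 hl
    rw [n₂ rfl, n₁ rfl]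
  | @iteTrue e c₁ c₂ σ σ' cur cur' l t he r₁ ih =>
    intro s hc hσ hs hB τ δ r tD h₁ h₂ h₃
    simp only [size] at hs
    obtain ⟨τ₁, δ₁, u₁, d₁, d₂, x₁, le₁, hd, g₁, k₁, s₁, n₁⟩ :=
      ih hc.2.1 hσ (by omega) hB τ δ _ tD h₁ h₂ h₃
    have a1 := e.cost_le_size
    exact ⟨τ₁, δ₁, _, d₁, d₂, .iteTrue (Expr.eval_eq_val hV hσ h₁ _ hc.1
      ((Nat.pow_le_pow_right (by omega) (by omega)).trans hB)) he x₁, by rw [mul_add]; omega, hd,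
      g₁, k₁, s₁, n₁⟩
  | @iteFalse e c₁ c₂ σ σ' cur cur' l t he r₁ ih =>
    intro s hc hσ hs hB τ δ r tD h₁ h₂ h₃
    simp only [size] at hs
    obtain ⟨τ₁, δ₁, u₁, d₁, d₂, x₁, le₁, hd, g₁, k₁, s₁, n₁⟩ :=
      ih hc.2.2 hσ (by omega) hB τ δ _ tD h₁ h₂ h₃
    have a1 := e.cost_le_size
    exact ⟨τ₁, δ₁, _, d₁, d₂, .iteFalse (by rw [Expr.eval_eq_val hV hσ h₁ _ hc.1
      ((Nat.pow_le_pow_right (by omega) (by omega)).trans hB), he]) x₁, by rw [mul_add]; omega, hd,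
      g₁, k₁, s₁, n₁⟩
  | @loopTrue e c σ σ' σ'' cur cur' cur'' l₁ l₂ t₁ t₂ he r₁ r₂ ih₁ ih₂ =>
    intro s hc hσ hs hB τ δ r tD h₁ h₂ h₃
    have hs' := hs
    simp only [size] at hs
    rw [List.append_assoc] at h₃
    obtain ⟨τ₁, δ₁, u₁, d₁, d₂, x₁, le₁, rfl, g₁, k₁, s₁, n₁⟩ :=
      ih₁ hc.2 hσ (by omega) hB τ δ _ tD h₁ h₂ h₃
    obtain ⟨τ₂, δ₂, u₂, d₃, d₄, x₂, le₂, rfl, g₂, k₂, s₂, n₂⟩ :=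
      ih₂ hc (r₁.bounded hσ) hs' hB τ₁ δ₁ _ d₂ g₁ k₁ s₁
    have a1 := e.cost_le_size
    refine ⟨τ₂, δ₂, _, d₁ + d₃, d₄, .loopTrue (Expr.eval_eq_val hV hσ h₁ _ hc.1
      ((Nat.pow_le_pow_right (by omega) (by omega)).trans hB)) he x₁ x₂,
      by rw [mul_add, mul_add]; omega, by omega, g₂, k₂, s₂, fun hl => ?_⟩
    obtain ⟨rfl, rfl⟩ := List.append_eq_nil_iff.1 hl
    rw [n₂ rfl, n₁ rfl]
  | @loopFalse e c σ cur he =>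
    intro s hc hσ hs hB τ δ r tD h₁ h₂ h₃
    simp only [size] at hs
    have a1 := e.cost_le_size
    exact ⟨τ, δ, _, 0, tD, .loopFalse (by rw [Expr.eval_eq_val hV hσ h₁ _ hc.1
      ((Nat.pow_le_pow_right (by omega) (by omega)).trans hB), he]), by omega, by simp, h₁, h₂, h₃,
      fun _ => rfl⟩
  | @insert e w σ cur h hcur hw =>
    intro s hc hσ hs hB τ δ r tD h₁ h₂ h₃
    simp only [size] at hs
    have a1 := e.cost_le_size
    have a2 := w.cost_le_size
    have x₁ := Exec.storeArg hV hσ h₁ hc.1 (s := s) (by omega) hB 0 (by omega)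
    have h₁' : ∀ b < lim, τ.write (5 + lim) 0 (e.val σ) b = σ b := fun b hb => by
      rw [State.write_of_ne _ _ _ (by omega), h₁ b hb]
    have x₂ := Exec.storeArg hV hσ h₁' hc.2 (s := s) (by omega) hB 1 (by omega)
    cases h₃ with
    | @insert _ _ δ₁ _ _ _ d₁ d₂ y₁ y₂ =>
    obtain ⟨τ₁, z₁, z₂, z₃⟩ := y₁.shift (lim := lim)
      (τ := (τ.write (5 + lim) 0 (e.val σ)).write (5 + lim) 1 (w.val σ)) (fun b => by
        funext a; simp [h₂])
    exact ⟨τ₁, δ₁, _, d₁, d₂, .seq (.seq x₁ x₂) z₁, by omega, rfl, fun b hb => by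
      rw [z₃ b hb, State.write_of_ne _ _ _ (by omega), h₁' b hb], z₂, y₂, by simp⟩
  | @set e w σ cur h hcur hw =>
    intro s hc hσ hs hB τ δ r tD h₁ h₂ h₃
    simp only [size] at hs
    have a1 := e.cost_le_size
    have a2 := w.cost_le_size
    have x₁ := Exec.storeArg hV hσ h₁ hc.1 (s := s) (by omega) hB 0 (by omega)
    cases h₃ with
    | @delete _ _ δ₁ _ _ d₁ d₂ y₁ y₂ =>
    cases y₂ with
    | @insert _ _ δ₂ _ _ _ d₃ d₄ y₃ y₄ =>
    obtain ⟨τ₁, z₁, z₂, z₃⟩ := y₁.shift (lim := lim)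
      (τ := τ.write (5 + lim) 0 (e.val σ)) (fun b => by funext a; simp [h₂])
    have h₂' : ∀ b < lim, τ₁ b = σ b := fun b hb => by
      rw [z₃ b hb, State.write_of_ne _ _ _ (by omega), h₁ b hb]
    have x₂ := Exec.storeArg hV hσ h₂' hc.1 (s := s) (by omega) hB 0 (by omega)
    have h₃' : ∀ b < lim, τ₁.write (5 + lim) 0 (e.val σ) b = σ b := fun b hb => by
      rw [State.write_of_ne _ _ _ (by omega), h₂' b hb]
    have x₃ := Exec.storeArg hV hσ h₃' hc.2 (s := s) (by omega) hB 1 (by omega)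
    obtain ⟨τ₂, w₁, w₂, w₃⟩ := y₃.shift (lim := lim)
      (τ := (τ₁.write (5 + lim) 0 (e.val σ)).write (5 + lim) 1 (w.val σ)) (fun b => by
        funext a; simp [z₂])
    rw [update_idem] at y₄
    exact ⟨τ₂, δ₂, _, d₁ + d₃, d₄, .seq (.seq x₁ z₁) (.seq (.seq x₂ x₃) w₁), by omega, by ring,
      fun b hb => by rw [w₃ b hb, State.write_of_ne _ _ _ (by omega), h₃' b hb], w₂, y₄, by simp⟩
  | @query b σ cur h =>
    intro s hc hσ hs hB τ δ r tD h₁ h₂ h₃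
    simp only [size] at hs
    cases h₃ with
    | @query _ _ δ₁ _ d₁ d₂ y₁ ha y₂ =>
    obtain ⟨τ₁, z₁, z₂, z₃⟩ := y₁.shift (lim := lim) (τ := τ) h₂
    have hB2 : V ^ 2 ≤ B := (Nat.pow_le_pow_right (by omega) (by omega)).trans hB
    have hVB : V < B := lt_of_lt_of_le (by nlinarith) hB2
    have e0 : (Expr.lit 0).eval B τ₁ = some 0 := by simp [Expr.eval, word]; omega
    have e1 : (Expr.read (6 + lim) (.lit 0)).eval B τ₁ =
        some (answerCode (G.value cur p)) := by
      simp only [Expr.eval, word, if_pos (show 0 < B by omega), Option.bind_some, z₂, ha]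
      rw [if_pos (lt_of_le_of_lt h hVB)]
    refine ⟨_, δ₁, _, d₁, d₂, .seq z₁ (.assign (b :=
        b) e0 e1), by simp [Expr.cost]; omega, rfl, ?_, ?_,
      y₂, by simp⟩
    · intro b' hb'
      funext a'
      simp [z₃ b' hb', h₁ b' hb']
    · intro b'
      rw [State.write_of_ne _ _ _ (by have : b < lim := hc; omega), z₂]

/-! ### Triples -/

/-- From the given state, the program runs in at most `T` steps with at most `Q` queries, and ends
in a state with the property `Post`. -/
def Does (val : (Fin m → ℕ∞) → ℕ∞) (V W : ℕ) (c : Cmd) (σ : State) (cur : Fin m → ℕ∞) (T Q : ℕ)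
    (Post : State → (Fin m → ℕ∞) → Prop) : Prop :=
  ∃ (l : List (DynOp m)) (t : ℕ) (σ' : State) (cur' : Fin m → ℕ∞),
    Run val V W c σ cur l t σ' cur' ∧ t ≤ T ∧ l.countP (fun o => o.isQuery) ≤ Q ∧ Post σ' cur'

variable {val : (Fin m → ℕ∞) → ℕ∞} {c c₁ c₂ : Cmd} {σ : State} {cur : Fin m → ℕ∞} {T Q : ℕ}
  {Post : State → (Fin m → ℕ∞) → Prop}

theorem Does.mono {T' Q' : ℕ} {Post' : State → (Fin m → ℕ∞) → Prop}
    (h : Does val V W c σ cur T Q Post) (hT : T ≤ T') (hQ : Q ≤ Q')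
    (hP : ∀ σ' cur', (∀ b, b ∉ c.mods → σ' b = σ b) → Post σ' cur' → Post' σ' cur') :
    Does val V W c σ cur T' Q' Post' := by
  obtain ⟨l, t, σ', cur', h₁, h₂, h₃, h₄⟩ := h
  exact ⟨l, t, σ', cur', h₁, h₂.trans hT, h₃.trans hQ, hP _ _ h₁.frame h₄⟩

theorem Does.assign {b : ℕ} {e₁ e₂ : Expr} (hV : e₂.val σ ≤ V)
    (h : Post (σ.write b (e₁.val σ) (e₂.val σ)) cur) :
    Does val V W (.assign b e₁ e₂) σ cur 1 0 Post :=
  ⟨_, _, _, _, .assign hV, le_rfl, by simp, h⟩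

theorem Does.seq {T₁ T₂ Q₁ Q₂ : ℕ} (h : Does val V W c₁ σ cur T₁ Q₁ fun σ' cur' =>
    Does val V W c₂ σ' cur' T₂ Q₂ Post) :
    Does val V W (.seq c₁ c₂) σ cur (T₁ + T₂) (Q₁ + Q₂) Post := by
  obtain ⟨l, t, σ', cur', h₁, h₂, h₃, l', t', σ'', cur'', k₁, k₂, k₃, k₄⟩ := h
  exact ⟨_, _, _, _, .seq h₁ k₁, by omega, by rw [List.countP_append]; omega, k₄⟩

theorem Does.ite {e : Expr} (h₁ : e.val σ ≠ 0 → Does val V W c₁ σ cur T Q Post)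
    (h₂ : e.val σ = 0 → Does val V W c₂ σ cur T Q Post) :
    Does val V W (.ite e c₁ c₂) σ cur (T + 1) Q Post := by
  by_cases he : e.val σ = 0
  · obtain ⟨l, t, σ', cur', k₁, k₂, k₃, k₄⟩ := h₂ he
    exact ⟨_, _, _, _, .iteFalse he k₁, by omega, k₃, k₄⟩
  · obtain ⟨l, t, σ', cur', k₁, k₂, k₃, k₄⟩ := h₁ he
    exact ⟨_, _, _, _, .iteTrue he k₁, by omega, k₃, k₄⟩

theorem Does.insert {e w : Expr} (h : e.val σ < m) (hcur : cur ⟨_, h⟩ = ⊤) (hw : w.val σ ≤ W)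
    (hP : Post σ (Function.update cur ⟨_, h⟩ (w.val σ))) :
    Does val V W (.insert e w) σ cur 1 0 Post :=
  ⟨_, _, _, _, .insert h hcur hw, le_rfl, by simp [DynOp.isQuery], hP⟩

theorem Does.set {e w : Expr} (h : e.val σ < m) (hcur : cur ⟨_, h⟩ ≠ ⊤) (hw : w.val σ ≤ W)
    (hP : Post σ (Function.update cur ⟨_, h⟩ (w.val σ))) :
    Does val V W (.set e w) σ cur 1 0 Post :=
  ⟨_, _, _, _, .set h hcur hw, le_rfl, by simp [DynOp.isQuery], hP⟩

theorem Does.query {b : ℕ} (hV : answerCode (val cur) ≤ V)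
    (hP : Post (σ.write b 0 (answerCode (val cur))) cur) :
    Does val V W (.query b) σ cur 1 1 Post :=
  ⟨_, _, _, _, .query hV, le_rfl, by simp [DynOp.isQuery], hP⟩

/-- `for v < e do c`. -/
def forLoop (v : ℕ) (e : Expr) (c : Cmd) : Cmd :=
  .seq (.assign v 0 0) (.loop (.lt (.var v) e) (.seq c (.assign v 0 (.var v + 1))))

/-- An iteration costs the body, the increment and the test; the final 2 is for the initial
assignment and the failing test. The invariant is stated just before the test, so it has to include
the value of the counter, and it has to determine the value of the bound `e`, which is evaluated
anew each time. -/
theorem Does.forLoop {v n : ℕ} {e : Expr} (Inv : ℕ → State → (Fin m → ℕ∞) → Prop) (hn : n ≤ V)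
    (h₀ : Inv 0 (σ.write v 0 0) cur)
    (hb : ∀ i ≤ n, ∀ σ cur, Inv i σ cur → σ v 0 = i ∧ e.val σ = n)
    (hc : ∀ i < n, ∀ σ cur, Inv i σ cur → Does val V W c σ cur T Q fun σ' cur' =>
      σ' v 0 = i ∧ Inv (i + 1) (σ'.write v 0 (i + 1)) cur') :
    Does val V W (forLoop v e c) σ cur (n * (T + 2) + 2) (n * Q) (Inv n) := by
  have key : ∀ k i, i + k = n → ∀ σ cur, Inv i σ cur →
      Does val V W (.loop (.lt (.var v) e) (.seq c (.assign v 0 (.var v + 1)))) σ cur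
        (k * (T + 2) + 1) (k * Q) (Inv n) := by
    intro k
    induction k with
    | zero =>
      intro i hi σ cur hI
      obtain rfl : i = n := by omega
      obtain ⟨h1, h2⟩ := hb i le_rfl σ cur hI
      exact ⟨_, _, _, _, .loopFalse (by simp [h1, h2]), by omega, by simp, hI⟩
    | succ k ih =>
      intro i hi σ cur hI
      obtain ⟨h1, h2⟩ := hb i (by omega) σ cur hI
      obtain ⟨l, t, σ', cur', r₁, r₂, r₃, r₄, r₅⟩ := hc i (by omega) σ cur hI
      have r₆ : Run val V W (.assign v 0 (.var v + 1)) σ' cur' [] 1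
          (σ'.write v 0 (i + 1)) cur' := by
        have := Run.assign (val := val) (V := V) (W := W) (b := v) (e₁ := 0) (e₂ := .var v + 1)
          (σ := σ') (cur := cur') (by simp [r₄]; omega)
        simpa [r₄] using this
      obtain ⟨l', t', σ'', cur'', k₁, k₂, k₃, k₄⟩ := ih (i + 1) (by omega) _ _ r₅
      refine ⟨_, _, _, _, .loopTrue (by simp [h1, h2]; omega) (.seq r₁ r₆) k₁, ?_, ?_, k₄⟩
      · rw [add_mul]; omega
      · rw [List.countP_append, List.append_nil, add_mul]; omega
  have := Does.seq (c₁ := .assign v 0 0) (T₁ := 1) (Q₁ := 0)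
    (Does.assign (val := val) (W := W) (V := V) (by simp) (key n 0 (by omega) _ _ h₀))
  exact this.mono (by omega) (by omega) (fun _ _ _ h => h)

end Cmd
end WordRAM

namespace WordRAM

/-! ### Programs without calls -/

/-- The plane graph with one node. -/
def singletonGraph : PlaneGraph 1 0 where
  x _ := 0
  y _ := 0
  src e := e.elim0
  tgt e := e.elim0
  s := 0
  t := 0
  pos_injective := fun _ _ _ => Subsingleton.elim _ _
  src_ne_tgt e := e.elim0
  node_notMem _ e := e.elim0
  edges_disjoint e := e.elim0

/-- The algorithm that does nothing. -/
def idleAlg : DynAlg := ⟨.skip, .skip, .skip, .skip⟩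

/-- A program without calls, as a program of the word RAM. -/
def Cmd.plain (lim : ℕ) (c : Cmd) : Prog := c.toProg idleAlg lim

/-- On a graph without edges nothing can be inserted or deleted, and queries are ruled out by the
count 0. So there are no calls, and the simulation applies with an algorithm that does nothing. -/
theorem Cmd.Does.exec_plain {V lim B : ℕ} (hV : 2 ≤ V) {c : Cmd}
    {σ : State} {cur : Fin 0 → ℕ∞} {T : ℕ} {Post : State → (Fin 0 → ℕ∞) → Prop}
    (h : Cmd.Does (fun cur => singletonGraph.value cur .stShortestPath) V 0 c σ cur T 0 Post)
    (hc : c.Within lim) (hσ : σ.BoundedBy V lim) (hB : V ^ c.size ≤ B) :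
    ∃ t τ σ', Exec B (c.plain lim) σ t τ ∧ t ≤ c.size * T ∧ (∃ cur', Post σ' cur') ∧
      σ'.BoundedBy V lim ∧ (∀ b < lim, τ b = σ' b) ∧ ∀ b, lim ≤ b → τ b = σ b := by
  obtain ⟨l, t, σ', cur', h₁, h₂, h₃, h₄⟩ := h
  have hl : l = [] := by
    cases l with
    | nil => rfl
    | cons o l =>
      cases o with
      | insert e => exact e.elim0
      | delete e => exact e.elim0
      | query => simp [DynOp.isQuery] at h₃
  obtain ⟨τ, δ, t', d₁, d₂, x₁, x₂, x₃, x₄, x₅, x₆, x₇⟩ :=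
    h₁.simulate (D := idleAlg) (lim := lim) (B := B) hV hc hσ le_rfl hB σ
      (fun b => σ (b + lim)) [] 0 (fun _ _ => rfl) (fun _ => rfl) (by rw [hl]; exact .nil _ _)
  refine ⟨t', τ, σ', x₁, ?_, ⟨cur', h₄⟩, h₁.bounded hσ, x₄, fun b hb => ?_⟩
  · have := Nat.mul_le_mul_left c.size h₂
    omega
  · obtain ⟨b, rfl⟩ := Nat.exists_eq_add_of_le' hb
    rw [x₅, x₇ hl]

/-! ### Compilation into a list of instructions -/

/-- Instructions: assignments, and jumps that are taken if an expression vanishes. -/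
inductive Instr
  | asg (b : ℕ) (e₁ e₂ : Expr)
  | jz (e : Expr) (tgt : ℕ)

/-- The number of instructions of the compiled program. -/
def Prog.len : Prog → ℕ
  | .skip => 0
  | .assign _ _ _ => 1
  | .seq p q => p.len + q.len
  | .ite _ p q => p.len + q.len + 2
  | .loop _ p => p.len + 2

/-- The instructions of a program whose code starts at the given position. -/
def Prog.compile : Prog → ℕ → List Instr
  | .skip, _ => []
  | .assign b e₁ e₂, _ => [.asg b e₁ e₂]
  | .seq p q, i => p.compile i ++ q.compile (i + p.len)
  | .ite e p q, i => .jz e (i + p.len + 2) :: (p.compile (i + 1) ++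
      .jz (.lit 0) (i + p.len + 2 + q.len) :: q.compile (i + p.len + 2))
  | .loop e p, i => .jz e (i + p.len + 2) :: (p.compile (i + 1) ++ [.jz (.lit 0) i])

theorem Prog.length_compile (p : Prog) : ∀ i, (p.compile i).length = p.len := by
  induction p <;> intro i <;> simp_all [Prog.compile, Prog.len]; all_goals omega

/-- One step of an instruction. -/
inductive Instr.Step (B : ℕ) : Instr → ℕ → State → ℕ → State → Prop
  | asg {b a v i : ℕ} {e₁ e₂ : Expr} {σ : State} (h₁ : e₁.eval B σ = some a)
      (h₂ : e₂.eval B σ = some v) : Step B (.asg b e₁ e₂) i σ (i + 1) (σ.write b a v)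
  | jump {e : Expr} {i tgt : ℕ} {σ : State} (h : e.eval B σ = some 0) :
      Step B (.jz e tgt) i σ tgt σ
  | next {e : Expr} {i tgt v : ℕ} {σ : State} (h : e.eval B σ = some v) (hv : v ≠ 0) :
      Step B (.jz e tgt) i σ (i + 1) σ

/-- Several steps of a list of instructions. -/
inductive Steps (B : ℕ) (code : List Instr) : ℕ → ℕ → State → ℕ → State → Prop
  | refl (i : ℕ) (σ : State) : Steps B code 0 i σ i σ
  | cons {n i i' i'' : ℕ} {σ σ' σ'' : State} {ins : Instr} (h : code[i]? = some ins)
      (h₁ : ins.Step B i σ i' σ') (h₂ : Steps B code n i' σ' i'' σ'') :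
      Steps B code (n + 1) i σ i'' σ''

theorem Steps.trans {B : ℕ} {code : List Instr} {n n' i i' i'' : ℕ} {σ σ' σ'' : State}
    (h : Steps B code n i σ i' σ') (h' : Steps B code n' i' σ' i'' σ'') :
    Steps B code (n + n') i σ i'' σ'' := by
  induction h with
  | refl => simpa using h'
  | @cons n i i' i'' σ σ' σ'' ins a b _ ih =>
    rw [show n + 1 + n' = n + n' + 1 by ring]
    exact .cons a b (ih h')

/-- Jump targets are absolute, so the induction needs arbitrary code before and after the compiled
program. Each instruction is charged to a step of the structured execution, whence `n ≤ t`; the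
jumps back to the head of a loop and over an else branch are paid by evaluating the condition. -/
theorem Exec.steps {B : ℕ} {p : Prog} {σ σ' : State} {t : ℕ} (h : Exec B p σ t σ') (hB : 0 < B) :
    ∀ pre post : List Instr, ∃ n ≤ t, Steps B (pre ++ p.compile pre.length ++ post) n pre.length σ
      (pre.length + p.len) σ' := by
  have hjmp : ∀ (code : List Instr) (i tgt : ℕ) (σ : State),
      code[i]? = some (.jz (.lit 0) tgt) → Steps B code 1 i σ tgt σ := fun code i tgt σ hh =>
    .cons hh (.jump (by simp [Expr.eval, word, hB])) (.refl _ _)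
  induction h with
  | skip σ => exact fun pre post => ⟨0, by omega, .refl _ _⟩
  | assign h₁ h₂ =>
    intro pre post
    exact ⟨1, by omega, .cons (by simp [Prog.compile]) (.asg h₁ h₂) (.refl _ _)⟩
  | @seq p q _ _ _ _ _ _ _ ih₁ ih₂ =>
    intro pre post
    obtain ⟨n₁, l₁, s₁⟩ := ih₁ pre (q.compile (pre.length + p.len) ++ post)
    obtain ⟨n₂, l₂, s₂⟩ := ih₂ (pre ++ p.compile pre.length) post
    refine ⟨n₁ + n₂, by omega, ?_⟩
    simp only [List.length_append, Prog.length_compile, Prog.compile, Prog.len, ← add_assoc,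
      List.append_assoc] at s₁ s₂ ⊢
    exact s₁.trans s₂
  | @iteTrue e p q σ σ' v t he hv _ ih =>
    intro pre post
    obtain ⟨n, l, s⟩ := ih (pre ++ [.jz e (pre.length + p.len + 2)])
      (.jz (.lit 0) (pre.length + p.len + 2 + q.len) ::
        (q.compile (pre.length + p.len + 2) ++ post))
    refine ⟨1 + n + 1, by have := e.one_le_cost; omega, ?_⟩
    simp only [List.length_append, Prog.compile, Prog.len, ← add_assoc,
      List.append_assoc, List.cons_append, List.nil_append, List.length_cons,
      List.length_nil, zero_add] at s ⊢
    refine (Steps.trans (.cons (ins :=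
        .jz e (pre.length + p.len + 2)) ?_ (.next he hv) (.refl _ _)) s).trans (hjmp _ _ _ _ ?_)
    · simp
    · rw [List.getElem?_append_right (by omega), show pre.length + 1 + p.len - pre.length =
        p.len + 1 by omega, List.getElem?_cons_succ, List.getElem?_append_right
        (by rw [Prog.length_compile])]
      simp [Prog.length_compile]; omega
  | @iteFalse e p q σ σ' t he _ ih =>
    intro pre post
    obtain ⟨n, l, s⟩ := ih (pre ++ [.jz e (pre.length + p.len + 2)] ++ p.compile (pre.length + 1) ++
      [.jz (.lit 0) (pre.length + p.len + 2 + q.len)]) post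
    refine ⟨1 + n, by have := e.one_le_cost; omega, ?_⟩
    have e1 : pre.length + (1 + (p.len + 1)) = pre.length + p.len + 2 := by ring
    have e2 : pre.length + (p.len + 1 + 1) = pre.length + p.len + 2 := by ring
    have e3 : pre.length + (p.len + q.len + 2) = pre.length + p.len + 2 + q.len := by ring
    simp only [List.length_append, Prog.length_compile, Prog.compile, Prog.len, add_assoc,
      List.append_assoc, List.cons_append, List.nil_append, List.length_cons,
      List.length_nil, zero_add] at s ⊢
    simp only [← add_assoc] at s ⊢
    have e4 : pre.length + p.len + 1 + 1 = pre.length + p.len + 2 := by ring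
    rw [e4] at s
    refine Steps.trans (.cons (ins := .jz e (pre.length + p.len + 2)) ?_ (.jump he) (.refl _ _)) ?_
    · simp
    · convert s using 1; ring
  | @loopTrue e p σ σ' σ'' v t₁ t₂ he hv _ _ ih₁ ih₂ =>
    intro pre post
    obtain ⟨n₁, l₁, s₁⟩ := ih₁ (pre ++ [.jz e (pre.length + p.len + 2)])
      (.jz (.lit 0) pre.length :: post)
    obtain ⟨n₂, l₂, s₂⟩ := ih₂ pre post
    refine ⟨1 + n₁ + 1 + n₂, by have := e.one_le_cost; omega, ?_⟩
    simp only [List.length_append, Prog.compile, Prog.len, ← add_assoc,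
      List.append_assoc, List.cons_append, List.nil_append, List.length_cons,
      List.length_nil, zero_add] at s₁ s₂ ⊢
    refine ((Steps.trans (.cons (ins :=
        .jz e (pre.length + p.len + 2)) ?_ (.next he hv) (.refl _ _)) s₁).trans (hjmp _ _ _ _
        ?_)).trans s₂
    · simp
    · rw [List.getElem?_append_right (by omega), show pre.length + 1 + p.len - pre.length =
        p.len + 1 by omega, List.getElem?_cons_succ, List.getElem?_append_right
        (by rw [Prog.length_compile])]
      simp [Prog.length_compile]
  | @loopFalse e p σ he =>
    intro pre post
    refine ⟨1, by omega, .cons (ins := .jz e (pre.length + p.len + 2)) ?_ (.jump he) ?_⟩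
    · simp [Prog.compile]
    · simp only [Prog.len, add_assoc]; exact .refl _ _

/-! ### Single steps as a program -/

/-- The program that performs the instruction whose position is in the bank `pc`; the banks of the
instructions are renamed by `f`. -/
def stepProg (f : ℕ → ℕ) (pc : ℕ) : List Instr → ℕ → Prog
  | [], _ => .skip
  | .asg b e₁ e₂ :: r, i => .ite (.eq (.var pc) (.lit i))
      (.seq (.assign (f b) (e₁.map f) (e₂.map f)) (.assign pc (.lit 0) (.lit (i + 1))))
      (stepProg f pc r (i + 1))
  | .jz e tgt :: r, i => .ite (.eq (.var pc) (.lit i))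
      (.ite (e.map f) (.assign pc (.lit 0) (.lit (i + 1))) (.assign pc (.lit 0) (.lit tgt)))
      (stepProg f pc r (i + 1))

theorem eval_lit {B v : ℕ} (h : v < B) (σ : State) : (Expr.lit v).eval B σ = some v := by
  simp [Expr.eval, word, h]

theorem eval_var {B b : ℕ} {σ : State} (h : σ b 0 < B) : (Expr.var b).eval B σ = some (σ b 0) := by
  have : 0 < B := by omega
  simp [Expr.var, Expr.eval, word, h, this]

theorem eval_eq {B x y : ℕ} {a b : Expr} {σ : State} (hB : 1 < B) (ha : a.eval B σ = some x)
    (hb : b.eval B σ = some y) : (Expr.eq a b).eval B σ = some (if x = y then 1 else 0) := by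
  simp only [Expr.eq, Expr.eval, ha, hb, Option.bind_some, BinOp.apply, word_eq_some, and_true]
  split_ifs <;> omega

theorem eval_lt {B x y : ℕ} {a b : Expr} {σ : State} (hB : 1 < B) (ha : a.eval B σ = some x)
    (hb : b.eval B σ = some y) : (Expr.lt a b).eval B σ = some (if x < y then 1 else 0) := by
  simp only [Expr.lt, Expr.eval, ha, hb, Option.bind_some, BinOp.apply, word_eq_some, and_true]
  split_ifs <;> omega

/-- The dispatcher compares the program counter with each position in turn. The code is fixed, so
the cost is a constant `κ`; taking `κ` also above all positions and jump targets makes `κ < B`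
sufficient for these literals to be words. -/
theorem exec_stepProg {f : ℕ → ℕ} (hf : f.Injective) {pc : ℕ} (hpc : pc ∉ Set.range f)
    (code : List Instr) : ∀ i : ℕ, ∃ κ, ∀ B, κ < B → ∀ (ins : Instr) (j j' : ℕ) (σ σ' τ : State),
      code[j]? = some ins → ins.Step B (i + j) σ j' σ' → (∀ b, τ (f b) = σ b) → τ pc 0 = i + j →
      ∃ t τ', Exec B (stepProg f pc code i) τ t τ' ∧ t ≤ κ ∧ (∀ b, τ' (f b) = σ' b) ∧
        τ' pc 0 = j' ∧ ∀ b, b ∉ Set.range f → b ≠ pc → τ' b = τ b := by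
  have hne : ∀ b, f b ≠ pc := fun b h => hpc ⟨b, h⟩
  induction code with
  | nil => intro i; exact ⟨0, by simp⟩
  | cons a code ih =>
    intro i
    obtain ⟨κ, hκ⟩ := ih (i + 1)
    have hlt : ∀ j, (a :: code)[j]? ≠ none → j ≤ code.length := by
      intro j hj
      simpa [Nat.lt_succ_iff] using hj
    cases a with
    | asg b e₁ e₂ =>
      refine ⟨κ + e₁.cost + e₂.cost + i + code.length + 20,
          fun B hB ins j j' σ σ' τ hj hs h₁ h₂ => ?_⟩
      have hjl := hlt j (by rw [hj]; simp)
      have hcond := eval_eq (by omega) (eval_var (B := B) (b := pc) (σ := τ) (by omega))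
        (eval_lit (v := i) (B := B) (by omega) τ)
      cases j with
      | zero =>
        simp only [List.getElem?_cons_zero, Option.some.injEq] at hj
        subst hj
        rw [h₂, if_pos (by omega)] at hcond
        cases hs with
        | @asg _ x v _ _ _ _ k₁ k₂ =>
        refine ⟨_, _, .iteTrue hcond one_ne_zero (.seq
          (.assign (by rw [Expr.eval_map h₁, k₁]) (by rw [Expr.eval_map h₁, k₂]))
          (.assign (eval_lit (by omega) _) (eval_lit (by omega) _))), ?_, ?_, ?_, ?_⟩
        · simp only [Expr.cost_map, Expr.cost, Expr.eq, Expr.var]; omega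
        · intro b'
          rw [State.write_of_ne _ _ _ (hne b'), State.write_map hf h₁]
        · simp
        · intro b' hb' hb''
          rw [State.write_of_ne _ _ _ hb'', State.write_of_ne _ _ _ (fun h => hb' ⟨b, h.symm⟩)]
      | succ j =>
        simp only [List.getElem?_cons_succ] at hj
        rw [show i + (j + 1) = i + 1 + j by ring] at hs h₂
        obtain ⟨t, τ', x₁, x₂, x₃, x₄, x₅⟩ := hκ B (by omega) ins j j' σ σ' τ hj hs h₁ h₂
        rw [h₂, if_neg (by omega)] at hcond
        refine ⟨_, τ', .iteFalse hcond x₁, ?_, x₃, x₄, x₅⟩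
        simp only [Expr.cost, Expr.eq, Expr.var]; omega
    | jz e tgt =>
      refine ⟨κ + e.cost + tgt + i + code.length + 20, fun B hB ins j j' σ σ' τ hj hs h₁ h₂ => ?_⟩
      have hjl := hlt j (by rw [hj]; simp)
      have hcond := eval_eq (by omega) (eval_var (B := B) (b := pc) (σ := τ) (by omega))
        (eval_lit (v := i) (B := B) (by omega) τ)
      cases j with
      | zero =>
        simp only [List.getElem?_cons_zero, Option.some.injEq] at hj
        subst hj
        rw [h₂, if_pos (by omega)] at hcond
        cases hs with
        | jump k =>
          refine ⟨_, _, .iteTrue hcond one_ne_zero (.iteFalse (by rw [Expr.eval_map h₁, k])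
            (.assign (eval_lit (by omega) _) (eval_lit (by omega) _))), ?_, ?_, ?_, ?_⟩
          · simp only [Expr.cost_map, Expr.cost, Expr.eq, Expr.var]; omega
          · intro b'
            rw [State.write_of_ne _ _ _ (hne b'), h₁]
          · simp
          · intro b' hb' hb''
            rw [State.write_of_ne _ _ _ hb'']
        | next k kv =>
          refine ⟨_, _, .iteTrue hcond one_ne_zero (.iteTrue (by rw [Expr.eval_map h₁, k]) kv
            (.assign (eval_lit (by omega) _) (eval_lit (by omega) _))), ?_, ?_, ?_, ?_⟩
          · simp only [Expr.cost_map, Expr.cost, Expr.eq, Expr.var]; omega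
          · intro b'
            rw [State.write_of_ne _ _ _ (hne b'), h₁]
          · simp
          · intro b' hb' hb''
            rw [State.write_of_ne _ _ _ hb'']
      | succ j =>
        simp only [List.getElem?_cons_succ] at hj
        rw [show i + (j + 1) = i + 1 + j by ring] at hs h₂
        obtain ⟨t, τ', x₁, x₂, x₃, x₄, x₅⟩ := hκ B (by omega) ins j j' σ σ' τ hj hs h₁ h₂
        rw [h₂, if_neg (by omega)] at hcond
        refine ⟨_, τ', .iteFalse hcond x₁, ?_, x₃, x₄, x₅⟩
        simp only [Expr.cost, Expr.eq, Expr.var]; omega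

end WordRAM

set_option linter.unusedSimpArgs false

namespace WordRAM

/-- A written value is the result of an evaluation and hence a word. This bounds the memory left
behind by the race, on which the final copying program has to run. -/
theorem Exec.lt_bound {B : ℕ} {p : Prog} {σ σ' : State} {t : ℕ} (h : Exec B p σ t σ')
    (hσ : ∀ b a, σ b a < B) : ∀ b a, σ' b a < B := by
  have key : ∀ {e : Expr} {σ : State} {v : ℕ}, e.eval B σ = some v → v < B := by
    intro e σ v h
    cases e <;> simp only [Expr.eval, Option.bind_eq_some_iff, word_eq_some] at h
    · omega
    · obtain ⟨_, _, h⟩ := h; omega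
    · obtain ⟨_, _, _, _, h⟩ := h; omega
  induction h with
  | skip => exact hσ
  | assign h₁ h₂ =>
    intro b a
    rw [State.write_apply]; split_ifs
    · exact key h₂
    · exact hσ b a
  | seq _ _ ih₁ ih₂ => exact ih₂ (ih₁ hσ)
  | iteTrue _ _ _ ih => exact ih hσ
  | iteFalse _ _ ih => exact ih hσ
  | loopTrue _ _ _ _ ih₁ ih₂ => exact ih₂ (ih₁ hσ)
  | loopFalse => exact hσ

/-! ### Running two programs in parallel -/

namespace Race

/-- Copy the input of the all pairs shortest path problem to the banks of two programs. -/
def copyIn : Cmd :=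
  .seq (.assign 10 0 (.var 0)) <| .seq (.assign 11 0 (.var 0)) <|
  .seq (.assign 8 0 (.var 0 * .var 0)) <| .forLoop 7 (.var 8) <|
  .seq (.assign 12 (.var 7) (.read 1 (.var 7))) <| .seq (.assign 13 (.var 7) (.read 1 (.var 7))) <|
  .seq (.assign 14 (.var 7) (.read 2 (.var 7))) (.assign 15 (.var 7) (.read 2 (.var 7)))

/-- Copy the output from the banks `b₁` and `b₂`. -/
def copyBanks (b₁ b₂ : ℕ) : Cmd :=
  .forLoop 7 (.var 8) <|
  .seq (.assign 3 (.var 7) (.read b₁ (.var 7))) (.assign 4 (.var 7) (.read b₂ (.var 7)))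

/-- Copy the output of the program that has finished. -/
def copyOut (len : ℕ) : Cmd :=
  .ite (.lt (.var 5) (.lit len)) (copyBanks 17 19) (copyBanks 16 18)

variable {val : (Fin 0 → ℕ∞) → ℕ∞} {V : ℕ} {σ : State} {cur : Fin 0 → ℕ∞}

theorem copyIn_does (n : ℕ) (h0 : σ 0 0 = n) (h0' : ∀ a, a ≠ 0 → σ 0 a = 0)
    (h1 : ∀ a, n * n ≤ a → σ 1 a = 0) (h2 : ∀ a, n * n ≤ a → σ 2 a = 0)
    (h3 : ∀ b, 3 ≤ b → σ b = fun _ => 0) (hV : n * n ≤ V) (hb : σ.BoundedBy V 20) :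
    Cmd.Does val V 0 copyIn σ cur (3 + (n * n * 6 + 2)) 0 fun σ' _ =>
      (∀ b, σ' (2 * b + 10) = σ b) ∧ (∀ b, σ' (2 * b + 11) = σ b) ∧ σ' 8 0 = n * n ∧
        σ' 5 0 = 0 ∧ σ' 6 0 = 0 := by
  have e10 := h3 10 (by omega)
  have e11 := h3 11 (by omega)
  have e12 := h3 12 (by omega)
  have e13 := h3 13 (by omega)
  have e14 := h3 14 (by omega)
  have e15 := h3 15 (by omega)
  have hn : σ 0 0 ≤ V := hb 0 (by norm_num) 0
  have main : Cmd.Does val V 0 copyIn σ cur (1 + (1 + (1 + (n * n * (4 + 2) + 2))))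
      (0 + (0 + (0 + n * n * 0)))
      fun σ' _ => σ' 7 0 = n * n ∧ σ' 8 0 = n * n ∧ σ' 1 = σ 1 ∧ σ' 2 = σ 2 ∧
        σ' 10 = σ 0 ∧ σ' 11 = σ 0 ∧
        (∀ a, σ' 12 a = if a < n * n then σ 1 a else 0) ∧
        (∀ a, σ' 13 a = if a < n * n then σ 1 a else 0) ∧
        (∀ a, σ' 14 a = if a < n * n then σ 2 a else 0) ∧
        (∀ a, σ' 15 a = if a < n * n then σ 2 a else 0) := by
    refine .seq (.assign (by simpa using hn) (.seq (.assign (by simpa using hn)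
      (.seq (.assign (by simp [h0, hV]) ?_)))))
    refine Cmd.Does.forLoop (fun i σ' _ => σ' 7 0 = i ∧ σ' 8 0 = n * n ∧ σ' 1 = σ 1 ∧ σ' 2 = σ 2 ∧
        σ' 10 = σ 0 ∧ σ' 11 = σ 0 ∧
        (∀ a, σ' 12 a = if a < i then σ 1 a else 0) ∧
        (∀ a, σ' 13 a = if a < i then σ 1 a else 0) ∧
        (∀ a, σ' 14 a = if a < i then σ 2 a else 0) ∧
        (∀ a, σ' 15 a = if a < i then σ 2 a else 0)) hV ?_ ?_ ?_
    · refine ⟨by simp, by simp [h0], by ext; simp, by ext; simp, ?_, ?_, ?_, ?_, ?_, ?_⟩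
      · ext a; simp only [State.write_apply, Expr.val_var, Expr.val_zero]; simp [e10]
        by_cases ha : a = 0 <;> simp [ha, h0']
      · ext a; simp only [State.write_apply, Expr.val_var, Expr.val_zero]; simp [e11]
        by_cases ha : a = 0 <;> simp [ha, h0']
      all_goals simp [e12, e13, e14, e15]
    · rintro i hi σ' cur' ⟨a, b, _⟩
      exact ⟨a, by simpa using b⟩
    · rintro i hi σ' cur' ⟨k7, k8, k1, k2, k10, k11, k12, k13, k14, k15⟩
      have b1 := hb 1 (by norm_num) i
      have b2 := hb 2 (by norm_num) i
      refine (Cmd.Does.seq (T₁ := 1) (Q₁ := 0) (T₂ := 1 + (1 + 1)) (Q₂ := 0 + (0 + 0))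
        (.assign (by simpa [k7, k1] using b1) (.seq (.assign (by simpa [k7, k1] using b1)
        (.seq (.assign (by simpa [k7, k2] using b2) (.assign (by simpa [k7, k2] using b2) ?_)))))))
      simp only [State.write_apply, Expr.val_var, Expr.val_read, k7, k8, k1, k2]
      refine ⟨by simp, by simp, by simp, ?_, ?_, ?_, ?_, ?_, ?_, ?_, ?_⟩
      · ext; simp [k1]
      · ext; simp [k2]
      · ext; simp [k10]
      · ext; simp [k11]
      all_goals
        intro a
        simp [k12, k13, k14, k15, k1, k2]
        by_cases ha : a = i
        · simp [ha]
        · simp only [ha, if_false]; congr 1; apply propext; omega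
  refine main.mono (by omega) (by omega) ?_
  rintro σ' _ hf ⟨-, k8, k1, k2, k10, k11, k12, k13, k14, k15⟩
  have hf' : ∀ b, 16 ≤ b → σ' b = σ b := fun b hb => hf b (by
    simp [copyIn, Cmd.mods, Cmd.forLoop]; omega)
  have f1 : ∀ a, (if a < n * n then σ 1 a else 0) = σ 1 a := fun a => by
    split_ifs with h
    · rfl
    · exact (h1 a (by omega)).symm
  have f2 : ∀ a, (if a < n * n then σ 2 a else 0) = σ 2 a := fun a => by
    split_ifs with h
    · rfl
    · exact (h2 a (by omega)).symm
  refine ⟨fun b => ?_, fun b => ?_, k8, ?_, ?_⟩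
  · match b with
    | 0 => exact k10
    | 1 => ext a; exact (k12 a).trans (f1 a)
    | 2 => ext a; exact (k14 a).trans (f2 a)
    | b + 3 => rw [hf' _ (by omega), h3 _ (by omega), h3 _ (by omega)]
  · match b with
    | 0 => exact k11
    | 1 => ext a; exact (k13 a).trans (f1 a)
    | 2 => ext a; exact (k15 a).trans (f2 a)
    | b + 3 => rw [hf' _ (by omega), h3 _ (by omega), h3 _ (by omega)]
  · rw [hf 5 (by simp [copyIn, Cmd.mods, Cmd.forLoop]), h3 5 (by omega)]
  · rw [hf 6 (by simp [copyIn, Cmd.mods, Cmd.forLoop]), h3 6 (by omega)]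

theorem copyBanks_does {b₁ b₂ N : ℕ} (h₁ : 8 < b₁) (h₂ : 8 < b₂) (h₁' : b₁ < 20) (h₂' : b₂ < 20)
    (h8 : σ 8 0 = N) (hb : σ.BoundedBy V 20) :
    Cmd.Does val V 0 (copyBanks b₁ b₂) σ cur (N * 4 + 2) 0 fun σ' _ =>
      ∀ a < N, σ' 3 a = σ b₁ a ∧ σ' 4 a = σ b₂ a := by
  have hN : N ≤ V := h8 ▸ hb 8 (by norm_num) 0
  have main : Cmd.Does val V 0 (copyBanks b₁ b₂) σ cur (N * (2 + 2) + 2) (N * 0) fun σ' _ =>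
      σ' 7 0 = N ∧ σ' 8 0 = N ∧ σ' b₁ = σ b₁ ∧ σ' b₂ = σ b₂ ∧
      ∀ a < N, σ' 3 a = σ b₁ a ∧ σ' 4 a = σ b₂ a := by
    refine Cmd.Does.forLoop (fun i σ' _ => σ' 7 0 = i ∧ σ' 8 0 = N ∧ σ' b₁ = σ b₁ ∧ σ' b₂ = σ b₂ ∧
      ∀ a < i, σ' 3 a = σ b₁ a ∧ σ' 4 a = σ b₂ a) hN ?_ ?_ ?_
    · refine ⟨by simp, by simp [h8], ?_, ?_, by simp⟩
      · exact State.write_of_ne _ _ _ (by omega)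
      · exact State.write_of_ne _ _ _ (by omega)
    · rintro i hi σ' cur' ⟨a, b, _⟩
      exact ⟨a, by simpa using b⟩
    · rintro i hi σ' cur' ⟨k7, k8, k1, k2, k⟩
      have c1 := hb b₁ h₁' i
      have c2 := hb b₂ h₂' i
      have n1 : ¬ b₁ = 3 := by omega
      have n2 : ¬ b₂ = 3 := by omega
      refine Cmd.Does.seq (T₁ := 1) (Q₁ := 0) (T₂ := 1) (Q₂ := 0)
        (.assign (by simpa [k7, k1] using c1) (.assign (by simpa [k7, k2, n2] using c2) ?_))
      simp only [State.write_apply, Expr.val_var, Expr.val_read, k7, k8, k1, k2]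
      refine ⟨by simp, by simp, by simp, ?_, ?_, ?_⟩
      · rw [State.write_of_ne _ _ _ (by omega), State.write_of_ne _ _ _ (by omega),
          State.write_of_ne _ _ _ (by omega), k1]
      · rw [State.write_of_ne _ _ _ (by omega), State.write_of_ne _ _ _ (by omega),
          State.write_of_ne _ _ _ (by omega), k2]
      · intro a ha
        by_cases h : a = i
        · simp [h, n2]
        · have := k a (by omega)
          simpa [h] using this
  exact main.mono (by omega) (by omega) (fun σ' _ _ h => h.2.2.2.2)

/-- The first bank map. -/
def left (b : ℕ) : ℕ := 2 * b + 10
/-- The second bank map. -/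
def right (b : ℕ) : ℕ := 2 * b + 11

theorem left_injective : left.Injective := fun a b h => by simp [left] at h; omega
theorem right_injective : right.Injective := fun a b h => by simp [right] at h; omega
theorem notMem_range_left {b : ℕ} (h : b < 10 ∨ b % 2 = 1) : b ∉ Set.range left := by
  rintro ⟨x, hx⟩; simp only [left] at hx; omega
theorem notMem_range_right {b : ℕ} (h : b < 10 ∨ b % 2 = 0) : b ∉ Set.range right := by
  rintro ⟨x, hx⟩; simp only [right] at hx; omega

/-- Perform steps of both codes alternately until one of them ends. -/
def stepLoop (c₁ c₂ : List Instr) : Prog :=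
  .loop (.op .mul (.lt (.var 5) (.lit c₁.length)) (.lt (.var 6) (.lit c₂.length)))
    (.seq (stepProg left 5 c₁ 0) (stepProg right 6 c₂ 0))

/-- Structured loops cannot be interleaved directly, but instructions can: a round performs one step
of each code, on the even and on the odd banks from 10 on, with program counters in banks 5 and 6. A
code has halted when its counter equals its length; the product of the two tests then vanishes,
after `min n₁ n₂` rounds. The induction on `n₁` follows the rounds. -/
theorem stepLoop_exec (c₁ c₂ : List Instr) : ∃ κ, ∀ B, κ < B → ∀ (n₁ n₂ i₁ i₂ : ℕ)
    (σ₁ σ₁' σ₂ σ₂' τ : State), Steps B c₁ n₁ i₁ σ₁ c₁.length σ₁' →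
      Steps B c₂ n₂ i₂ σ₂ c₂.length σ₂' → (∀ b, τ (left b) = σ₁ b) → (∀ b, τ (right b) = σ₂ b) →
      τ 5 0 = i₁ → τ 6 0 = i₂ →
      ∃ t τ', Exec B (stepLoop c₁ c₂) τ t τ' ∧ t ≤ κ * (min n₁ n₂ + 1) ∧
        (τ' 5 0 = c₁.length ∧ (∀ b, τ' (left b) = σ₁' b) ∨
          τ' 5 0 < c₁.length ∧ ∀ b, τ' (right b) = σ₂' b) ∧ τ' 8 = τ 8 := by
  obtain ⟨κ₁, h₁⟩ := exec_stepProg left_injective (pc := 5) (notMem_range_left (by omega)) c₁ 0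
  obtain ⟨κ₂, h₂⟩ := exec_stepProg right_injective (pc := 6) (notMem_range_right (by omega)) c₂ 0
  refine ⟨κ₁ + κ₂ + c₁.length + c₂.length + 20, fun B hB n₁ => ?_⟩
  have hcond : ∀ τ : State, τ 5 0 ≤ c₁.length → τ 6 0 ≤ c₂.length →
      Expr.eval B τ (.op .mul (.lt (.var 5) (.lit c₁.length)) (.lt (.var 6) (.lit c₂.length))) =
        some (if τ 5 0 < c₁.length ∧ τ 6 0 < c₂.length then 1 else 0) := by
    intro τ a b
    rw [Expr.eval, eval_lt (by omega) (eval_var (by omega)) (eval_lit (by omega) _),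
      eval_lt (by omega) (eval_var (by omega)) (eval_lit (by omega) _)]
    simp only [Option.bind_some, BinOp.apply, word_eq_some]
    by_cases u : τ 5 0 < c₁.length <;> by_cases v : τ 6 0 < c₂.length <;>
      simp [u, v] <;> omega
  have hcost : Expr.cost (.op .mul (.lt (.var 5) (.lit c₁.length))
      (.lt (.var 6) (.lit c₂.length))) = 9 := rfl
  induction n₁ with
  | zero =>
    intro n₂ i₁ i₂ σ₁ σ₁' σ₂ σ₂' τ s₁ s₂ f₁ f₂ p₁ p₂
    cases s₁
    have hi₂ : i₂ ≤ c₂.length := by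
      cases s₂ with
      | refl => rfl
      | cons h => by_contra hh; rw [List.getElem?_eq_none (by omega)] at h; cases h
    have := hcond τ (by omega) (by omega)
    rw [if_neg (by omega)] at this
    exact ⟨_, τ, .loopFalse this, by rw [hcost]; simp, .inl ⟨p₁, f₁⟩, rfl⟩
  | succ n₁ ih =>
    intro n₂ i₁ i₂ σ₁ σ₁' σ₂ σ₂' τ s₁ s₂ f₁ f₂ p₁ p₂
    cases s₁ with
    | @cons _ _ j₁ _ _ ρ₁ _ ins₁ g₁ u₁ w₁ =>
    have hi₁ : i₁ < c₁.length := by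
      by_contra hh; rw [List.getElem?_eq_none (by omega)] at g₁; cases g₁
    cases s₂ with
    | refl =>
      have := hcond τ (by omega) (by omega)
      rw [if_neg (by omega)] at this
      exact ⟨_, τ, .loopFalse this, by rw [hcost]; simp, .inr ⟨by omega, f₂⟩, rfl⟩
    | @cons n₂ _ j₂ _ _ ρ₂ _ ins₂ g₂ u₂ w₂ =>
      have hi₂ : i₂ < c₂.length := by
        by_contra hh; rw [List.getElem?_eq_none (by omega)] at g₂; cases g₂
      have hc := hcond τ (by omega) (by omega)
      rw [if_pos (by omega)] at hc
      obtain ⟨t₁, τ₁, x₁, le₁, y₁, z₁, q₁⟩ := h₁ B (by omega) ins₁ i₁ j₁ σ₁ ρ₁ τ g₁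
        (by simpa using u₁) f₁ (by omega)
      obtain ⟨t₂, τ₂, x₂, le₂, y₂, z₂, q₂⟩ := h₂ B (by omega) ins₂ i₂ j₂ σ₂ ρ₂ τ₁ g₂
        (by simpa using u₂) (fun b => by
          rw [q₁ _ (notMem_range_left (by simp [right])) (by simp [right]), f₂])
        (by rw [q₁ _ (notMem_range_left (by omega)) (by omega), p₂]; omega)
      obtain ⟨t₃, τ₃, x₃, le₃, y₃, z₃⟩ := ih n₂ j₁ j₂ ρ₁ σ₁' ρ₂ σ₂' τ₂ w₁ w₂ (fun b => by
          rw [q₂ _ (notMem_range_right (by simp [left])) (by simp [left]), y₁]) y₂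
        (by rw [q₂ _ (notMem_range_right (by omega)) (by omega), z₁]) z₂
      refine ⟨_, τ₃, .loopTrue hc one_ne_zero (.seq x₁ x₂) x₃, ?_, y₃, ?_⟩
      · rw [hcost, Nat.add_min_add_right, mul_add_one]
        refine le_trans ?_ (Nat.add_le_add_right le₃ _)
        omega
      · rw [z₃, q₂ _ (notMem_range_right (by omega)) (by omega),
          q₁ _ (notMem_range_left (by omega)) (by omega)]

end Race
end WordRAM

/-! ### The race of two programs for all pairs shortest paths -/

namespace WordRAM

/-- An admissible input of the all pairs shortest path problem. -/
def GoodInput (c n : ℕ) (w : Fin n → Fin n → WithTop ℤ) : Prop :=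
  1 ≤ n ∧ (∀ i j, ∀ z : ℤ, w i j = (z : WithTop ℤ) → |z| ≤ (n : ℤ) ^ c) ∧ NoNegativeCycle w

/-- The program solves all pairs shortest paths on an input, in a given number of steps. -/
def SolvesIn (P : Prog) (k : ℕ) {n : ℕ} (w : Fin n → Fin n → WithTop ℤ) (t : ℕ) : Prop :=
  ∃ σ : State, Exec ((n + 2) ^ k) P (apspInput w) t σ ∧ apspOutput w σ

theorem bankOf_le {m V : ℕ} {f : Fin m → ℕ} (h : ∀ a, f a ≤ V) (a : ℕ) : bankOf f a ≤ V := by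
  unfold bankOf; split_ifs
  · exact h _
  · omega

theorem bankOf_of_le {m : ℕ} (f : Fin m → ℕ) {a : ℕ} (h : m ≤ a) : bankOf f a = 0 := by
  simp [bankOf, h]

theorem signCode_le (x : WithTop ℤ) : signCode x ≤ 2 := by
  cases x with
  | top => simp [signCode]
  | coe z => simp only [signCode]; split_ifs <;> omega

theorem GoodInput.bounded {c n : ℕ} {w : Fin n → Fin n → WithTop ℤ} (h : GoodInput c n w) :
    ∀ b a, apspInput w b a ≤ (n + 2) ^ (c + 2) := by
  have h1 : (n + 2) ^ 1 ≤ (n + 2) ^ (c + 2) := Nat.pow_le_pow_right (by omega) (by omega)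
  have h2 : n ^ c ≤ (n + 2) ^ (c + 2) :=
    (Nat.pow_le_pow_left (by omega) c).trans (Nat.pow_le_pow_right (by omega) (by omega))
  rw [pow_one] at h1
  intro b a
  match b with
  | 0 => exact bankOf_le (fun a => by fin_cases a; simp; omega) a
  | 1 =>
    have h3 : 2 ≤ (n + 2) ^ (c + 2) := by omega
    exact bankOf_le (f := fun a : Fin (n * n) => signCode (w a.divNat a.modNat))
      (fun a => (signCode_le _).trans h3) a
  | 2 =>
    show bankOf (fun a : Fin (n * n) => absCode (w a.divNat a.modNat)) a ≤ _
    refine bankOf_le (fun a => ?_) a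
    cases hx : w a.divNat a.modNat with
    | top => simp [absCode]
    | coe z =>
      have := h.2.1 _ _ z hx
      simp only [absCode]
      zify at h2 ⊢
      exact this.trans h2
  | b + 3 => simp [apspInput]

/-- A round of the race has constant cost, and copying the input to both programs and the output
back costs O(n²). The program counter of the first program tells which output is the finished one.
-/
theorem exists_race (c : ℕ) (P₁ P₂ : Prog) (k₁ k₂ : ℕ) : ∃ (P : Prog) (k C : ℕ),
    ∀ (n : ℕ) (w : Fin n → Fin n → WithTop ℤ), GoodInput c n w → ∀ t₁ t₂ : ℕ,
      SolvesIn P₁ k₁ w t₁ → SolvesIn P₂ k₂ w t₂ →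
      ∃ t, SolvesIn P k w t ∧ t ≤ C * (min t₁ t₂ + n * n) := by
  set c₁ := P₁.compile 0
  set c₂ := P₂.compile 0
  obtain ⟨κ, hκ⟩ := Race.stepLoop_exec c₁ c₂
  set v := κ + k₁ + k₂ + c + 3 with hv
  set s := Race.copyIn.size + (Race.copyOut c₁.length).size with hs
  -- The exponent `v` covers both given programs, the input and `κ`. The copying programs need words
  -- up to the `s`-th power of the values in memory; this factor occurs twice, because after the
  -- first copy and the race the memory is only known to be below `(n + 2) ^ (v * s)`.
  refine ⟨.seq (Race.copyIn.plain 20) (.seq (Race.stepLoop c₁ c₂)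
    ((Race.copyOut c₁.length).plain 20)), v * s * s, 11 * s + 2 * κ + 20 * s, ?_⟩
  rintro n w hw t₁ t₂ ⟨σ₁, x₁, o₁⟩ ⟨σ₂, x₂, o₂⟩
  have hn := hw.1
  set B := (n + 2) ^ v with hB
  have hs1 : 1 ≤ s := by have := Race.copyIn.one_le_size; omega
  have hle : ∀ {a : ℕ}, a ≤ v → (n + 2) ^ a ≤ B := fun h => Nat.pow_le_pow_right (by omega) h
  have hBs : B ^ s = (n + 2) ^ (v * s) := (pow_mul _ _ _).symm
  have hB2 : 2 ≤ B := by have := hle (a := 1) (by omega); rw [pow_one] at this; omega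
  have hBle : ∀ {a : ℕ}, a ≤ s → B ^ a ≤ (n + 2) ^ (v * s) := fun h =>
    (Nat.pow_le_pow_right (by omega) h).trans hBs.le
  have hκB : κ < B := by
    calc κ < 2 ^ κ := Nat.lt_two_pow_self
      _ ≤ (n + 2) ^ κ := Nat.pow_le_pow_left (by omega) _
      _ ≤ B := hle (by omega)
  have hin : ∀ b a, apspInput w b a < B := fun b a => (hw.bounded b a).trans_lt
    (Nat.pow_lt_pow_right (by omega) (by omega))
  have hnn : n * n ≤ B := by
    have := hle (a := 2) (by omega)
    nlinarith
  obtain ⟨u₁, τ₁, σ', y₁, le₁, ⟨_, f₁, f₂, f₈, f₅, f₆⟩, -, g₁, g₂⟩ :=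
    (Race.copyIn_does (V := B) (σ := apspInput w) (cur :=
        fun _ => ⊤) n (by simp [apspInput, bankOf])
      (fun a ha => bankOf_of_le _ (by omega)) (fun a ha => bankOf_of_le (fun a : Fin (n * n) =>
          signCode (w a.divNat a.modNat)) ha)
      (fun a ha => bankOf_of_le (fun a : Fin (n * n) => absCode (w a.divNat a.modNat)) ha)
      (fun b hb => by
        obtain ⟨b, rfl⟩ := Nat.exists_eq_add_of_le' hb; rfl) hnn
      (fun b _ a => (hin b a).le)).exec_plain (lim := 20) (B := (n + 2) ^ (v * s)) hB2
      (by simp [Race.copyIn, Cmd.Within, Cmd.forLoop]) (fun b _ a => (hin b a).le) (hBle (by omega))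
  have g : ∀ b, τ₁ b = σ' b ∨ 20 ≤ b ∧ τ₁ b = fun _ => 0 := by
    intro b
    by_cases hb : b < 20
    · exact .inl (g₁ b hb)
    · refine .inr ⟨by omega, ?_⟩
      rw [g₂ b (by omega)]
      obtain ⟨b, rfl⟩ := Nat.exists_eq_add_of_le' (show 3 ≤ b by omega); rfl
  have gl : ∀ b, τ₁ (Race.left b) = apspInput w b := by
    intro b
    rcases g (Race.left b) with h | ⟨h, h'⟩
    · rw [h]; exact f₁ b
    · rw [h']; simp only [Race.left] at h
      obtain ⟨b, rfl⟩ := Nat.exists_eq_add_of_le' (show 3 ≤ b by omega); rfl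
  have gr : ∀ b, τ₁ (Race.right b) = apspInput w b := by
    intro b
    rcases g (Race.right b) with h | ⟨h, h'⟩
    · rw [h]; exact f₂ b
    · rw [h']; simp only [Race.right] at h
      obtain ⟨b, rfl⟩ := Nat.exists_eq_add_of_le' (show 3 ≤ b by omega); rfl
  obtain ⟨n₁, l₁, s₁⟩ := (x₁.mono (hle (by omega))).steps (by omega) [] []
  obtain ⟨n₂, l₂, s₂⟩ := (x₂.mono (hle (by omega))).steps (by omega) [] []
  simp only [List.nil_append, List.append_nil, List.length_nil, zero_add] at s₁ s₂
  rw [← P₁.length_compile 0] at s₁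
  rw [← P₂.length_compile 0] at s₂
  obtain ⟨u₂, τ₂, y₂, le₂, fin, h₈⟩ := hκ B hκB n₁ n₂ 0 0 _ _ _ _ τ₁ s₁ s₂ gl gr
    (by rw [g₁ 5 (by omega), f₅]) (by rw [g₁ 6 (by omega), f₆])
  have hτ₁ : ∀ b a, τ₁ b a < (n + 2) ^ (v * s) := y₁.lt_bound fun b a =>
    (hin b a).trans_le ((pow_one B).symm.le.trans (hBle hs1))
  have hτ₂ : ∀ b a, τ₂ b a < (n + 2) ^ (v * s) :=
    (y₂.mono ((pow_one B).symm.le.trans (hBle hs1))).lt_bound hτ₁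
  have h8 : τ₂ 8 0 = n * n := by rw [h₈, g₁ 8 (by omega), f₈]
  have hB3 : 2 ≤ (n + 2) ^ (v * s) := hB2.trans ((pow_one B).symm.le.trans (hBle hs1))
  have hbd : State.BoundedBy ((n + 2) ^ (v * s)) 20 τ₂ := fun b _ a => (hτ₂ b a).le
  have hle₂ : (n + 2) ^ (v * s) ≤ (n + 2) ^ (v * s * s) :=
    Nat.pow_le_pow_right (by omega) (Nat.le_mul_of_pos_right _ hs1)
  have hout : Cmd.Does (fun cur => singletonGraph.value cur .stShortestPath) ((n + 2) ^ (v * s)) 0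
      (Race.copyOut c₁.length) τ₂ (fun _ => ⊤) (n * n * 4 + 2 + 1) 0 fun σ' _ =>
      ∀ σ : State, ((τ₂ 5 0 = c₁.length ∧ ∀ b, τ₂ (Race.left b) = σ b) ∨
        (τ₂ 5 0 < c₁.length ∧ ∀ b, τ₂ (Race.right b) = σ b)) →
        ∀ a < n * n, σ' 3 a = σ 3 a ∧ σ' 4 a = σ 4 a := by
    refine .ite (fun he => ?_) (fun he => ?_)
    · refine (Race.copyBanks_does (by omega) (by omega) (by omega) (by omega) h8 hbd).mono le_rfl
        le_rfl fun σ' _ _ h σ hσ a ha => ?_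
      rcases hσ with ⟨h5, -⟩ | ⟨h5, hσ⟩
      · simp [h5] at he
      · rw [← hσ, ← hσ]; exact h a ha
    · refine (Race.copyBanks_does (by omega) (by omega) (by omega) (by omega) h8 hbd).mono le_rfl
        le_rfl fun σ' _ _ h σ hσ a ha => ?_
      rcases hσ with ⟨h5, hσ⟩ | ⟨h5, hσ⟩
      · rw [← hσ, ← hσ]; exact h a ha
      · simp [h5] at he
  obtain ⟨u₃, τ₃, σ₃, y₃, le₃, ⟨_, f₃⟩, -, g₃, -⟩ := hout.exec_plain (lim := 20)
    (B := (n + 2) ^ (v * s * s)) hB3 (by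
      simp [Race.copyOut, Race.copyBanks, Cmd.Within, Cmd.forLoop]) hbd
    (by rw [pow_mul _ (v * s)]; exact Nat.pow_le_pow_right (by omega) (by omega))
  have hidx : ∀ i j : Fin n, (i : ℕ) * n + j < n * n := fun i j => by
    have := i.2; have := j.2; nlinarith
  refine ⟨u₁ + (u₂ + u₃), ⟨τ₃, .seq (y₁.mono hle₂)
    (.seq (y₂.mono (((pow_one B).symm.le.trans (hBle hs1)).trans hle₂)) y₃), ?_⟩, ?_⟩
  · intro i j
    have h₃ := fun σ hσ => f₃ σ hσ _ (hidx i j)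
    rw [g₃ 3 (by omega), g₃ 4 (by omega)]
    rcases fin with h | h
    · obtain ⟨d, hd, e₁, e₂⟩ := o₁ i j
      exact ⟨d, hd, (h₃ σ₁ (.inl h)).1.trans e₁, (h₃ σ₁ (.inl h)).2.trans e₂⟩
    · obtain ⟨d, hd, e₁, e₂⟩ := o₂ i j
      exact ⟨d, hd, (h₃ σ₂ (.inr h)).1.trans e₁, (h₃ σ₂ (.inr h)).2.trans e₂⟩
  · have hp : 1 ≤ n * n := Nat.mul_pos hn hn
    have hm : min n₁ n₂ ≤ min t₁ t₂ := by omega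
    have a₁ : u₁ ≤ s * (11 * (n * n)) := le₁.trans (Nat.mul_le_mul (by omega) (by omega))
    have a₃ : u₃ ≤ s * (7 * (n * n)) := le₃.trans (Nat.mul_le_mul (by omega) (by omega))
    have a₂ : u₂ ≤ κ * (min t₁ t₂ + n * n) := le₂.trans (Nat.mul_le_mul_left _ (by omega))
    have : (11 * s + 2 * κ + 20 * s) * (min t₁ t₂ + n * n) = 31 * (s * (min t₁ t₂)) +
      31 * (s * (n * n)) + 2 * (κ * (min t₁ t₂ + n * n)) := by ring
    rw [this]
    have e1 : s * (11 * (n * n)) = 11 * (s * (n * n)) := by ring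
    have e2 : s * (7 * (n * n)) = 7 * (s * (n * n)) := by ring
    omega

end WordRAM

/-! ### The grid as a plane graph -/

namespace Grid

variable (A h : ℕ)

/-- The number of horizontal edges of the grid with `A + 1` columns and `h + 1` rows. -/
def numHor : ℕ := (h + 1) * A

/-- The number of edges. -/
def numEdges : ℕ := numHor A h + h * (A + 1)

/-- The column of the left or upper end of an edge. -/
def col (e : ℕ) : ℕ := if e < numHor A h then e % A else (e - numHor A h) % (A + 1)

/-- The row of the left or upper end of an edge. -/
def row (e : ℕ) : ℕ := if e < numHor A h then e / A else (e - numHor A h) / (A + 1)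

/-- The left or upper end. -/
def fst (e : ℕ) : ℕ := row A h e * (A + 1) + col A h e

/-- The right or lower end. -/
def snd (e : ℕ) : ℕ := fst A h e + if e < numHor A h then 1 else A + 1

/-- The edges directed to the left (in the last row) or upwards (in the first column). -/
def Reversed (e : ℕ) : Prop := if e < numHor A h then row A h e = h else col A h e = 0

instance (e : ℕ) : Decidable (Reversed A h e) := by unfold Reversed; infer_instance

/-- The tail of an edge. -/
def src (e : ℕ) : ℕ := if Reversed A h e then snd A h e else fst A h e

/-- The head of an edge. -/
def tgt (e : ℕ) : ℕ := if Reversed A h e then fst A h e else snd A h e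

variable {A h}

theorem col_lt {e : ℕ} (he : e < numHor A h) : col A h e < A := by
  have : 0 < A := by
    rcases Nat.eq_zero_or_pos A with h0 | h0
    · simp [numHor, h0] at he
    · exact h0
  rw [col, if_pos he]
  exact Nat.mod_lt _ this

theorem row_le {e : ℕ} (he : e < numHor A h) : row A h e ≤ h := by
  rw [row, if_pos he]
  exact Nat.lt_succ_iff.1 (Nat.div_lt_of_lt_mul (by rwa [mul_comm] ))

theorem col_lt' {e : ℕ} (he : ¬ e < numHor A h) : col A h e < A + 1 := by
  rw [col, if_neg he]
  exact Nat.mod_lt _ (by omega)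

theorem row_lt' {e : ℕ} (he : ¬ e < numHor A h) (hm : e < numEdges A h) : row A h e < h := by
  rw [row, if_neg he]
  refine Nat.div_lt_of_lt_mul ?_
  rw [numEdges, mul_comm h] at hm
  omega

theorem col_le (e : ℕ) : col A h e ≤ A := by
  by_cases he : e < numHor A h
  · exact (col_lt he).le
  · exact Nat.lt_succ_iff.1 (col_lt' he)

theorem eq_of_row_col {e e' : ℕ} (hh : e < numHor A h ↔ e' < numHor A h)
    (hr : row A h e = row A h e') (hc : col A h e = col A h e') : e = e' := by
  by_cases he : e < numHor A h
  · have he' := hh.1 he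
    simp only [row, col, he, he', if_true] at hr hc
    rw [← Nat.div_add_mod e A, ← Nat.div_add_mod e' A, hr, hc]
  · have he' : ¬ e' < numHor A h := fun h => he (hh.2 h)
    simp only [row, col, he, he', if_false] at hr hc
    have := Nat.div_add_mod (e - numHor A h) (A + 1)
    rw [hr, hc, Nat.div_add_mod] at this
    omega

theorem mod_of_lt {x y : ℕ} (hx : x ≤ A) : (y * (A + 1) + x) % (A + 1) = x := by
  rw [mul_comm, Nat.mul_add_mod, Nat.mod_eq_of_lt (by omega)]

theorem div_of_lt {x y : ℕ} (hx : x ≤ A) : (y * (A + 1) + x) / (A + 1) = y := by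
  rw [mul_comm, Nat.mul_add_div (by omega), Nat.div_eq_of_lt (by omega), add_zero]

theorem fst_mod (e : ℕ) : fst A h e % (A + 1) = col A h e := mod_of_lt (col_le e)
theorem fst_div (e : ℕ) : fst A h e / (A + 1) = row A h e := div_of_lt (col_le e)

theorem snd_mod (e : ℕ) : snd A h e % (A + 1) =
    if e < numHor A h then col A h e + 1 else col A h e := by
  unfold snd fst
  split_ifs with he
  · exact mod_of_lt (x := col A h e + 1) (col_lt he)
  · rw [Nat.add_mod_right]; exact mod_of_lt (col_le e)

theorem snd_div (e : ℕ) : snd A h e / (A + 1) =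
    if e < numHor A h then row A h e else row A h e + 1 := by
  unfold snd fst
  split_ifs with he
  · exact div_of_lt (x := col A h e + 1) (col_lt he)
  · rw [Nat.add_div_right _ (by omega)]; rw [div_of_lt (col_le e)]

theorem node_lt {x y : ℕ} (hx : x ≤ A) (hy : y ≤ h) : y * (A + 1) + x < (h + 1) * (A + 1) := by
  nlinarith

theorem fst_lt {e : ℕ} (he : e < numEdges A h) : fst A h e < (h + 1) * (A + 1) := by
  refine node_lt (col_le e) ?_
  by_cases hh : e < numHor A h
  · exact row_le hh
  · exact (row_lt' hh he).le

theorem snd_lt {e : ℕ} (he : e < numEdges A h) : snd A h e < (h + 1) * (A + 1) := by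
  unfold snd fst
  split_ifs with hh
  · exact node_lt (x := col A h e + 1) (col_lt hh) (row_le hh)
  · have := node_lt (x := col A h e) (y := row A h e + 1) (h := h) (col_le e) (row_lt' hh he)
    linarith

theorem openSegment_right {a b : ℝ} {p : ℝ × ℝ} (hp : p ∈ openSegment ℝ (a, b) (a + 1, b)) :
    a < p.1 ∧ p.1 < a + 1 ∧ p.2 = b := by
  obtain ⟨s, t, hs, ht, hst, rfl⟩ := hp
  simp only [Prod.smul_mk, smul_eq_mul, Prod.mk_add_mk]
  obtain rfl : s = 1 - t := by linarith
  refine ⟨by nlinarith, by nlinarith, by ring⟩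

theorem openSegment_down {a b : ℝ} {p : ℝ × ℝ} (hp : p ∈ openSegment ℝ (a, b) (a, b + 1)) :
    b < p.2 ∧ p.2 < b + 1 ∧ p.1 = a := by
  obtain ⟨s, t, hs, ht, hst, rfl⟩ := hp
  simp only [Prod.smul_mk, smul_eq_mul, Prod.mk_add_mk]
  obtain rfl : s = 1 - t := by linarith
  refine ⟨by nlinarith, by nlinarith, by ring⟩

/-- Open unit intervals with integer ends are disjoint unless equal; this separates different
collinear edges of the grid. -/
theorem nat_unique {a b : ℕ} {r : ℝ} (h₁ : (a : ℝ) < r) (h₂ : r < a + 1) (h₃ : (b : ℝ) < r)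
    (h₄ : r < b + 1) : a = b := by
  have u : (a : ℝ) < b + 1 := by linarith
  have v : (b : ℝ) < a + 1 := by linarith
  norm_cast at u v
  omega

theorem nat_not_between {a b : ℕ} (h₁ : (a : ℝ) < b) (h₂ : (b : ℝ) < a + 1) : False := by
  norm_cast at h₁ h₂
  omega

/-- The position of a point on an edge. -/
theorem mem_edge {e : ℕ} {p : ℝ × ℝ}
    (hp : p ∈ openSegment ℝ (((src A h e % (A + 1) : ℕ) : ℝ), ((src A h e / (A + 1) : ℕ) : ℝ))
      (((tgt A h e % (A + 1) : ℕ) : ℝ), ((tgt A h e / (A + 1) : ℕ) : ℝ))) :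
    if e < numHor A h then (col A h e : ℝ) < p.1 ∧ p.1 < col A h e + 1 ∧ p.2 = row A h e
    else (row A h e : ℝ) < p.2 ∧ p.2 < row A h e + 1 ∧ p.1 = col A h e := by
  have hp' : p ∈ openSegment ℝ
      (((fst A h e % (A + 1) : ℕ) : ℝ), ((fst A h e / (A + 1) : ℕ) : ℝ))
      (((snd A h e % (A + 1) : ℕ) : ℝ), ((snd A h e / (A + 1) : ℕ) : ℝ)) := by
    unfold src tgt at hp
    split_ifs at hp
    · rwa [openSegment_symm]
    · exact hp
  rw [fst_mod, fst_div, snd_mod, snd_div] at hp'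
  split_ifs at hp' ⊢
  · push_cast at hp'; exact openSegment_right hp'
  · push_cast at hp'; exact openSegment_down hp'

theorem fst_ne_snd (e : ℕ) : fst A h e ≠ snd A h e := by
  unfold snd; split_ifs <;> omega

variable (A h)

/-- The plane grid with `A + 1` columns and `h + 1` rows. -/
def graph : PlaneGraph ((h + 1) * (A + 1)) (numEdges A h) where
  x v := v % (A + 1)
  y v := v / (A + 1)
  src e := ⟨src A h e, by unfold src; split_ifs; exacts [snd_lt e.2, fst_lt e.2]⟩
  tgt e := ⟨tgt A h e, by unfold tgt; split_ifs; exacts [fst_lt e.2, snd_lt e.2]⟩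
  s := ⟨0, by positivity⟩
  t := ⟨h * (A + 1), by nlinarith⟩
  pos_injective := by
    intro v w hvw
    simp only [Prod.mk.injEq] at hvw
    apply Fin.ext
    rw [← Nat.div_add_mod v (A + 1), hvw.1, hvw.2, Nat.div_add_mod]
  src_ne_tgt e := by
    simp only [ne_eq, Fin.mk.injEq]
    unfold src tgt
    split_ifs
    · exact (fst_ne_snd _).symm
    · exact fst_ne_snd _
  node_notMem v e hv := by
    have := mem_edge hv
    split_ifs at this
    · exact nat_not_between this.1 this.2.1
    · exact nat_not_between this.1 this.2.1
  edges_disjoint e f hef := by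
    rw [Set.disjoint_left]
    intro p he hf
    have he := mem_edge he
    have hf := mem_edge hf
    split_ifs at he hf with h₁ h₂ h₂
    · refine hef (Fin.ext (eq_of_row_col (iff_of_true h₁ h₂) ?_ ?_))
      · have := he.2.2.symm.trans hf.2.2; exact_mod_cast this
      · exact nat_unique he.1 he.2.1 hf.1 hf.2.1
    · rw [hf.2.2] at he; exact nat_not_between he.1 he.2.1
    · rw [hf.2.2] at he; exact nat_not_between he.1 he.2.1
    · refine hef (Fin.ext (eq_of_row_col (iff_of_false h₁ h₂) ?_ ?_))
      · exact nat_unique he.1 he.2.1 hf.1 hf.2.1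
      · have := he.2.2.symm.trans hf.2.2; exact_mod_cast this

variable {A h}

/-- The horizontal edge from column `x` to column `x + 1` in row `y`. -/
def hor (A x y : ℕ) : ℕ := y * A + x

/-- The vertical edge from row `y` to row `y + 1` in column `x`. -/
def ver (A h x y : ℕ) : ℕ := numHor A h + (y * (A + 1) + x)

theorem hor_lt {x y : ℕ} (hx : x < A) (hy : y ≤ h) : hor A x y < numHor A h := by
  unfold hor numHor; nlinarith

theorem hor_lt_numEdges {x y : ℕ} (hx : x < A) (hy : y ≤ h) : hor A x y < numEdges A h :=
  (hor_lt hx hy).trans_le (Nat.le_add_right _ _)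

theorem ver_lt {x y : ℕ} (hx : x ≤ A) (hy : y < h) : ver A h x y < numEdges A h := by
  unfold ver numEdges
  have : y * (A + 1) + x < h * (A + 1) := by nlinarith
  omega

theorem ver_not_lt {x y : ℕ} : ¬ ver A h x y < numHor A h := by unfold ver; omega

theorem col_hor {x y : ℕ} (hx : x < A) (hy : y ≤ h) : col A h (hor A x y) = x := by
  rw [col, if_pos (hor_lt hx hy), hor, mul_comm, Nat.mul_add_mod, Nat.mod_eq_of_lt hx]

theorem row_hor {x y : ℕ} (hx : x < A) (hy : y ≤ h) : row A h (hor A x y) = y := by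
  rw [row, if_pos (hor_lt hx hy), hor, mul_comm, Nat.mul_add_div (by omega),
    Nat.div_eq_of_lt hx, add_zero]

theorem col_ver {x y : ℕ} (hx : x ≤ A) : col A h (ver A h x y) = x := by
  rw [col, if_neg ver_not_lt, ver, Nat.add_sub_cancel_left, mod_of_lt hx]

theorem row_ver {x y : ℕ} (hx : x ≤ A) : row A h (ver A h x y) = y := by
  rw [row, if_neg ver_not_lt, ver, Nat.add_sub_cancel_left, div_of_lt hx]

theorem eq_hor {e x y : ℕ} (he : e < numHor A h) (hc : col A h e = x) (hr : row A h e = y) :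
    e = hor A x y := by
  subst hc hr
  exact eq_of_row_col (iff_of_true he (hor_lt (col_lt he) (row_le he)))
    (row_hor (col_lt he) (row_le he)).symm (col_hor (col_lt he) (row_le he)).symm

theorem eq_ver {e x y : ℕ} (he : ¬ e < numHor A h) (hc : col A h e = x) (hr : row A h e = y) :
    e = ver A h x y := by
  subst hc hr
  exact eq_of_row_col (iff_of_false he ver_not_lt) (row_ver (col_le e)).symm
    (col_ver (col_le e)).symm

end Grid

/-! ### Walks -/

section Walk

variable {V : Type} (w : V → V → ℕ∞)

/-- There is a walk of weight at most `d`. -/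
def Reach (a b : V) (d : ℕ) : Prop :=
  ∃ l : List V, (a :: l).getLast (List.cons_ne_nil a l) = b ∧ walkWeight w a l ≤ d

variable {w}

theorem walkWeight_append_cons {α : Type} [AddMonoid α] (w : V → V → α) (x : V) (r : List V) :
    ∀ (l : List V) (a : V),
      walkWeight w a (l ++ x :: r) = walkWeight w a (l ++ [x]) + walkWeight w x r := by
  intro l
  induction l with
  | nil => intro a; simp [walkWeight]
  | cons b l ih => intro a; simp only [List.cons_append, walkWeight]; rw [ih, add_assoc]

theorem walkWeight_append {α : Type} [AddMonoid α] (w : V → V → α) (r : List V) :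
    ∀ (l : List V) (a : V), walkWeight w a (l ++ r) =
      walkWeight w a l + walkWeight w ((a :: l).getLast (List.cons_ne_nil a l)) r := by
  intro l
  induction l with
  | nil => intro a; simp [walkWeight]
  | cons b l ih =>
    intro a
    simp only [List.cons_append, walkWeight]
    rw [ih, add_assoc]
    simp

theorem getLast_cons_append (a : V) (l r : List V) (h : a :: (l ++ r) ≠ []) :
    (a :: (l ++ r)).getLast h =
      ((a :: l).getLast (List.cons_ne_nil a l) :: r).getLast (List.cons_ne_nil _ r) := by
  induction l generalizing a with
  | nil => simp
  | cons b l ih =>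
    simp only [List.cons_append]
    rw [List.getLast_cons (by simp), ih, List.getLast_cons (List.cons_ne_nil b l)]

theorem Reach.refl (a : V) : Reach w a a 0 := ⟨[], rfl, by simp [walkWeight]⟩

theorem Reach.step {a b : V} {d : ℕ} (h : w a b ≤ d) : Reach w a b d :=
  ⟨[b], by simp, by simpa [walkWeight] using h⟩

theorem Reach.trans {a b c : V} {d e : ℕ} (h₁ : Reach w a b d) (h₂ : Reach w b c e) :
    Reach w a c (d + e) := by
  obtain ⟨l, rfl, hl⟩ := h₁
  obtain ⟨r, rfl, hr⟩ := h₂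
  refine ⟨l ++ r, getLast_cons_append _ _ _ _, ?_⟩
  rw [walkWeight_append]
  push_cast
  exact add_le_add hl hr

theorem Reach.mono {a b : V} {d e : ℕ} (h : Reach w a b d) (hd : d ≤ e) : Reach w a b e := by
  obtain ⟨l, h₁, h₂⟩ := h
  exact ⟨l, h₁, h₂.trans (by exact_mod_cast hd)⟩

theorem Reach.of_le {w' : V → V → ℕ∞} (hw : ∀ a b, w' a b ≤ w a b) {a b : V} {d : ℕ}
    (h : Reach w a b d) : Reach w' a b d := by
  obtain ⟨l, h₁, h₂⟩ := h
  refine ⟨l, h₁, le_trans ?_ h₂⟩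
  clear h₁ h₂
  induction l generalizing a with
  | nil => exact le_rfl
  | cons c l ih => exact add_le_add (hw a c) ih

theorem Reach.sInf_le {a b : V} {d : ℕ} (h : Reach w a b d) : sInf (walkWeights w a b) ≤ d := by
  obtain ⟨l, h₁, h₂⟩ := h
  exact (_root_.sInf_le (show _ ∈ walkWeights w a b from ⟨l, h₁, rfl⟩)).trans h₂

theorem Reach.symm (hw : ∀ a b, w a b = w b a) {a b : V} {d : ℕ} (h : Reach w a b d) :
    Reach w b a d := by
  obtain ⟨l, rfl, hl⟩ := h
  obtain ⟨l', h₁, h₂⟩ : ∃ l', ((a :: l).getLast (List.cons_ne_nil a l) :: l').getLast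
      (List.cons_ne_nil _ l') = a ∧
      walkWeight w ((a :: l).getLast (List.cons_ne_nil a l)) l' ≤ walkWeight w a l := by
    clear hl
    induction l generalizing a with
    | nil => exact ⟨[], rfl, le_rfl⟩
    | cons b l ih =>
      obtain ⟨l', h₁, h₂⟩ := ih (a := b)
      rw [List.getLast_cons (List.cons_ne_nil b l)]
      refine ⟨l' ++ [a], ?_, ?_⟩
      · rw [getLast_cons_append]; simp
      · rw [walkWeight_append, h₁, walkWeight, walkWeight, add_zero, walkWeight, add_comm, hw b a]
        exact add_le_add le_rfl h₂
  exact ⟨l', h₁, h₂.trans hl⟩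

/-- A function that increases along no arc by more than its weight bounds distances from below; the
increments telescope along a walk. -/
theorem potential_le {π : V → ℕ} (h : ∀ a b, (π b : ℕ∞) ≤ π a + w a b) :
    ∀ (l : List V) (a : V),
      (π ((a :: l).getLast (List.cons_ne_nil a l)) : ℕ∞) ≤ π a + walkWeight w a l := by
  intro l
  induction l with
  | nil => intro a; simp [walkWeight]
  | cons b l ih =>
    intro a
    rw [List.getLast_cons (List.cons_ne_nil b l)]
    refine (ih b).trans ?_
    rw [walkWeight, ← add_assoc]
    exact add_le_add (h a b) le_rfl

theorem le_sInf_walkWeights {π : V → ℕ} (h : ∀ a b, (π b : ℕ∞) ≤ π a + w a b) {a b : V} {d : ℕ}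
    (hd : π a + d ≤ π b) : (d : ℕ∞) ≤ sInf (walkWeights w a b) := by
  refine le_sInf ?_
  rintro x ⟨l, rfl, rfl⟩
  have h1 := potential_le h l a
  have h2 : (π a : ℕ∞) + d ≤ π a + walkWeight w a l :=
    le_trans (by exact_mod_cast hd) h1
  exact (ENat.add_le_add_iff_left (by simp)).1 h2

theorem exists_repeated : ∀ {L : List V}, ¬ L.Nodup → ∃ l₁ x l₂ l₃, L = l₁ ++ x :: (l₂ ++ x :: l₃)
  | [], h => absurd List.nodup_nil h
  | a :: L, h => by
    by_cases ha : a ∈ L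
    · obtain ⟨l₂, l₃, rfl⟩ := List.append_of_mem ha
      exact ⟨[], a, l₂, l₃, rfl⟩
    · have : ¬ L.Nodup := fun hn => h (List.nodup_cons.2 ⟨ha, hn⟩)
      obtain ⟨l₁, x, l₂, l₃, rfl⟩ := exists_repeated this
      exact ⟨a :: l₁, x, l₂, l₃, rfl⟩

/-- A closed walk contains a cycle of at most its weight. -/
theorem exists_cycle_le (k : ℕ) : ∀ (v : V) (l : List V), l.length ≤ k →
    ∃ (v' : V) (l' : List V), (v' :: l').Nodup ∧
      walkWeight w v' (l' ++ [v']) ≤ walkWeight w v (l ++ [v]) := by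
  induction k with
  | zero =>
    intro v l hl
    obtain rfl : l = [] := List.length_eq_zero_iff.1 (by omega)
    exact ⟨v, [], by simp, le_rfl⟩
  | succ k ih =>
    intro v l hl
    by_cases hn : (v :: l).Nodup
    · exact ⟨v, l, hn, le_rfl⟩
    · obtain ⟨l₁, x, l₂, l₃, h⟩ := exists_repeated hn
      cases l₁ with
      | nil =>
        simp only [List.nil_append, List.cons.injEq] at h
        obtain ⟨rfl, rfl⟩ := h
        obtain ⟨v', l', h₁, h₂⟩ := ih v l₂ (by simp at hl; omega)
        refine ⟨v', l', h₁, h₂.trans ?_⟩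
        rw [show (l₂ ++ v :: l₃) ++ [v] = l₂ ++ v :: (l₃ ++ [v]) by simp,
          walkWeight_append_cons w v (l₃ ++ [v]) l₂ v]
        exact le_self_add
      | cons y l₁ =>
        simp only [List.cons_append, List.cons.injEq] at h
        obtain ⟨rfl, rfl⟩ := h
        obtain ⟨v', l', h₁, h₂⟩ := ih x l₂ (by simp at hl; omega)
        refine ⟨v', l', h₁, h₂.trans ?_⟩
        rw [show (l₁ ++ x :: (l₂ ++ x :: l₃)) ++ [v] = l₁ ++ x :: (l₂ ++ x :: (l₃ ++ [v])) by simp,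
          walkWeight_append_cons w x (l₂ ++ x :: (l₃ ++ [v])) l₁ v,
          walkWeight_append_cons w x (l₃ ++ [v]) l₂ x]
        exact le_add_left le_self_add

/-- If every arc increases `τ` or has a surplus of `d` over the potential, then closed walks have
weight at least `d`. -/
theorem le_closed_walk {π τ : V → ℕ} {d : ℕ}
    (h : ∀ a b, (τ a < τ b ∧ (π b : ℕ∞) ≤ π a + w a b) ∨ (π b + d : ℕ∞) ≤ π a + w a b)
    (v : V) (l : List V) : (d : ℕ∞) ≤ walkWeight w v (l ++ [v]) := by
  have h' : ∀ a b, (π b : ℕ∞) ≤ π a + w a b := fun a b => by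
    rcases h a b with h | h
    · exact h.2
    · exact le_trans le_self_add h
  -- Either all arcs of the walk raise `τ`, which is impossible for a closed walk, or some arc has
  -- the surplus `d`, which the potential carries over to the whole walk.
  have key : ∀ (l : List V) (a b : V),
      (τ a < τ b) ∨ (π b + d : ℕ∞) ≤ π a + walkWeight w a (l ++ [b]) := by
    intro l
    induction l with
    | nil =>
      intro a b
      rcases h a b with h | h
      · exact .inl h.1
      · right; simpa [walkWeight] using h
    | cons c l ih =>
      intro a b
      simp only [List.cons_append, walkWeight]
      rcases ih c b with i | i
      · rcases h a c with j | j
        · exact .inl (j.1.trans i)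
        · right
          have := potential_le h' (l ++ [b]) c
          rw [getLast_cons_append] at this
          simp only [List.getLast_cons_cons, List.getLast_singleton] at this
          calc (π b + d : ℕ∞) ≤ (π c + walkWeight w c (l ++ [b])) + d := add_le_add this le_rfl
            _ = (π c + d) + walkWeight w c (l ++ [b]) := by rw [add_right_comm]
            _ ≤ (π a + w a c) + walkWeight w c (l ++ [b]) := add_le_add j le_rfl
            _ = _ := add_assoc _ _ _
      · right
        calc (π b + d : ℕ∞) ≤ π c + walkWeight w c (l ++ [b]) := i
          _ ≤ (π a + w a c) + walkWeight w c (l ++ [b]) := add_le_add (h' a c) le_rfl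
          _ = _ := add_assoc _ _ _
  rcases key l v v with i | i
  · exact absurd i (lt_irrefl _)
  · exact (ENat.add_le_add_iff_left (by simp)).1 i

end Walk

section Arcs

variable {N m : ℕ} (G : PlaneGraph N m) (cur : Fin m → ℕ∞)

theorem PlaneGraph.arcs_le (e : Fin m) : G.arcs cur (G.src e) (G.tgt e) ≤ cur e :=
  iInf₂_le e ⟨rfl, rfl⟩

theorem PlaneGraph.le_arcs {a b : Fin N} {c : ℕ∞}
    (h : ∀ e, G.src e = a → G.tgt e = b → c ≤ cur e) : c ≤ G.arcs cur a b :=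
  le_iInf₂ fun e he => h e he.1 he.2

theorem PlaneGraph.potential_edges {π : Fin N → ℕ}
    (h : ∀ e, (π (G.tgt e) : ℕ∞) ≤ π (G.src e) + cur e ∧ (π (G.src e) : ℕ∞) ≤ π (G.tgt e) + cur e)
    (a b : Fin N) : (π b : ℕ∞) ≤ π a + G.edges cur a b := by
  rw [← tsub_le_iff_left]
  refine le_min (G.le_arcs cur fun e h₁ h₂ => ?_) (G.le_arcs cur fun e h₁ h₂ => ?_)
  · rw [tsub_le_iff_left, ← h₁, ← h₂]; exact (h e).1
  · rw [tsub_le_iff_left, ← h₁, ← h₂]; exact (h e).2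

end Arcs

/-! ### Edge weights of the grid that encode a vector and a matrix -/

namespace Gadget

variable (n₂ n₃ S : ℕ)

/-- The weight of a vertical step. -/
def drop : ℕ := (n₃ + 1) * (2 * S)
/-- The weight of edges that are not used. -/
def big : ℕ := (n₂ + 1) * drop n₃ S + n₃ * ((n₂ + 1) * (2 * S)) + 2 * S
/-- The weight of the edges at the two terminals. -/
def pend : ℕ := (2 * n₃ + n₂ + 4) * big n₂ n₃ S
/-- The weight of the edges that cut off the first column. -/
def far : ℕ := 2 * pend n₂ n₃ S + big n₂ n₃ S

variable (a : ℕ → ℕ) (b : ℕ → ℕ → ℕ)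

/-- The weight of the horizontal edge from column `x` to column `x + 1` in row `y`. -/
def horWeight (x y : ℕ) : ℕ :=
  if x = 0 then (if y = 0 ∨ y = n₂ + 1 then pend n₂ n₃ S else far n₂ n₃ S)
  else if y = 0 ∨ y = n₂ + 1 then 0
  else if x ≤ n₃ then (n₂ + 1 - y) * (2 * S) + (if x = n₃ then a y else 0)
  else y * (2 * S) + b y (x - n₃) - b y (x - n₃ - 1)

/-- The weight of the vertical edge from row `y` to row `y + 1` in column `x`; in the first and
the last layer, only the columns `top` and `bot` are open. -/
def verWeight (top bot x y : ℕ) : ℕ :=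
  if x = 0 then (if y = n₂ then far n₂ n₃ S else 0)
  else if y = 0 then (if x = top then drop n₃ S else big n₂ n₃ S)
  else if y = n₂ then (if x = bot then drop n₃ S else big n₂ n₃ S)
  else drop n₃ S

/-- The weight of an edge of the grid. -/
def weight (top bot e : ℕ) : ℕ :=
  if e < Grid.numHor (2 * n₃ + 1) (n₂ + 1) then
    horWeight n₂ n₃ S a b (Grid.col (2 * n₃ + 1) (n₂ + 1) e) (Grid.row (2 * n₃ + 1) (n₂ + 1) e)
  else verWeight n₂ n₃ S top bot (Grid.col (2 * n₃ + 1) (n₂ + 1) e)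
    (Grid.row (2 * n₃ + 1) (n₂ + 1) e)

/-- The least of `2 * S` and the sums `a i + b i j` with `1 ≤ i ≤ k`. -/
def rowMin (j : ℕ) : ℕ → ℕ
  | 0 => 2 * S
  | k + 1 => min (rowMin j k) (a (k + 1) + b (k + 1) j)

/-- The length of a shortest path between the inner terminals. -/
def dist (j : ℕ) : ℕ :=
  (n₂ + 1) * drop n₃ S + j * ((n₂ + 1) * (2 * S)) + rowMin S a b j n₂

/-- The potential in the main part of the grid. -/
def mainPot (j x y : ℕ) : ℕ :=
  if x ≤ n₃ + 1 then
    y * drop n₃ S + (x - (n₃ + 1 - j)) * ((n₂ + 1 - y) * (2 * S)) + (if x = n₃ + 1 then a y else 0)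
  else if x < n₃ + 1 + j then
    y * drop n₃ S + j * ((n₂ + 1 - y) * (2 * S)) + (x - (n₃ + 1)) * (y * (2 * S)) + a y +
      b y (x - (n₃ + 1))
  else y * drop n₃ S + j * ((n₂ + 1) * (2 * S)) + rowMin S a b j y

/-- A lower bound for the distances from the first terminal. -/
def pot (j x y : ℕ) : ℕ :=
  if x = 0 then (if y = n₂ + 1 then dist n₂ n₃ S a b j + 2 * pend n₂ n₃ S else 0)
  else if y = 0 then pend n₂ n₃ S
  else if y = n₂ + 1 then dist n₂ n₃ S a b j + pend n₂ n₃ S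
  else pend n₂ n₃ S + mainPot n₂ n₃ S a b j x y

variable {n₂ n₃ S a b} {j x y k : ℕ}

theorem rowMin_le : rowMin S a b j k ≤ 2 * S := by
  induction k with
  | zero => exact le_rfl
  | succ k ih => exact (min_le_left _ _).trans ih

theorem rowMin_le_add (hk : 1 ≤ k) : rowMin S a b j k ≤ a k + b k j := by
  cases k with
  | zero => omega
  | succ k => exact min_le_right _ _

/-- All sums are at most `2 * S`, so the initial value `2 * S` never undercuts them and the minimum
is attained by an index. -/
theorem exists_rowMin (ha : ∀ y, a y ≤ S) (hb : ∀ y c, b y c ≤ S) (hk : 1 ≤ k) :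
    ∃ i, 1 ≤ i ∧ i ≤ k ∧ rowMin S a b j k = a i + b i j := by
  induction k with
  | zero => omega
  | succ k ih =>
    rcases Nat.eq_zero_or_pos k with rfl | h0
    · refine ⟨1, le_rfl, le_rfl, min_eq_right ?_⟩
      have := ha (0 + 1); have := hb (0 + 1) j
      simp only [rowMin]; omega
    · obtain ⟨i, h₁, h₂, h₃⟩ := ih h0
      rcases le_total (rowMin S a b j k) (a (k + 1) + b (k + 1) j) with h | h
      · exact ⟨i, h₁, by omega, by rw [rowMin, min_eq_left h, h₃]⟩
      · exact ⟨k + 1, by omega, le_rfl, by rw [rowMin, min_eq_right h]⟩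

/-- The formula right of the middle also holds in the middle column itself, because `b y 0 = 0`;
this removes a case distinction. -/
theorem mainPot_mid (hb0 : ∀ y, b y 0 = 0) (hj : 1 ≤ j) (hj' : j ≤ n₃) {c : ℕ} (hc : c < j) :
    mainPot n₂ n₃ S a b j (n₃ + 1 + c) y = y * drop n₃ S + j * ((n₂ + 1 - y) * (2 * S)) +
      c * (y * (2 * S)) + a y + b y c := by
  unfold mainPot
  rcases Nat.eq_zero_or_pos c with rfl | h0
  · rw [if_pos (by omega), if_pos (by omega), show n₃ + 1 + 0 - (n₃ + 1 - j) = j by omega, hb0]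
    ring
  · rw [if_neg (by omega), if_pos (by omega), Nat.add_sub_cancel_left]

/-- This is what `big` is made for: no closed vertical edge, of weight `big`, can violate the
potential. -/
theorem mainPot_le (ha : ∀ y, a y ≤ S) (hb : ∀ y c, b y c ≤ S) (hj' : j ≤ n₃)
    (hy : y ≤ n₂) : mainPot n₂ n₃ S a b j x y ≤ big n₂ n₃ S := by
  have h1 : y * drop n₃ S ≤ (n₂ + 1) * drop n₃ S := Nat.mul_le_mul_right _ (by omega)
  have h2 : j * ((n₂ + 1) * (2 * S)) ≤ n₃ * ((n₂ + 1) * (2 * S)) := Nat.mul_le_mul_right _ hj'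
  have ha := ha y
  unfold mainPot big
  split_ifs with c₁ c₂ c₃
  · have h3 : (x - (n₃ + 1 - j)) * ((n₂ + 1 - y) * (2 * S)) ≤ n₃ * ((n₂ + 1) * (2 * S)) :=
      Nat.mul_le_mul (by omega) (Nat.mul_le_mul_right _ (by omega))
    omega
  · have h3 : (x - (n₃ + 1 - j)) * ((n₂ + 1 - y) * (2 * S)) ≤ n₃ * ((n₂ + 1) * (2 * S)) :=
      Nat.mul_le_mul (by omega) (Nat.mul_le_mul_right _ (by omega))
    omega
  · have h3 : (x - (n₃ + 1)) * (y * (2 * S)) ≤ j * (y * (2 * S)) :=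
      Nat.mul_le_mul_right _ (by omega)
    have h4 : j * ((n₂ + 1 - y) * (2 * S)) + j * (y * (2 * S)) = j * ((n₂ + 1) * (2 * S)) := by
      rw [← mul_add, ← add_mul, Nat.sub_add_cancel (by omega)]
    have := hb y (x - (n₃ + 1))
    omega
  · have := rowMin_le (S := S) (a := a) (b := b) (j := j) (k := y)
    omega

theorem dist_le (hj' : j ≤ n₃) : dist n₂ n₃ S a b j ≤ big n₂ n₃ S := by
  have h2 : j * ((n₂ + 1) * (2 * S)) ≤ n₃ * ((n₂ + 1) * (2 * S)) := Nat.mul_le_mul_right _ hj'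
  have := rowMin_le (S := S) (a := a) (b := b) (j := j) (k := n₂)
  unfold dist big
  omega

/-- The potential is constant left of the opened top column, then grows by exactly the weight of
each edge up to column `n₃ + j`. The next edge enters the opened bottom column, where `a y + b y j`
is replaced by the minimum over the rows up to y, so the growth can only be smaller there. Further
to the right the potential is constant again. -/
theorem mainPot_hor (ha : ∀ y, a y ≤ S) (hb : ∀ y c, b y c ≤ S) (hb0 : ∀ y, b y 0 = 0)
    (hj : 1 ≤ j) (hj' : j ≤ n₃) (hx : 1 ≤ x) (hy : 1 ≤ y) (hy' : y ≤ n₂) :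
    mainPot n₂ n₃ S a b j (x + 1) y ≤ mainPot n₂ n₃ S a b j x y + horWeight n₂ n₃ S a b x y ∧
    mainPot n₂ n₃ S a b j x y ≤ mainPot n₂ n₃ S a b j (x + 1) y + horWeight n₂ n₃ S a b x y := by
  have hw : horWeight n₂ n₃ S a b x y =
      if x ≤ n₃ then (n₂ + 1 - y) * (2 * S) + (if x = n₃ then a y else 0)
      else y * (2 * S) + b y (x - n₃) - b y (x - n₃ - 1) := by
    unfold horWeight
    rw [if_neg (by omega), if_neg (by omega)]
  -- Together with `1 ≤ y` this makes the truncated difference in the weights right of the middle a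
  -- true one.
  have hS : 2 * S ≤ y * (2 * S) := Nat.le_mul_of_pos_left _ hy
  by_cases h1 : x ≤ n₃
  · rw [hw, if_pos h1]
    unfold mainPot
    rw [if_pos (show x + 1 ≤ n₃ + 1 by omega), if_pos (show x ≤ n₃ + 1 by omega),
      if_neg (show ¬ x = n₃ + 1 by omega)]
    simp only [Nat.add_right_cancel_iff]
    by_cases h2 : n₃ + 1 - j ≤ x
    · obtain ⟨k, rfl⟩ := Nat.exists_eq_add_of_le h2
      rw [show n₃ + 1 - j + k + 1 - (n₃ + 1 - j) = k + 1 by omega, Nat.add_sub_cancel_left,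
        add_mul, one_mul]
      omega
    · rw [show x + 1 - (n₃ + 1 - j) = 0 by omega, show x - (n₃ + 1 - j) = 0 by omega,
        if_neg (by omega)]
      omega
  · obtain ⟨c, rfl⟩ := Nat.exists_eq_add_of_le (show n₃ + 1 ≤ x by omega)
    rw [hw, if_neg (by omega), show n₃ + 1 + c - n₃ = c + 1 by omega, Nat.add_sub_cancel]
    have hbc := hb y c
    have hbc' := hb y (c + 1)
    have hay := ha y
    rcases lt_trichotomy (c + 1) j with h2 | h2 | h2
    · rw [mainPot_mid hb0 hj hj' (by omega), add_assoc (n₃ + 1) c 1,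
        mainPot_mid hb0 hj hj' h2, add_mul, one_mul]
      omega
    · rw [mainPot_mid hb0 hj hj' (by omega), add_assoc (n₃ + 1) c 1]
      have e : mainPot n₂ n₃ S a b j (n₃ + 1 + (c + 1)) y =
          y * drop n₃ S + j * ((n₂ + 1) * (2 * S)) + rowMin S a b j y := by
        unfold mainPot
        rw [if_neg (by omega), if_neg (by omega)]
      -- The basic weights of the two halves add up to `(n₂ + 1) * (2 * S)` per pair of columns,
      -- whatever the row.
      have e' : j * ((n₂ + 1) * (2 * S)) = j * ((n₂ + 1 - y) * (2 * S)) + c * (y * (2 * S)) +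
          y * (2 * S) := by
        rw [show n₂ + 1 = (n₂ + 1 - y) + y by omega, ← h2]
        simp only [Nat.add_sub_cancel]
        ring
      have := rowMin_le_add (S := S) (a := a) (b := b) (j := j) hy
      rw [e, e', h2]
      rw [h2] at hbc'
      omega
    · have e : ∀ c', j ≤ c' → mainPot n₂ n₃ S a b j (n₃ + 1 + c') y =
          y * drop n₃ S + j * ((n₂ + 1) * (2 * S)) + rowMin S a b j y := by
        intro c' hc'
        unfold mainPot
        rw [if_neg (by omega), if_neg (by omega)]
      rw [add_assoc (n₃ + 1) c 1, e _ (by omega), e _ (by omega)]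
      omega

/-- One row further down the basic weights already collected change by at most `j * (2 * S)` in
total, and never upwards by more than `drop`. In the columns where entries of `a` or `b` contribute,
at least one unit `2 * S` of decrease is left over, which absorbs the change of the entries. In the
remaining columns `rowMin` decreases with the row. -/
theorem mainPot_ver (ha : ∀ y, a y ≤ S) (hb : ∀ y c, b y c ≤ S)
    (hj : 1 ≤ j) (hj' : j ≤ n₃) (hy' : y < n₂) :
    mainPot n₂ n₃ S a b j x (y + 1) ≤ mainPot n₂ n₃ S a b j x y + drop n₃ S ∧
    mainPot n₂ n₃ S a b j x y ≤ mainPot n₂ n₃ S a b j x (y + 1) + drop n₃ S := by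
  obtain ⟨z, hz⟩ := Nat.exists_eq_add_of_le (show y + 1 ≤ n₂ by omega)
  have hz1 : n₂ + 1 - (y + 1) = z + 1 := by omega
  have hz2 : n₂ + 1 - y = z + 1 + 1 := by omega
  have ha1 := ha y
  have ha2 := ha (y + 1)
  have hd : drop n₃ S = n₃ * (2 * S) + 2 * S := by unfold drop; ring
  have hjS : j * (2 * S) ≤ n₃ * (2 * S) := Nat.mul_le_mul_right _ hj'
  have e0 : (y + 1) * drop n₃ S = y * drop n₃ S + drop n₃ S := by ring
  have e1 : ∀ k, k * ((z + 1 + 1) * (2 * S)) = k * ((z + 1) * (2 * S)) + k * (2 * S) := by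
    intro k; ring
  have e2 : ∀ c, c * ((y + 1) * (2 * S)) = c * (y * (2 * S)) + c * (2 * S) := by intro c; ring
  unfold mainPot
  rw [hz1, hz2, e0]
  split_ifs with c₁ c₂ c₃
  · rw [e1]
    have h3 : (x - (n₃ + 1 - j)) * (2 * S) ≤ j * (2 * S) := Nat.mul_le_mul_right _ (by omega)
    have h4 : 1 * (2 * S) ≤ (x - (n₃ + 1 - j)) * (2 * S) := Nat.mul_le_mul_right _ (by omega)
    omega
  · rw [e1]
    have h3 : (x - (n₃ + 1 - j)) * (2 * S) ≤ j * (2 * S) := Nat.mul_le_mul_right _ (by omega)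
    omega
  · rw [e1, e2]
    have h3 : (x - (n₃ + 1)) * (2 * S) + 2 * S ≤ j * (2 * S) := by
      rw [← Nat.succ_mul]; exact Nat.mul_le_mul_right _ (by omega)
    have := hb y (x - (n₃ + 1))
    have := hb (y + 1) (x - (n₃ + 1))
    omega
  · have h1 : rowMin S a b j (y + 1) ≤ rowMin S a b j y := min_le_left _ _
    have h2 := rowMin_le (S := S) (a := a) (b := b) (j := j) (k := y)
    omega

theorem pot_hor (ha : ∀ y, a y ≤ S) (hb : ∀ y c, b y c ≤ S) (hb0 : ∀ y, b y 0 = 0)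
    (hj : 1 ≤ j) (hj' : j ≤ n₃) (hy : y ≤ n₂ + 1) :
    pot n₂ n₃ S a b j (x + 1) y ≤ pot n₂ n₃ S a b j x y + horWeight n₂ n₃ S a b x y ∧
    pot n₂ n₃ S a b j x y ≤ pot n₂ n₃ S a b j (x + 1) y + horWeight n₂ n₃ S a b x y := by
  by_cases hx : x = 0
  · subst hx
    unfold pot horWeight
    rw [if_neg (by omega), if_pos rfl, if_pos rfl]
    by_cases h0 : y = 0
    · subst h0; simp
    · by_cases h1 : y = n₂ + 1
      · subst h1; simp; omega
      · have := mainPot_le (x := 0 + 1) ha hb hj' (show y ≤ n₂ by omega)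
        simp only [h0, h1, if_false, or_self, far]
        omega
  · by_cases h0 : y = 0 ∨ y = n₂ + 1
    · unfold pot
      rw [if_neg (by omega), if_neg hx]
      split_ifs <;> omega
    · have := mainPot_hor (x := x) ha hb hb0 hj hj' (by omega) (show 1 ≤ y by omega)
        (show y ≤ n₂ by omega)
      unfold pot
      simp only [Nat.add_eq_zero_iff, one_ne_zero, and_false, hx, (not_or.1 h0).1,
          (not_or.1 h0).2, if_false]
      omega

/-- In the opened columns the potential fits exactly: below the top opening it has grown by `drop`,
and at the bottom opening `drop` leads from the main potential to `dist`. In all other columns of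
these layers `big` is large enough. In the first column only the edge above the second terminal
matters, and `far` exceeds the whole range of the potential. -/
theorem pot_ver (ha : ∀ y, a y ≤ S) (hb : ∀ y c, b y c ≤ S) (hn₂ : 1 ≤ n₂)
    (hj : 1 ≤ j) (hj' : j ≤ n₃) (hy : y < n₂ + 1) :
    pot n₂ n₃ S a b j x (y + 1) ≤ pot n₂ n₃ S a b j x y +
      verWeight n₂ n₃ S (n₃ + 1 - j) (n₃ + 1 + j) x y ∧
    pot n₂ n₃ S a b j x y ≤ pot n₂ n₃ S a b j x (y + 1) +
      verWeight n₂ n₃ S (n₃ + 1 - j) (n₃ + 1 + j) x y := by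
  have hdist := dist_le (n₂ := n₂) (S := S) (a := a) (b := b) hj'
  by_cases hx : x = 0
  · subst hx
    unfold pot verWeight far
    simp only [if_true]
    split_ifs <;> omega
  · unfold pot verWeight
    simp only [hx, if_false]
    by_cases h0 : y = 0
    · subst h0
      have h1 := mainPot_le (x := x) ha hb hj' hn₂
      rw [if_neg (by omega), if_neg (by omega), if_pos rfl, if_pos rfl]
      split_ifs with ht
      · have : mainPot n₂ n₃ S a b j x (0 + 1) = drop n₃ S := by
          unfold mainPot
          rw [if_pos (by omega), if_neg (by omega), ht]; simp
        omega
      · simp only [zero_add]; omega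
    · by_cases h1 : y = n₂
      · subst h1
        have h1 := mainPot_le (x := x) ha hb hj' (le_refl y)
        rw [if_neg (by omega), if_pos rfl, if_neg h0, if_neg (by omega), if_neg h0, if_pos rfl]
        split_ifs with ht
        · have : mainPot y n₃ S a b j x y + drop n₃ S = dist y n₃ S a b j := by
            unfold mainPot dist
            rw [if_neg (by omega), if_neg (by omega)]; ring
          omega
        · omega
      · have := mainPot_ver (x := x) ha hb hj hj' (show y < n₂ by omega)
        rw [if_neg (by omega), if_neg (by omega), if_neg h0, if_neg (by omega), if_neg h0,
            if_neg h1]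
        omega

end Gadget

/-! ### Distances, cycles and diameter of the encoding grid -/

namespace Gadget

open Grid

section

variable {A h : ℕ}

/-- The node in column `x` and row `y` of the grid. -/
def node (A h x y : ℕ) : Fin ((h + 1) * (A + 1)) :=
  ⟨(y * (A + 1) + x) % ((h + 1) * (A + 1)), Nat.mod_lt _ (by positivity)⟩

theorem node_val {x y : ℕ} (hx : x ≤ A) (hy : y ≤ h) :
    (node A h x y : ℕ) = y * (A + 1) + x := Nat.mod_eq_of_lt (node_lt hx hy)

theorem node_mod {x y : ℕ} (hx : x ≤ A) (hy : y ≤ h) : (node A h x y : ℕ) % (A + 1) = x := by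
  rw [node_val hx hy, mod_of_lt hx]

theorem node_div {x y : ℕ} (hx : x ≤ A) (hy : y ≤ h) : (node A h x y : ℕ) / (A + 1) = y := by
  rw [node_val hx hy, div_of_lt hx]

theorem exists_node (v : Fin ((h + 1) * (A + 1))) : ∃ x y, x ≤ A ∧ y ≤ h ∧ v = node A h x y := by
  have h1 : (v : ℕ) % (A + 1) ≤ A := Nat.lt_succ_iff.1 (Nat.mod_lt _ (by omega))
  have h2 : (v : ℕ) / (A + 1) ≤ h := Nat.lt_succ_iff.1
    (Nat.div_lt_of_lt_mul (lt_of_lt_of_eq v.2 (Nat.mul_comm _ _)))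
  exact ⟨_, _, h1, h2, Fin.ext ((Nat.div_add_mod' _ _).symm.trans (node_val h1 h2).symm)⟩

theorem fst_hor {x y : ℕ} (hx : x < A) (hy : y ≤ h) : fst A h (hor A x y) = y * (A + 1) + x := by
  rw [fst, row_hor hx hy, col_hor hx hy]

theorem snd_hor {x y : ℕ} (hx : x < A) (hy : y ≤ h) :
    snd A h (hor A x y) = y * (A + 1) + (x + 1) := by
  rw [snd, fst_hor hx hy, if_pos (hor_lt hx hy), add_assoc]

theorem fst_ver {x y : ℕ} (hx : x ≤ A) : fst A h (ver A h x y) = y * (A + 1) + x := by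
  rw [fst, row_ver hx, col_ver hx]

theorem snd_ver {x y : ℕ} (hx : x ≤ A) :
    snd A h (ver A h x y) = (y + 1) * (A + 1) + x := by
  rw [snd, fst_ver hx, if_neg ver_not_lt]; ring

theorem reversed_hor {x y : ℕ} (hx : x < A) (hy : y ≤ h) : Reversed A h (hor A x y) ↔ y = h := by
  rw [Reversed, if_pos (hor_lt hx hy), row_hor hx hy]

theorem reversed_ver {x y : ℕ} (hx : x ≤ A) : Reversed A h (ver A h x y) ↔ x = 0 := by
  rw [Reversed, if_neg ver_not_lt, col_ver hx]

variable (wt : ℕ → ℕ)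

/-- The current edges when all edges are present. -/
def full (m : ℕ) (wt : ℕ → ℕ) : Fin m → ℕ∞ := fun e => (wt e : ℕ∞)

variable {wt}

theorem arc_right {x y : ℕ} (hx : x < A) (hy : y < h) :
    (graph A h).arcs (full _ wt) (node A h x y) (node A h (x + 1) y) ≤ wt (hor A x y) := by
  have h1 := (graph A h).arcs_le (full _ wt) ⟨hor A x y, hor_lt_numEdges hx hy.le⟩
  refine le_trans (le_of_eq ?_) h1
  congr 1
  · apply Fin.ext
    rw [node_val hx.le hy.le]
    simp only [graph, src]
    rw [if_neg (by rw [reversed_hor hx hy.le]; omega), fst_hor hx hy.le]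
  · apply Fin.ext
    rw [node_val hx hy.le]
    simp only [graph, tgt]
    rw [if_neg (by rw [reversed_hor hx hy.le]; omega), snd_hor hx hy.le]

theorem arc_left {x : ℕ} (hx : x < A) :
    (graph A h).arcs (full _ wt) (node A h (x + 1) h) (node A h x h) ≤ wt (hor A x h) := by
  have h1 := (graph A h).arcs_le (full _ wt) ⟨hor A x h, hor_lt_numEdges hx le_rfl⟩
  refine le_trans (le_of_eq ?_) h1
  congr 1
  · apply Fin.ext
    rw [node_val hx le_rfl]
    simp only [graph, src]
    rw [if_pos (by rw [reversed_hor hx le_rfl]), snd_hor hx le_rfl]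
  · apply Fin.ext
    rw [node_val hx.le le_rfl]
    simp only [graph, tgt]
    rw [if_pos (by rw [reversed_hor hx le_rfl]), fst_hor hx le_rfl]

theorem arc_down {x y : ℕ} (hx : x ≤ A) (hx0 : x ≠ 0) (hy : y < h) :
    (graph A h).arcs (full _ wt) (node A h x y) (node A h x (y + 1)) ≤ wt (ver A h x y) := by
  have h1 := (graph A h).arcs_le (full _ wt) ⟨ver A h x y, ver_lt hx hy⟩
  refine le_trans (le_of_eq ?_) h1
  congr 1
  · apply Fin.ext
    rw [node_val hx hy.le]
    simp only [graph, src]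
    rw [if_neg (by rw [reversed_ver hx]; exact hx0), fst_ver hx]
  · apply Fin.ext
    rw [node_val hx hy]
    simp only [graph, tgt]
    rw [if_neg (by rw [reversed_ver hx]; exact hx0), snd_ver hx]

theorem arc_up {y : ℕ} (hy : y < h) :
    (graph A h).arcs (full _ wt) (node A h 0 (y + 1)) (node A h 0 y) ≤ wt (ver A h 0 y) := by
  have h1 := (graph A h).arcs_le (full _ wt) ⟨ver A h 0 y, ver_lt (Nat.zero_le _) hy⟩
  refine le_trans (le_of_eq ?_) h1
  congr 1
  · apply Fin.ext
    rw [node_val (Nat.zero_le _) hy]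
    simp only [graph, src]
    rw [if_pos (by rw [reversed_ver (Nat.zero_le _)]), snd_ver (Nat.zero_le _)]
  · apply Fin.ext
    rw [node_val (Nat.zero_le _) hy.le]
    simp only [graph, tgt]
    rw [if_pos (by rw [reversed_ver (Nat.zero_le _)]), fst_ver (Nat.zero_le _)]

theorem edges_comm {N m : ℕ} (G : PlaneGraph N m) (cur : Fin m → ℕ∞) (a b : Fin N) :
    G.edges cur a b = G.edges cur b a := min_comm _ _

theorem edge_hor {x y : ℕ} (hx : x < A) (hy : y ≤ h) :
    (graph A h).edges (full _ wt) (node A h x y) (node A h (x + 1) y) ≤ wt (hor A x y) := by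
  rcases hy.lt_or_eq with hy | rfl
  · exact (min_le_left _ _).trans (arc_right hx hy)
  · exact (min_le_right _ _).trans (arc_left hx)

theorem edge_ver {x y : ℕ} (hx : x ≤ A) (hy : y < h) :
    (graph A h).edges (full _ wt) (node A h x y) (node A h x (y + 1)) ≤ wt (ver A h x y) := by
  rcases Nat.eq_zero_or_pos x with rfl | hx0
  · exact (min_le_right _ _).trans (arc_up hy)
  · exact (min_le_left _ _).trans (arc_down hx hx0.ne' hy)

/-- Follow a row to the right. -/
theorem reach_right {x x' y : ℕ} (f : ℕ → ℕ) (hxx : x ≤ x') (hx : x' ≤ A) (hy : y < h)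
    (hf : ∀ i, x ≤ i → i < x' → f i + wt (hor A i y) ≤ f (i + 1)) :
    Reach ((graph A h).arcs (full _ wt)) (node A h x y) (node A h x' y) (f x' - f x) := by
  have : ∀ i, x ≤ i → i ≤ x' → f x ≤ f i ∧
      Reach ((graph A h).arcs (full _ wt)) (node A h x y) (node A h i y) (f i - f x) := by
    intro i hi
    induction i, hi using Nat.le_induction with
    | base => intro _; rw [Nat.sub_self]; exact ⟨le_rfl, .refl _⟩
    | succ i hi ih =>
      intro hi'
      obtain ⟨h1, h2⟩ := ih (by omega)
      have h3 := hf i hi (by omega)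
      exact ⟨by omega, (h2.trans (.step (arc_right (by omega) hy))).mono (by omega)⟩
  exact (this x' hxx le_rfl).2

/-- Follow a column downwards. -/
theorem reach_down {x y y' : ℕ} (d : ℕ) (hyy : y ≤ y') (hx : x ≤ A) (hx0 : x ≠ 0) (hy : y' ≤ h)
    (hf : ∀ i, y ≤ i → i < y' → wt (ver A h x i) ≤ d) :
    Reach ((graph A h).arcs (full _ wt)) (node A h x y) (node A h x y') ((y' - y) * d) := by
  have : ∀ i, y ≤ i → i ≤ y' →
      Reach ((graph A h).arcs (full _ wt)) (node A h x y) (node A h x i) ((i - y) * d) := by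
    intro i hi
    induction i, hi using Nat.le_induction with
    | base => intro _; rw [Nat.sub_self, zero_mul]; exact .refl _
    | succ i hi ih =>
      intro hi'
      have h3 := hf i hi (by omega)
      refine ((ih (by omega)).trans (.step (arc_down hx hx0 (by omega)))).mono ?_
      have e : (i + 1 - y) * d = (i - y) * d + d := by rw [Nat.sub_add_comm hi, add_mul, one_mul]
      omega
  exact this y' hyy le_rfl

/-- Follow the last row to the left. -/
theorem reach_left {x x' : ℕ} (hxx : x ≤ x') (hx : x' ≤ A)
    (hf : ∀ i, x ≤ i → i < x' → wt (hor A i h) = 0) :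
    Reach ((graph A h).arcs (full _ wt)) (node A h x' h) (node A h x h) 0 := by
  induction x', hxx using Nat.le_induction with
  | base => exact .refl _
  | succ i hi ih =>
    have h3 := hf i hi (by omega)
    have := (Reach.step (arc_left (wt := wt) (h := h) (show i < A by omega))).trans
      (ih (by omega) (fun i' h1 h2 => hf i' h1 (by omega)))
    rwa [h3] at this

/-- Follow the first column upwards. -/
theorem reach_up {y y' : ℕ} (hyy : y ≤ y') (hy : y' ≤ h)
    (hf : ∀ i, y ≤ i → i < y' → wt (ver A h 0 i) = 0) :
    Reach ((graph A h).arcs (full _ wt)) (node A h 0 y') (node A h 0 y) 0 := by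
  induction y', hyy using Nat.le_induction with
  | base => exact .refl _
  | succ i hi ih =>
    have h3 := hf i hi (by omega)
    have := (Reach.step (arc_up (wt := wt) (A := A) (show i < h by omega))).trans
      (ih (by omega) (fun i' h1 h2 => hf i' h1 (by omega)))
    rwa [h3] at this

theorem reach_row {x x' y d : ℕ} (hxx : x ≤ x') (hx : x' ≤ A) (hy : y ≤ h)
    (hf : ∀ i, x ≤ i → i < x' → wt (hor A i y) ≤ d) :
    Reach ((graph A h).edges (full _ wt)) (node A h x y) (node A h x' y) ((x' - x) * d) ∧
    Reach ((graph A h).edges (full _ wt)) (node A h x' y) (node A h x y) ((x' - x) * d) := by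
  induction x', hxx using Nat.le_induction with
  | base => rw [Nat.sub_self, zero_mul]; exact ⟨.refl _, .refl _⟩
  | succ i hi ih =>
    have h3 := hf i hi (by omega)
    obtain ⟨h1, h2⟩ := ih (by omega) (fun i' h1 h2 => hf i' h1 (by omega))
    have h4 := edge_hor (wt := wt) (show i < A by omega) hy
    have e : (i + 1 - x) * d = (i - x) * d + d := by rw [Nat.sub_add_comm hi, add_mul, one_mul]
    rw [e]
    refine ⟨(h1.trans (.step h4)).mono (by omega), ?_⟩
    rw [edges_comm] at h4
    exact ((Reach.step h4).trans h2).mono (by omega)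

theorem reach_col {x y y' d : ℕ} (hyy : y ≤ y') (hx : x ≤ A) (hy : y' ≤ h)
    (hf : ∀ i, y ≤ i → i < y' → wt (ver A h x i) ≤ d) :
    Reach ((graph A h).edges (full _ wt)) (node A h x y) (node A h x y') ((y' - y) * d) ∧
    Reach ((graph A h).edges (full _ wt)) (node A h x y') (node A h x y) ((y' - y) * d) := by
  induction y', hyy using Nat.le_induction with
  | base => rw [Nat.sub_self, zero_mul]; exact ⟨.refl _, .refl _⟩
  | succ i hi ih =>
    have h3 := hf i hi (by omega)
    obtain ⟨h1, h2⟩ := ih (by omega) (fun i' h1 h2 => hf i' h1 (by omega))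
    have h4 := edge_ver (wt := wt) hx (show i < h by omega)
    have e : (i + 1 - y) * d = (i - y) * d + d := by rw [Nat.sub_add_comm hi, add_mul, one_mul]
    rw [e]
    refine ⟨(h1.trans (.step h4)).mono (by omega), ?_⟩
    rw [edges_comm] at h4
    exact ((Reach.step h4).trans h2).mono (by omega)

end

variable {n₂ n₃ S : ℕ} {a : ℕ → ℕ} {b : ℕ → ℕ → ℕ} {j : ℕ}

theorem weight_hor {top bot x y : ℕ} (hx : x < 2 * n₃ + 1) (hy : y ≤ n₂ + 1) :
    weight n₂ n₃ S a b top bot (hor (2 * n₃ + 1) x y) = horWeight n₂ n₃ S a b x y := by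
  rw [weight, if_pos (hor_lt hx hy), col_hor hx hy, row_hor hx hy]

theorem weight_ver {top bot x y : ℕ} (hx : x ≤ 2 * n₃ + 1) :
    weight n₂ n₃ S a b top bot (ver (2 * n₃ + 1) (n₂ + 1) x y) =
      verWeight n₂ n₃ S top bot x y := by
  rw [weight, if_neg ver_not_lt, col_ver hx, row_ver hx]

/-- The current edges in the query for column `j`. -/
def queryCur (n₂ n₃ S : ℕ) (a : ℕ → ℕ) (b : ℕ → ℕ → ℕ) (j : ℕ) :
    Fin (numEdges (2 * n₃ + 1) (n₂ + 1)) → ℕ∞ :=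
  full _ (weight n₂ n₃ S a b (n₃ + 1 - j) (n₃ + 1 + j))

/-- The grid in which the weights live. -/
def grid (n₂ n₃ : ℕ) := graph (2 * n₃ + 1) (n₂ + 1)

/-- The data of a query are within their bounds. -/
structure Fits (n₂ n₃ S : ℕ) (a : ℕ → ℕ) (b : ℕ → ℕ → ℕ) (j : ℕ) : Prop where
  left_le : ∀ y, a y ≤ S
  right_le : ∀ y c, b y c ≤ S
  right_zero : ∀ y, b y 0 = 0
  one_le_rows : 1 ≤ n₂
  one_le : 1 ≤ j
  le : j ≤ n₃

/-- The path crosses in the row `i` that attains the minimum. It moves to the right, downwards, and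
to the left only in the last row, so it respects the directions of the edges; hence it serves the
undirected problems and, closed up, the girth. -/
theorem reach_st (hf : Fits n₂ n₃ S a b j) :
    Reach ((grid n₂ n₃).arcs (queryCur n₂ n₃ S a b j)) (node _ _ 0 0) (node _ _ 0 (n₂ + 1))
      (dist n₂ n₃ S a b j + 2 * pend n₂ n₃ S) := by
  obtain ⟨ha, hb, hb0, hn₂, hj, hj'⟩ := hf
  obtain ⟨i, hi, hi', hmin⟩ := exists_rowMin (j := j) ha hb hn₂
  have s1 : Reach ((grid n₂ n₃).arcs (queryCur n₂ n₃ S a b j)) (node _ _ 0 0) (node _ _ 1 0)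
      (pend n₂ n₃ S) := by
    refine .step ((arc_right (by omega) (by omega)).trans ?_)
    rw [weight_hor (by omega) (by omega)]
    simp [horWeight]
  have s2 : Reach ((grid n₂ n₃).arcs (queryCur n₂ n₃ S a b j)) (node _ _ 1 0)
      (node _ _ (n₃ + 1 - j) 0) (0 - 0) := by
    refine reach_right (fun _ => 0) (by omega) (by omega) (by omega) fun x hx hx' => ?_
    rw [weight_hor (by omega) (by omega)]
    simp [horWeight, show x ≠ 0 by omega]
  have s3 : Reach ((grid n₂ n₃).arcs (queryCur n₂ n₃ S a b j)) (node _ _ (n₃ + 1 - j) 0)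
      (node _ _ (n₃ + 1 - j) i) ((i - 0) * drop n₃ S) := by
    refine reach_down _ (by omega) (by omega) (by omega) (by omega) fun y _ hy => ?_
    rw [weight_ver (by omega), verWeight, if_neg (by omega)]
    split_ifs
    · exact le_rfl
    · omega
    · omega
    · omega
    · exact le_rfl
  -- The edge that enters the middle column also carries `a i`; the condition `x = n₃ + 1` in the
  -- partial sums adds it at the last step.
  have s4 : Reach ((grid n₂ n₃).arcs (queryCur n₂ n₃ S a b j)) (node _ _ (n₃ + 1 - j) i)
      (node _ _ (n₃ + 1) i) (j * ((n₂ + 1 - i) * (2 * S)) + a i) := by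
    refine Reach.mono (reach_right (fun x => (x - (n₃ + 1 - j)) * ((n₂ + 1 - i) * (2 * S)) +
      if x = n₃ + 1 then a i else 0) (by omega) (by omega) (by omega) fun x hx hx' => ?_)
      (by simp only [if_true, show n₃ + 1 - (n₃ + 1 - j) = j by omega]; omega)
    rw [weight_hor (by omega) (by omega), horWeight, if_neg (show ¬ x = 0 by omega),
      if_neg (show ¬ (i = 0 ∨ i = n₂ + 1) by omega), if_pos (show x ≤ n₃ by omega),
      if_neg (show ¬ x = n₃ + 1 by omega),
          show x + 1 - (n₃ + 1 - j) = x - (n₃ + 1 - j) + 1 by omega,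
      add_mul, one_mul]
    simp only [Nat.add_right_cancel_iff]
    omega
  -- The differences of `b i` telescope from `b i 0 = 0` to `b i j`.
  have s5 : Reach ((grid n₂ n₃).arcs (queryCur n₂ n₃ S a b j)) (node _ _ (n₃ + 1) i)
      (node _ _ (n₃ + 1 + j) i) (j * (i * (2 * S)) + b i j) := by
    refine Reach.mono (reach_right (fun x => (x - (n₃ + 1)) * (i * (2 * S)) + b i (x - (n₃ + 1)))
      (by omega) (by omega) (by omega) fun x hx hx' => ?_)
      (by simp only [Nat.add_sub_cancel_left]; omega)
    rw [weight_hor (by omega) (by omega), horWeight, if_neg (by omega), if_neg (by omega),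
      if_neg (by omega), show x + 1 - (n₃ + 1) = x - (n₃ + 1) + 1 by omega,
      show x - n₃ = x - (n₃ + 1) + 1 by omega, Nat.add_sub_cancel, add_mul, one_mul]
    have h1 := hb i (x - (n₃ + 1))
    have h2 : 2 * S ≤ i * (2 * S) := Nat.le_mul_of_pos_left _ hi
    omega
  have s6 : Reach ((grid n₂ n₃).arcs (queryCur n₂ n₃ S a b j)) (node _ _ (n₃ + 1 + j) i)
      (node _ _ (n₃ + 1 + j) (n₂ + 1)) ((n₂ + 1 - i) * drop n₃ S) := by
    refine reach_down _ (by omega) (by omega) (by omega) (by omega) fun y _ hy => ?_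
    rw [weight_ver (by omega), verWeight, if_neg (by omega)]
    split_ifs
    · exact le_rfl
    · omega
    · exact le_rfl
    · omega
    · exact Nat.le_refl _
  have s7 : Reach ((grid n₂ n₃).arcs (queryCur n₂ n₃ S a b j)) (node _ _ (n₃ + 1 + j) (n₂ + 1))
      (node _ _ 1 (n₂ + 1)) 0 := by
    refine reach_left (by omega) (by omega) fun x hx hx' => ?_
    rw [weight_hor (by omega) (by omega)]
    simp [horWeight, show x ≠ 0 by omega]
  have s8 : Reach ((grid n₂ n₃).arcs (queryCur n₂ n₃ S a b j)) (node _ _ (0 + 1) (n₂ + 1))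
      (node _ _ 0 (n₂ + 1)) (pend n₂ n₃ S) := by
    refine .step ((arc_left (by omega)).trans ?_)
    rw [weight_hor (by omega) (by omega)]
    simp [horWeight]
  refine (s1.trans (s2.trans (s3.trans (s4.trans (s5.trans (s6.trans (s7.trans s8))))))).mono ?_
  rw [dist, hmin]
  have e1 : (n₂ + 1) * drop n₃ S = i * drop n₃ S + (n₂ + 1 - i) * drop n₃ S := by
    rw [← add_mul, Nat.add_sub_cancel' (by omega)]
  have e2 : j * ((n₂ + 1) * (2 * S)) = j * ((n₂ + 1 - i) * (2 * S)) + j * (i * (2 * S)) := by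
    rw [← mul_add, ← add_mul, Nat.sub_add_cancel (by omega)]
  simp only [Nat.sub_self, Nat.sub_zero]
  omega

/-- A vertex function of the coordinates. -/
def onGrid (n₂ n₃ : ℕ) (f : ℕ → ℕ → ℕ) (v : Fin ((n₂ + 1 + 1) * (2 * n₃ + 1 + 1))) : ℕ :=
  f (v % (2 * n₃ + 1 + 1)) (v / (2 * n₃ + 1 + 1))

theorem onGrid_node (f : ℕ → ℕ → ℕ) {x y : ℕ} (hx : x ≤ 2 * n₃ + 1) (hy : y ≤ n₂ + 1) :
    onGrid n₂ n₃ f (node _ _ x y) = f x y := by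
  rw [onGrid, node_mod hx hy, node_div hx hy]

/-- The edges of the grid, in their directions. -/
theorem edge_cases {A h : ℕ} (e : Fin (numEdges A h)) :
    (∃ x y, x < A ∧ y < h ∧ (e : ℕ) = hor A x y ∧ (graph A h).src e = node A h x y ∧
      (graph A h).tgt e = node A h (x + 1) y) ∨
    (∃ x, x < A ∧ (e : ℕ) = hor A x h ∧ (graph A h).src e = node A h (x + 1) h ∧
      (graph A h).tgt e = node A h x h) ∨
    (∃ x y, x ≤ A ∧ x ≠ 0 ∧ y < h ∧ (e : ℕ) = ver A h x y ∧ (graph A h).src e = node A h x y ∧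
      (graph A h).tgt e = node A h x (y + 1)) ∨
    (∃ y, y < h ∧ (e : ℕ) = ver A h 0 y ∧ (graph A h).src e = node A h 0 (y + 1) ∧
      (graph A h).tgt e = node A h 0 y) := by
  by_cases he : (e : ℕ) < numHor A h
  · have hx := col_lt he
    have hy := row_le he
    have e1 := eq_hor he rfl rfl
    have e2 := fst_hor hx hy
    have e3 := snd_hor hx hy
    have e4 := reversed_hor hx hy
    rw [← e1] at e2 e3 e4
    rcases hy.lt_or_eq with hy' | hy'
    · refine .inl ⟨_, _, hx, hy', e1, ?_, ?_⟩
      · apply Fin.ext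
        rw [node_val hx.le hy]
        simp only [graph, src]
        rw [if_neg (by rw [e4]; omega), e2]
      · apply Fin.ext
        rw [node_val hx hy]
        simp only [graph, tgt]
        rw [if_neg (by rw [e4]; omega), e3]
    · refine .inr (.inl ⟨_, hx, e1.trans (by rw [hy']), ?_, ?_⟩)
      · apply Fin.ext
        rw [node_val hx le_rfl]
        simp only [graph, src]
        rw [if_pos (by rw [e4]; omega), e3, hy']
      · apply Fin.ext
        rw [node_val hx.le le_rfl]
        simp only [graph, tgt]
        rw [if_pos (by rw [e4]; omega), e2, hy']
  · have hx := col_le (A := A) (h := h) e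
    have e1 := eq_ver he rfl rfl
    have hy : row A h e < h := by
      have h2 := e.2
      rw [e1] at h2
      unfold ver numEdges at h2
      by_contra h3
      have : h * (A + 1) ≤ row A h e * (A + 1) := Nat.mul_le_mul_right _ (by omega)
      omega
    have e2 := fst_ver (h := h) (y := row A h e) hx
    have e3 := snd_ver (h := h) (y := row A h e) hx
    have e4 := reversed_ver (h := h) (y := row A h e) hx
    rw [← e1] at e2 e3 e4
    by_cases hx' : col A h e = 0
    · refine .inr (.inr (.inr ⟨_, hy, hx' ▸ e1, ?_, ?_⟩))
      · apply Fin.ext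
        rw [node_val (by omega) hy]
        simp only [graph, src]
        rw [if_pos (by rw [e4]; exact hx'), e3, hx']
      · apply Fin.ext
        rw [node_val (by omega) hy.le]
        simp only [graph, tgt]
        rw [if_pos (by rw [e4]; exact hx'), e2, hx']
    · refine .inr (.inr (.inl ⟨_, _, hx, hx', hy, e1, ?_, ?_⟩))
      · apply Fin.ext
        rw [node_val hx hy.le]
        simp only [graph, src]
        rw [if_neg (by rw [e4]; exact hx'), e2]
      · apply Fin.ext
        rw [node_val hx hy]
        simp only [graph, tgt]
        rw [if_neg (by rw [e4]; exact hx'), e3]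

theorem pot_edge (hf : Fits n₂ n₃ S a b j) (e : Fin (numEdges (2 * n₃ + 1) (n₂ + 1))) :
    (onGrid n₂ n₃ (pot n₂ n₃ S a b j) ((grid n₂ n₃).tgt e) : ℕ∞) ≤
      onGrid n₂ n₃ (pot n₂ n₃ S a b j) ((grid n₂ n₃).src e) + queryCur n₂ n₃ S a b j e ∧
    (onGrid n₂ n₃ (pot n₂ n₃ S a b j) ((grid n₂ n₃).src e) : ℕ∞) ≤
      onGrid n₂ n₃ (pot n₂ n₃ S a b j) ((grid n₂ n₃).tgt e) + queryCur n₂ n₃ S a b j e := by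
  obtain ⟨ha, hb, hb0, hn₂, hj, hj'⟩ := hf
  unfold queryCur full grid
  rcases edge_cases e with ⟨x, y, hx, hy, h1, h2, h3⟩ | ⟨x, hx, h1, h2, h3⟩ |
    ⟨x, y, hx, -, hy, h1, h2, h3⟩ | ⟨y, hy, h1, h2, h3⟩
  · have := pot_hor (x := x) ha hb hb0 hj hj' hy.le
    rw [h2, h3, h1, weight_hor hx hy.le, onGrid_node _ hx.le hy.le, onGrid_node _ hx hy.le]
    exact ⟨by exact_mod_cast this.1, by exact_mod_cast this.2⟩
  · have := pot_hor (x := x) ha hb hb0 hj hj' (le_refl (n₂ + 1))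
    rw [h2, h3, h1, weight_hor hx le_rfl, onGrid_node _ hx.le le_rfl, onGrid_node _ hx le_rfl]
    exact ⟨by exact_mod_cast this.2, by exact_mod_cast this.1⟩
  · have := pot_ver (x := x) ha hb hn₂ hj hj' hy
    rw [h2, h3, h1, weight_ver hx, onGrid_node _ hx hy.le, onGrid_node _ hx hy]
    exact ⟨by exact_mod_cast this.1, by exact_mod_cast this.2⟩
  · have := pot_ver (x := 0) ha hb hn₂ hj hj' hy
    rw [h2, h3, h1, weight_ver (Nat.zero_le _), onGrid_node _ (Nat.zero_le _) hy.le,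
      onGrid_node _ (Nat.zero_le _) hy]
    exact ⟨by exact_mod_cast this.2, by exact_mod_cast this.1⟩

theorem le_dist_st (hf : Fits n₂ n₃ S a b j) :
    ((dist n₂ n₃ S a b j + 2 * pend n₂ n₃ S : ℕ) : ℕ∞) ≤
      sInf (walkWeights ((grid n₂ n₃).edges (queryCur n₂ n₃ S a b j)) (node _ _ 0 0)
        (node _ _ 0 (n₂ + 1))) := by
  refine le_sInf_walkWeights (π := onGrid n₂ n₃ (pot n₂ n₃ S a b j))
    (PlaneGraph.potential_edges _ _ (pot_edge hf)) ?_
  rw [onGrid_node _ (by omega) (by omega), onGrid_node _ (by omega) (by omega)]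
  simp [pot]

theorem value_stShortestPath (hf : Fits n₂ n₃ S a b j) :
    (grid n₂ n₃).value (queryCur n₂ n₃ S a b j) .stShortestPath =
      (dist n₂ n₃ S a b j + 2 * pend n₂ n₃ S : ℕ) := by
  have hs : (grid n₂ n₃).s = node _ _ 0 0 :=
      Fin.ext (by rw [node_val (by omega) (by omega)]; simp [grid, graph])
  have ht : (grid n₂ n₃).t = node _ _ 0 (n₂ + 1) :=
    Fin.ext (by rw [node_val (by omega) (by omega)]; simp [grid, graph])
  rw [PlaneGraph.value, hs, ht]
  refine le_antisymm ?_ (le_dist_st hf)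
  exact ((reach_st hf).of_le fun _ _ => min_le_left _ _).sInf_le

theorem value_directedGirth (hf : Fits n₂ n₃ S a b j) :
    (grid n₂ n₃).value (queryCur n₂ n₃ S a b j) .directedGirth =
      (dist n₂ n₃ S a b j + 2 * pend n₂ n₃ S + far n₂ n₃ S : ℕ) := by
  refine le_antisymm ?_ ?_
  · have s1 : Reach ((grid n₂ n₃).arcs (queryCur n₂ n₃ S a b j)) (node _ _ 0 (n₂ + 1))
        (node _ _ 0 n₂) (far n₂ n₃ S) := by
      refine .step ((arc_up (by omega)).trans ?_)
      rw [weight_ver (by omega)]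
      simp [verWeight]
    have s2 : Reach ((grid n₂ n₃).arcs (queryCur n₂ n₃ S a b j)) (node _ _ 0 n₂)
        (node _ _ 0 0) 0 := by
      refine reach_up (Nat.zero_le _) (by omega) fun y _ hy => ?_
      rw [weight_ver (by omega), verWeight, if_pos rfl, if_neg (by omega)]
    have hne : node (2 * n₃ + 1) (n₂ + 1) 0 (n₂ + 1) ≠ node _ _ 0 0 := by
      intro h
      have := congrArg Fin.val h
      rw [node_val (by omega) (by omega), node_val (by omega) (by omega)] at this
      have h2 : 0 < (n₂ + 1) * (2 * n₃ + 1 + 1) := by positivity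
      omega
    obtain ⟨l, h1, h2⟩ := reach_st hf
    obtain ⟨r, h3, h4⟩ := s1.trans s2
    obtain rfl | ⟨r, z, rfl⟩ := List.eq_nil_or_concat r
    · exact absurd h3 hne
    · obtain rfl : z = node _ _ 0 0 := by
        rw [← h3, List.concat_eq_append, getLast_cons_append]; simp
      rw [List.concat_eq_append, ← h1] at h4
      -- The path to `t` and the way back form a closed walk, possibly with repeated nodes; a cycle
      -- inside it is not heavier.
      obtain ⟨v, l', h5, h6⟩ := exists_cycle_le (w := (grid n₂ n₃).arcs (queryCur n₂ n₃ S a b j)) _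
        (node _ _ 0 0) (l ++ r) le_rfl
      refine (iInf_le_of_le v (iInf_le_of_le l' (iInf_le_of_le h5 h6))).trans ?_
      rw [List.append_assoc, walkWeight_append]
      push_cast at h2 h4 ⊢
      exact add_le_add h2 (by simpa using h4)
  · refine le_iInf fun v => le_iInf fun l => le_iInf fun _ => ?_
    -- The order `τ` runs up the first column, then through the main part along x + y, and finally
    -- through the last row from right to left, above everything else. Only the arc leaving `t` goes
    -- against it, and there the potential falls from its maximal value to 0, which gives the
    -- surplus.
    refine le_closed_walk (π := onGrid n₂ n₃ (pot n₂ n₃ S a b j))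
      (τ := onGrid n₂ n₃ fun x y => if y = n₂ + 1 then 3 * (2 * n₃ + 1 + (n₂ + 1)) + (2 * n₃ +
          1 - x)
        else if x = 0 then n₂ + 1 - y else n₂ + 1 + x + y) ?_ v l
    intro v w
    rw [← tsub_le_iff_left, ← tsub_le_iff_left]
    have key : ∀ e, (grid n₂ n₃).src e = v → (grid n₂ n₃).tgt e = w →
        onGrid n₂ n₃ (fun x y => if y = n₂ + 1 then 3 * (2 * n₃ + 1 + (n₂ + 1)) + (2 * n₃ + 1 - x)
          else if x = 0 then n₂ + 1 - y else n₂ + 1 + x + y) v <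
        onGrid n₂ n₃ (fun x y => if y = n₂ + 1 then 3 * (2 * n₃ + 1 + (n₂ + 1)) + (2 * n₃ + 1 - x)
          else if x = 0 then n₂ + 1 - y else n₂ + 1 + x + y) w ∨
        ((onGrid n₂ n₃ (pot n₂ n₃ S a b j) w : ℕ∞) + (dist n₂ n₃ S a b j + 2 * pend n₂ n₃ S +
            far n₂ n₃ S)
          ≤ onGrid n₂ n₃ (pot n₂ n₃ S a b j) v + queryCur n₂ n₃ S a b j e) := by
      intro e hv hw
      subst hv hw
      unfold grid
      rcases edge_cases e with ⟨x, y, hx, hy, h1, h2, h3⟩ | ⟨x, hx, h1, h2, h3⟩ |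
        ⟨x, y, hx, hx0, hy, h1, h2, h3⟩ | ⟨y, hy, h1, h2, h3⟩
      · left
        rw [h2, h3, onGrid_node _ hx.le hy.le, onGrid_node _ hx hy.le]
        split_ifs <;> first | omega | contradiction
      · left
        rw [h2, h3, onGrid_node _ hx.le le_rfl, onGrid_node _ hx le_rfl]
        split_ifs <;> omega
      · left
        rw [h2, h3, onGrid_node _ hx hy.le, onGrid_node _ hx hy]
        split_ifs <;> omega
      · by_cases hy' : y = n₂
        · right
          subst hy'
          unfold queryCur full
          rw [h2, h3, h1, weight_ver (Nat.zero_le _), onGrid_node _ (Nat.zero_le _) hy.le,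
            onGrid_node _ (Nat.zero_le _) hy]
          simp [pot, verWeight]
        · left
          rw [h2, h3, onGrid_node _ (Nat.zero_le _) hy.le, onGrid_node _ (Nat.zero_le _) hy]
          split_ifs <;> omega
    by_cases hτ : onGrid n₂ n₃ (fun x y => if y = n₂ + 1 then
        3 * (2 * n₃ + 1 + (n₂ + 1)) + (2 * n₃ + 1 - x)
          else if x = 0 then n₂ + 1 - y else n₂ + 1 + x + y) v <
        onGrid n₂ n₃ (fun x y => if y = n₂ + 1 then 3 * (2 * n₃ + 1 + (n₂ + 1)) + (2 * n₃ + 1 - x)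
          else if x = 0 then n₂ + 1 - y else n₂ + 1 + x + y) w
    · refine .inl ⟨hτ, PlaneGraph.le_arcs _ _ fun e hv hw => ?_⟩
      rw [tsub_le_iff_left, ← hv, ← hw]
      exact (pot_edge hf e).1
    · refine .inr (PlaneGraph.le_arcs _ _ fun e hv hw => ?_)
      rw [tsub_le_iff_left]
      have := (key e hv hw).resolve_left hτ
      push_cast
      exact this

/-- Closed edges are heavy but still present, so nodes of the main part are within `pend` of each
other. In the first column, all nodes except `t` are joined to `s` by edges of weight zero. Thus
every other pair is at most as far apart as `s` and `t`. -/
theorem value_diameter (hf : Fits n₂ n₃ S a b j) :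
    (grid n₂ n₃).value (queryCur n₂ n₃ S a b j) .diameter =
      (dist n₂ n₃ S a b j + 2 * pend n₂ n₃ S : ℕ) := by
  refine le_antisymm ?_ ((le_dist_st hf).trans (le_iSup₂_of_le _ _ le_rfl))
  have hj' := hf.le
  refine iSup₂_le fun v w => Reach.sInf_le ?_
  set E := (grid n₂ n₃).edges (queryCur n₂ n₃ S a b j) with hE
  have hsymm : ∀ v w d, Reach E v w d → Reach E w v d := fun v w d h => h.symm (edges_comm _ _)
  have hrow : ∀ x x' y, 1 ≤ x → x ≤ x' → x' ≤ 2 * n₃ + 1 → y ≤ n₂ + 1 →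
      Reach E (node _ _ x y) (node _ _ x' y) ((2 * n₃ + 1) * big n₂ n₃ S) := by
    intro x x' y h1 h2 h3 h4
    refine (reach_row (d := big n₂ n₃ S) h2 h3 h4 fun i hi hi' => ?_).1.mono
      (Nat.mul_le_mul_right _ (by omega))
    rw [weight_hor (by omega) h4, horWeight, if_neg (by omega)]
    split_ifs with c1 c2 c3
    · exact Nat.zero_le _
    · have := hf.left_le y
      have h6 : (n₂ + 1 - y) * (2 * S) ≤ 1 * ((n₂ + 1) * (2 * S)) := by
        rw [one_mul]; exact Nat.mul_le_mul_right _ (by omega)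
      have h7 : 1 * ((n₂ + 1) * (2 * S)) ≤ n₃ * ((n₂ + 1) * (2 * S)) :=
        Nat.mul_le_mul_right _ (by omega)
      unfold big; omega
    · have h6 : (n₂ + 1 - y) * (2 * S) ≤ 1 * ((n₂ + 1) * (2 * S)) := by
        rw [one_mul]; exact Nat.mul_le_mul_right _ (by omega)
      have h7 : 1 * ((n₂ + 1) * (2 * S)) ≤ n₃ * ((n₂ + 1) * (2 * S)) :=
        Nat.mul_le_mul_right _ (hf.one_le.trans hf.le)
      unfold big; omega
    · have := hf.right_le y (i - n₃)
      have h6 : y * (2 * S) ≤ 1 * ((n₂ + 1) * (2 * S)) := by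
        rw [one_mul]; exact Nat.mul_le_mul_right _ (by omega)
      have h7 : 1 * ((n₂ + 1) * (2 * S)) ≤ n₃ * ((n₂ + 1) * (2 * S)) :=
        Nat.mul_le_mul_right _ (hf.one_le.trans hf.le)
      unfold big; omega
  have hcol : ∀ x y y', 1 ≤ x → x ≤ 2 * n₃ + 1 → y ≤ y' → y' ≤ n₂ + 1 →
      Reach E (node _ _ x y) (node _ _ x y') ((n₂ + 1) * big n₂ n₃ S) := by
    intro x y y' h1 h2 h3 h4
    refine (reach_col (d := big n₂ n₃ S) h3 h2 h4 fun i hi hi' => ?_).1.mono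
      (Nat.mul_le_mul_right _ (by omega))
    have : drop n₃ S ≤ big n₂ n₃ S := by
      have : 1 * drop n₃ S ≤ (n₂ + 1) * drop n₃ S := Nat.mul_le_mul_right _ (by omega)
      unfold big; omega
    rw [weight_ver h2, verWeight, if_neg (by omega)]
    split_ifs <;> first | exact le_rfl | exact this
  -- At most `2 * n₃ + 1` horizontal and `n₂ + 1` vertical edges of weight at most `big` suffice,
  -- and `pend` is `2 * n₃ + n₂ + 4` times `big`.
  have hmain : ∀ x y x' y', 1 ≤ x → x ≤ 2 * n₃ + 1 → y ≤ n₂ + 1 → 1 ≤ x' → x' ≤ 2 * n₃ + 1 →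
      y' ≤ n₂ + 1 → Reach E (node _ _ x y) (node _ _ x' y') (pend n₂ n₃ S) := by
    intro x y x' y' h1 h2 h3 h4 h5 h6
    have s1 : Reach E (node _ _ x y) (node _ _ x' y) ((2 * n₃ + 1) * big n₂ n₃ S) := by
      rcases le_total x x' with h | h
      · exact hrow _ _ _ h1 h h5 h3
      · exact hsymm _ _ _ (hrow _ _ _ h4 h h2 h3)
    have s2 : Reach E (node _ _ x' y) (node _ _ x' y') ((n₂ + 1) * big n₂ n₃ S) := by
      rcases le_total y y' with h | h
      · exact hcol _ _ _ h4 h5 h h6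
      · exact hsymm _ _ _ (hcol _ _ _ h4 h5 h h3)
    refine (s1.trans s2).mono ?_
    rw [← add_mul]
    exact Nat.mul_le_mul_right _ (by omega)
  have hfirst : ∀ y, y ≤ n₂ → Reach E (node _ _ 0 0) (node _ _ 0 y) 0 := by
    intro y hy
    refine (reach_col (d := 0) (Nat.zero_le _) (by omega) (by omega) fun i hi hi' => ?_).1.mono
      (by omega)
    rw [weight_ver (by omega), verWeight, if_pos rfl, if_neg (by omega)]
  have hs : Reach E (node _ _ 0 0) (node _ _ 1 0) (pend n₂ n₃ S) := by
    refine .step ((edge_hor (by omega) (by omega)).trans ?_)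
    rw [weight_hor (by omega) (by omega)]
    simp [horWeight]
  have ht : Reach E (node _ _ 0 (n₂ + 1)) (node _ _ 1 (n₂ + 1)) (pend n₂ n₃ S) := by
    refine .step ((edge_hor (by omega) (by omega)).trans ?_)
    rw [weight_hor (by omega) (by omega)]
    simp [horWeight]
  have hst : Reach E (node _ _ 0 0) (node _ _ 0 (n₂ + 1)) _ :=
    (reach_st hf).of_le fun _ _ => min_le_left _ _
  obtain ⟨x, y, hx, hy, rfl⟩ := exists_node v
  obtain ⟨x', y', hx', hy', rfl⟩ := exists_node w
  -- Up to exchanging the two nodes, the first is `t` only if the second is, and the second lies on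
  -- the side of `s` in the first column only if the first does.
  have hwlog : ∀ x y x' y', x ≤ 2 * n₃ + 1 → y ≤ n₂ + 1 → x' ≤ 2 * n₃ + 1 → y' ≤ n₂ + 1 →
      (x = 0 → y = n₂ + 1 → x' = 0 ∧ y' = n₂ + 1) → (x' = 0 → y' ≤ n₂ → x = 0 ∧ y ≤ n₂) →
      Reach E (node _ _ x y) (node _ _ x' y') (dist n₂ n₃ S a b j + 2 * pend n₂ n₃ S) := by
    intro x y x' y' hx hy hx' hy' h1 h2
    rcases Nat.eq_zero_or_pos x with rfl | h0
    · by_cases hyn : y = n₂ + 1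
      · obtain ⟨rfl, rfl⟩ := h1 rfl hyn
        subst hyn
        exact (Reach.refl _).mono (Nat.zero_le _)
      · have s1 := hsymm _ _ _ (hfirst y (by omega))
        rcases Nat.eq_zero_or_pos x' with rfl | h0'
        · by_cases hyn' : y' = n₂ + 1
          · subst hyn'
            exact (s1.trans hst).mono (by omega)
          · exact (s1.trans (hfirst y' (by omega))).mono (by omega)
        · exact ((s1.trans hs).trans (hmain _ _ _ _ le_rfl (by omega) (by omega) h0' hx' hy')).mono
            (by omega)
    · rcases Nat.eq_zero_or_pos x' with rfl | h0'
      · by_cases hyn' : y' = n₂ + 1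
        · subst hyn'
          exact ((hmain _ _ _ _ h0 hx hy le_rfl (by omega) (by omega)).trans
            (hsymm _ _ _ ht)).mono (by omega)
        · have := h2 rfl (by omega); omega
      · exact (hmain _ _ _ _ h0 hx hy h0' hx' hy').mono (by omega)
  by_cases hc : (x = 0 → y = n₂ + 1 → x' = 0 ∧ y' = n₂ + 1) ∧
      (x' = 0 → y' ≤ n₂ → x = 0 ∧ y ≤ n₂)
  · exact hwlog x y x' y' hx hy hx' hy' hc.1 hc.2
  · exact hsymm _ _ _ (hwlog x' y' x y hx' hy' hx hy (by omega) (by omega))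

/-- The difference between the value in a query and the length of a shortest path between the inner
terminals. -/
def offset (n₂ n₃ S : ℕ) : PlanarProblem → ℕ
  | .directedGirth => 2 * pend n₂ n₃ S + far n₂ n₃ S
  | _ => 2 * pend n₂ n₃ S

theorem value_queryCur (hf : Fits n₂ n₃ S a b j) (p : PlanarProblem) :
    (grid n₂ n₃).value (queryCur n₂ n₃ S a b j) p =
      (dist n₂ n₃ S a b j + offset n₂ n₃ S p : ℕ) := by
  cases p
  · exact value_stShortestPath hf
  · rw [value_directedGirth hf, offset, add_assoc]
  · exact value_diameter hf

end Gadget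

/-! ### Building blocks of the calling program -/

namespace WordRAM

/-- A conditional expression. -/
def Expr.ifLt (a b x y : Expr) : Expr := a.lt b * x + (1 - a.lt b) * y
/-- A conditional expression. -/
def Expr.ifEq (a b x y : Expr) : Expr := a.eq b * x + (1 - a.eq b) * y

@[simp] theorem Expr.val_ifLt (σ : State) (a b x y : Expr) :
    (Expr.ifLt a b x y).val σ = if a.val σ < b.val σ then x.val σ else y.val σ := by
  simp only [ifLt, val_add, val_mul, val_sub, val_lt, val_one]; split_ifs <;> simp

@[simp] theorem Expr.val_ifEq (σ : State) (a b x y : Expr) :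
    (Expr.ifEq a b x y).val σ = if a.val σ = b.val σ then x.val σ else y.val σ := by
  simp only [ifEq, val_add, val_mul, val_sub, val_eq, val_one]; split_ifs <;> simp

@[simp] theorem Expr.within_ifLt {lim : ℕ} {a b x y : Expr} : (Expr.ifLt a b x y).Within lim ↔
    (a.Within lim ∧ b.Within lim) ∧ x.Within lim ∧ y.Within lim := by
  simp only [ifLt, within_add, within_mul, within_sub, within_lt, within_one]; tauto

@[simp] theorem Expr.within_ifEq {lim : ℕ} {a b x y : Expr} : (Expr.ifEq a b x y).Within lim ↔
    (a.Within lim ∧ b.Within lim) ∧ x.Within lim ∧ y.Within lim := by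
  simp only [ifEq, within_add, within_mul, within_sub, within_eq, within_one]; tauto

namespace Cmd

variable {m V W : ℕ} {val : (Fin m → ℕ∞) → ℕ∞} {c c₁ c₂ : Cmd} {σ : State} {cur : Fin m → ℕ∞}
  {T Q : ℕ} {Post : State → (Fin m → ℕ∞) → Prop}

theorem Does.andThen {T₁ T₂ Q₁ Q₂ : ℕ} {Mid : State → (Fin m → ℕ∞) → Prop}
    (h₁ : Does val V W c₁ σ cur T₁ Q₁ Mid)
    (h₂ : ∀ σ' cur', (∀ b, b ∉ c₁.mods → σ' b = σ b) → Mid σ' cur' →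
      Does val V W c₂ σ' cur' T₂ Q₂ Post) :
    Does val V W (.seq c₁ c₂) σ cur (T₁ + T₂) (Q₁ + Q₂) Post :=
  .seq (h₁.mono le_rfl le_rfl h₂)

/-- Fill an initial segment of a bank. -/
def fill (b v : ℕ) (eN e : Expr) : Cmd := forLoop v eN (.assign b (.var v) e)

/-- The hypotheses range over all states that agree with `σ` off the counter and the target bank, as
these are the states in which the loop evaluates `eN` and `e`; `e` may read the part of the bank
that is not yet overwritten. -/
theorem Does.fill {b v n : ℕ} {eN e : Expr} (f : ℕ → ℕ) (hbv : b ≠ v) (hn : n ≤ V)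
    (hf : ∀ i < n, f i ≤ V)
    (hN : ∀ σ' : State, (∀ b', b' ≠ v → b' ≠ b → σ' b' = σ b') → eN.val σ' = n)
    (he : ∀ i < n, ∀ σ' : State, (∀ b', b' ≠ v → b' ≠ b → σ' b' = σ b') → σ' v 0 = i →
      (∀ a, σ' b a = if a < i then f a else σ b a) → e.val σ' = f i) :
    Does val V W (fill b v eN e) σ cur (n * 3 + 2) 0 fun σ' cur' => cur' = cur ∧
      (∀ b', b' ≠ v → b' ≠ b → σ' b' = σ b') ∧ ∀ a, σ' b a = if a < n then f a else σ b a := by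
  refine (Does.forLoop (n := n) (T := 1) (Q := 0) (fun i σ' cur' => σ' v 0 = i ∧ cur' = cur ∧
    (∀ b', b' ≠ v → b' ≠ b → σ' b' = σ b') ∧ ∀ a, σ' b a = if a < i then f a else σ b a) hn
    ⟨by simp, rfl, fun b' h₁ h₂ => State.write_of_ne _ _ _ h₁, fun a => by
      rw [State.write_of_ne _ _ _ hbv]; simp⟩ ?_ ?_).mono le_rfl (by simp) fun _ _ _ h => h.2
  · rintro i hi σ' cur' ⟨h₁, -, h₂, -⟩
    exact ⟨h₁, hN σ' h₂⟩
  · rintro i hi σ' cur' ⟨h₁, rfl, h₂, h₃⟩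
    have h₄ := he i hi σ' h₂ h₁ h₃
    refine .assign (by rw [h₄]; exact hf i hi) ⟨?_, by simp, rfl, fun b' h₅ h₆ => ?_, fun a => ?_⟩
    · rw [State.write_of_ne _ _ _ hbv.symm, h₁]
    · rw [State.write_of_ne _ _ _ h₅, State.write_of_ne _ _ _ h₆, h₂ b' h₅ h₆]
    · rw [State.write_of_ne _ _ _ hbv, State.write_apply, h₄, Expr.val_var, h₁, h₃]
      by_cases ha : a = i
      · subst ha; simp
      · rw [if_neg (by simp [ha])]
        split_ifs <;> first | rfl | omega

/-- Insert the first edges, with weight zero. -/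
def insertAll (v : ℕ) (eN : Expr) : Cmd := forLoop v eN (.insert (.var v) 0)

/-- From here on all edges are present, and changing a weight is a deletion followed by an
insertion; the graph stays connected between operations on an edge. -/
theorem Does.insertAll {v : ℕ} {eN : Expr} (hm : m ≤ V)
    (hN : ∀ σ' : State, (∀ b', b' ≠ v → σ' b' = σ b') → eN.val σ' = m) :
    Does val V W (insertAll v eN) σ (fun _ => ⊤) (m * 3 + 2) 0 fun σ' cur' =>
      cur' = Gadget.full m (fun _ => 0) ∧ ∀ b', b' ≠ v → σ' b' = σ b' := by
  refine (Does.forLoop (n := m) (T := 1) (Q := 0) (fun i σ' cur' => σ' v 0 = i ∧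
    (cur' = fun e : Fin m => if (e : ℕ) < i then 0 else ⊤) ∧ ∀ b', b' ≠ v → σ' b' = σ b') hm
    ⟨by simp, by simp, fun b' h₁ => State.write_of_ne _ _ _ h₁⟩ ?_ ?_).mono le_rfl (by simp)
      fun σ' cur' _ h => ⟨h.2.1.trans (by funext e; simp [Gadget.full]), h.2.2⟩
  · rintro i hi σ' cur' ⟨h₁, -, h₂⟩
    exact ⟨h₁, hN σ' h₂⟩
  · rintro i hi σ' cur' ⟨h₁, h₃, h₂⟩
    have h₄ : (Expr.var v).val σ' = i := by simp [h₁]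
    refine .insert (by rw [h₄]; exact hi) (by simp [h₃, h₁]) (by simp)
      ⟨h₁, by simp, ?_, fun b' h₅ => ?_⟩
    · funext e
      simp only [Function.update_apply, h₃, Fin.ext_iff, h₄]
      rcases lt_trichotomy (e : ℕ) i with he | he | he
      · rw [if_neg (by omega), if_pos he, if_pos (by omega)]
      · rw [if_pos he, if_pos (by omega)]; simp
      · rw [if_neg (by omega), if_neg (by omega), if_neg (by omega)]
    · rw [State.write_of_ne _ _ _ h₅, h₂ b' h₅]

theorem Does.setTo {wt : ℕ → ℕ} {e w : Expr} (wt' : ℕ → ℕ) (he : e.val σ < m) (hw : w.val σ ≤ W)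
    (hwt : ∀ k < m, wt' k = if k = e.val σ then w.val σ else wt k) :
    Does val V W (.set e w) σ (Gadget.full m wt) 1 0 fun σ' cur' =>
      cur' = Gadget.full m wt' ∧ σ' = σ := by
  refine .set he (by simp [Gadget.full]) hw ⟨?_, rfl⟩
  funext k
  rw [Function.update_apply, Gadget.full, Gadget.full, hwt k k.2]
  by_cases hk : (k : ℕ) = e.val σ
  · rw [if_pos (Fin.ext hk), if_pos hk]
  · rw [if_neg (fun h => hk (by rw [h])), if_neg hk]

/-- Change the weights of a sequence of edges. -/
def setLoop (v : ℕ) (eN e w : Expr) : Cmd := forLoop v eN (.set e w)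

/-- `wt k` describes the weights after `k` iterations. -/
theorem Does.setLoop {v n : ℕ} {eN e w : Expr} (wt : ℕ → ℕ → ℕ) (hn : n ≤ V)
    (hN : ∀ σ' : State, (∀ b', b' ≠ v → σ' b' = σ b') → eN.val σ' = n)
    (he : ∀ i < n, ∀ σ' : State, (∀ b', b' ≠ v → σ' b' = σ b') → σ' v 0 = i →
      e.val σ' < m ∧ w.val σ' ≤ W ∧
      ∀ k < m, wt (i + 1) k = if k = e.val σ' then w.val σ' else wt i k) :
    Does val V W (setLoop v eN e w) σ (Gadget.full m (wt 0)) (n * 3 + 2) 0 fun σ' cur' =>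
      cur' = Gadget.full m (wt n) ∧ ∀ b', b' ≠ v → σ' b' = σ b' := by
  refine (Does.forLoop (n := n) (T := 1) (Q := 0) (fun i σ' cur' => σ' v 0 = i ∧
    (cur' = Gadget.full m (wt i)) ∧ ∀ b', b' ≠ v → σ' b' = σ b') hn
    ⟨by simp, rfl, fun b' h₁ => State.write_of_ne _ _ _ h₁⟩ ?_ ?_).mono le_rfl (by simp)
      fun σ' cur' _ h => h.2
  · rintro i hi σ' cur' ⟨h₁, -, h₂⟩
    exact ⟨h₁, hN σ' h₂⟩
  · rintro i hi σ' cur' ⟨h₁, rfl, h₂⟩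
    obtain ⟨h₄, h₅, h₆⟩ := he i hi σ' h₂ h₁
    refine (Does.setTo (wt (i + 1)) h₄ h₅ h₆).mono le_rfl le_rfl ?_
    rintro σ'' cur'' - ⟨h₇, rfl⟩
    exact ⟨h₁, by simp, h₇, fun b' h₈ => by rw [State.write_of_ne _ _ _ h₈, h₂ b' h₈]⟩

end Cmd
end WordRAM

/-! ### The effect of single updates on the weights of the grid -/

namespace Gadget

open Grid

theorem exists_hor_or_ver {A h e : ℕ} (he : e < numEdges A h) :
    (∃ x y, x < A ∧ y ≤ h ∧ e = hor A x y) ∨ ∃ x y, x ≤ A ∧ y < h ∧ e = ver A h x y := by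
  by_cases h1 : e < numHor A h
  · exact .inl ⟨_, _, col_lt h1, row_le h1, eq_hor h1 rfl rfl⟩
  · exact .inr ⟨_, _, col_le e, row_lt' h1 he, eq_ver h1 rfl rfl⟩

theorem hor_inj {A h x y x' y' : ℕ} (hx : x < A) (hy : y ≤ h) (hx' : x' < A) (hy' : y' ≤ h)
    (he : hor A x y = hor A x' y') : x = x' ∧ y = y' := by
  have h1 := congrArg (col A h) he
  have h2 := congrArg (row A h) he
  rw [col_hor hx hy, col_hor hx' hy'] at h1
  rw [row_hor hx hy, row_hor hx' hy'] at h2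
  exact ⟨h1, h2⟩

theorem ver_inj {A h x y x' y' : ℕ} (hx : x ≤ A) (hx' : x' ≤ A)
    (he : ver A h x y = ver A h x' y') : x = x' ∧ y = y' := by
  have h1 := congrArg (col A h) he
  have h2 := congrArg (row A h) he
  rw [col_ver hx, col_ver hx'] at h1
  rw [row_ver hx, row_ver hx'] at h2
  exact ⟨h1, h2⟩

theorem hor_ne_ver {A h x y x' y' : ℕ} (hx : x < A) (hy : y ≤ h) :
    hor A x y ≠ ver A h x' y' := fun he => by
  have := hor_lt hx hy
  rw [he] at this
  exact ver_not_lt this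

variable {n₂ n₃ S : ℕ} {a a' : ℕ → ℕ} {b : ℕ → ℕ → ℕ} {top bot : ℕ}

/-- The number of edges of the grid. -/
abbrev size (n₂ n₃ : ℕ) : ℕ := numEdges (2 * n₃ + 1) (n₂ + 1)

theorem weight_congr_left (h : ∀ y, 1 ≤ y → y ≤ n₂ → a y = a' y) {e : ℕ} (he : e < size n₂ n₃) :
    weight n₂ n₃ S a b top bot e = weight n₂ n₃ S a' b top bot e := by
  rcases exists_hor_or_ver he with ⟨x, y, hx, hy, rfl⟩ | ⟨x, y, hx, hy, rfl⟩
  · rw [weight_hor hx hy, weight_hor hx hy]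
    unfold horWeight
    by_cases h0 : y = 0 ∨ y = n₂ + 1
    · simp [h0]
    · rw [h y (by omega) (by omega)]
  · rw [weight_ver hx, weight_ver hx]

/-- The weight of a vertical edge, depending on whether its column is open. -/
theorem weight_update_left {y : ℕ} (hy : 1 ≤ y) (hy' : y ≤ n₂) (h3 : 1 ≤ n₃)
    (ha : ∀ z, z ≠ y → a' z = a z) {e : ℕ} (he : e < size n₂ n₃) :
    weight n₂ n₃ S a' b top bot e = if e = hor (2 * n₃ + 1) n₃ y then
      (n₂ + 1 - y) * (2 * S) + a' y else weight n₂ n₃ S a b top bot e := by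
  rcases exists_hor_or_ver he with ⟨x, z, hx, hz, rfl⟩ | ⟨x, z, hx, hz, rfl⟩
  · rw [weight_hor hx hz, weight_hor hx hz]
    by_cases hzy : z = y
    · subst hzy
      by_cases hxn : x = n₃
      · subst hxn
        rw [if_pos rfl, horWeight, if_neg (by omega), if_neg (by omega), if_pos le_rfl, if_pos rfl]
      · rw [if_neg (fun h => hxn (hor_inj hx hz (by omega) hz h).1)]
        simp only [horWeight, hxn, if_false]
    · rw [if_neg (fun h => hzy (hor_inj hx hz (by omega) (by omega) h).2)]
      simp only [horWeight, ha z hzy]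
  · rw [weight_ver hx, weight_ver hx, if_neg (hor_ne_ver (by omega) (by omega)).symm]

/-- The value 0 of `top` or `bot` encodes that no column is open, since column 0 is not part of the
main grid. The hypothesis `h` covers opening and closing of column `t` at once. -/
theorem weight_update_top {t t' : ℕ} (ht : 1 ≤ t) (htn : t ≤ 2 * n₃ + 1)
    (h : (t' = t ∧ top = 0) ∨ (t' = 0 ∧ top = t)) {e : ℕ} (he : e < size n₂ n₃) :
    weight n₂ n₃ S a b t' bot e = if e = ver (2 * n₃ + 1) (n₂ + 1) t 0 then
      (if t' = 0 then big n₂ n₃ S else drop n₃ S) else weight n₂ n₃ S a b top bot e := by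
  rcases exists_hor_or_ver he with ⟨x, z, hx, hz, rfl⟩ | ⟨x, z, hx, hz, rfl⟩
  · rw [weight_hor hx hz, weight_hor hx hz, if_neg (hor_ne_ver hx hz)]
  · rw [weight_ver hx, weight_ver hx]
    by_cases hxt : x = t
    · subst hxt
      by_cases hz0 : z = 0
      · subst hz0
        rw [if_pos rfl, verWeight, if_neg (by omega), if_pos rfl]
        split_ifs <;> first | rfl | omega
      · rw [if_neg (fun h => hz0 (ver_inj hx hx h).2)]
        simp only [verWeight, hz0, if_false]
    · rw [if_neg (fun h => hxt (ver_inj hx htn h).1)]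
      unfold verWeight
      split_ifs <;> first | rfl | omega

theorem weight_update_bot {t t' : ℕ} (ht : 1 ≤ t) (htn : t ≤ 2 * n₃ + 1) (hn₂ : 1 ≤ n₂)
    (h : (t' = t ∧ bot = 0) ∨ (t' = 0 ∧ bot = t)) {e : ℕ} (he : e < size n₂ n₃) :
    weight n₂ n₃ S a b top t' e = if e = ver (2 * n₃ + 1) (n₂ + 1) t n₂ then
      (if t' = 0 then big n₂ n₃ S else drop n₃ S) else weight n₂ n₃ S a b top bot e := by
  rcases exists_hor_or_ver he with ⟨x, z, hx, hz, rfl⟩ | ⟨x, z, hx, hz, rfl⟩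
  · rw [weight_hor hx hz, weight_hor hx hz, if_neg (hor_ne_ver hx hz)]
  · rw [weight_ver hx, weight_ver hx]
    by_cases hxt : x = t
    · subst hxt
      by_cases hz0 : z = n₂
      · subst hz0
        rw [if_pos rfl, verWeight, if_neg (by omega), if_neg (by omega), if_pos rfl]
        split_ifs <;> first | rfl | omega
      · rw [if_neg (fun h => hz0 (ver_inj hx hx h).2)]
        simp only [verWeight, hz0, if_false]
    · rw [if_neg (fun h => hxt (ver_inj hx htn h).1)]
      unfold verWeight
      split_ifs <;> first | rfl | omega

theorem big_le_far : big n₂ n₃ S ≤ far n₂ n₃ S := Nat.le_add_left _ _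

theorem drop_le_big : drop n₃ S ≤ big n₂ n₃ S := by
  have : 1 * drop n₃ S ≤ (n₂ + 1) * drop n₃ S := Nat.mul_le_mul_right _ (by omega)
  unfold big; omega

theorem pend_le_far : 2 * pend n₂ n₃ S ≤ far n₂ n₃ S := Nat.le_add_right _ _

theorem layer_le_big (h3 : 1 ≤ n₃) : (n₂ + 1) * (2 * S) + 2 * S ≤ big n₂ n₃ S := by
  have : 1 * ((n₂ + 1) * (2 * S)) ≤ n₃ * ((n₂ + 1) * (2 * S)) := Nat.mul_le_mul_right _ h3
  unfold big; omega

theorem weight_le (ha : ∀ y, a y ≤ S) (hb : ∀ y c, b y c ≤ S) (h3 : 1 ≤ n₃) {e : ℕ}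
    (he : e < size n₂ n₃) : weight n₂ n₃ S a b top bot e ≤ far n₂ n₃ S := by
  have h1 := big_le_far (n₂ := n₂) (n₃ := n₃) (S := S)
  have h2 := drop_le_big (n₂ := n₂) (n₃ := n₃) (S := S)
  have h4 := pend_le_far (n₂ := n₂) (n₃ := n₃) (S := S)
  have h5 := layer_le_big (n₂ := n₂) (S := S) h3
  rcases exists_hor_or_ver he with ⟨x, z, hx, hz, rfl⟩ | ⟨x, z, hx, hz, rfl⟩
  · rw [weight_hor hx hz]
    have h6 := ha z
    have h7 := hb z (x - n₃)
    have h8 : (n₂ + 1 - z) * (2 * S) ≤ (n₂ + 1) * (2 * S) := Nat.mul_le_mul_right _ (by omega)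
    have h9 : z * (2 * S) ≤ (n₂ + 1) * (2 * S) := Nat.mul_le_mul_right _ (by omega)
    unfold horWeight
    split_ifs <;> omega
  · rw [weight_ver hx]
    unfold verWeight
    split_ifs <;> omega

end Gadget

/-! ### Min-plus products with a dynamic planar graph algorithm -/

namespace Driver

open WordRAM WordRAM.Cmd Gadget

/-- The shift that makes weights nonnegative. -/
def shift (c n : ℕ) : ℕ := 2 * n ^ (c + 1)
/-- The code of `⊤`. -/
def cap (c n : ℕ) : ℕ := 4 * shift c n + 1

/-- The scalar variables that hold the parameters. -/
structure Env (n n₂ n₃ d : ℕ) (σ : State) : Prop where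
  order : σ 0 0 = n
  rows : σ 10 0 = n₂
  cols : σ 11 0 = n₃
  blocks : σ 12 0 = d

theorem Env.congr {n n₂ n₃ d : ℕ} {σ σ' : State} (h : Env n n₂ n₃ d σ)
    (hσ : ∀ b < 20, σ' b = σ b) : Env n n₂ n₃ d σ' :=
  ⟨by rw [hσ _ (by omega), h.order], by rw [hσ _ (by omega), h.rows],
    by rw [hσ _ (by omega), h.cols], by rw [hσ _ (by omega), h.blocks]⟩

/-- The order of the weight matrix. -/
def eN : Expr := .var 0
/-- The number of inner rows of the grid. -/
def e₂ : Expr := .var 10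
/-- Half the number of inner columns of the grid. -/
def e₃ : Expr := .var 11
/-- The number of blocks. -/
def eD : Expr := .var 12
/-- The value `shift c n`. -/
def eShift (c : ℕ) : Expr := 2 * eN.pow (c + 1)
/-- The value `cap c n`. -/
def eCap (c : ℕ) : Expr := 4 * eShift c + 1
/-- The order of the padded matrix. -/
def eZ : Expr := e₂ * e₃ * eD
/-- The value `Gadget.drop`. -/
def eDrop (c : ℕ) : Expr := (e₃ + 1) * (2 * eCap c)
/-- The value `Gadget.big`. -/
def eBig (c : ℕ) : Expr := (e₂ + 1) * eDrop c + e₃ * ((e₂ + 1) * (2 * eCap c)) + 2 * eCap c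
/-- The value `Gadget.pend`. -/
def ePend (c : ℕ) : Expr := (2 * e₃ + e₂ + 4) * eBig c
/-- The value `Gadget.far`. -/
def eFar (c : ℕ) : Expr := 2 * ePend c + eBig c
/-- The index of a horizontal edge. -/
def eHor (x y : Expr) : Expr := y * (2 * e₃ + 1) + x
/-- The number of horizontal edges. -/
def eNumHor : Expr := (e₂ + 1 + 1) * (2 * e₃ + 1)
/-- The index of a vertical edge. -/
def eVer (x y : Expr) : Expr := eNumHor + (y * (2 * e₃ + 1 + 1) + x)
/-- The number of edges. -/
def eSize : Expr := eNumHor + (e₂ + 1) * (2 * e₃ + 1 + 1)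
/-- The value `Gadget.offset`. -/
def eOffset (c : ℕ) : PlanarProblem → Expr
  | .directedGirth => 2 * ePend c + eFar c
  | _ => 2 * ePend c

section

variable {n n₂ n₃ d : ℕ} {σ : State} (h : Env n n₂ n₃ d σ) (c : ℕ)
include h

theorem Env.val_eN : eN.val σ = n := h.order
theorem Env.val_e₂ : e₂.val σ = n₂ := h.rows
theorem Env.val_e₃ : e₃.val σ = n₃ := h.cols
theorem Env.val_eD : eD.val σ = d := h.blocks
theorem Env.val_eShift : (eShift c).val σ = shift c n := by simp [eShift, shift, h.val_eN]
theorem Env.val_eCap : (eCap c).val σ = cap c n := by simp [eCap, cap, h.val_eShift]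
theorem Env.val_eZ : eZ.val σ = n₂ * n₃ * d := by simp [eZ, h.val_e₂, h.val_e₃, h.val_eD]
theorem Env.val_eDrop : (eDrop c).val σ = drop n₃ (cap c n) := by
  simp [eDrop, drop, h.val_e₃, h.val_eCap]
theorem Env.val_eBig : (eBig c).val σ = big n₂ n₃ (cap c n) := by
  simp [eBig, big, h.val_e₃, h.val_e₂, h.val_eCap, h.val_eDrop]
theorem Env.val_ePend : (ePend c).val σ = pend n₂ n₃ (cap c n) := by
  simp [ePend, pend, h.val_e₃, h.val_e₂, h.val_eBig]
theorem Env.val_eFar : (eFar c).val σ = far n₂ n₃ (cap c n) := by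
  simp [eFar, far, h.val_ePend, h.val_eBig]
theorem Env.val_eHor (x y : Expr) :
    (eHor x y).val σ = Grid.hor (2 * n₃ + 1) (x.val σ) (y.val σ) := by
  simp [eHor, Grid.hor, h.val_e₃]
theorem Env.val_eNumHor : eNumHor.val σ = Grid.numHor (2 * n₃ + 1) (n₂ + 1) := by
  simp [eNumHor, Grid.numHor, h.val_e₃, h.val_e₂]
theorem Env.val_eVer (x y : Expr) :
    (eVer x y).val σ = Grid.ver (2 * n₃ + 1) (n₂ + 1) (x.val σ) (y.val σ) := by
  simp [eVer, Grid.ver, h.val_e₃, h.val_eNumHor]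
theorem Env.val_eSize : eSize.val σ = Gadget.size n₂ n₃ := by
  simp [eSize, Gadget.size, Grid.numEdges, h.val_e₃, h.val_e₂, h.val_eNumHor]
theorem Env.val_eOffset (p : PlanarProblem) :
    (eOffset c p).val σ = offset n₂ n₃ (cap c n) p := by
  cases p <;> simp [eOffset, offset, h.val_ePend, h.val_eFar]

end

/-- The entries of the right factor that are encoded in a block. -/
def blockRight (m : ℕ → ℕ) (n₂ n₃ d p q y x : ℕ) : ℕ :=
  if x = 0 then 0 else m ((p * n₂ + y - 1) * (n₂ * n₃ * d) + (q * n₃ + x - 1))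

/-- The entries of the left factor that are encoded in a row of the product. -/
def blockLeft (m : ℕ → ℕ) (n₂ n₃ d p i y : ℕ) : ℕ := m (i * (n₂ * n₃ * d) + (p * n₂ + y - 1))

/-- The value `blockRight`, for the block given by the variables `31` and `32`. -/
def eRight (y x : Expr) : Expr :=
  .ifEq x 0 0 (.read 20 ((.var 31 * e₂ + y - 1) * eZ + (.var 32 * e₃ + x - 1)))

/-- The weight of a horizontal edge. -/
def eHorWeight (c : ℕ) (x y : Expr) : Expr :=
  .ifEq x 0 (.ifEq y 0 (ePend c) (.ifEq y (e₂ + 1) (ePend c) (eFar c)))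
    (.ifEq y 0 0 (.ifEq y (e₂ + 1) 0 (.ifLt e₃ x
      (y * (2 * eCap c) + eRight y (x - e₃) - eRight y (x - e₃ - 1))
      ((e₂ + 1 - y) * (2 * eCap c)))))

/-- The weight of a vertical edge when no column is open. -/
def eVerWeight (c : ℕ) (x y : Expr) : Expr :=
  .ifEq x 0 (.ifEq y e₂ (eFar c) 0) (.ifEq y 0 (eBig c) (.ifEq y e₂ (eBig c) (eDrop c)))

/-- The weight of an edge when no column is open. -/
def eWeight (c : ℕ) (e : Expr) : Expr :=
  .ifLt e eNumHor (eHorWeight c (e % (2 * e₃ + 1)) (e / (2 * e₃ + 1)))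
    (eVerWeight c ((e - eNumHor) % (2 * e₃ + 1 + 1)) ((e - eNumHor) / (2 * e₃ + 1 + 1)))

theorem Env.val_eRight {n n₂ n₃ d : ℕ} {σ : State} (h : Env n n₂ n₃ d σ) (y x : Expr) :
    (eRight y x).val σ =
      blockRight (σ 20) n₂ n₃ d (σ 31 0) (σ 32 0) (y.val σ) (x.val σ) := by
  simp [eRight, blockRight, h.val_e₂, h.val_e₃, h.val_eZ]

theorem Env.val_eWeight {n n₂ n₃ d : ℕ} {σ : State} (h : Env n n₂ n₃ d σ) (c : ℕ) (e : Expr) :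
    (eWeight c e).val σ = weight n₂ n₃ (cap c n) (fun _ => 0)
      (blockRight (σ 20) n₂ n₃ d (σ 31 0) (σ 32 0)) 0 0 (e.val σ) := by
  have hh : ∀ x y : Expr, (eHorWeight c x y).val σ = horWeight n₂ n₃ (cap c n) (fun _ => 0)
      (blockRight (σ 20) n₂ n₃ d (σ 31 0) (σ 32 0)) (x.val σ) (y.val σ) := by
    intro x y
    simp only [eHorWeight, horWeight, Expr.val_ifEq, Expr.val_ifLt,
      Expr.val_add, Expr.val_sub, Expr.val_mul, h.val_eRight, h.val_ePend, h.val_eFar, h.val_e₂,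
      h.val_e₃, h.val_eCap, Expr.val_ofNat]
    split_ifs <;> first | rfl | omega
  have hv : ∀ x y : Expr, (eVerWeight c x y).val σ = verWeight n₂ n₃ (cap c n) 0 0 (x.val σ)
      (y.val σ) := by
    intro x y
    simp only [eVerWeight, verWeight, Expr.val_ifEq, Expr.val_zero, h.val_eBig, h.val_eFar,
      h.val_e₂, h.val_eDrop]
    split_ifs <;> rfl
  simp only [eWeight, weight, Expr.val_ifLt, hh, hv, h.val_eNumHor, Expr.val_mod, Expr.val_div,
    Expr.val_sub, Expr.val_add, Expr.val_mul, Expr.val_ofNat, h.val_e₃]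
  by_cases he : e.val σ < Grid.numHor (2 * n₃ + 1) (n₂ + 1)
  · simp only [he, if_true, Grid.col, Grid.row]
  · simp only [he, if_false, Grid.col, Grid.row]

/-- The bounds that are needed to run the program. -/
structure Bounds (c n n₂ n₃ d V W : ℕ) : Prop where
  rows : 1 ≤ n₂
  cols : 1 ≤ n₃
  weight_le : far n₂ n₃ (cap c n) ≤ W
  answer_le : 2 * far n₂ n₃ (cap c n) + 1 ≤ V
  square_le : (n₂ * n₃ * d) * (n₂ * n₃ * d) ≤ V
  size_le : size n₂ n₃ ≤ V
  order_le : n * n ≤ V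

section

variable {c n n₂ n₃ d V W : ℕ} (hB : Bounds c n n₂ n₃ d V W)
include hB

theorem Bounds.dim_le : n₂ * n₃ * d ≤ V := (Nat.le_mul_self _).trans hB.square_le
theorem Bounds.rowBlocks_le : n₃ * d ≤ V := by
  refine le_trans ?_ hB.dim_le
  rw [mul_assoc]; exact Nat.le_mul_of_pos_left _ hB.rows
theorem Bounds.colBlocks_le : n₂ * d ≤ V := by
  refine le_trans ?_ hB.dim_le
  rw [mul_right_comm]; exact Nat.le_mul_of_pos_right _ hB.cols
theorem Bounds.rows_le : n₂ ≤ V := by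
  refine le_trans ?_ hB.size_le
  unfold Gadget.size Grid.numEdges Grid.numHor; nlinarith
theorem Bounds.cols_le : n₃ ≤ V := by
  refine le_trans ?_ hB.size_le
  unfold Gadget.size Grid.numEdges Grid.numHor; nlinarith
theorem Bounds.cap_le : 2 * cap c n ≤ V := by
  have h1 := layer_le_big (n₂ := n₂) (S := cap c n) hB.cols
  have h2 := big_le_far (n₂ := n₂) (n₃ := n₃) (S := cap c n)
  have := hB.answer_le
  omega

end

theorem full_congr {m : ℕ} {f g : ℕ → ℕ} (h : ∀ e < m, f e = g e) : full m f = full m g := by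
  funext e; simp [full, h e e.2]

/-- Set the edges of the middle column according to a row of the left factor. -/
def setRow (c : ℕ) : Cmd := setLoop 33 e₂ (eHor e₃ (.var 33 + 1))
  ((e₂ + 1 - (.var 33 + 1)) * (2 * eCap c) + .read 20 (.var 34 * eZ + (.var 31 * e₂ + .var 33)))

section

variable {c n n₂ n₃ d V W : ℕ} {val : (Fin (size n₂ n₃) → ℕ∞) → ℕ∞} {σ : State}

/-- The right block stays in place; passing to another row of the left factor changes only the `n₂`
edges that enter the middle column. -/
theorem Does.setRow (hB : Bounds c n n₂ n₃ d V W) (h : Env n n₂ n₃ d σ) (a₀ : ℕ → ℕ)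
    (hm : ∀ a, σ 20 a ≤ cap c n) (b : ℕ → ℕ → ℕ) :
    Does val V W (setRow c) σ (full _ (weight n₂ n₃ (cap c n) a₀ b 0 0)) (n₂ * 3 + 2) 0
      fun σ' cur' => cur' = full _ (weight n₂ n₃ (cap c n)
          (blockLeft (σ 20) n₂ n₃ d (σ 31 0) (σ 34 0)) b 0 0) ∧ ∀ b', b' ≠ 33 → σ' b' = σ b' := by
  have h0 : full (size n₂ n₃) (weight n₂ n₃ (cap c n) a₀ b 0 0) = full (size n₂ n₃) (weight n₂ n₃
      (cap c n) (fun y => if y ≤ 0 then blockLeft (σ 20) n₂ n₃ d (σ 31 0) (σ 34 0) y else a₀ y)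
      b 0 0) := full_congr fun e he => weight_congr_left (fun y hy _ =>
          by rw [if_neg (by omega)]) he
  rw [h0]
  -- After `k` updates the rows up to `k` carry the new entries and the others still the old ones.
  refine (Does.setLoop (fun k => weight n₂ n₃ (cap c n) (fun y => if y ≤ k then
    blockLeft (σ 20) n₂ n₃ d (σ 31 0) (σ 34 0) y else a₀ y) b 0 0) hB.rows_le ?_ ?_).mono le_rfl
      le_rfl fun σ' cur' _ hh => ⟨hh.1.trans (full_congr fun e he =>
        weight_congr_left (fun y _ hy => by rw [if_pos hy]) he), hh.2⟩
  · intro σ' hσ'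
    exact (h.congr fun b hb => hσ' b (by omega)).val_e₂
  · intro i hi σ' hσ' hv
    have h' := h.congr fun b hb => hσ' b (by omega)
    have e1 : (eHor e₃ (.var 33 + 1)).val σ' = Grid.hor (2 * n₃ + 1) n₃ (i + 1) := by
      simp [h'.val_eHor, h'.val_e₃, hv]
    have e2 : ((e₂ + 1 - (.var 33 + 1)) * (2 * eCap c) +
        .read 20 (.var 34 * eZ + (.var 31 * e₂ + .var 33)) : Expr).val σ' =
        (n₂ + 1 - (i + 1)) * (2 * cap c n) +
          blockLeft (σ 20) n₂ n₃ d (σ 31 0) (σ 34 0) (i + 1) := by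
      simp [h'.val_e₂, h'.val_eCap, h'.val_eZ, hv, blockLeft, hσ']
    rw [e1, e2]
    refine ⟨Grid.hor_lt_numEdges (by omega) (by omega), ?_, fun k hk => ?_⟩
    · refine le_trans ?_ hB.weight_le
      have h1 := layer_le_big (n₂ := n₂) (S := cap c n) hB.cols
      have h2 := big_le_far (n₂ := n₂) (n₃ := n₃) (S := cap c n)
      have h3 : (n₂ + 1 - (i + 1)) * (2 * cap c n) ≤ (n₂ + 1) * (2 * cap c n) :=
        Nat.mul_le_mul_right _ (by omega)
      have h4 : blockLeft (σ 20) n₂ n₃ d (σ 31 0) (σ 34 0) (i + 1) ≤ cap c n := hm _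
      omega
    · rw [weight_update_left (y := i + 1) (a := fun y => if y ≤ i then
        blockLeft (σ 20) n₂ n₃ d (σ 31 0) (σ 34 0) y else a₀ y) (by omega) (by omega) hB.cols
        (fun z hz => ?_) hk, if_pos le_rfl]
      split_ifs <;> first | rfl | omega

/-- Query the entry in the column given by the variable `35`. -/
def queryEntry (c : ℕ) (p : PlanarProblem) : Cmd :=
  .seq (.set (eVer (e₃ + 1 - (.var 35 + 1)) 0) (eDrop c))
  (.seq (.set (eVer (e₃ + 1 + (.var 35 + 1)) e₂) (eDrop c))
  (.seq (.query 36)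
  (.seq (.set (eVer (e₃ + 1 - (.var 35 + 1)) 0) (eBig c))
  (.seq (.set (eVer (e₃ + 1 + (.var 35 + 1)) e₂) (eBig c))
  (.assign 21 (.var 34 * eZ + (.var 32 * e₃ + .var 35))
    (.ifLt (.read 21 (.var 34 * eZ + (.var 32 * e₃ + .var 35)))
      (.var 36 - 1 - eOffset c p - ((e₂ + 1) * eDrop c + (.var 35 + 1) * ((e₂ + 1) * (2 * eCap c))))
      (.read 21 (.var 34 * eZ + (.var 32 * e₃ + .var 35)))
      (.var 36 - 1 - eOffset c p -
        ((e₂ + 1) * eDrop c + (.var 35 + 1) * ((e₂ + 1) * (2 * eCap c))))))))))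

/-- Two edges are opened, the value is queried, and the edges are closed again, so that the weights
are restored for the next column. The answer, freed of its constants, is merged with the minimum
collected so far in bank 21. -/
theorem Does.queryEntry (hB : Bounds c n n₂ n₃ d V W) (h : Env n n₂ n₃ d σ) (p : PlanarProblem)
    {a : ℕ → ℕ} {b : ℕ → ℕ → ℕ} (hf : Fits n₂ n₃ (cap c n) a b (σ 35 0 + 1))
    (hR : ∀ x, σ 21 x ≤ 2 * cap c n) :
    Does (fun cur => (grid n₂ n₃).value cur p) V W (queryEntry c p) σ
      (full _ (weight n₂ n₃ (cap c n) a b 0 0)) 6 1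
      fun σ' cur' => cur' = full _ (weight n₂ n₃ (cap c n) a b 0 0) ∧
        (∀ b', b' ≠ 36 → b' ≠ 21 → σ' b' = σ b') ∧
        ∀ x, σ' 21 x = if x = σ 34 0 * (n₂ * n₃ * d) + (σ 32 0 * n₃ + σ 35 0) then
          min (σ 21 x) (rowMin (cap c n) a b (σ 35 0 + 1) n₂) else σ 21 x := by
  have hj := hf.one_le
  have hj' := hf.le
  have hn₂ := hf.one_le_rows
  have hbig : (eBig c).val σ ≤ W := by
    rw [h.val_eBig]; exact big_le_far.trans hB.weight_le
  have hdrop : (eDrop c).val σ ≤ W := by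
    rw [h.val_eDrop]; exact drop_le_big.trans (big_le_far.trans hB.weight_le)
  have e1 : (eVer (e₃ + 1 - (.var 35 + 1)) 0).val σ =
      Grid.ver (2 * n₃ + 1) (n₂ + 1) (n₃ + 1 - (σ 35 0 + 1)) 0 := by
    simp [h.val_eVer, h.val_e₃]
  have e2 : (eVer (e₃ + 1 + (.var 35 + 1)) e₂).val σ =
      Grid.ver (2 * n₃ + 1) (n₂ + 1) (n₃ + 1 + (σ 35 0 + 1)) n₂ := by
    simp [h.val_eVer, h.val_e₃, h.val_e₂]
  have l1 : (eVer (e₃ + 1 - (.var 35 + 1)) 0).val σ < size n₂ n₃ := by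
    rw [e1]; exact Grid.ver_lt (by omega) (by omega)
  have l2 : (eVer (e₃ + 1 + (.var 35 + 1)) e₂).val σ < size n₂ n₃ := by
    rw [e2]; exact Grid.ver_lt (by omega) (by omega)
  have hans := value_queryCur hf p
  have hcode : answerCode ((grid n₂ n₃).value (queryCur n₂ n₃ (cap c n) a b (σ 35 0 + 1)) p) =
      Gadget.dist n₂ n₃ (cap c n) a b (σ 35 0 + 1) + offset n₂ n₃ (cap c n) p + 1 := by
    rw [hans]; rfl
  have hdist := dist_le (n₂ := n₂) (S := cap c n) (a := a) (b := b) hj'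
  have hoff : offset n₂ n₃ (cap c n) p ≤ 2 * pend n₂ n₃ (cap c n) + far n₂ n₃ (cap c n) := by
    cases p <;> simp [offset]
  have hcodeV : answerCode ((grid n₂ n₃).value (queryCur n₂ n₃ (cap c n) a b (σ 35 0 + 1)) p) ≤
      V := by
    rw [hcode]
    refine le_trans ?_ hB.answer_le
    have : far n₂ n₃ (cap c n) = 2 * pend n₂ n₃ (cap c n) + big n₂ n₃ (cap c n) := rfl
    omega
  refine (Does.andThen (Does.setTo (weight n₂ n₃ (cap c n) a b (n₃ + 1 - (σ 35 0 + 1)) 0) l1 hdrop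
    fun k hk => ?_) ?_ (T₁ := 1) (Q₁ := 0) (T₂ := 5) (Q₂ := 1))
  · rw [e1, h.val_eDrop, weight_update_top (t := n₃ + 1 - (σ 35 0 + 1)) (top := 0) (by omega)
      (by omega) (.inl ⟨rfl, rfl⟩) hk, if_neg (show ¬ n₃ + 1 - (σ 35 0 + 1) = 0 by omega)]
  rintro σ₁ cur₁ - ⟨rfl, rfl⟩
  refine (Does.andThen (Does.setTo (weight n₂ n₃ (cap c n) a b (n₃ + 1 - (σ₁ 35 0 + 1))
    (n₃ + 1 + (σ₁ 35 0 + 1))) l2 hdrop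
    fun k hk => ?_) ?_ (T₁ := 1) (Q₁ := 0) (T₂ := 4) (Q₂ := 1))
  · rw [e2, h.val_eDrop, weight_update_bot (t := n₃ + 1 + (σ₁ 35 0 + 1)) (bot := 0) (by omega)
      (by omega) hn₂ (.inl ⟨rfl, rfl⟩) hk, if_neg (show ¬ n₃ + 1 + (σ₁ 35 0 + 1) = 0 by omega)]
  rintro σ₂ cur₂ - ⟨rfl, rfl⟩
  refine Does.seq (T₁ := 1) (Q₁ := 1) (T₂ := 3) (Q₂ := 0) (Does.query hcodeV ?_)
  -- After the two updates the current weights are by definition those of `queryCur`.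
  change Does _ _ _ _ (σ₂.write 36 0 (answerCode ((grid n₂ n₃).value
    (queryCur n₂ n₃ (cap c n) a b (σ₂ 35 0 + 1)) p))) _ _ _ _
  rw [hcode]
  set σ₃ := σ₂.write 36 0
    (Gadget.dist n₂ n₃ (cap c n) a b (σ₂ 35 0 + 1) + offset n₂ n₃ (cap c n) p + 1) with hσ₃
  have hfr : ∀ b', b' ≠ 36 → σ₃ b' = σ₂ b' := fun b' hb' => State.write_of_ne _ _ _ hb'
  have h3 : Env n n₂ n₃ d σ₃ := h.congr fun b' hb' => hfr b' (by omega)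
  have e1' : (eVer (e₃ + 1 - (.var 35 + 1)) 0).val σ₃ =
      Grid.ver (2 * n₃ + 1) (n₂ + 1) (n₃ + 1 - (σ₂ 35 0 + 1)) 0 := by
    simp [h3.val_eVer, h3.val_e₃, hfr]
  have e2' : (eVer (e₃ + 1 + (.var 35 + 1)) e₂).val σ₃ =
      Grid.ver (2 * n₃ + 1) (n₂ + 1) (n₃ + 1 + (σ₂ 35 0 + 1)) n₂ := by
    simp [h3.val_eVer, h3.val_e₃, h3.val_e₂, hfr]
  have hbig' : (eBig c).val σ₃ ≤ W := by
    rw [h3.val_eBig]; exact big_le_far.trans hB.weight_le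
  refine (Does.andThen (Does.setTo (weight n₂ n₃ (cap c n) a b 0 (n₃ + 1 + (σ₂ 35 0 + 1)))
    (by rw [e1', ← e1]; exact l1) hbig'
    fun k hk => ?_) ?_ (T₁ := 1) (Q₁ := 0) (T₂ := 2) (Q₂ := 0))
  · rw [e1', h3.val_eBig, weight_update_top (t := n₃ + 1 - (σ₂ 35 0 + 1))
      (top := n₃ + 1 - (σ₂ 35 0 + 1)) (by omega) (by omega) (.inr ⟨rfl, rfl⟩) hk, if_pos rfl]
  rintro σ₄ cur₄ - ⟨rfl, hσ₄⟩
  rw [hσ₄]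
  refine (Does.andThen (Does.setTo (weight n₂ n₃ (cap c n) a b 0 0)
    (by rw [e2', ← e2]; exact l2) hbig'
    fun k hk => ?_) ?_ (T₁ := 1) (Q₁ := 0) (T₂ := 1) (Q₂ := 0))
  · rw [e2', h3.val_eBig, weight_update_bot (t := n₃ + 1 + (σ₂ 35 0 + 1))
      (bot := n₃ + 1 + (σ₂ 35 0 + 1)) (by omega) (by omega) hn₂ (.inr ⟨rfl, rfl⟩) hk, if_pos rfl]
  rintro σ₅ cur₅ - ⟨rfl, hσ₅⟩
  rw [hσ₅]
  have v36 : σ₃ 36 0 = Gadget.dist n₂ n₃ (cap c n) a b (σ₂ 35 0 + 1) +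
      offset n₂ n₃ (cap c n) p + 1 := by simp [hσ₃]
  have v3 : (.var 34 * eZ + (.var 32 * e₃ + .var 35) : Expr).val σ₃ =
      σ₂ 34 0 * (n₂ * n₃ * d) + (σ₂ 32 0 * n₃ + σ₂ 35 0) := by
    simp [h3.val_eZ, h3.val_e₃, hfr]
  -- The answer is stored increased by 1; what remains after removing the offset of the problem and
  -- the two constant summands of `dist` is the minimum.
  have v4 : (.var 36 - 1 - eOffset c p -
      ((e₂ + 1) * eDrop c + (.var 35 + 1) * ((e₂ + 1) * (2 * eCap c))) : Expr).val σ₃ =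
      rowMin (cap c n) a b (σ₂ 35 0 + 1) n₂ := by
    simp only [Expr.val_sub, Expr.val_var, Expr.val_add, Expr.val_mul,
      Expr.val_ofNat, h3.val_e₂, h3.val_eDrop, h3.val_eCap, h3.val_eOffset, hfr 35 (by omega), v36,
      Gadget.dist]
    omega
  have hmin : (Expr.ifLt (.read 21 (.var 34 * eZ + (.var 32 * e₃ + .var 35)))
      (.var 36 - 1 - eOffset c p - ((e₂ + 1) * eDrop c + (.var 35 + 1) * ((e₂ + 1) * (2 * eCap c))))
      (.read 21 (.var 34 * eZ + (.var 32 * e₃ + .var 35)))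
      (.var 36 - 1 - eOffset c p -
        ((e₂ + 1) * eDrop c + (.var 35 + 1) * ((e₂ + 1) * (2 * eCap c))))).val σ₃ =
      min (σ₂ 21 (σ₂ 34 0 * (n₂ * n₃ * d) + (σ₂ 32 0 * n₃ + σ₂ 35 0)))
        (rowMin (cap c n) a b (σ₂ 35 0 + 1) n₂) := by
    rw [Expr.val_ifLt, v4, Expr.val_read, v3, hfr 21 (by omega), min_def]
    split_ifs <;> omega
  refine .assign ?_ ⟨rfl, fun b' h1 h2 => ?_, fun x => ?_⟩
  · rw [hmin]
    exact (min_le_left _ _).trans ((hR _).trans hB.cap_le)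
  · rw [State.write_of_ne _ _ _ h2, hfr b' h1]
  · rw [hmin, v3, State.write_apply, hfr 21 (by omega)]
    by_cases hx : x = σ₂ 34 0 * (n₂ * n₃ * d) + (σ₂ 32 0 * n₃ + σ₂ 35 0)
    · rw [if_pos ⟨rfl, hx⟩, if_pos hx, hx]
    · rw [if_neg (fun hh => hx hh.2), if_neg hx]

end

end Driver

/-! ### The blocked min-plus square -/

namespace Driver

open WordRAM WordRAM.Cmd Gadget

/-- The least of `2 * S` and the first `k` sums in the min-plus product of a matrix with itself. -/
def part (m : ℕ → ℕ) (Z S : ℕ) : ℕ → ℕ → ℕ → ℕ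
  | 0, _, _ => 2 * S
  | k + 1, i, l => min (part m Z S k i l) (m (i * Z + k) + m (k * Z + l))

theorem part_le {m : ℕ → ℕ} {Z S k i l : ℕ} : part m Z S k i l ≤ 2 * S := by
  induction k with
  | zero => exact le_rfl
  | succ k ih => exact (min_le_left _ _).trans ih

/-- The state of the product when the first `k i l` sums for the entry `i l` are known. -/
structure Partial (m : ℕ → ℕ) (Z S : ℕ) (k : ℕ → ℕ → ℕ) (R : ℕ → ℕ) : Prop where
  le : ∀ x, R x ≤ 2 * S
  eq : ∀ i < Z, ∀ l < Z, R (i * Z + l) = part m Z S (k i l) i l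

theorem Partial.congr {m : ℕ → ℕ} {Z S : ℕ} {k k' : ℕ → ℕ → ℕ} {R R' : ℕ → ℕ}
    (h : Partial m Z S k R) (hR : R' = R) (hk : ∀ i < Z, ∀ l < Z, k i l = k' i l) :
    Partial m Z S k' R' := by
  subst hR
  exact ⟨h.le, fun i hi l hl => by rw [← hk i hi l hl, h.eq i hi l hl]⟩

section

variable {c n n₂ n₃ d V W : ℕ} {σ : State} {m : ℕ → ℕ} {p q i S : ℕ}

theorem fits_block (hm : ∀ x, m x ≤ S) (hn₂ : 1 ≤ n₂) {j : ℕ} (hj : j < n₃) :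
    Fits n₂ n₃ S (blockLeft m n₂ n₃ d p i) (blockRight m n₂ n₃ d p q) (j + 1) where
  left_le _ := hm _
  right_le y x := by unfold blockRight; split_ifs <;> simp [hm]
  right_zero y := by simp [blockRight]
  one_le_rows := hn₂
  one_le := by omega
  le := hj

/-- Row y of block `p` stands for the summation index `p * n₂ + y - 1`, and column `j + 1` of block
`q` for the matrix column `q * n₃ + j`. So the block continues the minimum exactly where the
previous one stopped; the default `2 * S` of the block is harmless because the running value starts
with it. -/
theorem part_add (k j : ℕ) :
    part m (n₂ * n₃ * d) S (p * n₂ + k) i (q * n₃ + j) =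
      min (part m (n₂ * n₃ * d) S (p * n₂) i (q * n₃ + j)) (rowMin S
        (blockLeft m n₂ n₃ d p i) (blockRight m n₂ n₃ d p q) (j + 1) k) := by
  induction k with
  | zero => exact (min_eq_left part_le).symm
  | succ k ih =>
    rw [← add_assoc, part, ih, rowMin, min_assoc]
    congr 2

/-- In row-major order the part of a matrix row inside block column `q` is an interval, and by `hq`
it does not run over into the next row. -/
theorem mem_row_iff {Z i i' l n₃ q : ℕ} (hl : l < Z) (hq : (q + 1) * n₃ ≤ Z) (h3 : 0 < n₃) :
    (i * Z + q * n₃ ≤ i' * Z + l ∧ i' * Z + l < i * Z + q * n₃ + n₃) ↔ i' = i ∧ l / n₃ = q := by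
  rw [Nat.div_eq_iff h3]
  rw [add_mul, one_mul] at hq
  rcases lt_trichotomy i' i with h | h | h
  · have : (i' + 1) * Z ≤ i * Z := Nat.mul_le_mul_right _ h
    rw [add_mul, one_mul] at this
    omega
  · subst h; omega
  · have : (i + 1) * Z ≤ i' * Z := Nat.mul_le_mul_right _ h
    rw [add_mul, one_mul] at this
    omega

theorem Partial.row {k : ℕ → ℕ → ℕ} {R R' : ℕ → ℕ} (h : Partial m (n₂ * n₃ * d) S k R)
    (hk : ∀ l, l / n₃ = q → k i l = p * n₂) (hq : (q + 1) * n₃ ≤ n₂ * n₃ * d) (h3 : 0 < n₃)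
    (hR : ∀ x, R' x = if i * (n₂ * n₃ * d) + q * n₃ ≤ x ∧ x < i * (n₂ * n₃ * d) + q * n₃ + n₃ then
      min (R x) (rowMin S (blockLeft m n₂ n₃ d p i) (blockRight m n₂ n₃ d p q)
        (x - (i * (n₂ * n₃ * d) + q * n₃) + 1) n₂) else R x) :
    Partial m (n₂ * n₃ * d) S (fun i' l => if i' = i ∧ l / n₃ = q then (p + 1) * n₂ else k i' l)
      R' := by
  refine ⟨fun x => ?_, fun i' hi' l hl => ?_⟩
  · rw [hR]; split_ifs
    · exact (min_le_left _ _).trans (h.le x)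
    · exact h.le x
  · rw [hR]
    by_cases hc : i' = i ∧ l / n₃ = q
    · rw [if_pos ((mem_row_iff hl hq h3).2 hc), if_pos hc]
      obtain ⟨rfl, hlq⟩ := hc
      have hl' := (Nat.div_eq_iff h3).1 hlq
      obtain ⟨j, rfl⟩ := Nat.exists_eq_add_of_le hl'.1
      rw [h.eq _ hi' _ hl, hk _ hlq, add_mul, one_mul, part_add]
      congr 3
      omega
    · rw [if_neg (fun hh => hc ((mem_row_iff hl hq h3).1 hh)), if_neg hc, h.eq _ hi' _ hl]

/-- Query all entries of a row in the current block. -/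
def queryRow (c : ℕ) (p : PlanarProblem) : Cmd := forLoop 35 e₃ (queryEntry c p)

theorem Does.queryRow (hB : Bounds c n n₂ n₃ d V W) (h : Env n n₂ n₃ d σ) (pr : PlanarProblem)
    {a : ℕ → ℕ} {b : ℕ → ℕ → ℕ} (hf : ∀ j < n₃, Fits n₂ n₃ (cap c n) a b (j + 1))
    (hR : ∀ x, σ 21 x ≤ 2 * cap c n) :
    Does (fun cur => (grid n₂ n₃).value cur pr) V W (queryRow c pr) σ
      (full _ (weight n₂ n₃ (cap c n) a b 0 0)) (n₃ * 8 + 2) n₃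
      fun σ' cur' => cur' = full _ (weight n₂ n₃ (cap c n) a b 0 0) ∧
        (∀ b', b' ≠ 35 → b' ≠ 36 → b' ≠ 21 → σ' b' = σ b') ∧
        ∀ x, σ' 21 x = if σ 34 0 * (n₂ * n₃ * d) + σ 32 0 * n₃ ≤ x ∧
            x < σ 34 0 * (n₂ * n₃ * d) + σ 32 0 * n₃ + n₃ then
          min (σ 21 x) (rowMin (cap c n) a b
            (x - (σ 34 0 * (n₂ * n₃ * d) + σ 32 0 * n₃) + 1) n₂) else σ 21 x := by
  refine (Does.forLoop (n := n₃) (T := 6) (Q := 1) (fun j σ' cur' => σ' 35 0 = j ∧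
    cur' = full _ (weight n₂ n₃ (cap c n) a b 0 0) ∧
    (∀ b', b' ≠ 35 → b' ≠ 36 → b' ≠ 21 → σ' b' = σ b') ∧
        ∀ x, σ' 21 x = if σ 34 0 * (n₂ * n₃ * d) + σ 32 0 * n₃ ≤ x ∧
            x < σ 34 0 * (n₂ * n₃ * d) + σ 32 0 * n₃ + j then
          min (σ 21 x) (rowMin (cap c n) a b
            (x - (σ 34 0 * (n₂ * n₃ * d) + σ 32 0 * n₃) + 1) n₂) else σ 21 x) hB.cols_le
    ⟨by simp, rfl, fun b' h1 _ _ => State.write_of_ne _ _ _ h1, fun x => ?_⟩ ?_ ?_).mono le_rfl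
    (by omega) fun σ' cur' _ hh => hh.2
  · rw [if_neg (by omega), State.write_of_ne _ _ _ (by omega)]
  · rintro j hj σ' cur' ⟨h1, -, h2, -⟩
    exact ⟨h1, (h.congr fun b hb => h2 b (by omega) (by omega) (by omega)).val_e₃⟩
  · rintro j hj σ' cur' ⟨h1, rfl, h2, h3⟩
    have hE := h.congr fun b hb => h2 b (by omega) (by omega) (by omega)
    have hR' : ∀ x, σ' 21 x ≤ 2 * cap c n := fun x => by
      rw [h3]; split_ifs
      · exact (min_le_left _ _).trans (hR x)
      · exact hR x
    refine (Does.queryEntry hB hE pr (by rw [h1]; exact hf j hj) hR').mono le_rfl le_rfl ?_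
    rintro σ'' cur'' - ⟨k1, k2, k3⟩
    refine ⟨by rw [k2 _ (by omega) (by omega), h1], by simp, k1, fun b' g1 g2 g3 => ?_, fun x => ?_⟩
    · rw [State.write_of_ne _ _ _ g1, k2 b' g2 g3, h2 b' g1 g2 g3]
    · rw [State.write_of_ne _ _ _ (by omega), k3, h3, h1, h2 34 (by omega) (by omega) (by omega),
        h2 32 (by omega) (by omega) (by omega), ← add_assoc]
      by_cases hx : x = σ 34 0 * (n₂ * n₃ * d) + σ 32 0 * n₃ + j
      · rw [if_pos hx, if_neg (by omega), if_pos (by omega), hx, Nat.add_sub_cancel_left]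
      · rw [if_neg hx]
        split_ifs <;> first | rfl | omega

/-- Process one row of the left factor. -/
def rowStep (c : ℕ) (p : PlanarProblem) : Cmd := .seq (setRow c) (queryRow c p)

theorem Does.rowStep (hB : Bounds c n n₂ n₃ d V W) (h : Env n n₂ n₃ d σ) (pr : PlanarProblem)
    (a₀ : ℕ → ℕ) (hm : ∀ a, σ 20 a ≤ cap c n) (hq : (σ 32 0 + 1) * n₃ ≤ n₂ * n₃ * d)
    {k : ℕ → ℕ → ℕ} (hR : Partial (σ 20) (n₂ * n₃ * d) (cap c n) k (σ 21))
    (hk : ∀ l, l / n₃ = σ 32 0 → k (σ 34 0) l = σ 31 0 * n₂) :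
    Does (fun cur => (grid n₂ n₃).value cur pr) V W (rowStep c pr) σ
      (full _ (weight n₂ n₃ (cap c n) a₀ (blockRight (σ 20) n₂ n₃ d (σ 31 0) (σ 32 0)) 0 0))
      (n₂ * 3 + n₃ * 8 + 4) n₃
      fun σ' cur' => (∃ a, cur' = full _ (weight n₂ n₃ (cap c n) a
          (blockRight (σ 20) n₂ n₃ d (σ 31 0) (σ 32 0)) 0 0)) ∧
        (∀ b', b' ≠ 33 → b' ≠ 35 → b' ≠ 36 → b' ≠ 21 → σ' b' = σ b') ∧
        Partial (σ 20) (n₂ * n₃ * d) (cap c n)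
          (fun i l => if i = σ 34 0 ∧ l / n₃ = σ 32 0 then (σ 31 0 + 1) * n₂ else k i l)
          (σ' 21) := by
  refine ((Does.setRow hB h a₀ hm (blockRight (σ 20) n₂ n₃ d (σ 31 0) (σ 32 0))).andThen
    (T₂ := n₃ * 8 + 2) (Q₂ := n₃) ?_).mono (by omega) (by omega) fun _ _ _ h => h
  rintro σ₁ cur₁ - ⟨rfl, h1⟩
  have h' := h.congr fun b hb => h1 b (by omega)
  refine (Does.queryRow hB h' pr (fun j hj => fits_block hm hB.rows hj)
    (by rw [h1 _ (by omega)]; exact hR.le)).mono le_rfl le_rfl ?_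
  rintro σ₂ cur₂ - ⟨k1, k2, k3⟩
  refine ⟨⟨_, k1⟩, fun b' g1 g2 g3 g4 => by rw [k2 b' g2 g3 g4, h1 b' g1], ?_⟩
  simp only [h1 34 (by omega), h1 32 (by omega), h1 21 (by omega)] at k3
  exact hR.row hk hq hB.cols k3

/-- Process one block of the product. -/
def block (c : ℕ) (p : PlanarProblem) : Cmd :=
  .seq (setLoop 33 eSize (.var 33) (eWeight c (.var 33))) (forLoop 34 eZ (rowStep c p))

/-- The cost of a block. -/
def blockCost (n₂ n₃ d : ℕ) : ℕ :=
  Gadget.size n₂ n₃ * 3 + n₂ * n₃ * d * (n₂ * 3 + n₃ * 8 + 6) + 4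

/-- The right block is written once and used for all `n₂ * n₃ * d` rows of the left factor. This
amortises the rewriting of all edges, which would be too expensive for every row. -/
theorem Does.block (hB : Bounds c n n₂ n₃ d V W) (h : Env n n₂ n₃ d σ) (pr : PlanarProblem)
    (wt : ℕ → ℕ) (hm : ∀ a, σ 20 a ≤ cap c n) (hq : (σ 32 0 + 1) * n₃ ≤ n₂ * n₃ * d)
    (hR : Partial (σ 20) (n₂ * n₃ * d) (cap c n)
      (fun _ l => if l / n₃ < σ 32 0 then (σ 31 0 + 1) * n₂ else σ 31 0 * n₂) (σ 21)) :
    Does (fun cur => (grid n₂ n₃).value cur pr) V W (block c pr) σ (full _ wt)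
      (blockCost n₂ n₃ d) (n₂ * n₃ * d * n₃)
      fun σ' cur' => (∃ wt', cur' = full _ wt') ∧
        (∀ b', b' ≠ 33 → b' ≠ 34 → b' ≠ 35 → b' ≠ 36 → b' ≠ 21 → σ' b' = σ b') ∧
        Partial (σ 20) (n₂ * n₃ * d) (cap c n)
          (fun _ l => if l / n₃ < σ 32 0 + 1 then (σ 31 0 + 1) * n₂ else σ 31 0 * n₂)
          (σ' 21) := by
  set B := blockRight (σ 20) n₂ n₃ d (σ 31 0) (σ 32 0) with hBdef
  have e0 : full (Gadget.size n₂ n₃) wt = full _ (fun e => if e < 0 then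
      weight n₂ n₃ (cap c n) (fun _ => 0) B 0 0 e else wt e) := full_congr fun e _ => by simp
  rw [e0]
  refine ((Does.setLoop (fun k e => if e < k then weight n₂ n₃ (cap c n) (fun _ => 0) B 0 0 e
    else wt e) hB.size_le ?_ ?_).andThen (T₂ := n₂ * n₃ * d * (n₂ * 3 + n₃ * 8 + 6) + 2)
    (Q₂ := n₂ * n₃ * d * n₃) ?_).mono (by unfold blockCost; omega) (by omega) fun _ _ _ h => h
  · intro σ' hσ'
    exact (h.congr fun b hb => hσ' b (by omega)).val_eSize
  · intro e he σ' hσ' hv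
    have h' := h.congr fun b hb => hσ' b (by omega)
    have e1 : (eWeight c (.var 33)).val σ' =
        weight n₂ n₃ (cap c n) (fun _ => 0) B 0 0 e := by
      rw [h'.val_eWeight, hσ' 20 (by omega), hσ' 31 (by omega), hσ' 32 (by omega)]
      simp [hv, hBdef]
    rw [e1, Expr.val_var, hv]
    refine ⟨he, (weight_le (fun _ => Nat.zero_le _) (fun y x => ?_) hB.cols he).trans hB.weight_le,
      fun k hk => ?_⟩
    · rw [hBdef]; unfold blockRight; split_ifs <;> simp [hm]
    · rcases lt_trichotomy k e with h1 | rfl | h1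
      · rw [if_pos (by omega), if_neg (by omega), if_pos h1]
      · rw [if_pos (by omega), if_pos rfl]
      · rw [if_neg (by omega), if_neg (by omega), if_neg (by omega)]
  rintro σ₁ cur₁ - ⟨rfl, h1⟩
  rw [full_congr (g := weight n₂ n₃ (cap c n) (fun _ => 0) B 0 0) fun e he => if_pos he]
  -- Inside block column `q`, the rows before `i` have received the contribution of block `p`, the
  -- others not yet.
  refine (Does.forLoop (n := n₂ * n₃ * d) (T := n₂ * 3 + n₃ * 8 + 4) (Q := n₃) (fun i σ' cur' =>
    σ' 34 0 = i ∧ (∃ a, cur' = full _ (weight n₂ n₃ (cap c n) a B 0 0)) ∧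
    (∀ b', b' ≠ 33 → b' ≠ 34 → b' ≠ 35 → b' ≠ 36 → b' ≠ 21 → σ' b' = σ b') ∧
    Partial (σ 20) (n₂ * n₃ * d) (cap c n)
          (fun i' l => if l / n₃ < σ 32 0 ∨ (l / n₃ = σ 32 0 ∧ i' < i) then (σ 31 0 + 1) * n₂
            else σ 31 0 * n₂) (σ' 21)) hB.dim_le
    ⟨by simp, ⟨_, rfl⟩, fun b' g1 g2 g3 g4 g5 => ?_, hR.congr ?_ ?_⟩ ?_ ?_).mono le_rfl
    le_rfl ?_
  · rw [State.write_of_ne _ _ _ g2, h1 b' g1]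
  · rw [State.write_of_ne _ _ _ (by omega), h1 _ (by omega)]
  · intro i _ l _; simp
  · rintro i hi σ' cur' ⟨k1, -, k2, -⟩
    exact ⟨k1, (h.congr fun b hb => k2 b (by omega) (by omega) (by omega) (by omega)
      (by omega)).val_eZ⟩
  · rintro i hi σ' cur' ⟨k1, ⟨a, rfl⟩, k2, k3⟩
    have h' := h.congr fun b hb => k2 b (by omega) (by omega) (by omega) (by omega) (by omega)
    have f20 := k2 20 (by omega) (by omega) (by omega) (by omega) (by omega)
    have f31 := k2 31 (by omega) (by omega) (by omega) (by omega) (by omega)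
    have f32 := k2 32 (by omega) (by omega) (by omega) (by omega) (by omega)
    have := Does.rowStep (k := fun i' l => if l / n₃ < σ 32 0 ∨ (l / n₃ = σ 32 0 ∧ i' < i) then
      (σ 31 0 + 1) * n₂ else σ 31 0 * n₂) hB h' pr a (by rw [f20]; exact hm)
      (by rw [f32]; exact hq) (by rw [f20]; exact k3) (fun l hl => by
        rw [f32] at hl
        rw [if_neg (by omega), f31])
    rw [f20, f31, f32, ← hBdef] at this
    refine this.mono le_rfl le_rfl ?_
    rintro σ'' cur'' - ⟨g1, g2, g3⟩
    refine ⟨by rw [g2 _ (by omega) (by omega) (by omega) (by omega), k1], by simp, g1,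
      fun b' l1 l2 l3 l4 l5 => ?_, g3.congr ?_ ?_⟩
    · rw [State.write_of_ne _ _ _ l2, g2 b' l1 l3 l4 l5, k2 b' l1 l2 l3 l4 l5]
    · rw [State.write_of_ne _ _ _ (by omega)]
    · intro i' _ l _
      rw [k1]
      split_ifs <;> first | rfl | omega
  · rintro σ' cur' - ⟨-, ⟨a, ha⟩, k2, k3⟩
    refine ⟨⟨_, ha⟩, k2, k3.congr rfl ?_⟩
    intro i hi l _
    split_ifs <;> first | rfl | omega

/-- The min-plus product of the matrix with itself. -/
def product (c : ℕ) (p : PlanarProblem) : Cmd :=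
  .seq (fill 21 33 (eZ * eZ) (2 * eCap c))
  (.seq (forLoop 31 (e₃ * eD) (forLoop 32 (e₂ * eD) (block c p)))
  (fill 20 33 (eZ * eZ) (.ifLt (.read 21 (.var 33)) (eCap c)
    (.read 21 (.var 33) - eShift c) (eCap c))))

/-- The entries of the product. -/
def squareEntry (S O Z : ℕ) (m : ℕ → ℕ) (x : ℕ) : ℕ :=
  if part m Z S Z (x / Z) (x % Z) < S then part m Z S Z (x / Z) (x % Z) - O else S

/-- The matrix after squaring. -/
def square (S O Z : ℕ) (m : ℕ → ℕ) (x : ℕ) : ℕ := if x < Z * Z then squareEntry S O Z m x else m x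

/-- The cost of a product. -/
def productCost (n₂ n₃ d : ℕ) : ℕ :=
  (n₃ * d) * ((n₂ * d) * (blockCost n₂ n₃ d + 2) + 4) +
    (n₂ * n₃ * d) * (n₂ * n₃ * d) * 6 + 6

theorem square_le {S O Z : ℕ} (hm : ∀ x, m x ≤ S) (x : ℕ) : square S O Z m x ≤ S := by
  unfold square squareEntry
  split_ifs
  · omega
  · exact le_rfl
  · exact hm x

/-- With Z = `n₂ * n₃ * d` there are Z / `n₂` = `n₃ * d` blocks of summation indices and Z / `n₃` =
`n₂ * d` blocks of columns. The matrix is overwritten only after all minima have been collected,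
because its old entries serve as both factors. -/
theorem Does.product (hB : Bounds c n n₂ n₃ d V W) (h : Env n n₂ n₃ d σ) (pr : PlanarProblem)
    (wt : ℕ → ℕ) (hm : ∀ a, σ 20 a ≤ cap c n) (hR : ∀ a, σ 21 a ≤ 2 * cap c n) :
    Does (fun cur => (grid n₂ n₃).value cur pr) V W (product c pr) σ (full _ wt)
      (productCost n₂ n₃ d) ((n₃ * d) * ((n₂ * d) * (n₂ * n₃ * d * n₃)))
      fun σ' cur' => (∃ wt', cur' = full _ wt') ∧
        (∀ b', b' ≠ 20 → b' ≠ 21 → (b' ≤ 30 ∨ 37 ≤ b') → σ' b' = σ b') ∧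
        (∀ x, σ' 21 x ≤ 2 * cap c n) ∧
        ∀ x, σ' 20 x = square (cap c n) (shift c n) (n₂ * n₃ * d) (σ 20) x := by
  set Z := n₂ * n₃ * d with hZ
  have hcap := hB.cap_le
  have hfill := Does.fill (val := fun cur => (grid n₂ n₃).value cur pr) (V := V) (W := W)
    (cur := full _ wt) (σ := σ) (b := 21) (v := 33)
    (n := Z * Z) (eN := eZ * eZ) (e := 2 * eCap c)
    (fun _ => 2 * cap c n) (by omega) hB.square_le (fun _ _ => hcap)
    (fun σ' hσ' => by
      simp [(h.congr fun b hb => hσ' b (by omega) (by omega)).val_eZ, hZ])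
    (fun i hi σ' hσ' _ _ => by
      simp [(h.congr fun b hb => hσ' b (by omega) (by omega)).val_eCap])
  refine (hfill.andThen (T₂ := (n₃ * d) * ((n₂ * d) * (blockCost n₂ n₃ d + 2) + 4) + 2 +
      (Z * Z * 3 + 2))
    (Q₂ := (n₃ * d) * ((n₂ * d) * (Z * n₃)) + 0) ?_).mono
    (by unfold productCost; rw [← hZ]; omega) (by omega) fun _ _ _ h => h
  rintro σ₁ cur₁ - ⟨rfl, h1, h2⟩
  refine Does.andThen (Mid := fun σ' cur' => (∃ wt', cur' = full _ wt') ∧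
    (∀ b', b' ≠ 21 → (b' ≤ 30 ∨ 37 ≤ b') → σ' b' = σ b') ∧
    Partial (σ 20) Z (cap c n) (fun _ _ => Z) (σ' 21)) ?_ ?_
  -- After `p` rounds every entry accounts for the summation indices below `p * n₂`.
  · refine (Does.forLoop (n := n₃ * d) (T := (n₂ * d) * (blockCost n₂ n₃ d + 2) + 2)
      (Q := (n₂ * d) * (Z * n₃)) (fun p σ' cur' => σ' 31 0 = p ∧ (∃ wt', cur' = full _ wt') ∧
      (∀ b', b' ≠ 21 → (b' ≤ 30 ∨ 37 ≤ b') → σ' b' = σ b') ∧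
      Partial (σ 20) Z (cap c n) (fun _ _ => p * n₂) (σ' 21)) hB.rowBlocks_le
      ⟨by simp, ⟨_, rfl⟩, fun b' g1 g2 => ?_, ⟨fun x => ?_, fun i hi l hl => ?_⟩⟩ ?_ ?_).mono
      le_rfl (by omega) ?_
    · rw [State.write_of_ne _ _ _ (by omega), h1 b' (by omega) (by omega)]
    · rw [State.write_of_ne _ _ _ (by omega), h2]
      split_ifs
      · exact le_rfl
      · exact hR x
    · rw [State.write_of_ne _ _ _ (by omega), h2, if_pos, zero_mul, part]
      have : (i + 1) * Z ≤ Z * Z := Nat.mul_le_mul_right _ hi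
      rw [add_mul, one_mul] at this
      omega
    · rintro p hp σ' cur' ⟨k1, -, k2, -⟩
      have h' := h.congr fun b hb => k2 b (by omega) (by omega)
      exact ⟨k1, by simp [h'.val_e₃, h'.val_eD]⟩
    · rintro p hp σ' cur' ⟨k1, ⟨wt₁, rfl⟩, k2, k3⟩
      refine (Does.forLoop (n := n₂ * d) (T := blockCost n₂ n₃ d)
        (Q := Z * n₃) (fun q σ' cur' => σ' 32 0 = q ∧ σ' 31 0 = p ∧ (∃ wt', cur' = full _ wt') ∧
        (∀ b', b' ≠ 21 → (b' ≤ 30 ∨ 37 ≤ b') → σ' b' = σ b') ∧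
        Partial (σ 20) Z (cap c n)
          (fun _ l => if l / n₃ < q then (p + 1) * n₂ else p * n₂) (σ' 21))
        hB.colBlocks_le ⟨by simp, by rw [State.write_of_ne _ _ _ (by omega), k1], ⟨_, rfl⟩,
          fun b' g1 g2 => ?_, k3.congr ?_ ?_⟩ ?_ ?_).mono le_rfl le_rfl ?_
      · rw [State.write_of_ne _ _ _ (by omega), k2 b' g1 g2]
      · rw [State.write_of_ne _ _ _ (by omega)]
      · intro i _ l _; simp
      · rintro q hq σ' cur' ⟨k1, -, -, k2, -⟩
        have h' := h.congr fun b hb => k2 b (by omega) (by omega)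
        exact ⟨k1, by simp [h'.val_e₂, h'.val_eD]⟩
      · rintro q hq σ₂ cur₂ ⟨g1, g2, ⟨wt₂, rfl⟩, g3, g4⟩
        have h' := h.congr fun b hb => g3 b (by omega) (by omega)
        have f20 := g3 20 (by omega) (by omega)
        have := Does.block hB h' pr wt₂ (by rw [f20]; exact hm) (by
            rw [g1]
            calc (q + 1) * n₃ ≤ (n₂ * d) * n₃ := Nat.mul_le_mul_right _ hq
              _ = n₂ * n₃ * d := by ring) (by rw [f20, g1, g2]; exact g4)
        rw [f20, g1, g2] at this
        refine this.mono le_rfl le_rfl ?_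
        rintro σ₃ cur₃ - ⟨l1, l2, l3⟩
        refine ⟨by rw [l2 _ (by omega) (by omega) (by omega) (by omega) (by omega), g1], by simp,
          ?_, l1, fun b' m1 m2 => ?_, l3.congr ?_ (fun _ _ _ _ => rfl)⟩
        · rw [State.write_of_ne _ _ _ (by omega),
            l2 _ (by omega) (by omega) (by omega) (by omega) (by omega), g2]
        · rw [State.write_of_ne _ _ _ (by omega),
            l2 _ (by omega) (by omega) (by omega) (by omega) (by omega), g3 b' m1 m2]
        · rw [State.write_of_ne _ _ _ (by omega)]
      · rintro σ₂ cur₂ - ⟨g1, g2, g3, g4, g5⟩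
        refine ⟨g2, by simp, g3, fun b' m1 m2 => ?_, g5.congr ?_ ?_⟩
        · rw [State.write_of_ne _ _ _ (by omega), g4 b' m1 m2]
        · rw [State.write_of_ne _ _ _ (by omega)]
        · intro i _ l hl
          -- When the inner loop ends, `q` is Z / `n₃`, so every column lies in a finished block.
          rw [if_pos (Nat.div_lt_of_lt_mul (by rw [hZ] at hl; convert hl using 1; ring))]
    · rintro σ₂ cur₂ - ⟨-, g3, g4, g5⟩
      exact ⟨g3, g4, g5.congr rfl fun _ _ _ _ => by rw [hZ]; ring⟩
  · rintro σ₂ cur₂ - ⟨⟨wt₂, rfl⟩, g4, g5⟩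
    refine (Does.fill (n := Z * Z) (fun x => squareEntry (cap c n) (shift c n) Z (σ 20) x)
      (by omega) hB.square_le (fun x hx => ?_) (fun σ' hσ' => ?_) (fun x hx σ' hσ' hv _ => ?_)).mono
      le_rfl le_rfl ?_
    · unfold squareEntry; split_ifs <;> omega
    · simp [(h.congr fun b hb => (hσ' b (by omega) (by omega)).trans
        (g4 b (by omega) (by omega))).val_eZ, hZ]
    · have h' := h.congr fun b hb => (hσ' b (by omega) (by omega)).trans
        (g4 b (by omega) (by omega))
      have hZ0 : 0 < Z := by
        rcases Nat.eq_zero_or_pos Z with h0 | h0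
        · rw [h0] at hx; omega
        · exact h0
      have e1 := g5.eq (x / Z) (Nat.div_lt_of_lt_mul hx) (x % Z) (Nat.mod_lt _ hZ0)
      rw [Nat.div_add_mod'] at e1
      simp only [Expr.val_ifLt, Expr.val_read, Expr.val_var, hv, h'.val_eCap, h'.val_eShift,
        Expr.val_sub, hσ' 21 (by omega) (by omega), e1, squareEntry]
    · rintro σ₃ cur₃ - ⟨rfl, l1, l2⟩
      refine ⟨⟨_, rfl⟩, fun b' m1 m2 m3 => ?_, fun x => ?_, fun x => ?_⟩
      · rw [l1 b' (by omega) m1, g4 b' m2 m3]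
      · rw [l1 _ (by omega) (by omega)]; exact g5.le x
      · rw [l2, square, g4 20 (by omega) (by omega)]

end

end Driver

/-! ### Encoding of the input, repeated squaring, decoding of the output -/

namespace Driver

open WordRAM WordRAM.Cmd Gadget

/-- The entries of the padded matrix of weights. -/
def initEntry (S O n Z : ℕ) (sg ab : ℕ → ℕ) (x : ℕ) : ℕ :=
  if x / Z < n then
    if x % Z < n then
      if x / Z = x % Z then O
      else if sg (x / Z * n + x % Z) = 0 then S
      else if sg (x / Z * n + x % Z) = 1 then O + ab (x / Z * n + x % Z)
      else O - ab (x / Z * n + x % Z)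
    else S
  else S

/-- The value `initEntry` at the variable `33`. -/
def eInit (c : ℕ) : Expr :=
  .ifLt (.var 33 / eZ) eN
    (.ifLt (.var 33 % eZ) eN
      (.ifEq (.var 33 / eZ) (.var 33 % eZ) (eShift c)
        (.ifEq (.read 1 (.var 33 / eZ * eN + .var 33 % eZ)) 0 (eCap c)
          (.ifEq (.read 1 (.var 33 / eZ * eN + .var 33 % eZ)) 1
            (eShift c + .read 2 (.var 33 / eZ * eN + .var 33 % eZ))
            (eShift c - .read 2 (.var 33 / eZ * eN + .var 33 % eZ)))))
      (eCap c))
    (eCap c)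

/-- The padded matrix of weights. -/
def initMatrix (S O n Z : ℕ) (sg ab : ℕ → ℕ) (x : ℕ) : ℕ :=
  if x < Z * Z then initEntry S O n Z sg ab x else 0

/-- Decode the sign. -/
def signOf (S O e : ℕ) : ℕ := if e < S then if e < O then 2 else 1 else 0
/-- Decode the absolute value. -/
def absOf (S O e : ℕ) : ℕ := if e < S then if e < O then O - e else e - O else 0

/-- The entry of the padded matrix at the position given by the variable `33`. -/
def eEntry : Expr := .read 20 (.var 33 / eN * eZ + .var 33 % eN)
/-- The decoded sign of `eEntry`. -/
def eSign (c : ℕ) : Expr := .ifLt eEntry (eCap c) (.ifLt eEntry (eShift c) 2 1) 0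
/-- The decoded absolute value of `eEntry`. -/
def eAbs (c : ℕ) : Expr :=
  .ifLt eEntry (eCap c) (.ifLt eEntry (eShift c) (eShift c - eEntry) (eEntry - eShift c)) 0

/-- Compute all distances by repeated squaring. -/
def main (c : ℕ) (p : PlanarProblem) : Cmd :=
  .seq (insertAll 33 eSize)
  (.seq (fill 20 33 (eZ * eZ) (eInit c))
  (.seq (forLoop 30 (.var 13) (product c p))
  (.seq (fill 3 33 (eN * eN) (eSign c)) (fill 4 33 (eN * eN) (eAbs c)))))

/-- The cost of all computations except for queries. -/
def mainCost (n n₂ n₃ d L : ℕ) : ℕ :=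
  Gadget.size n₂ n₃ * 3 + (n₂ * n₃ * d) * (n₂ * n₃ * d) * 3 + L * (productCost n₂ n₃ d + 2) +
    n * n * 6 + 10

/-- The number of queries. -/
def mainQueries (n₂ n₃ d L : ℕ) : ℕ := L * ((n₃ * d) * ((n₂ * d) * (n₂ * n₃ * d * n₃)))

theorem initMatrix_le {S O n Z : ℕ} {sg ab : ℕ → ℕ} (hO : 2 * O ≤ S) (hab : ∀ x, ab x ≤ O) (x : ℕ) :
    initMatrix S O n Z sg ab x ≤ S := by
  unfold initMatrix initEntry
  have := hab (x / Z * n + x % Z)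
  split_ifs <;> omega

theorem iterate_square_le {S O Z : ℕ} {m : ℕ → ℕ} (hm : ∀ x, m x ≤ S) (l : ℕ) :
    ∀ x, (square S O Z)^[l] m x ≤ S := by
  induction l with
  | zero => exact hm
  | succ l ih => rw [Function.iterate_succ_apply']; exact square_le ih

/-- Bank 20 holds the current matrix. The weights left in the grid by one squaring do not matter for
the next, since each block rewrites all edges; only that all edges are present is kept in the
invariant. -/
theorem Does.main {c n n₂ n₃ d V W L : ℕ} {σ : State} (hB : Bounds c n n₂ n₃ d V W)
    (h : Env n n₂ n₃ d σ) (pr : PlanarProblem) (hL : σ 13 0 = L) (hLV : L ≤ V)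
    (hab : ∀ x, σ 2 x ≤ shift c n) (h20 : ∀ x, σ 20 x = 0) (h21 : ∀ x, σ 21 x = 0) :
    Does (fun cur => (grid n₂ n₃).value cur pr) V W (main c pr) σ (fun _ => ⊤)
      (mainCost n n₂ n₃ d L) (mainQueries n₂ n₃ d L)
      fun σ' _ => ∀ x < n * n,
        σ' 3 x = signOf (cap c n) (shift c n) ((square (cap c n) (shift c n) (n₂ * n₃ * d))^[L]
          (initMatrix (cap c n) (shift c n) n (n₂ * n₃ * d) (σ 1) (σ 2))
            (x / n * (n₂ * n₃ * d) + x % n)) ∧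
        σ' 4 x = absOf (cap c n) (shift c n) ((square (cap c n) (shift c n) (n₂ * n₃ * d))^[L]
          (initMatrix (cap c n) (shift c n) n (n₂ * n₃ * d) (σ 1) (σ 2))
            (x / n * (n₂ * n₃ * d) + x % n)) := by
  set Z := n₂ * n₃ * d with hZ
  have hcap := hB.cap_le
  have hO : 2 * shift c n ≤ cap c n := by unfold cap; omega
  have hm₀ := initMatrix_le (n := n) (Z := Z) (sg := σ 1) hO hab
  set m₀ := initMatrix (cap c n) (shift c n) n Z (σ 1) (σ 2) with hm₀def
  refine ((Does.insertAll hB.size_le fun σ' hσ' =>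
    (h.congr fun b hb => hσ' b (by omega)).val_eSize).andThen
    (T₂ := (Z * Z * 3 + 2) + ((L * (productCost n₂ n₃ d + 2) + 2) +
      ((n * n * 3 + 2) + (n * n * 3 + 2)))) (Q₂ := 0 + (mainQueries n₂ n₃ d L + (0 + 0))) ?_).mono
    (by unfold mainCost; rw [← hZ]; omega) (by omega) fun _ _ _ h => h
  rintro σ₁ cur₁ - ⟨rfl, h1⟩
  refine (Does.fill (n := Z * Z) (initEntry (cap c n) (shift c n) n Z (σ 1) (σ 2)) (by omega)
    hB.square_le (fun x hx => ?_) (fun σ' hσ' => ?_) (fun x hx σ' hσ' hv _ => ?_)).andThen ?_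
  · have := hm₀ x
    rw [hm₀def, initMatrix, if_pos hx] at this
    omega
  · have h' := h.congr fun b hb => (hσ' b (by omega) (by omega)).trans (h1 b (by omega))
    simp [h'.val_eZ, hZ]
  · have h' := h.congr fun b hb => (hσ' b (by omega) (by omega)).trans (h1 b (by omega))
    simp only [eInit, initEntry, Expr.val_ifLt, Expr.val_ifEq, Expr.val_div, Expr.val_mod,
      Expr.val_add, Expr.val_sub, Expr.val_mul, Expr.val_read, Expr.val_var, Expr.val_ofNat,
      h'.val_eZ, h'.val_eN, h'.val_eCap, h'.val_eShift, hv, ← hZ,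
      (hσ' 1 (by omega) (by omega)).trans (h1 1 (by omega)),
      (hσ' 2 (by omega) (by omega)).trans (h1 2 (by omega))]
  rintro σ₂ cur₂ - ⟨rfl, h2, h3⟩
  have h20' : σ₂ 20 = m₀ := by
    funext x
    rw [h3, h1 20 (by omega), h20]; rfl
  refine Does.andThen (Mid := fun σ' _ => σ' 20 = (square (cap c n) (shift c n) Z)^[L] m₀ ∧
    ∀ b' < 20, σ' b' = σ b') ?_ ?_
  · refine (Does.forLoop (n := L) (T := productCost n₂ n₃ d)
      (Q := (n₃ * d) * ((n₂ * d) * (Z * n₃))) (fun l σ' cur' => σ' 30 0 = l ∧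
      (∃ wt, cur' = full _ wt) ∧ σ' 20 = (square (cap c n) (shift c n) Z)^[l] m₀ ∧
      (∀ x, σ' 21 x ≤ 2 * cap c n) ∧ ∀ b' < 20, σ' b' = σ b') hLV
      ⟨by simp, ⟨_, rfl⟩, ?_, fun x => ?_, fun b' hb' => ?_⟩ ?_ ?_).mono le_rfl
      (by unfold mainQueries; rw [← hZ]) fun _ _ _ hh => ⟨hh.2.2.1, hh.2.2.2.2⟩
    · rw [State.write_of_ne _ _ _ (by omega), h20']; rfl
    · rw [State.write_of_ne _ _ _ (by omega), h2 _ (by omega) (by omega), h1 _ (by omega), h21]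
      omega
    · rw [State.write_of_ne _ _ _ (by omega), h2 _ (by omega) (by omega), h1 _ (by omega)]
    · rintro l hl σ' cur' ⟨g1, -, -, -, g2⟩
      exact ⟨g1, by rw [Expr.val_var, g2 _ (by omega), hL]⟩
    · rintro l hl σ' cur' ⟨g1, ⟨wt, rfl⟩, g2, g3, g4⟩
      have h' := h.congr fun b hb => g4 b hb
      refine (Does.product hB h' pr wt (by rw [g2]; exact iterate_square_le hm₀ l) g3).mono le_rfl
        le_rfl ?_
      rintro σ₃ cur₃ - ⟨k1, k2, k3, k4⟩
      refine ⟨by rw [k2 _ (by omega) (by omega) (by omega), g1], by simp, k1, ?_, fun x => ?_,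
        fun b' hb' => ?_⟩
      · rw [State.write_of_ne _ _ _ (by omega)]
        funext x
        rw [k4, g2, Function.iterate_succ_apply']
      · rw [State.write_of_ne _ _ _ (by omega)]; exact k3 x
      · rw [State.write_of_ne _ _ _ (by omega), k2 _ (by omega) (by omega) (by omega), g4 _ hb']
  rintro σ₃ cur₃ - ⟨g1, g2⟩
  set mL := (square (cap c n) (shift c n) Z)^[L] m₀ with hmL
  have hmL_le : ∀ x, mL x ≤ cap c n := iterate_square_le hm₀ L
  have heval : ∀ σ', Env n n₂ n₃ d σ' → σ' 20 = mL →
      eEntry.val σ' = mL (σ' 33 0 / n * Z + σ' 33 0 % n) := by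
    intro σ' h' h20
    simp only [eEntry, Expr.val_read, Expr.val_add, Expr.val_mul, Expr.val_div, Expr.val_mod,
      Expr.val_var, h'.val_eN, h'.val_eZ, h20, hZ]
  have hE : ∀ σ' : State, (∀ b', b' ≠ 33 → b' ≠ 3 → b' ≠ 4 ∧ b' < 20 → σ' b' = σ b') →
      Env n n₂ n₃ d σ' := fun σ' hσ' => by
    refine ⟨?_, ?_, ?_, ?_⟩ <;> rw [hσ' _ (by omega) (by omega) (by omega)]
    exacts [h.order, h.rows, h.cols, h.blocks]
  refine (Does.fill (n := n * n)
    (fun x => signOf (cap c n) (shift c n) (mL (x / n * Z + x % n))) (by omega)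
    hB.order_le (fun x hx => ?_) (fun σ' hσ' => ?_) (fun x hx σ' hσ' hv _ => ?_)).andThen ?_
  · unfold signOf cap at *; split_ifs <;> omega
  · simp [(hE σ' fun b' k1 k2 k3 => (hσ' b' k1 k2).trans (g2 b' (by omega))).val_eN]
  · have h' := hE σ' fun b' k1 k2 k3 => (hσ' b' k1 k2).trans (g2 b' (by omega))
    simp only [eSign, signOf, Expr.val_ifLt, heval σ' h' ((hσ' 20 (by omega) (by omega)).trans g1),
      Expr.val_ofNat, h'.val_eCap, h'.val_eShift, hv]
  rintro σ₄ cur₄ - ⟨rfl, k1, k2⟩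
  refine (Does.fill (n := n * n)
    (fun x => absOf (cap c n) (shift c n) (mL (x / n * Z + x % n))) (by omega)
    hB.order_le (fun x hx => ?_) (fun σ' hσ' => ?_) (fun x hx σ' hσ' hv _ => ?_)).mono le_rfl
    le_rfl ?_
  · have := hmL_le (x / n * Z + x % n)
    unfold absOf; split_ifs <;> omega
  · simp [(hE σ' fun b' l1 l2 l3 =>
      ((hσ' b' l1 l3.1).trans (k1 b' l1 l2)).trans (g2 b' (by omega))).val_eN]
  · have h' := hE σ' fun b' l1 l2 l3 =>
      ((hσ' b' l1 l3.1).trans (k1 b' l1 l2)).trans (g2 b' (by omega))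
    simp only [eAbs, absOf, Expr.val_ifLt, heval σ' h' (((hσ' 20 (by omega) (by omega)).trans
      (k1 20 (by omega) (by omega))).trans g1), Expr.val_ofNat, Expr.val_sub, h'.val_eCap,
      h'.val_eShift, hv]
  rintro σ₅ cur₅ - ⟨-, l1, l2⟩ x hx
  exact ⟨by rw [l1 3 (by omega) (by omega), k2, if_pos hx], by rw [l2, if_pos hx]⟩

end Driver

/-! ### Parameters of the grid and its description in memory -/

namespace Driver

open WordRAM WordRAM.Cmd Gadget

/-- The integer part of the root of `n`. -/
def root (E n : ℕ) : ℕ := Nat.findGreatest (fun k => k ^ E ≤ n) n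

/-- The number of inner rows of the grid. -/
def rows (r K j : ℕ) : ℕ := 4 * r ^ (K - j) - 2
/-- Half the number of inner columns of the grid. -/
def cols (r j : ℕ) : ℕ := 2 * r ^ j - 1

/-- The number of nodes of the grid. -/
def eNodes : Expr := (e₂ + 1 + 1) * (2 * e₃ + 1 + 1)
/-- The column of the edge given by the variable `16`. -/
def eCol : Expr := .ifLt (.var 16) eNumHor (.var 16 % (2 * e₃ + 1))
  ((.var 16 - eNumHor) % (2 * e₃ + 1 + 1))
/-- The row of the edge given by the variable `16`. -/
def eRow : Expr := .ifLt (.var 16) eNumHor (.var 16 / (2 * e₃ + 1))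
  ((.var 16 - eNumHor) / (2 * e₃ + 1 + 1))
/-- The left or upper end of the edge given by the variable `16`. -/
def eFst : Expr := eRow * (2 * e₃ + 1 + 1) + eCol
/-- The right or lower end of the edge given by the variable `16`. -/
def eSnd : Expr := eFst + .ifLt (.var 16) eNumHor 1 (2 * e₃ + 1 + 1)
/-- The tail of the edge given by the variable `16`. -/
def eSrc : Expr :=
  .ifLt (.var 16) eNumHor (.ifEq eRow (e₂ + 1) eSnd eFst) (.ifEq eCol 0 eSnd eFst)
/-- The head of the edge given by the variable `16`. -/
def eTgt : Expr :=
  .ifLt (.var 16) eNumHor (.ifEq eRow (e₂ + 1) eFst eSnd) (.ifEq eCol 0 eFst eSnd)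

section

variable {n n₂ n₃ d : ℕ} {σ : State} (h : Env n n₂ n₃ d σ)
include h

theorem Env.val_eNodes : eNodes.val σ = (n₂ + 1 + 1) * (2 * n₃ + 1 + 1) := by
  simp [eNodes, h.val_e₂, h.val_e₃]
theorem Env.val_eCol : eCol.val σ = Grid.col (2 * n₃ + 1) (n₂ + 1) (σ 16 0) := by
  simp [eCol, Grid.col, h.val_e₃, h.val_eNumHor]
theorem Env.val_eRow : eRow.val σ = Grid.row (2 * n₃ + 1) (n₂ + 1) (σ 16 0) := by
  simp [eRow, Grid.row, h.val_e₃, h.val_eNumHor]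
theorem Env.val_eFst : eFst.val σ = Grid.fst (2 * n₃ + 1) (n₂ + 1) (σ 16 0) := by
  simp [eFst, Grid.fst, h.val_e₃, h.val_eRow, h.val_eCol]
theorem Env.val_eSnd : eSnd.val σ = Grid.snd (2 * n₃ + 1) (n₂ + 1) (σ 16 0) := by
  simp [eSnd, Grid.snd, h.val_e₃, h.val_eFst, h.val_eNumHor]
theorem Env.val_eSrc : eSrc.val σ = Grid.src (2 * n₃ + 1) (n₂ + 1) (σ 16 0) := by
  simp only [eSrc, Grid.src, Grid.Reversed, h.val_eRow, h.val_eCol, h.val_eFst, h.val_eSnd,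
    h.val_eNumHor, h.val_e₂, Expr.val_ifLt, Expr.val_ifEq, Expr.val_var, Expr.val_ofNat,
    Expr.val_add]
  by_cases hc : σ 16 0 < Grid.numHor (2 * n₃ + 1) (n₂ + 1) <;> simp [hc]
theorem Env.val_eTgt : eTgt.val σ = Grid.tgt (2 * n₃ + 1) (n₂ + 1) (σ 16 0) := by
  simp only [eTgt, Grid.tgt, Grid.Reversed, h.val_eRow, h.val_eCol, h.val_eFst, h.val_eSnd,
    h.val_eNumHor, h.val_e₂, Expr.val_ifLt, Expr.val_ifEq, Expr.val_var, Expr.val_ofNat,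
    Expr.val_add]
  by_cases hc : σ 16 0 < Grid.numHor (2 * n₃ + 1) (n₂ + 1) <;> simp [hc]

end

/-- Compute the root. -/
def findRoot (E : ℕ) : Cmd := forLoop 16 (.var 0)
  (.assign 14 0 (.ifLt ((Expr.var 16 + 1).pow E) (.var 0 + 1) (.var 16 + 1) (.var 14)))

/-- Compute the number of squarings. -/
def findLog : Cmd := .seq (.assign 15 0 1) (forLoop 16 (.var 0)
  (.seq (.assign 13 0 (.ifLt (.var 15) (.var 0) (.var 13 + 1) (.var 13)))
    (.assign 15 0 (.ifLt (.var 15) (.var 0) (2 * .var 15) (.var 15)))))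

/-- Compute the dimensions. -/
def findDims (K j : ℕ) : Cmd :=
  .seq (.assign 10 0 (4 * (Expr.var 14).pow (K - j) - 2))
  (.seq (.assign 11 0 (2 * (Expr.var 14).pow j - 1))
  (.assign 12 0 (.var 0 / (e₂ * e₃) + 1)))

/-- Write the description of the grid for the dynamic algorithm. -/
def writeGrid : Cmd :=
  .seq (.assign 64 0 eNodes)
  (.seq (.assign 64 1 eSize)
  (.seq (.assign 64 3 ((e₂ + 1) * (2 * e₃ + 1 + 1)))
  (.seq (fill 65 16 eNodes (.var 16 % (2 * e₃ + 1 + 1)))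
  (.seq (fill 66 16 eNodes (.var 16 / (2 * e₃ + 1 + 1)))
  (.seq (fill 67 16 eSize eSrc) (fill 68 16 eSize eTgt))))))

variable {m V W n : ℕ} {val : (Fin m → ℕ∞) → ℕ∞} {σ : State} {cur : Fin m → ℕ∞}

theorem Does.findRoot {E : ℕ} (h0 : σ 0 0 = n) (h14 : σ 14 0 = 0) (hV : n + 1 ≤ V) :
    Does val V W (findRoot E) σ cur (n * 3 + 2) 0 fun σ' _ => σ' 14 0 = root E n := by
  refine (Does.forLoop (n := n) (T := 1) (Q := 0) (fun i σ' _ => σ' 16 0 = i ∧ σ' 0 0 = n ∧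
    σ' 14 0 = Nat.findGreatest (fun k => k ^ E ≤ n) i) (by omega) ⟨by simp, ?_, ?_⟩ ?_ ?_).mono
    le_rfl (by omega) fun _ _ _ h => h.2.2
  · rw [State.write_of_ne _ _ _ (by omega), h0]
  · rw [State.write_of_ne _ _ _ (by omega), h14, Nat.findGreatest_zero]
  · rintro i hi σ' _ ⟨h1, h2, -⟩
    exact ⟨h1, h2⟩
  · rintro i hi σ' _ ⟨h1, h2, h3⟩
    have e : (Expr.ifLt ((Expr.var 16 + 1).pow E) (.var 0 + 1) (.var 16 + 1) (.var 14)).val σ' =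
        Nat.findGreatest (fun k => k ^ E ≤ n) (i + 1) := by
      simp only [Expr.val_ifLt, Expr.val_pow, Expr.val_add, Expr.val_var, Expr.val_ofNat, h1, h2,
        h3, Nat.lt_succ_iff, Nat.findGreatest_succ]
    refine .assign ?_ ⟨?_, by simp, ?_, ?_⟩
    · rw [e]; exact (Nat.findGreatest_le _).trans (by omega)
    · simp [h1]
    · simp [h2]
    · rw [e]; simp

/-- The power of two is doubled only while it is below `n`, which keeps it below `2 * n`; this bound
later limits the number of arcs of the walks considered, and with it the size of the words. -/
theorem Does.findLog (h0 : σ 0 0 = n) (h13 : σ 13 0 = 0) (hV : 2 * n + 1 ≤ V) (hn : 1 ≤ n) :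
    Does val V W findLog σ cur (n * 4 + 3) 0 fun σ' _ =>
      n ≤ 2 ^ σ' 13 0 ∧ 2 ^ σ' 13 0 < 2 * n := by
  refine (Does.seq (T₁ := 1) (Q₁ := 0) (T₂ := n * 4 + 2) (Q₂ := 0) (Does.assign (by simp; omega)
    ((Does.forLoop (n := n) (T := 2) (Q := 0) (fun i σ' _ => σ' 16 0 = i ∧ σ' 0 0 = n ∧
    σ' 15 0 = 2 ^ σ' 13 0 ∧ (n ≤ 2 ^ σ' 13 0 ∨ σ' 13 0 = i) ∧ 2 ^ σ' 13 0 < 2 * n) (by omega)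
    ⟨by simp, ?_, ?_, ?_, ?_⟩ ?_ ?_).mono (by omega) (by omega) ?_))).mono (by omega) (by omega)
    fun _ _ _ h => h
  · simp [h0]
  · simp [h13]
  · right; simp [h13]
  · simp [h13]; omega
  · rintro i hi σ' _ ⟨h1, h2, -⟩
    exact ⟨h1, h2⟩
  · rintro i hi σ' _ ⟨h1, h2, h3, h4, h5⟩
    have hlt : σ' 13 0 < 2 ^ σ' 13 0 := Nat.lt_two_pow_self
    refine Does.seq (T₁ := 1) (T₂ := 1) (Q₁ := 0) (Q₂ := 0) (Does.assign ?_ (Does.assign ?_ ?_))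
    · rw [Expr.val_ifLt]
      split_ifs
      · simp only [Expr.val_add, Expr.val_var, Expr.val_ofNat]; omega
      · rw [Expr.val_var]; omega
    · rw [Expr.val_ifLt]
      split_ifs with hc
      · simp only [Expr.val_var, Expr.val_mul, Expr.val_ofNat,
          State.write_of_ne _ _ _ (show 15 ≠ 13 by omega),
          State.write_of_ne _ _ _ (show 0 ≠ 13 by omega)] at hc ⊢
        omega
      · simp only [Expr.val_var, State.write_of_ne _ _ _ (show 15 ≠ 13 by omega)]
        omega
    · by_cases hc : 2 ^ σ' 13 0 < n
      · simp [hc, h1, h2, h3, pow_succ]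
        omega
      · simp [hc, h1, h2, h3]
        omega
  · rintro σ' _ - ⟨h1, h2, h3, h4, h5⟩
    refine ⟨?_, h5⟩
    rcases h4 with h4 | h4
    · exact h4
    -- If doubling never stopped, the exponent is `n`, and the power exceeds `n` anyway.
    · have : σ' 13 0 < 2 ^ σ' 13 0 := Nat.lt_two_pow_self
      omega

theorem Does.findDims {r K j : ℕ} (h0 : σ 0 0 = n) (h14 : σ 14 0 = r)
    (h1 : rows r K j ≤ V) (h2 : cols r j ≤ V) (h3 : n + 1 ≤ V) :
    Does val V W (findDims K j) σ cur 3 0 fun σ' _ =>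
      Env n (rows r K j) (cols r j) (n / (rows r K j * cols r j) + 1) σ' := by
  refine Does.seq (T₁ := 1) (T₂ := 2) (Q₁ := 0) (Q₂ :=
      0) (Does.assign (by simpa [h14, rows] using h1)
    (Does.seq (T₁ := 1) (T₂ := 1) (Q₁ := 0) (Q₂ := 0) (Does.assign (by simpa [h14, cols] using h2)
      (Does.assign ?_ ⟨?_, ?_, ?_, ?_⟩))))
  · simp [e₂, e₃, h0, h14]
    refine le_trans ?_ h3
    exact Nat.succ_le_succ (Nat.div_le_self _ _)
  · simp [h0]
  · simp [h14, rows]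
  · simp [h14, cols]
  · simp [h14, h0, e₂, e₃, rows, cols]

theorem Does.writeGrid {n₂ n₃ d : ℕ} (h : Env n n₂ n₃ d σ)
    (hN : (n₂ + 1 + 1) * (2 * n₃ + 1 + 1) ≤ V) (hM : Gadget.size n₂ n₃ ≤ V)
    (hσ : ∀ b, 64 ≤ b → ∀ a, σ b a = 0) :
    Does val V W writeGrid σ cur
      ((n₂ + 1 + 1) * (2 * n₃ + 1 + 1) * 6 + Gadget.size n₂ n₃ * 6 + 11) 0 fun σ' _ =>
      (∀ b, σ' (b + 64) = (grid n₂ n₃).input b) ∧ ∀ b < 16, σ' b = σ b := by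
  set N := (n₂ + 1 + 1) * (2 * n₃ + 1 + 1) with hNdef
  set M := Gadget.size n₂ n₃ with hMdef
  have ht : (n₂ + 1) * (2 * n₃ + 1 + 1) ≤ N := Nat.mul_le_mul_right _ (by omega)
  refine (Does.seq (T₁ := 1) (T₂ := N * 6 + M * 6 + 10) (Q₁ := 0) (Q₂ := 0)
    (Does.assign (by rw [h.val_eNodes]; exact hN) ?_)).mono (by omega) (by omega)
    fun _ _ _ h => h
  rw [h.val_eNodes, Expr.val_ofNat]
  set σ₁ := σ.write 64 0 ((n₂ + 1 + 1) * (2 * n₃ + 1 + 1)) with hσ₁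
  have h1 : Env n n₂ n₃ d σ₁ := h.congr fun b hb => State.write_of_ne _ _ _ (by omega)
  refine (Does.seq (T₁ := 1) (T₂ := N * 6 + M * 6 + 9) (Q₁ := 0) (Q₂ := 0)
    (Does.assign (by rw [h1.val_eSize]; exact hM) ?_)).mono (by omega) (by omega)
    fun _ _ _ h => h
  rw [h1.val_eSize, Expr.val_ofNat]
  set σ₂ := σ₁.write 64 1 (Gadget.size n₂ n₃) with hσ₂
  have h2 : Env n n₂ n₃ d σ₂ := h1.congr fun b hb => State.write_of_ne _ _ _ (by omega)
  have e3 : ((e₂ + 1) * (2 * e₃ + 1 + 1) : Expr).val σ₂ = (n₂ + 1) * (2 * n₃ + 1 + 1) := by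
    simp [h2.val_e₂, h2.val_e₃]
  refine (Does.seq (T₁ := 1) (T₂ := N * 6 + M * 6 + 8) (Q₁ := 0) (Q₂ := 0)
    (Does.assign (by rw [e3]; omega) ?_)).mono (by omega) (by omega)
    fun _ _ _ h => h
  rw [e3, Expr.val_ofNat]
  set σ₃ := σ₂.write 64 3 ((n₂ + 1) * (2 * n₃ + 1 + 1)) with hσ₃
  have hne : ∀ b, b ≠ 64 → σ₃ b = σ b := fun b hb => by
    rw [hσ₃, State.write_of_ne _ _ _ hb, hσ₂, State.write_of_ne _ _ _ hb, hσ₁,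
      State.write_of_ne _ _ _ hb]
  -- Address 2 of this bank, the node `s` with number 0, is not written: the memory is zero there.
  have h64 : σ₃ 64 = (grid n₂ n₃).input 0 := by
    funext a
    rw [hσ₃, hσ₂, hσ₁]
    simp only [State.write_apply, true_and, PlaneGraph.input, bankOf, hσ 64 le_rfl a]
    rcases lt_or_ge a 4 with ha | ha
    · rw [dif_pos ha]
      interval_cases a <;> simp [grid, Grid.graph]
    · rw [dif_neg (by omega), if_neg (by omega), if_neg (by omega), if_neg (by omega)]
  have hE : ∀ σ' : State, (∀ b < 16, σ' b = σ₃ b) → Env n n₂ n₃ d σ' := fun σ' hσ' => by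
    refine ⟨?_, ?_, ?_, ?_⟩ <;> rw [hσ' _ (by omega), hne _ (by omega)]
    exacts [h.order, h.rows, h.cols, h.blocks]
  refine ((Does.fill (n := N) (fun v => v % (2 * n₃ + 1 + 1)) (by omega) hN
    (fun v hv => (Nat.mod_le _ _).trans (by omega)) (fun σ' hσ' => ?_)
    (fun v hv σ' hσ' hv' _ => ?_)).andThen (T₂ := N * 3 + M * 6 + 6) (Q₂ := 0) ?_).mono (by omega)
    (by omega) fun _ _ _ h => h
  · exact (hE σ' fun b hb => hσ' b (by omega) (by omega)).val_eNodes
  · simp [(hE σ' fun b hb => hσ' b (by omega) (by omega)).val_e₃, hv']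
  rintro σ₄ - - ⟨-, g1, g2⟩
  refine ((Does.fill (n := N) (fun v => v / (2 * n₃ + 1 + 1)) (by omega) hN
    (fun v hv => (Nat.div_le_self _ _).trans (by omega)) (fun σ' hσ' => ?_)
    (fun v hv σ' hσ' hv' _ => ?_)).andThen (T₂ := M * 6 + 4) (Q₂ := 0) ?_).mono (by omega)
    (by omega) fun _ _ _ h => h
  · exact (hE σ' fun b hb => (hσ' b (by omega) (by omega)).trans
      (g1 b (by omega) (by omega))).val_eNodes
  · simp [(hE σ' fun b hb => (hσ' b (by omega) (by omega)).trans
      (g1 b (by omega) (by omega))).val_e₃, hv']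
  rintro σ₅ - - ⟨-, k1, k2⟩
  refine ((Does.fill (n := M) (fun e => Grid.src (2 * n₃ + 1) (n₂ + 1) e) (by omega) hM
    (fun e he => ?_) (fun σ' hσ' => ?_)
    (fun v hv σ' hσ' hv' _ => ?_)).andThen (T₂ := M * 3 + 2) (Q₂ := 0) ?_).mono (by omega)
    (by omega) fun _ _ _ h => h
  · exact le_trans ((Grid.graph (2 * n₃ + 1) (n₂ + 1)).src ⟨e, he⟩).2.le hN
  · exact (hE σ' fun b hb => ((hσ' b (by omega) (by omega)).trans
      (k1 b (by omega) (by omega))).trans (g1 b (by omega) (by omega))).val_eSize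
  · rw [(hE σ' fun b hb => ((hσ' b (by omega) (by omega)).trans
      (k1 b (by omega) (by omega))).trans (g1 b (by omega) (by omega))).val_eSrc, hv']
  rintro σ₆ - - ⟨-, l1, l2⟩
  refine (Does.fill (n := M) (fun e => Grid.tgt (2 * n₃ + 1) (n₂ + 1) e) (by omega) hM
    (fun e he => ?_) (fun σ' hσ' => ?_)
    (fun v hv σ' hσ' hv' _ => ?_)).mono le_rfl le_rfl ?_
  · exact le_trans ((Grid.graph (2 * n₃ + 1) (n₂ + 1)).tgt ⟨e, he⟩).2.le hN
  · exact (hE σ' fun b hb => (((hσ' b (by omega) (by omega)).trans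
      (l1 b (by omega) (by omega))).trans (k1 b (by omega) (by omega))).trans
      (g1 b (by omega) (by omega))).val_eSize
  · rw [(hE σ' fun b hb => (((hσ' b (by omega) (by omega)).trans
      (l1 b (by omega) (by omega))).trans (k1 b (by omega) (by omega))).trans
      (g1 b (by omega) (by omega))).val_eTgt, hv']
  rintro σ₇ - - ⟨-, m1, m2⟩
  refine ⟨fun b => ?_, fun b hb => by
    rw [m1 _ (by omega) (by omega), l1 _ (by omega) (by omega), k1 _ (by omega) (by omega),
      g1 _ (by omega) (by omega), hne _ (by omega)]⟩
  have z : ∀ b, b ≠ 0 → ∀ a, σ₃ (b + 64) a = 0 := fun b hb a => by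
    rw [hne _ (by omega), hσ _ (by omega)]
  match b with
  | 0 =>
    rw [m1 _ (by omega) (by omega), l1 _ (by omega) (by omega), k1 _ (by omega) (by omega),
      g1 _ (by omega) (by omega), ← h64]
  | 1 =>
    rw [m1 _ (by omega) (by omega), l1 _ (by omega) (by omega), k1 _ (by omega) (by omega)]
    funext a
    rw [show 1 + 64 = 65 from rfl, g2, z 1 (by omega)]
    rfl
  | 2 =>
    rw [m1 _ (by omega) (by omega), l1 _ (by omega) (by omega)]
    funext a
    rw [show 2 + 64 = 66 from rfl, k2, g1 _ (by omega) (by omega), z 2 (by omega)]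
    rfl
  | 3 =>
    rw [m1 _ (by omega) (by omega)]
    funext a
    rw [show 3 + 64 = 67 from rfl, l2, k1 _ (by omega) (by omega), g1 _ (by omega) (by omega),
      z 3 (by omega)]
    rfl
  | 4 =>
    funext a
    rw [show 4 + 64 = 68 from rfl, m2, l1 _ (by omega) (by omega), k1 _ (by omega) (by omega),
      g1 _ (by omega) (by omega), z 4 (by omega)]
    rfl
  | b + 5 =>
    rw [m1 _ (by omega) (by omega), l1 _ (by omega) (by omega), k1 _ (by omega) (by omega),
      g1 _ (by omega) (by omega)]
    funext a
    rw [z _ (by omega)]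
    rfl

/-- Compute the parameters and write the grid. -/
def setup (E K j : ℕ) : Cmd :=
  .seq (findRoot E) (.seq findLog (.seq (findDims K j) writeGrid))

theorem Does.setup {E K j : ℕ} (h0 : σ 0 0 = n) (hn : 1 ≤ n)
    (hσ : ∀ b, 5 ≤ b → ∀ a, σ b a = 0) (hV : 2 * n + 1 ≤ V)
    (hN : (rows (root E n) K j + 1 + 1) * (2 * cols (root E n) j + 1 + 1) ≤ V)
    (hM : Gadget.size (rows (root E n) K j) (cols (root E n) j) ≤ V) :
    Does val V W (setup E K j) σ cur
      (n * 7 + (rows (root E n) K j + 1 + 1) * (2 * cols (root E n) j + 1 + 1) * 6 +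
        Gadget.size (rows (root E n) K j) (cols (root E n) j) * 6 + 19) 0 fun σ' _ =>
      Env n (rows (root E n) K j) (cols (root E n) j)
        (n / (rows (root E n) K j * cols (root E n) j) + 1) σ' ∧
      n ≤ 2 ^ σ' 13 0 ∧ 2 ^ σ' 13 0 < 2 * n ∧
      (∀ b, σ' (b + 64) = (grid (rows (root E n) K j) (cols (root E n) j)).input b) ∧
      ∀ b, (b < 10 ∨ 16 < b ∧ b < 64) → σ' b = σ b := by
  set r := root E n
  set N := (rows r K j + 1 + 1) * (2 * cols r j + 1 + 1) with hNdef
  set M := Gadget.size (rows r K j) (cols r j) with hMdef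
  have hr : rows r K j ≤ V := le_trans (by rw [hNdef]; nlinarith) hN
  have hc : cols r j ≤ V := le_trans (by rw [hNdef]; nlinarith) hN
  refine ((Does.findRoot (E := E) (σ := σ) (n := n) h0 (hσ 14 (by omega) 0) (by omega)).andThen
    (T₂ := n * 4 + N * 6 + M * 6 + 17) (Q₂ := 0) ?_).mono (by omega) (by omega) ?_
    (Post := fun σ' _ => (Env n (rows r K j) (cols r j) (n / (rows r K j * cols r j) + 1) σ' ∧
      n ≤ 2 ^ σ' 13 0 ∧ 2 ^ σ' 13 0 < 2 * n ∧
      (∀ b, σ' (b + 64) = (grid (rows r K j) (cols r j)).input b)))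
  · intro σ₁ cur₁ f1 g1
    have f1' : ∀ b, b ≠ 14 → b ≠ 16 → σ₁ b = σ b := fun b h1 h2 =>
      f1 b (by simp [Driver.findRoot, forLoop, mods, h1, h2])
    refine ((Does.findLog (σ := σ₁) (n := n) (by rw [f1' 0 (by omega) (by omega), h0])
      (by rw [f1' 13 (by omega) (by omega), hσ 13 (by omega)]) hV hn).andThen
      (T₂ := N * 6 + M * 6 + 14) (Q₂ := 0) ?_).mono (by omega) (by omega) fun _ _ _ h => h
    intro σ₂ cur₂ f2 g2
    have f2' : ∀ b, b ≠ 13 → b ≠ 15 → b ≠ 16 → σ₂ b = σ₁ b := fun b h1 h2 h3 =>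
      f2 b (by simp [Driver.findLog, forLoop, mods, h1, h2, h3])
    refine ((Does.findDims (σ := σ₂) (n := n) (r := r) (K := K) (j := j)
      (by rw [f2' 0 (by omega) (by omega) (by omega), f1' 0 (by omega) (by omega), h0])
      (by rw [f2' 14 (by omega) (by omega) (by omega), g1]) hr hc (by omega)).andThen
      (T₂ := N * 6 + M * 6 + 11) (Q₂ := 0) ?_).mono (by omega) (by omega) fun _ _ _ h => h
    intro σ₃ cur₃ f3 g3
    have f3' : ∀ b, b ≠ 10 → b ≠ 11 → b ≠ 12 → σ₃ b = σ₂ b := fun b h1 h2 h3 =>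
      f3 b (by simp [Driver.findDims, mods, h1, h2, h3])
    refine (Does.writeGrid g3 hN hM fun b hb a => ?_).mono le_rfl le_rfl ?_
    · rw [f3' _ (by omega) (by omega) (by omega), f2' _ (by omega) (by omega) (by omega),
        f1' _ (by omega) (by omega), hσ _ (by omega)]
    · rintro σ₄ cur₄ - ⟨g4, g5⟩
      have e13 : σ₄ 13 = σ₂ 13 := by rw [g5 _ (by omega), f3' _ (by omega) (by omega) (by omega)]
      rw [e13]
      refine ⟨?_, g2.1, g2.2, g4⟩
      refine ⟨?_, ?_, ?_, ?_⟩ <;> rw [g5 _ (by omega)]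
      exacts [g3.order, g3.rows, g3.cols, g3.blocks]
  · rintro σ' cur' f ⟨h1, h2, h3, h4⟩
    refine ⟨h1, h2, h3, h4, fun b hb => f b ?_⟩
    simp [Driver.findRoot, Driver.findLog, Driver.findDims, Driver.writeGrid, forLoop,
      Cmd.fill, mods]
    omega

end Driver

/-! ### Distances by repeated squaring -/

namespace Driver

open WordRAM

theorem le_part_iff {m : ℕ → ℕ} {Z S K i l x : ℕ} :
    x ≤ part m Z S K i l ↔ x ≤ 2 * S ∧ ∀ k < K, x ≤ m (i * Z + k) + m (k * Z + l) := by
  induction K with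
  | zero => simp [part]
  | succ K ih =>
    rw [part, le_min_iff, ih, and_assoc]
    refine and_congr_right fun _ => ⟨fun h k hk => ?_, fun h => ⟨fun k hk => h k (by omega),
      h K (by omega)⟩⟩
    rcases Nat.lt_succ_iff_lt_or_eq.1 hk with hk | rfl
    · exact h.1 k hk
    · exact h.2

section Walks

variable {n : ℕ} {w : Fin n → Fin n → WithTop ℤ}

/-- The weights of walks with at most `2 ^ l` arcs. -/
noncomputable def pathDist (w : Fin n → Fin n → WithTop ℤ) : ℕ → Fin n → Fin n → WithTop ℤ
  | 0, i, j => if i = j then 0 else w i j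
  | l + 1, i, j => Finset.univ.inf fun k => pathDist w l i k + pathDist w l k j

theorem pathDist_eq_walk (l : ℕ) (i j : Fin n) (h : pathDist w l i j ≠ ⊤) :
    ∃ r : List (Fin n), (i :: r).getLast (List.cons_ne_nil i r) = j ∧ r.length ≤ 2 ^ l ∧
      pathDist w l i j = walkWeight w i r := by
  induction l generalizing i j with
  | zero =>
    rw [pathDist]
    split_ifs with hij
    · exact ⟨[], hij, by simp, rfl⟩
    · exact ⟨[j], by simp, by simp, by simp [walkWeight]⟩
  | succ l ih =>
    obtain ⟨k, -, hk⟩ := Finset.exists_mem_eq_inf Finset.univ ⟨i, Finset.mem_univ i⟩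
      fun k => pathDist w l i k + pathDist w l k j
    rw [pathDist] at h ⊢
    rw [hk] at h ⊢
    obtain ⟨h1, h2⟩ := WithTop.add_ne_top.1 h
    obtain ⟨r, rfl, hr, er⟩ := ih _ _ h1
    obtain ⟨s, rfl, hs, es⟩ := ih _ _ h2
    refine ⟨r ++ s, getLast_cons_append _ _ _ _, ?_, ?_⟩
    · rw [List.length_append, pow_succ]; omega
    · rw [walkWeight_append, er, es]

/-- A walk with at most 2^(l+1) arcs is cut after 2^l arcs. In the base case, where distances from a
node to itself are set to 0, a loop must not have negative weight. -/
theorem pathDist_le_walk (hw : NoNegativeCycle w) (l : ℕ) (i : Fin n) (r : List (Fin n))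
    (hr : r.length ≤ 2 ^ l) :
    pathDist w l i ((i :: r).getLast (List.cons_ne_nil i r)) ≤ walkWeight w i r := by
  induction l generalizing i r with
  | zero =>
    match r, hr with
    | [], _ => simp [pathDist, walkWeight]
    | [a], _ =>
      rw [show [i, a].getLast (List.cons_ne_nil _ _) = a by simp, pathDist,
        show walkWeight w i [a] = w i a by simp [walkWeight]]
      by_cases h : i = a
      · subst h
        rw [if_pos rfl]
        simpa [walkWeight] using hw i []
      · rw [if_neg h]
  | succ l ih =>
    have e := List.take_append_drop (2 ^ l) r
    have h1 := ih i (r.take (2 ^ l)) (by rw [List.length_take]; omega)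
    have h2 := ih ((i :: r.take (2 ^ l)).getLast (List.cons_ne_nil _ _)) (r.drop (2 ^ l))
      (by rw [List.length_drop]; rw [pow_succ] at hr; omega)
    rw [← getLast_cons_append i (r.take (2 ^ l)) (r.drop (2 ^ l)) (by simp)] at h2
    simp only [e] at h2
    have h3 := walkWeight_append w (r.drop (2 ^ l)) (r.take (2 ^ l)) i
    rw [e] at h3
    rw [h3, pathDist]
    exact (Finset.inf_le (Finset.mem_univ _)).trans (add_le_add h1 h2)

/-- A walk with more than `n` arcs repeats a node; the closed walk in between has nonnegative weight
and can be cut out. -/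
theorem exists_short_walk (hw : NoNegativeCycle w) (k : ℕ) (i : Fin n) (r : List (Fin n))
    (hr : r.length ≤ k) : ∃ r' : List (Fin n), r'.length ≤ n ∧
      (i :: r').getLast (List.cons_ne_nil i r') = (i :: r).getLast (List.cons_ne_nil i r) ∧
      walkWeight w i r' ≤ walkWeight w i r := by
  induction k generalizing r with
  | zero => exact ⟨r, by omega, rfl, le_rfl⟩
  | succ k ih =>
    by_cases hn : r.length ≤ n
    · exact ⟨r, hn, rfl, le_rfl⟩
    have hd : ¬ (i :: r).Nodup := fun h => by
      have := h.length_le_card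
      rw [Fintype.card_fin, List.length_cons] at this
      omega
    obtain ⟨l₁, x, l₂, l₃, h⟩ := exists_repeated hd
    cases l₁ with
    | nil =>
      simp only [List.nil_append, List.cons.injEq] at h
      obtain ⟨rfl, rfl⟩ := h
      obtain ⟨r', h1, h2, h3⟩ := ih l₃ (by simp at hr; omega)
      refine ⟨r', h1, h2.trans ?_, h3.trans ?_⟩
      · simp
      · rw [walkWeight_append_cons w i l₃ l₂ i]
        exact le_add_of_nonneg_left (hw i l₂)
    | cons y l₁ =>
      simp only [List.cons_append, List.cons.injEq] at h
      obtain ⟨rfl, rfl⟩ := h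
      obtain ⟨r', h1, h2, h3⟩ := ih (l₁ ++ x :: l₃) (by simp at hr ⊢; omega)
      refine ⟨r', h1, h2.trans ?_, h3.trans ?_⟩
      · simp
      · rw [walkWeight_append_cons w x l₃ l₁ i,
          walkWeight_append_cons w x (l₂ ++ x :: l₃) l₁ i, walkWeight_append_cons w x l₃ l₂ x]
        exact add_le_add le_rfl (le_add_of_nonneg_left (hw x l₂))

theorem isLeast_pathDist (hw : NoNegativeCycle w) {L : ℕ} (hL : n ≤ 2 ^ L) (i j : Fin n) :
    IsLeast (walkWeights w i j) (pathDist w L i j) := by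
  have lower : ∀ x ∈ walkWeights w i j, pathDist w L i j ≤ x := by
    rintro x ⟨r, rfl, rfl⟩
    obtain ⟨r', h1, h2, h3⟩ := exists_short_walk hw _ i r le_rfl
    rw [← h2]
    exact (pathDist_le_walk hw L i r' (h1.trans hL)).trans h3
  refine ⟨?_, lower⟩
  by_cases h : pathDist w L i j = ⊤
  -- The value `⊤` must be attained too: the single arc from `i` to `j` is a walk, and its weight is
  -- then `⊤`.
  · have : walkWeight w i [j] ∈ walkWeights w i j := ⟨[j], by simp, rfl⟩
    have h1 := lower _ this
    rw [h, top_le_iff] at h1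
    rw [h, ← h1]
    exact this
  · obtain ⟨r, h1, -, h2⟩ := pathDist_eq_walk L i j h
    exact ⟨r, h1, h2⟩

theorem abs_walkWeight_le {B : ℤ} (hB : ∀ i j, ∀ z : ℤ, w i j = (z : WithTop ℤ) → |z| ≤ B)
    (r : List (Fin n)) (i : Fin n) (z : ℤ) (hz : walkWeight w i r = (z : WithTop ℤ)) :
    |z| ≤ r.length * B := by
  induction r generalizing i z with
  | nil =>
    have : z = 0 := by
      rw [walkWeight] at hz
      exact_mod_cast hz.symm
    simp [this]
  | cons b r ih =>
    rw [walkWeight] at hz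
    obtain ⟨x, y, hx, hy, hxy⟩ := WithTop.add_eq_coe.1 hz
    have h1 := hB i b x hx.symm
    have h2 := ih b y hy.symm
    have h3 := abs_add_le x y
    rw [hxy] at h3
    push_cast [List.length_cons]
    linarith

/-- At most `2 * n` arcs of absolute weight at most `n ^ c` give exactly the bound `shift c n`. -/
theorem abs_pathDist_le {c l : ℕ}
    (hB : ∀ i j, ∀ z : ℤ, w i j = (z : WithTop ℤ) → |z| ≤ (n : ℤ) ^ c) (hl : 2 ^ l ≤ 2 * n)
    (i j : Fin n) (z : ℤ) (hz : pathDist w l i j = (z : WithTop ℤ)) : |z| ≤ shift c n := by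
  obtain ⟨r, -, h1, h2⟩ := pathDist_eq_walk l i j (by rw [hz]; exact WithTop.coe_ne_top)
  refine (abs_walkWeight_le hB r i z (by rw [← h2, hz])).trans ?_
  have h3 : (r.length : ℤ) ≤ 2 * n := by exact_mod_cast h1.trans hl
  calc (r.length : ℤ) * (n : ℤ) ^ c ≤ 2 * n * (n : ℤ) ^ c :=
        mul_le_mul_of_nonneg_right h3 (by positivity)
    _ = (shift c n : ℤ) := by unfold shift; push_cast; ring

/-- The code of a distance in the matrix. -/
def code (S O : ℕ) : WithTop ℤ → ℕ
  | ⊤ => S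
  | (z : ℤ) => (z + O).toNat

@[simp] theorem code_top {S O : ℕ} : code S O ⊤ = S := rfl
@[simp] theorem code_coe {S O : ℕ} (z : ℤ) : code S O (z : WithTop ℤ) = (z + O).toNat := rfl

theorem signOf_code {S O : ℕ} (hS : 2 * O < S) {x : WithTop ℤ}
    (hx : ∀ z : ℤ, x = (z : WithTop ℤ) → |z| ≤ O) : signOf S O (code S O x) = signCode x := by
  induction x using WithTop.recTopCoe with
  | top => simp [signOf, signCode]
  | coe z =>
    have := abs_le.1 (hx z rfl)
    rw [code_coe, signOf, if_pos (by omega)]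
    show _ = if 0 ≤ z then 1 else 2
    split_ifs <;> omega

theorem absOf_code {S O : ℕ} (hS : 2 * O < S) {x : WithTop ℤ}
    (hx : ∀ z : ℤ, x = (z : WithTop ℤ) → |z| ≤ O) : absOf S O (code S O x) = absCode x := by
  induction x using WithTop.recTopCoe with
  | top => simp [absOf, absCode]
  | coe z =>
    have := abs_le.1 (hx z rfl)
    rw [code_coe, absOf, if_pos (by omega)]
    show _ = z.natAbs
    split_ifs <;> omega

/-- The matrix holds the codes of the given distances, and is padded. -/
def Encodes (S O n Z : ℕ) (m : ℕ → ℕ) (D : Fin n → Fin n → WithTop ℤ) : Prop :=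
  ∀ i < Z, ∀ k < Z, m (i * Z + k) =
    if h : i < n ∧ k < n then code S O (D ⟨i, h.1⟩ ⟨k, h.2⟩) else S

/-- Finite entries have codes from 0 to `2 * O`, so the sum of two finite codes is at most `4 * O`,
below `S`, while a sum with the code `S` of `⊤` is at least `S`. Comparing with `S` thus decides
finiteness, and subtracting `O` once restores the code, as a sum contains the shift twice. The
padding with `S` acts like `⊤`. The hypothesis `hD'` ensures that the new entries again fit the
code. -/
theorem Encodes.square {S O Z : ℕ} (hS : S = 4 * O + 1) (hZ : n ≤ Z) {m : ℕ → ℕ}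
    {D : Fin n → Fin n → WithTop ℤ} (h : Encodes S O n Z m D)
    (hD : ∀ i k, ∀ z : ℤ, D i k = (z : WithTop ℤ) → |z| ≤ O)
    (hD' : ∀ i j, ∀ z : ℤ, (Finset.univ.inf fun k => D i k + D k j) = (z : WithTop ℤ) → |z| ≤ O) :
    Encodes S O n Z (square S O Z m) fun i j => Finset.univ.inf fun k => D i k + D k j := by
  intro i hi j hj
  have hlt : i * Z + j < Z * Z := by
    have : (i + 1) * Z ≤ Z * Z := Nat.mul_le_mul_right _ hi
    rw [add_mul, one_mul] at this
    omega
  have hdiv : (i * Z + j) / Z = i := by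
    rw [mul_comm, Nat.mul_add_div (by omega), Nat.div_eq_of_lt hj, add_zero]
  have hmod : (i * Z + j) % Z = j := by
    rw [mul_comm, Nat.mul_add_mod, Nat.mod_eq_of_lt hj]
  rw [Driver.square, if_pos hlt, squareEntry, hdiv, hmod]
  by_cases hij : i < n ∧ j < n
  · rw [dif_pos hij]
    obtain ⟨hin, hjn⟩ := hij
    have hcases : ∀ k < Z, S ≤ m (i * Z + k) + m (k * Z + j) ∨ ∃ (hk : k < n) (x y : ℤ),
        D ⟨i, hin⟩ ⟨k, hk⟩ = (x : WithTop ℤ) ∧ D ⟨k, hk⟩ ⟨j, hjn⟩ = (y : WithTop ℤ) ∧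
        m (i * Z + k) = (x + O).toNat ∧ m (k * Z + j) = (y + O).toNat := by
      intro k hk
      rw [h i hi k hk, h k hk j hj]
      by_cases hkn : k < n
      · rw [dif_pos ⟨hin, hkn⟩, dif_pos ⟨hkn, hjn⟩]
        by_cases h1 : D ⟨i, hin⟩ ⟨k, hkn⟩ = ⊤
        · left; rw [h1, code_top]; omega
        by_cases h2 : D ⟨k, hkn⟩ ⟨j, hjn⟩ = ⊤
        · left; rw [h2, code_top]; omega
        obtain ⟨x, hx⟩ := WithTop.ne_top_iff_exists.1 h1
        obtain ⟨y, hy⟩ := WithTop.ne_top_iff_exists.1 h2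
        exact .inr ⟨hkn, x, y, hx.symm, hy.symm, by rw [← hx, code_coe], by rw [← hy, code_coe]⟩
      · left; rw [dif_neg (by omega)]; omega
    obtain ⟨k₀, -, hk₀⟩ := Finset.exists_mem_eq_inf Finset.univ ⟨⟨i, hin⟩, Finset.mem_univ _⟩
      fun k => D ⟨i, hin⟩ k + D k ⟨j, hjn⟩
    have hle : ∀ k, (Finset.univ.inf fun k => D ⟨i, hin⟩ k + D k ⟨j, hjn⟩) ≤
        D ⟨i, hin⟩ k + D k ⟨j, hjn⟩ := fun k => Finset.inf_le (Finset.mem_univ k)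
    set X := Finset.univ.inf fun k => D ⟨i, hin⟩ k + D k ⟨j, hjn⟩ with hX
    change _ = code S O X
    by_cases htop : X = ⊤
    · rw [htop, code_top, if_neg]
      rw [not_lt, le_part_iff]
      refine ⟨by omega, fun k hk => ?_⟩
      rcases hcases k hk with h1 | ⟨hkn, x, y, hx, hy, -, -⟩
      · exact h1
      · have := hle ⟨k, hkn⟩
        rw [htop, hx, hy, top_le_iff] at this
        exact absurd this (by rw [← WithTop.coe_add]; exact WithTop.coe_ne_top)
    · obtain ⟨z, hz⟩ := WithTop.ne_top_iff_exists.1 htop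
      have hzO := abs_le.1 (hD' ⟨i, hin⟩ ⟨j, hjn⟩ z hz.symm)
      have hpart : part m Z S Z i j = (z + 2 * O).toNat := by
        apply le_antisymm
        · have h1 := (le_part_iff.1 (le_refl (part m Z S Z i j))).2 k₀ (by omega)
          rcases hcases k₀ (by omega) with h2 | ⟨hkn, x, y, hx, hy, ex, ey⟩
          -- At the minimising index both summands are finite, so the sum of their codes is at most
          -- `4 * O`.
          · exfalso
            rw [← hz] at hk₀
            obtain ⟨x, y, hx, hy, hxy⟩ := WithTop.add_eq_coe.1 hk₀.symm
            have b1 := abs_le.1 (hD _ _ x hx.symm)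
            have b2 := abs_le.1 (hD _ _ y hy.symm)
            rw [h i hi k₀ (by omega), h k₀ (by omega) j hj, dif_pos ⟨hin, k₀.2⟩,
              dif_pos ⟨k₀.2, hjn⟩] at h2
            simp only [Fin.eta, ← hx, ← hy, code_coe] at h2
            omega
          · rw [ex, ey] at h1
            rw [← hz] at hk₀
            simp only [Fin.eta] at hx hy
            have b1 := abs_le.1 (hD _ _ x hx)
            have b2 := abs_le.1 (hD _ _ y hy)
            rw [hx, hy, ← WithTop.coe_add, WithTop.coe_inj] at hk₀
            omega
        · rw [le_part_iff]
          refine ⟨by omega, fun k hk => ?_⟩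
          rcases hcases k hk with h1 | ⟨hkn, x, y, hx, hy, ex, ey⟩
          · omega
          · have h2 := hle ⟨k, hkn⟩
            rw [← hz, hx, hy, ← WithTop.coe_add, WithTop.coe_le_coe] at h2
            have b1 := abs_le.1 (hD _ _ x hx)
            have b2 := abs_le.1 (hD _ _ y hy)
            omega
      rw [hpart, if_pos (by omega), ← hz, code_coe]
      omega
  · rw [dif_neg hij, if_neg]
    rw [not_lt, le_part_iff]
    refine ⟨by omega, fun k hk => ?_⟩
    rw [h i hi k hk, h k hk j hj]
    by_cases hin : i < n
    · rw [dif_neg (c := k < n ∧ j < n) (by omega)]; omega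
    · rw [dif_neg (c := i < n ∧ k < n) (by omega)]; omega

theorem apspInput_one {i k : ℕ} (hi : i < n) (hk : k < n) :
    apspInput w 1 (i * n + k) = signCode (w ⟨i, hi⟩ ⟨k, hk⟩) := by
  have hlt : i * n + k < n * n := by
    have : (i + 1) * n ≤ n * n := Nat.mul_le_mul_right _ hi
    rw [add_mul, one_mul] at this
    omega
  rw [apspInput, bankOf, dif_pos hlt]
  congr 2
  · apply Fin.ext
    simp only [Fin.divNat]
    rw [mul_comm, Nat.mul_add_div (by omega), Nat.div_eq_of_lt hk, add_zero]
  · apply Fin.ext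
    simp only [Fin.modNat]
    rw [mul_comm, Nat.mul_add_mod, Nat.mod_eq_of_lt hk]

theorem apspInput_two {i k : ℕ} (hi : i < n) (hk : k < n) :
    apspInput w 2 (i * n + k) = absCode (w ⟨i, hi⟩ ⟨k, hk⟩) := by
  have hlt : i * n + k < n * n := by
    have : (i + 1) * n ≤ n * n := Nat.mul_le_mul_right _ hi
    rw [add_mul, one_mul] at this
    omega
  rw [apspInput, bankOf, dif_pos hlt]
  congr 2
  · apply Fin.ext
    simp only [Fin.divNat]
    rw [mul_comm, Nat.mul_add_div (by omega), Nat.div_eq_of_lt hk, add_zero]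
  · apply Fin.ext
    simp only [Fin.modNat]
    rw [mul_comm, Nat.mul_add_mod, Nat.mod_eq_of_lt hk]

theorem encodes_initMatrix {S O Z : ℕ}
    (hB : ∀ i j, ∀ z : ℤ, w i j = (z : WithTop ℤ) → |z| ≤ O) :
    Encodes S O n Z (initMatrix S O n Z (apspInput w 1) (apspInput w 2)) (pathDist w 0) := by
  intro i hi k hk
  have hlt : i * Z + k < Z * Z := by
    have : (i + 1) * Z ≤ Z * Z := Nat.mul_le_mul_right _ hi
    rw [add_mul, one_mul] at this
    omega
  have hdiv : (i * Z + k) / Z = i := by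
    rw [mul_comm, Nat.mul_add_div (by omega), Nat.div_eq_of_lt hk, add_zero]
  have hmod : (i * Z + k) % Z = k := by
    rw [mul_comm, Nat.mul_add_mod, Nat.mod_eq_of_lt hk]
  rw [initMatrix, if_pos hlt, initEntry, hdiv, hmod]
  by_cases hik : i < n ∧ k < n
  · rw [dif_pos hik, if_pos hik.1, if_pos hik.2, pathDist, apspInput_one hik.1 hik.2,
      apspInput_two hik.1 hik.2]
    simp only [Fin.mk.injEq]
    by_cases he : i = k
    · rw [if_pos he, if_pos he]; simp [code]
    · rw [if_neg he, if_neg he]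
      have hb := hB ⟨i, hik.1⟩ ⟨k, hik.2⟩
      generalize w ⟨i, hik.1⟩ ⟨k, hik.2⟩ = x at hb
      induction x using WithTop.recTopCoe with
      | top => simp [signCode]
      | coe z =>
        have := abs_le.1 (hb z rfl)
        simp only [signCode, absCode, code_coe]
        by_cases hz : 0 ≤ z
        · simp only [hz, if_true]; norm_num; omega
        · simp only [hz, if_false]; norm_num; omega
  · rw [dif_neg hik]
    split_ifs <;> first | rfl | omega

theorem encodes_iterate {c Z L : ℕ} (hZ : n ≤ Z) (hn : 1 ≤ n)
    (hB : ∀ i j, ∀ z : ℤ, w i j = (z : WithTop ℤ) → |z| ≤ (n : ℤ) ^ c) (hL : 2 ^ L ≤ 2 * n) :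
    Encodes (cap c n) (shift c n) n Z ((square (cap c n) (shift c n) Z)^[L]
      (initMatrix (cap c n) (shift c n) n Z (apspInput w 1) (apspInput w 2))) (pathDist w L) := by
  induction L with
  | zero =>
    refine encodes_initMatrix fun i j z hz => (hB i j z hz).trans ?_
    have h1 : n ^ c ≤ shift c n := by
      unfold shift
      calc n ^ c ≤ n ^ (c + 1) := Nat.pow_le_pow_right hn (by omega)
        _ ≤ 2 * n ^ (c + 1) := by omega
    exact_mod_cast h1
  | succ L ih =>
    have h1 : 2 ^ L ≤ 2 * n := (Nat.pow_le_pow_right (by omega) (by omega)).trans hL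
    rw [Function.iterate_succ_apply']
    exact (ih h1).square rfl hZ (abs_pathDist_le hB h1)
      fun i j z hz => abs_pathDist_le (l := L + 1) hB hL i j z hz

theorem apspOutput_of_main {c Z L : ℕ} (hZ : n ≤ Z) (hn : 1 ≤ n) (hw : NoNegativeCycle w)
    (hB : ∀ i j, ∀ z : ℤ, w i j = (z : WithTop ℤ) → |z| ≤ (n : ℤ) ^ c) (hL : 2 ^ L ≤ 2 * n)
    (hL' : n ≤ 2 ^ L) {σ : State}
    (h : ∀ x < n * n,
      σ 3 x = signOf (cap c n) (shift c n) ((square (cap c n) (shift c n) Z)^[L]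
        (initMatrix (cap c n) (shift c n) n Z (apspInput w 1) (apspInput w 2))
          (x / n * Z + x % n)) ∧
      σ 4 x = absOf (cap c n) (shift c n) ((square (cap c n) (shift c n) Z)^[L]
        (initMatrix (cap c n) (shift c n) n Z (apspInput w 1) (apspInput w 2))
          (x / n * Z + x % n))) : apspOutput w σ := by
  intro i j
  have hlt : (i : ℕ) * n + j < n * n := by
    have : ((i : ℕ) + 1) * n ≤ n * n := Nat.mul_le_mul_right _ i.2
    rw [add_mul, one_mul] at this
    omega
  have hdiv : ((i : ℕ) * n + j) / n = i := by
    rw [mul_comm, Nat.mul_add_div (by omega), Nat.div_eq_of_lt j.2, add_zero]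
  have hmod : ((i : ℕ) * n + j) % n = j := by
    rw [mul_comm, Nat.mul_add_mod, Nat.mod_eq_of_lt j.2]
  have h1 := h _ hlt
  rw [hdiv, hmod, encodes_iterate hZ hn hB hL i (i.2.trans_le hZ) j (j.2.trans_le hZ),
    dif_pos ⟨i.2, j.2⟩] at h1
  have hcap : 2 * shift c n < cap c n := by unfold cap; omega
  have hb := abs_pathDist_le hB hL i j
  refine ⟨_, isLeast_pathDist hw hL' i j, ?_, ?_⟩
  · rw [h1.1]; exact signOf_code hcap hb
  · rw [h1.2]; exact absOf_code hcap hb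

end Walks

end Driver

/-! ### Dimensions -/

namespace Driver

open WordRAM WordRAM.Cmd Gadget

theorem root_pow_le {E n : ℕ} (hE : E ≠ 0) : root E n ^ E ≤ n :=
  Nat.findGreatest_spec (P := fun k => k ^ E ≤ n) (Nat.zero_le n) (by simp [hE])

theorem lt_root_succ_pow {E n : ℕ} (hE : E ≠ 0) : n < (root E n + 1) ^ E := by
  by_cases h : root E n + 1 ≤ n
  · exact lt_of_not_ge (Nat.findGreatest_is_greatest (P := fun k => k ^ E ≤ n)
      (Nat.lt_succ_self _) h)
  · exact (lt_of_not_ge h).trans_le (Nat.le_self_pow hE _)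

theorem one_le_root {E n : ℕ} (hE : E ≠ 0) (hn : 1 ≤ n) : 1 ≤ root E n := by
  by_contra h
  have := lt_root_succ_pow (n := n) hE
  rw [show root E n = 0 by omega, zero_add, one_pow] at this
  omega

/-- The number of nodes of the grid. -/
abbrev nodes (r K j : ℕ) : ℕ := (rows r K j + 1 + 1) * (2 * cols r j + 1 + 1)

/-- The number of blocks in which the matrix is cut. -/
def blocks (n r K j : ℕ) : ℕ := n / (rows r K j * cols r j) + 1

section

variable {E K j n r : ℕ}

theorem rows_add_two (hr : 1 ≤ r) : rows r K j + 1 + 1 = 4 * r ^ (K - j) := by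
  have : 1 ≤ r ^ (K - j) := Nat.one_le_pow _ _ hr
  unfold rows; omega

theorem cols_add_two (hr : 1 ≤ r) : 2 * cols r j + 1 + 1 = 4 * r ^ j := by
  have : 1 ≤ r ^ j := Nat.one_le_pow _ _ hr
  unfold cols; omega

theorem one_le_rows (hr : 1 ≤ r) : 1 ≤ rows r K j := by
  have : 1 ≤ r ^ (K - j) := Nat.one_le_pow _ _ hr
  unfold rows; omega

theorem one_le_cols (hr : 1 ≤ r) : 1 ≤ cols r j := by
  have : 1 ≤ r ^ j := Nat.one_le_pow _ _ hr
  unfold cols; omega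

/-- The odd constants in `rows` and `cols` are chosen for this: every shape `j` has the same number
of nodes, so all shapes are measured with the same values of u and q. -/
theorem nodes_eq (hr : 1 ≤ r) (hj : j ≤ K) : nodes r K j = 16 * r ^ K := by
  rw [nodes, rows_add_two hr, cols_add_two hr]
  calc 4 * r ^ (K - j) * (4 * r ^ j) = 16 * (r ^ (K - j) * r ^ j) := by ring
    _ = _ := by rw [← pow_add, Nat.sub_add_cancel hj]

theorem rows_mul_cols_le (hj : j ≤ K) : rows r K j * cols r j ≤ 8 * r ^ K := by
  have h1 : rows r K j ≤ 4 * r ^ (K - j) := by unfold rows; omega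
  have h2 : cols r j ≤ 2 * r ^ j := by unfold cols; omega
  calc rows r K j * cols r j ≤ 4 * r ^ (K - j) * (2 * r ^ j) := Nat.mul_le_mul h1 h2
    _ = 8 * (r ^ (K - j) * r ^ j) := by ring
    _ = _ := by rw [← pow_add, Nat.sub_add_cancel hj]

theorem size_le_nodes : Gadget.size (rows r K j) (cols r j) ≤ 2 * nodes r K j := by
  unfold Gadget.size Grid.numEdges Grid.numHor nodes
  have : ∀ a b : ℕ, (a + 1 + 1) * (2 * b + 1) + (a + 1) * (2 * b + 1 + 1) ≤
    2 * ((a + 1 + 1) * (2 * b + 1 + 1)) := fun a b => by nlinarith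
  exact this _ _

theorem le_dim (hr : 1 ≤ r) : n ≤ rows r K j * cols r j * blocks n r K j := by
  have : 0 < rows r K j * cols r j := Nat.mul_pos (one_le_rows hr) (one_le_cols hr)
  exact (Nat.lt_mul_div_succ n this).le

/-- Rounding up to a multiple of the block area adds at most that area, which is `8 * n` at most. So
padding costs only a constant factor. -/
theorem dim_le (hj : j ≤ K) (hK : r ^ K ≤ n) :
    rows r K j * cols r j * blocks n r K j ≤ 9 * n := by
  have h1 := rows_mul_cols_le (r := r) hj
  have h2 := Nat.mul_div_le n (rows r K j * cols r j)
  rw [blocks, mul_add, mul_one]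
  omega

/-- Conversely, n is polynomial in the number of nodes, so weights polynomial in n are admissible
for the dynamic problem. -/
theorem le_nodes_pow (hE : E ≠ 0) (hn : 1 ≤ n) (hK : K ≠ 0) (hj : j ≤ K) :
    n + 2 ≤ nodes (root E n) K j ^ (E + 1) := by
  have hr := one_le_root hE hn
  have h1 : root E n + 1 ≤ nodes (root E n) K j := by
    rw [nodes_eq hr hj]
    have := Nat.le_self_pow hK (root E n)
    omega
  have h2 := (lt_root_succ_pow (n := n) hE).trans_le (Nat.pow_le_pow_left h1 E)
  have h3 : 16 ≤ nodes (root E n) K j := by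
    rw [nodes_eq hr hj]
    have := Nat.one_le_pow K _ hr
    omega
  rw [pow_succ]
  nlinarith

theorem far_le {n₂ n₃ S : ℕ} (h2 : 1 ≤ n₂) (h3 : 1 ≤ n₃) :
    far n₂ n₃ S ≤ 100 * ((n₂ + 1 + 1) * (2 * n₃ + 1 + 1)) ^ 2 * S := by
  set N := (n₂ + 1 + 1) * (2 * n₃ + 1 + 1) with hN
  have h4 : (n₂ + 1) * (n₃ + 1) ≤ N := by rw [hN]; nlinarith
  have h5 : n₃ * (n₂ + 1) ≤ N := by rw [hN]; nlinarith
  have h6 : 2 * n₃ + n₂ + 4 ≤ N := by rw [hN]; nlinarith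
  have h7 : 1 ≤ N := by omega
  have hbig : big n₂ n₃ S ≤ 6 * N * S := by
    unfold big drop
    calc (n₂ + 1) * ((n₃ + 1) * (2 * S)) + n₃ * ((n₂ + 1) * (2 * S)) + 2 * S
        = ((n₂ + 1) * (n₃ + 1) + n₃ * (n₂ + 1) + 1) * (2 * S) := by ring
      _ ≤ (N + N + N) * (2 * S) := Nat.mul_le_mul_right _ (by omega)
      _ = _ := by ring
  have hp : pend n₂ n₃ S ≤ N * (6 * N * S) := Nat.mul_le_mul h6 hbig
  have h8 : N * S ≤ N ^ 2 * S := Nat.mul_le_mul_right _ (Nat.le_self_pow (by omega) N)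
  unfold far
  nlinarith

/-- The exponent that bounds the weights in the grid. -/
def weightExp (E c : ℕ) : ℕ := (E + 1) * (c + 1) + 5

/-- The exponent depends on E and c only. The dynamic algorithm is later taken for this exponent,
while E has been fixed by the exponent of its preprocessing time, which is therefore required to be
the same for all weight bounds. -/
theorem far_le_pow {c : ℕ} (hE : E ≠ 0) (hn : 1 ≤ n) (hK : K ≠ 0) (hj : j ≤ K) :
    far (rows (root E n) K j) (cols (root E n) j) (cap c n) ≤
      nodes (root E n) K j ^ weightExp E c := by
  have hr := one_le_root hE hn
  have h16 : 16 ≤ nodes (root E n) K j := by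
    rw [nodes_eq hr hj]
    have := Nat.one_le_pow K _ hr
    omega
  have h0 := le_nodes_pow hE hn hK hj
  refine (far_le (one_le_rows hr) (one_le_cols hr)).trans ?_
  change 100 * nodes (root E n) K j ^ 2 * cap c n ≤ _
  set N := nodes (root E n) K j
  have hS : cap c n ≤ 9 * N ^ ((E + 1) * (c + 1)) := by
    have h1 : n ^ (c + 1) ≤ N ^ ((E + 1) * (c + 1)) := by
      rw [pow_mul]; exact Nat.pow_le_pow_left (by omega) _
    have h2 : 1 ≤ N ^ ((E + 1) * (c + 1)) := Nat.one_le_pow _ _ (by omega)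
    unfold cap shift
    omega
  have h3 : 900 ≤ N ^ 3 := le_trans (by norm_num) (Nat.pow_le_pow_left h16 3)
  calc 100 * N ^ 2 * cap c n ≤ 100 * N ^ 2 * (9 * N ^ ((E + 1) * (c + 1))) :=
        Nat.mul_le_mul_left _ hS
    _ = 900 * (N ^ 2 * N ^ ((E + 1) * (c + 1))) := by ring
    _ ≤ N ^ 3 * (N ^ 2 * N ^ ((E + 1) * (c + 1))) := Nat.mul_le_mul_right _ h3
    _ = _ := by unfold weightExp; ring

/-- Constants are absorbed into the exponent, as `n + 2` is at least 3. -/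
theorem mul_pow_le {C κ e : ℕ} (hC : C ≤ 3 ^ κ) (hn : 1 ≤ n) : C * n ^ e ≤ (n + 2) ^ (κ + e) := by
  rw [pow_add]
  exact Nat.mul_le_mul (hC.trans (Nat.pow_le_pow_left (by omega) _))
    (Nat.pow_le_pow_left (by omega) _)

theorem bounds_of_root {c V : ℕ} (hE : E ≠ 0) (hn : 1 ≤ n) (hK : K ≠ 0) (hj : j ≤ K)
    (hKE : K ≤ E) (hV : (n + 2) ^ (c + 20) ≤ V) :
    Bounds c n (rows (root E n) K j) (cols (root E n) j) (blocks n (root E n) K j) V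
      (nodes (root E n) K j ^ weightExp E c) := by
  have hr := one_le_root hE hn
  have hrK : root E n ^ K ≤ n := (Nat.pow_le_pow_right hr hKE).trans (root_pow_le hE)
  have hN : nodes (root E n) K j ≤ 16 * n := by rw [nodes_eq hr hj]; omega
  have h2 : ∀ {e κ : ℕ}, κ + e ≤ c + 20 → (n + 2) ^ (κ + e) ≤ V := fun h =>
    (Nat.pow_le_pow_right (by omega) h).trans hV
  refine ⟨one_le_rows hr, one_le_cols hr, far_le_pow hE hn hK hj, ?_, ?_, ?_, ?_⟩
  · have h3 := far_le (n₂ := rows (root E n) K j) (n₃ := cols (root E n) j) (S := cap c n)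
      (one_le_rows hr) (one_le_cols hr)
    change _ ≤ 100 * nodes (root E n) K j ^ 2 * cap c n at h3
    have hS : cap c n ≤ 9 * n ^ (c + 1) := by
      have h1 : 1 ≤ n ^ (c + 1) := Nat.one_le_pow _ _ hn
      unfold cap shift
      omega
    have h4 : 100 * nodes (root E n) K j ^ 2 * cap c n ≤ 100 * (16 * n) ^ 2 * (9 * n ^ (c + 1)) :=
      Nat.mul_le_mul (Nat.mul_le_mul_left _ (Nat.pow_le_pow_left hN 2)) hS
    have h5 : 100 * (16 * n) ^ 2 * (9 * n ^ (c + 1)) = 230400 * n ^ (c + 3) := by ring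
    have h6 : 1 ≤ n ^ (c + 3) := Nat.one_le_pow _ _ hn
    have h7 := mul_pow_le (n := n) (C := 460801) (κ := 17) (e := c + 3) (by norm_num) hn
    have h8 := h2 (e := c + 3) (κ := 17) (by omega)
    omega
  · have h3 := dim_le (n := n) hj hrK
    calc _ ≤ (9 * n) * (9 * n) := Nat.mul_le_mul h3 h3
      _ = 81 * n ^ 2 := by ring
      _ ≤ _ := mul_pow_le (κ := 4) (by norm_num) hn
      _ ≤ V := h2 (by omega)
  · have h3 := size_le_nodes (r := root E n) (K := K) (j := j)
    have h4 := mul_pow_le (n := n) (C := 32) (κ := 4) (e := 1) (by norm_num) hn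
    have h5 := h2 (e := 1) (κ := 4) (by omega)
    rw [pow_one] at h4
    omega
  · have h4 := mul_pow_le (n := n) (C := 1) (κ := 0) (e := 2) (by norm_num) hn
    have h5 := h2 (e := 2) (κ := 0) (by omega)
    nlinarith

/-- A crude bound: it only serves to show that the number of operations is polynomial in n, so that
words of logarithmic length suffice for the dynamic algorithm. -/
theorem mainCost_le {n₂ n₃ d L : ℕ} (h2 : 1 ≤ n₂) (h3 : 1 ≤ n₃) (hn : 1 ≤ n)
    (hZ : n₂ * n₃ * d ≤ 9 * n) (hN : (n₂ + 1 + 1) * (2 * n₃ + 1 + 1) ≤ 16 * n) (hL : L ≤ 2 * n) :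
    mainCost n n₂ n₃ d L ≤ (n + 2) ^ 35 := by
  set X := 40 * n with hX
  have hX1 : 40 ≤ X := by omega
  have b2 : n₂ ≤ X := by nlinarith
  have b3 : n₃ ≤ X := by nlinarith
  have bs : Gadget.size n₂ n₃ ≤ X := by
    unfold Gadget.size Grid.numEdges Grid.numHor
    nlinarith
  have bz : n₂ * n₃ * d ≤ X := by omega
  have bd : n₃ * d ≤ X := le_trans (by rw [mul_assoc]; exact Nat.le_mul_of_pos_left _ h2) bz
  have be : n₂ * d ≤ X :=
    le_trans (by rw [mul_right_comm]; exact Nat.le_mul_of_pos_right _ h3) bz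
  have p2 : X ≤ X ^ 2 := Nat.le_self_pow (by omega) X
  have p3 : X ^ 2 ≤ X ^ 3 := Nat.pow_le_pow_right (by omega) (by omega)
  have p4 : X ^ 3 ≤ X ^ 4 := Nat.pow_le_pow_right (by omega) (by omega)
  have p5 : X ^ 4 ≤ X ^ 5 := Nat.pow_le_pow_right (by omega) (by omega)
  have c1 : blockCost n₂ n₃ d ≤ 30 * X ^ 2 := by
    unfold blockCost
    calc _ ≤ X * 3 + X * (X * 3 + X * 8 + 6) + 4 := by gcongr
      _ = 11 * X ^ 2 + 9 * X + 4 := by ring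
      _ ≤ _ := by omega
  have c2 : productCost n₂ n₃ d ≤ 60 * X ^ 4 := by
    unfold productCost
    calc _ ≤ X * (X * (30 * X ^ 2 + 2) + 4) + X * X * 6 + 6 := by gcongr
      _ = 30 * X ^ 4 + 8 * X ^ 2 + 4 * X + 6 := by ring
      _ ≤ _ := by omega
  have c3 : mainCost n n₂ n₃ d L ≤ 100 * X ^ 5 := by
    unfold mainCost
    have hn' : n ≤ X := by omega
    have hL' : L ≤ X := by omega
    calc _ ≤ X * 3 + X * X * 3 + X * (60 * X ^ 4 + 2) + X * X * 6 + 10 := by gcongr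
      _ = 60 * X ^ 5 + 9 * X ^ 2 + 5 * X + 10 := by ring
      _ ≤ _ := by omega
  refine c3.trans ?_
  calc 100 * X ^ 5 = (100 * 40 ^ 5) * n ^ 5 := by rw [hX]; ring
    _ ≤ _ := mul_pow_le (κ := 30) (by norm_num) hn

end

end Driver

/-! ### The program for all pairs shortest paths -/

open WordRAM

theorem Serves.mono {N m : ℕ} {G : PlaneGraph N m} {p : PlanarProblem} {D : DynAlg} {B B' : ℕ}
    (hB : B ≤ B') {cur : Fin m → ℕ∞} {σ : State} {ops : List (DynOp m)} {t : ℕ}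
    (h : Serves G p D B cur σ ops t) : Serves G p D B' cur σ ops t := by
  induction h with
  | nil cur σ => exact .nil cur σ
  | insert h₁ _ ih => exact .insert (h₁.mono hB) ih
  | delete h₁ _ ih => exact .delete (h₁.mono hB) ih
  | query h₁ ha _ ih => exact .query (h₁.mono hB) ha ih

theorem Serves.length_le {N m : ℕ} {G : PlaneGraph N m} {p : PlanarProblem} {D : DynAlg} {B : ℕ}
    {cur : Fin m → ℕ∞} {σ : State} {ops : List (DynOp m)} {t : ℕ}
    (h : Serves G p D B cur σ ops t) : ops.length ≤ t := by
  induction h with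
  | nil cur σ => exact le_rfl
  | insert h₁ _ ih => have := h₁.one_le; rw [List.length_cons]; omega
  | delete h₁ _ ih => have := h₁.one_le; rw [List.length_cons]; omega
  | query h₁ _ _ ih => have := h₁.one_le; rw [List.length_cons]; omega

/-- The algorithm solves the dynamic problem for weights and coordinates up to `N ^ c`, with the
given time bounds. -/
def DynAlg.Solves (D : DynAlg) (p : PlanarProblem) (u q : ℕ → ℝ) (a c k C : ℕ) : Prop :=
  ∀ (N m : ℕ) (G : PlaneGraph N m), (∀ v, G.x v ≤ N ^ c ∧ G.y v ≤ N ^ c) →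
    ∀ ops : List (DynOp m), ValidOps (N ^ c) (fun _ => ⊤) ops →
      ∃ (t₀ t : ℕ) (σ : State),
        Exec ((N + ops.length + 2) ^ k) D.init G.input t₀ σ ∧
        Serves G p D ((N + ops.length + 2) ^ k) (fun _ => ⊤) σ ops t ∧
        ((t₀ + t : ℕ) : ℝ) ≤ C * ((N : ℝ) ^ a + (ops.countP fun o => !o.isQuery) * u N +
          (ops.countP fun o => o.isQuery) * q N)

namespace Driver

open WordRAM WordRAM.Cmd Gadget

/-- All pairs shortest paths by means of a dynamic algorithm. -/
def program (D : DynAlg) (E K j c : ℕ) (p : PlanarProblem) : Prog :=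
  .seq ((setup E K j).plain 70) (.seq (D.init.map (· + 64)) ((main c p).toProg D 64))

theorem within_setup (E K j : ℕ) : (setup E K j).Within 70 := by
  have h : ((Expr.var 16 + 1).pow E).Within 70 := Expr.within_pow _ _ _ (by simp)
  have h' : ∀ i, ((Expr.var 14).pow i).Within 70 := fun i => Expr.within_pow _ _ _ (by simp)
  simp [setup, findRoot, findLog, findDims, writeGrid, fill, forLoop, Cmd.Within, h, h', e₂, e₃,
    eNodes, eSize, eNumHor, eSrc, eTgt, eFst, eSnd, eRow, eCol]

theorem within_main (c : ℕ) (p : PlanarProblem) : (main c p).Within 64 := by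
  have h : (eN.pow (c + 1)).Within 64 := Expr.within_pow _ _ _ (by simp [eN])
  have hs : (eShift c).Within 64 := by simp [eShift, h]
  have hc : (eCap c).Within 64 := by simp [eCap, hs]
  have hz : eZ.Within 64 := by simp [eZ, e₂, e₃, eD]
  have hd : (eDrop c).Within 64 := by simp [eDrop, e₃, hc]
  have hb : (eBig c).Within 64 := by simp [eBig, e₂, e₃, hc, hd]
  have hp : (ePend c).Within 64 := by simp [ePend, e₂, e₃, hb]
  have hf : (eFar c).Within 64 := by simp [eFar, hb, hp]
  have ho : (eOffset c p).Within 64 := by cases p <;> simp [eOffset, hp, hf]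
  have hN : eN.Within 64 := by simp [eN]
  have h2 : e₂.Within 64 := by simp [e₂]
  have h3 : e₃.Within 64 := by simp [e₃]
  have hD : eD.Within 64 := by simp [eD]
  have hH : eNumHor.Within 64 := by simp [eNumHor, h2, h3]
  have hsz : eSize.Within 64 := by simp [eSize, h2, h3, hH]
  have hr : ∀ x y : Expr, x.Within 64 → y.Within 64 → (eRight x y).Within 64 := by
    intro x y hx hy
    simp [eRight, hx, hy, h2, h3, hz]
  have hhw : ∀ x y : Expr, x.Within 64 → y.Within 64 → (eHorWeight c x y).Within 64 := by
    intro x y hx hy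
    simp [eHorWeight, hx, hy, h2, h3, hr, hp, hf, hc]
  have hvw : ∀ x y : Expr, x.Within 64 → y.Within 64 → (eVerWeight c x y).Within 64 := by
    intro x y hx hy
    simp [eVerWeight, hx, hy, h2, hb, hd, hf]
  simp [main, insertAll, fill, forLoop, product, block, rowStep, setRow, queryRow, queryEntry,
    setLoop, Cmd.Within, hs, hc, hz, hd, hb, ho, hN, h2, h3, hD, hH, hsz, eInit, eSign, eAbs,
    eEntry, eWeight, eHor, eVer, hhw, hvw]

theorem apspInput_of_le {n b : ℕ} (w : Fin n → Fin n → WithTop ℤ) (hb : 3 ≤ b) (x : ℕ) :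
    apspInput w b x = 0 := by
  obtain ⟨b, rfl⟩ := Nat.exists_eq_add_of_le' hb
  rfl

theorem input_of_le {N m : ℕ} (G : PlaneGraph N m) {b : ℕ} (hb : 5 ≤ b) (x : ℕ) :
    G.input b x = 0 := by
  obtain ⟨b, rfl⟩ := Nat.exists_eq_add_of_le' hb
  rfl

theorem apspInput_two_le {c n : ℕ} {w : Fin n → Fin n → WithTop ℤ} (hw : GoodInput c n w) (x : ℕ) :
    apspInput w 2 x ≤ shift c n := by
  refine bankOf_le (f := fun a : Fin (n * n) => absCode (w a.divNat a.modNat)) (fun a => ?_) x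
  have h2 : n ^ c ≤ shift c n := by
    unfold shift
    calc n ^ c ≤ n ^ (c + 1) := Nat.pow_le_pow_right hw.1 (by omega)
      _ ≤ 2 * n ^ (c + 1) := by omega
  cases hx : w a.divNat a.modNat with
  | top => simp [absCode]
  | coe z =>
    have := hw.2.1 _ _ z hx
    simp only [absCode]
    zify at h2 ⊢
    exact this.trans h2

theorem grid_coord_le {n₂ n₃ e : ℕ} (he : e ≠ 0) (v) :
    (grid n₂ n₃).x v ≤ ((n₂ + 1 + 1) * (2 * n₃ + 1 + 1)) ^ e ∧
      (grid n₂ n₃).y v ≤ ((n₂ + 1 + 1) * (2 * n₃ + 1 + 1)) ^ e :=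
  ⟨((Nat.mod_le _ _).trans v.2.le).trans (Nat.le_self_pow he _),
    ((Nat.div_le_self _ _).trans v.2.le).trans (Nat.le_self_pow he _)⟩

/-- The time of the program, in terms of the number `L` of squarings. -/
noncomputable def time (u q : ℕ → ℝ) (a n r K j L : ℕ) : ℝ :=
  n + mainCost n (rows r K j) (cols r j) (blocks n r K j) L + (nodes r K j : ℝ) ^ a +
    mainCost n (rows r K j) (cols r j) (blocks n r K j) L * u (nodes r K j) +
    mainQueries (rows r K j) (cols r j) (blocks n r K j) L * q (nodes r K j)

theorem total_le {x y s n T C X : ℕ} {A U Q : ℝ} (hA : 0 ≤ A) (hU : 0 ≤ U) (hQ : 0 ≤ Q)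
    (h : x ≤ s * (400 * n) + s * T + y) (h' : (y : ℝ) ≤ C * (A + X * U + Q))
    (hX : X ≤ 2 * T) :
    (x : ℝ) ≤ (400 * s + 2 * C : ℕ) * (n + T + A + T * U + Q) := by
  have h1 : (x : ℝ) ≤ s * (400 * n) + s * T + y := by exact_mod_cast h
  have h2 : (X : ℝ) * U ≤ 2 * T * U := mul_le_mul_of_nonneg_right (by exact_mod_cast hX) hU
  have h3 : (y : ℝ) ≤ C * (2 * (A + T * U + Q)) :=
    h'.trans (mul_le_mul_of_nonneg_left (by linarith) (Nat.cast_nonneg _))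
  have e1 : 0 ≤ s * (A + T * U + Q) := by positivity
  have e2 : (0 : ℝ) ≤ C * (n + T) := by positivity
  have e3 : (0 : ℝ) ≤ s * T := by positivity
  push_cast
  linarith

theorem exists_solvesIn {p : PlanarProblem} {u q : ℕ → ℝ} {D : DynAlg} {a c k C E K j : ℕ}
    (hD : D.Solves p u q a (weightExp E c) k C) (hE : E ≠ 0) (hK : K ≠ 0) (hKE : K ≤ E)
    (hj : j ≤ K) : ∃ k' C' : ℕ, ∀ (n : ℕ) (w : Fin n → Fin n → WithTop ℤ), GoodInput c n w →
      0 ≤ u (nodes (root E n) K j) → 0 ≤ q (nodes (root E n) K j) →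
      ∃ t L, SolvesIn (program D E K j c p) k' w t ∧ 2 ^ L < 2 * n ∧
        (t : ℝ) ≤ C' * time u q a n (root E n) K j L := by
  set s := (setup E K j).size + (main c p).size with hs
  -- The first summand of the exponent is for the values in expressions of the caller. The second is
  -- for the dynamic algorithm, since the number of nodes and operations is below `(n + 2) ^ 38`.
  -- The setup takes at most `s * (400 * n)` steps, and `2 * C` reflects that a step of the caller
  -- makes up to two updates.
  refine ⟨(c + 20) * s + 38 * k, 400 * s + 2 * C, fun n w hw hu hq => ?_⟩
  have hn := hw.1
  set r := root E n with hrdef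
  have hr : 1 ≤ r := one_le_root hE hn
  have hrK : r ^ K ≤ n := (Nat.pow_le_pow_right hr hKE).trans (root_pow_le hE)
  set V := (n + 2) ^ (c + 20) with hV
  set B := (n + 2) ^ ((c + 20) * s + 38 * k) with hB
  have hBd := bounds_of_root (c := c) (V := V) hE hn hK hj hKE le_rfl
  rw [← hrdef] at hBd
  have hN : nodes r K j ≤ 16 * n := by rw [nodes_eq hr hj]; omega
  have hM := size_le_nodes (r := r) (K := K) (j := j)
  have hV1 : 32 * n ≤ V := by
    have := mul_pow_le (n := n) (C := 32) (κ := 4) (e := 1) (by norm_num) hn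
    rw [pow_one] at this
    have h' : (n + 2) ^ (4 + 1) ≤ V := Nat.pow_le_pow_right (by omega) (by omega)
    omega
  have hVs : ∀ {x}, x ≤ s → V ^ x ≤ B := fun h => by
    rw [hV, ← pow_mul, hB]
    exact Nat.pow_le_pow_right (by omega) ((Nat.mul_le_mul_left _ h).trans (Nat.le_add_right _ _))
  have hV2 : 2 ≤ V := by omega
  have h₀ : ∀ lim, (apspInput w).BoundedBy V lim := fun lim b _ x =>
    (hw.bounded b x).trans (Nat.pow_le_pow_right (by omega) (by omega))
  obtain ⟨t₁, τ₁, σ₁, x₁, y₁, ⟨-, env, hL, hL', hin, hfr⟩, bd₁, z₁, z₁'⟩ :=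
    (Does.setup (val := fun cur => singletonGraph.value cur .stShortestPath) (W := 0)
      (cur := fun _ => ⊤) (σ := apspInput w) (V := V) (n := n) (E := E) (K := K) (j := j)
      (by simp [apspInput, bankOf]) hn (fun b hb x => apspInput_of_le w (by omega) x) (by omega)
      (by change nodes r K j ≤ V; omega) (by rw [← hrdef]; omega)).exec_plain (lim := 70) (B := B)
      hV2 (within_setup E K j) (h₀ _) (hVs (by omega))
  rw [← hrdef] at env hin y₁
  change t₁ ≤ (setup E K j).size * (n * 7 + nodes r K j * 6 + _ + 19) at y₁
  have bd₁' : τ₁.BoundedBy V 64 := fun b hb x => by rw [z₁ b (by omega)]; exact bd₁ b (by omega) x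
  have hfr' : ∀ b, b < 10 ∨ 16 < b ∧ b < 64 → τ₁ b = apspInput w b := fun b hb => by
    rw [z₁ b (by omega), hfr b hb]
  -- The setup treats the banks up to 69 as its own in order to write the input of the dynamic
  -- algorithm, which starts at bank 64; all further banks are still zero.
  have hin' : ∀ b, τ₁ (b + 64) = (grid (rows r K j) (cols r j)).input b := fun b => by
    by_cases hb : b < 6
    · rw [z₁ _ (by omega), hin]
    · rw [z₁' _ (by omega)]
      funext x
      rw [apspInput_of_le w (by omega), input_of_le _ (by omega)]
  have env' : Env n (rows r K j) (cols r j) (blocks n r K j) τ₁ :=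
      env.congr fun b hb => z₁ b (by omega)
  set L := τ₁ 13 0 with hLdef
  rw [← z₁ 13 (by omega), ← hLdef] at hL hL'
  have hLn : L ≤ 2 * n := (Nat.lt_two_pow_self.trans hL').le
  obtain ⟨l, t, σ₂, cur₂, run, ht, hQ, hpost⟩ := Does.main hBd env' p hLdef.symm (by omega)
    (fun x => by rw [hfr' 2 (by omega)]; exact apspInput_two_le hw x)
    (fun x => by rw [hfr' 20 (by omega)]; exact apspInput_of_le w (by omega) x)
    (fun x => by rw [hfr' 21 (by omega)]; exact apspInput_of_le w (by omega) x)
  have hmain := mainCost_le (d := blocks n r K j) (L := L) (one_le_rows (K := K) (j := j) hr)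
    (one_le_cols (j := j) hr) hn (dim_le hj hrK) hN hLn
  set T := mainCost n (rows r K j) (cols r j) (blocks n r K j) L with hT
  have hlen := run.length_le
  have hvalid := run.validOps [] trivial
  rw [List.append_nil] at hvalid
  obtain ⟨t₀, tD, δ, d₁, d₂, d₃⟩ := hD _ _ (grid (rows r K j) (cols r j))
    (grid_coord_le (by unfold weightExp; omega)) l hvalid
  have hBB : (nodes r K j + l.length + 2) ^ k ≤ B := by
    have h1 : nodes r K j + l.length + 2 ≤ (n + 2) ^ 38 := by
      have h2 : (n + 2) ^ 35 * 3 ^ 3 ≤ (n + 2) ^ 35 * (n + 2) ^ 3 :=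
        Nat.mul_le_mul_left _ (Nat.pow_le_pow_left (by omega) 3)
      rw [← pow_add, show 35 + 3 = 38 from rfl] at h2
      have h3 : n + 2 ≤ (n + 2) ^ 35 := Nat.le_self_pow (by omega) _
      omega
    calc _ ≤ ((n + 2) ^ 38) ^ k := Nat.pow_le_pow_left h1 k
      _ ≤ B := by rw [← pow_mul, hB]; exact Nat.pow_le_pow_right (by omega) (by omega)
  obtain ⟨τ₂, x₂, y₂, z₂⟩ := (d₁.mono hBB).shift hin'
  obtain ⟨τ₃, δ', t₃, tD₁, tD₂, x₃, y₃, e₃, z₃, -, -, -⟩ := run.simulate (D := D) (lim := 64)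
    (B := B) hV2 (s := s) (within_main c p) bd₁' (by omega) (hVs le_rfl) τ₂ δ [] tD z₂ y₂
    (by rw [List.append_nil]; exact d₂.mono hBB)
  refine ⟨t₁ + (t₀ + t₃), L, ⟨τ₃, .seq x₁ (.seq x₂ x₃), ?_⟩, hL', ?_⟩
  · refine apspOutput_of_main (c := c) (Z := rows r K j * cols r j * blocks n r K j) (L := L)
      (le_dim hr) hn hw.2.2 hw.2.1 hL'.le hL ?_
    rw [z₃ 3 (by omega), z₃ 4 (by omega)]
    intro x hx
    have := hpost x hx
    rwa [hfr' 1 (by omega), hfr' 2 (by omega)] at this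
  · have hU : (l.countP fun o => !o.isQuery) ≤ 2 * T :=
      List.countP_le_length.trans (hlen.trans (by omega))
    have hst : t₁ ≤ s * (400 * n) :=
      y₁.trans (Nat.mul_le_mul (by omega) (by omega))
    have hst' : s * t ≤ s * T := Nat.mul_le_mul_left _ ht
    have htot : t₁ + (t₀ + t₃) ≤ s * (400 * n) + s * T + (t₀ + tD) := by omega
    have hQ' : ((l.countP fun o => o.isQuery : ℕ) : ℝ) * q (nodes r K j) ≤
        mainQueries (rows r K j) (cols r j) (blocks n r K j) L * q (nodes r K j) :=
      mul_le_mul_of_nonneg_right (by exact_mod_cast hQ) hq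
    have hQ0 : 0 ≤ (mainQueries (rows r K j) (cols r j) (blocks n r K j) L : ℝ) *
      q (nodes r K j) := mul_nonneg (Nat.cast_nonneg _) hq
    have hA : (0 : ℝ) ≤ (nodes r K j : ℝ) ^ a := pow_nonneg (Nat.cast_nonneg _) _
    have d₄ := d₃.trans
      (mul_le_mul_of_nonneg_left (add_le_add le_rfl hQ') (Nat.cast_nonneg C))
    exact total_le hA hu hQ0 htot d₄ hU

end Driver

/-! ### Lower bounds on the time of dynamic algorithms -/

open WordRAM

/-- Insert an edge and delete it again, `k` times. -/
def toggles {m : ℕ} (e : Fin m) : ℕ → List (DynOp m)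
  | 0 => []
  | k + 1 => .insert e 0 :: .delete e :: toggles e k

theorem length_toggles {m : ℕ} (e : Fin m) (k : ℕ) : (toggles e k).length = 2 * k := by
  induction k with
  | zero => rfl
  | succ k ih => rw [toggles, List.length_cons, List.length_cons, ih]; ring

theorem countP_toggles {m : ℕ} (e : Fin m) (k : ℕ) :
    (toggles e k).countP (fun o => !o.isQuery) = 2 * k ∧
      (toggles e k).countP (fun o => o.isQuery) = 0 := by
  induction k with
  | zero => exact ⟨rfl, rfl⟩
  | succ k ih =>
    constructor
    · rw [toggles, List.countP_cons_of_pos (by rfl), List.countP_cons_of_pos (by rfl), ih.1]; ring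
    · rw [toggles, List.countP_cons_of_neg (by simp [DynOp.isQuery]),
        List.countP_cons_of_neg (by simp [DynOp.isQuery]), ih.2]

theorem validOps_toggles {m W : ℕ} (e : Fin m) (k : ℕ) :
    ValidOps W (fun _ => ⊤) (toggles e k) := by
  induction k with
  | zero => trivial
  | succ k ih =>
    refine ⟨rfl, Nat.zero_le _, by simp, ?_⟩
    rw [Function.update_idem]
    rwa [Function.update_eq_self_iff.2 rfl]

theorem one_le_of_linear_le {C B x : ℝ} (h : ∀ k : ℕ, (2 * k : ℕ) ≤ C * (B + (2 * k : ℕ) * x)) :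
    1 ≤ C * x := by
  by_contra hx
  obtain ⟨k, hk⟩ := exists_nat_gt (C * B / (1 - C * x))
  rw [div_lt_iff₀ (by linarith)] at hk
  have h1 := h k
  push_cast at h1
  nlinarith [mul_nonneg (Nat.cast_nonneg (α := ℝ) k) (sub_nonneg.2 (not_le.1 hx).le)]

section

variable {D : DynAlg} {p : PlanarProblem} {u q : ℕ → ℝ} {a c k C N m : ℕ} {G : PlaneGraph N m}

/-- Every operation takes at least one step. An edge can be toggled arbitrarily often, and for fixed
N the preprocessing term does not grow, so it cannot pay for these steps. -/
theorem DynAlg.Solves.one_le_update (h : D.Solves p u q a c k C)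
    (hG : ∀ v, G.x v ≤ N ^ c ∧ G.y v ≤ N ^ c) (hm : 0 < m) : 1 ≤ C * u N := by
  refine one_le_of_linear_le (B := (N : ℝ) ^ a) fun i => ?_
  obtain ⟨t₀, t, σ, -, h1, h2⟩ := h N m G hG (toggles ⟨0, hm⟩ i) (validOps_toggles _ _)
  have h3 := h1.length_le
  rw [length_toggles] at h3
  rw [(countP_toggles _ i).1, (countP_toggles _ i).2, Nat.cast_zero, zero_mul, add_zero] at h2
  refine le_trans ?_ h2
  exact_mod_cast h3.trans (Nat.le_add_left _ _)

end

/-! ### The running time -/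

namespace Driver

open Gadget

section

variable {K j n r L : ℕ}

theorem blocks_mul_le (hr : 1 ≤ r) (hj : j ≤ K) (hK : r ^ K ≤ n) :
    blocks n r K j * r ^ K ≤ 9 * n := by
  have h1 : r ^ (K - j) ≤ rows r K j := by
    have : 1 ≤ r ^ (K - j) := Nat.one_le_pow _ _ hr
    unfold rows; omega
  have h2 : r ^ j ≤ cols r j := by
    have : 1 ≤ r ^ j := Nat.one_le_pow _ _ hr
    unfold cols; omega
  refine le_trans ?_ (dim_le (n := n) hj hK)
  rw [mul_comm]
  refine Nat.mul_le_mul_right _ ?_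
  calc r ^ K = r ^ (K - j) * r ^ j := by rw [← pow_add, Nat.sub_add_cancel hj]
    _ ≤ _ := Nat.mul_le_mul h1 h2

/-- In each squaring, each of the Z² entries is queried once for every block of summation indices,
and there are d n₃ such blocks. -/
theorem mainQueries_le (hj : j ≤ K) (hK : r ^ K ≤ n) :
    mainQueries (rows r K j) (cols r j) (blocks n r K j) L ≤
      162 * L * n ^ 2 * (blocks n r K j * r ^ j) := by
  have hZ := dim_le (n := n) hj hK
  have h2 : cols r j ≤ 2 * r ^ j := by unfold cols; omega
  calc mainQueries (rows r K j) (cols r j) (blocks n r K j) L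
      = L * ((rows r K j * cols r j * blocks n r K j) * (rows r K j * cols r j * blocks n r K j) *
        (blocks n r K j * cols r j)) := by unfold mainQueries; ring
    _ ≤ L * ((9 * n) * (9 * n) * (blocks n r K j * (2 * r ^ j))) := by gcongr
    _ = _ := by ring

/-- A squaring consists of `(n₃ * d) * (n₂ * d)` blocks, each with a rewriting of all edges and
about `n₂ + n₃` steps for every row. The rewriting is of lower order, since `d` times the number of
edges is O(n); the row work gives the factor `d * (r ^ (K - j) + r ^ j)`. -/
theorem mainCost_le_blocks (hr : 1 ≤ r) (hj : j ≤ K) (hK : r ^ K ≤ n) :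
    mainCost n (rows r K j) (cols r j) (blocks n r K j) L ≤
      11000 * (L + 1) * n ^ 2 * (1 + blocks n r K j * (r ^ (K - j) + r ^ j)) := by
  have hZ := dim_le (n := n) hj hK
  have hd := blocks_mul_le (n := n) hr hj hK
  have h2 : rows r K j ≤ 4 * r ^ (K - j) := by unfold rows; omega
  have h3 : cols r j ≤ 2 * r ^ j := by unfold cols; omega
  have hR : 1 ≤ r ^ (K - j) := Nat.one_le_pow _ _ hr
  have hrK : 1 ≤ r ^ K := Nat.one_le_pow _ _ hr
  have hn : 1 ≤ n := hrK.trans hK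
  have hs : Gadget.size (rows r K j) (cols r j) ≤ 32 * r ^ K :=
    (size_le_nodes (r := r) (K := K) (j := j)).trans (by rw [nodes_eq hr hj]; omega)
  have hc : cols r j * blocks n r K j ≤ 9 * n := by
    refine le_trans ?_ hZ
    rw [mul_assoc]
    exact Nat.le_mul_of_pos_left _ (one_le_rows hr)
  have hd' : blocks n r K j ≤ 9 * n := (Nat.le_mul_of_pos_right _ hrK).trans hd
  generalize rows r K j = a at *
  generalize cols r j = b at *
  generalize blocks n r K j = d at *
  generalize r ^ (K - j) = R at *
  generalize r ^ j = S at *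
  generalize hrK' : r ^ K = N at *
  have hn2 : n ≤ n ^ 2 := Nat.le_self_pow (by omega) n
  have hn3 : 1 ≤ n ^ 2 := by omega
  have hds : d * Gadget.size a b ≤ 288 * n := by
    calc d * Gadget.size a b ≤ d * (32 * N) := Nat.mul_le_mul_left _ hs
      _ = 32 * (d * N) := by ring
      _ ≤ 32 * (9 * n) := Nat.mul_le_mul_left _ hd
      _ = _ := by ring
  have hpc : productCost a b d ≤ 10000 * n ^ 2 + 1458 * n ^ 2 * (d * (R + S)) := by
    calc productCost a b d = (a * b * d) * (3 * (d * Gadget.size a b)) +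
          (a * b * d) * (a * b * d) * (d * (3 * a + 8 * b + 6)) + 6 * ((a * b * d) * d) +
          4 * (b * d) + 6 * ((a * b * d) * (a * b * d)) + 6 := by
          unfold productCost blockCost; ring
      _ ≤ (9 * n) * (3 * (288 * n)) +
          (9 * n) * (9 * n) * (d * (3 * (4 * R) + 8 * (2 * S) + 6 * R)) + 6 * ((9 * n) * (9 * n)) +
          4 * (9 * n) + 6 * ((9 * n) * (9 * n)) + 6 := by gcongr; omega
      _ = 8748 * n ^ 2 + 36 * n + 6 + 81 * n ^ 2 * (d * (18 * R + 16 * S)) := by ring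
      _ ≤ 8748 * n ^ 2 + 36 * n + 6 + 81 * n ^ 2 * (d * (18 * (R + S))) := by gcongr; omega
      _ = 8748 * n ^ 2 + 36 * n + 6 + 1458 * n ^ 2 * (d * (R + S)) := by ring
      _ ≤ _ := by omega
  calc mainCost n a b d L = Gadget.size a b * 3 + (a * b * d) * (a * b * d) * 3 +
        L * (productCost a b d + 2) + n * n * 6 + 10 := rfl
    _ ≤ 32 * n * 3 + (9 * n) * (9 * n) * 3 +
        L * (10000 * n ^ 2 + 1458 * n ^ 2 * (d * (R + S)) + 2) + n * n * 6 + 10 := by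
        gcongr; omega
    _ = L * (10000 * n ^ 2 + 2) + L * (1458 * n ^ 2 * (d * (R + S))) + 249 * n ^ 2 + 96 * n +
        10 := by
        ring
    _ ≤ L * (11000 * n ^ 2) + (L + 1) * (11000 * n ^ 2 * (d * (R + S))) + 11000 * n ^ 2 := by
        have e1 : L * (10000 * n ^ 2 + 2) ≤ L * (11000 * n ^ 2) :=
          Nat.mul_le_mul_left _ (by omega)
        have e2 : L * (1458 * n ^ 2 * (d * (R + S))) ≤
            (L + 1) * (11000 * n ^ 2 * (d * (R + S))) := by
          gcongr <;> omega
        omega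
    _ = _ := by ring

/-- Multiplied by r, each part of the running time is O((L + 1) n³). Updates and queries are
controlled by `h` and by the estimate of the number of blocks times `r ^ K` by O(n), and the
preprocessing by `hn`, which makes it linear in n. -/
theorem time_le {u q : ℕ → ℝ} {a A C : ℕ} {Φ : ℝ} (hr : 1 ≤ r) (hj : j ≤ K) (hK : K ≠ 0)
    (hA : a ≤ A) (hn : r ^ (K * A) ≤ n) (hKn : r ^ K ≤ n)
    (hu : 1 ≤ C * u (nodes r K j)) (hu' : 0 ≤ u (nodes r K j))
    (huq : u (nodes r K j) ≤ q (nodes r K j))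
    (h : (r : ℝ) * ((r : ℝ) ^ (K - j) * u (nodes r K j) + (r : ℝ) ^ j * q (nodes r K j)) ≤
      Φ * (r : ℝ) ^ K) :
    r * time u q a n r K j L ≤ (1 + 16 ^ a + 200000 * (C + 1) * Φ) * ((L + 1) * n ^ 3) := by
  have hc : (mainCost n (rows r K j) (cols r j) (blocks n r K j) L : ℝ) ≤
      11000 * (L + 1) * n ^ 2 * (1 + blocks n r K j * (r ^ (K - j) + r ^ j)) := by
    exact_mod_cast mainCost_le_blocks (n := n) (L := L) hr hj hKn
  have hq : (mainQueries (rows r K j) (cols r j) (blocks n r K j) L : ℝ) ≤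
      162 * L * n ^ 2 * (blocks n r K j * r ^ j) := by
    exact_mod_cast mainQueries_le (n := n) (L := L) hj hKn
  have hd : (blocks n r K j : ℝ) * (r : ℝ) ^ K ≤ 9 * n := by
    exact_mod_cast blocks_mul_le hr hj hKn
  have hN : (nodes r K j : ℝ) ^ a ≤ 16 ^ a * n := by
    rw [nodes_eq hr hj]
    have h1 : r ^ (K * a) ≤ n :=
      (Nat.pow_le_pow_right hr (Nat.mul_le_mul_left _ hA)).trans hn
    have h2 : (16 * r ^ K) ^ a ≤ 16 ^ a * n := by
      rw [mul_pow, ← pow_mul]; exact Nat.mul_le_mul_left _ h1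
    exact_mod_cast h2
  have hrn : (r : ℝ) ≤ n := by exact_mod_cast (Nat.le_self_pow hK r).trans hKn
  have hr1 : (1 : ℝ) ≤ r := by exact_mod_cast hr
  have hKn' : (r : ℝ) ^ K ≤ n := by exact_mod_cast hKn
  have hR : (1 : ℝ) ≤ (r : ℝ) ^ (K - j) := one_le_pow₀ hr1
  have hS : (1 : ℝ) ≤ (r : ℝ) ^ j := one_le_pow₀ hr1
  have hP : (1 : ℝ) ≤ (r : ℝ) ^ K := one_le_pow₀ hr1
  have hL : (0 : ℝ) ≤ L := Nat.cast_nonneg _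
  have hB : (0 : ℝ) ≤ (nodes r K j : ℝ) ^ a := pow_nonneg (Nat.cast_nonneg _) _
  have hM : (0 : ℝ) ≤ mainCost n (rows r K j) (cols r j) (blocks n r K j) L := Nat.cast_nonneg _
  unfold time
  generalize (mainCost n (rows r K j) (cols r j) (blocks n r K j) L : ℝ) = M at *
  generalize (mainQueries (rows r K j) (cols r j) (blocks n r K j) L : ℝ) = Q at *
  have hd0 : (0 : ℝ) ≤ blocks n r K j := Nat.cast_nonneg _
  generalize (blocks n r K j : ℝ) = d at *
  generalize (nodes r K j : ℝ) ^ a = B at *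
  generalize u (nodes r K j) = x at *
  generalize q (nodes r K j) = y at *
  generalize (r : ℝ) ^ (K - j) = R at *
  generalize (r : ℝ) ^ j = S at *
  generalize (r : ℝ) ^ K = P at *
  clear hn hKn
  have hn1 : (1 : ℝ) ≤ n := hr1.trans hrn
  generalize (n : ℝ) = n at *
  generalize (r : ℝ) = r at *
  generalize (L : ℝ) = L at *
  have hC : (0 : ℝ) ≤ C := Nat.cast_nonneg _
  generalize (C : ℝ) = C at *
  have hy : 0 ≤ y := hu'.trans huq
  have hΦ : 0 ≤ Φ := by
    refine nonneg_of_mul_nonneg_left (le_trans ?_ h) (by linarith : 0 < P)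
    positivity
  have hSy : r * (S * y) ≤ Φ * P := by
    refine le_trans ?_ h
    gcongr
    exact le_add_of_nonneg_left (by positivity)
  have hn2 : n ≤ n ^ 2 := by nlinarith
  have hn3 : n ^ 2 ≤ n ^ 3 := by nlinarith [sq_nonneg n]
  have hLn : n ^ 3 ≤ (L + 1) * n ^ 3 := le_mul_of_one_le_left (by positivity) (by linarith)
  have e1 : r * n ≤ (L + 1) * n ^ 3 := by nlinarith
  have e2 : r * B ≤ 16 ^ a * ((L + 1) * n ^ 3) := by
    calc r * B ≤ n * (16 ^ a * n) := by gcongr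
      _ = 16 ^ a * n ^ 2 := by ring
      _ ≤ _ := by gcongr; linarith
  have e3 : r * (Q * y) ≤ 1458 * Φ * ((L + 1) * n ^ 3) := by
    calc r * (Q * y) ≤ r * (162 * L * n ^ 2 * (d * S) * y) := by gcongr
      _ = 162 * L * n ^ 2 * (d * (r * (S * y))) := by ring
      _ ≤ 162 * L * n ^ 2 * (d * (Φ * P)) := by gcongr
      _ = 162 * L * n ^ 2 * (Φ * (d * P)) := by ring
      _ ≤ 162 * (L + 1) * n ^ 2 * (Φ * (9 * n)) := by gcongr; linarith
      _ = _ := by ring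
  have e4 : r * (M * x) ≤ 110000 * Φ * ((L + 1) * n ^ 3) := by
    have e5 : r * x ≤ Φ * n := by
      calc r * x ≤ r * (R * x + S * y) := by
            gcongr
            nlinarith [mul_nonneg (by linarith : 0 ≤ S) hy]
        _ ≤ Φ * P := h
        _ ≤ _ := by gcongr
    calc r * (M * x) ≤ r * (11000 * (L + 1) * n ^ 2 * (1 + d * (R + S)) * x) := by gcongr
      _ = 11000 * (L + 1) * n ^ 2 * (r * x + d * (r * (R * x + S * x))) := by ring
      -- The updates that accompany the queries are charged to the queries, as u is at most q.
      _ ≤ 11000 * (L + 1) * n ^ 2 * (Φ * n + d * (r * (R * x + S * y))) := by gcongr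
      _ ≤ 11000 * (L + 1) * n ^ 2 * (Φ * n + d * (Φ * P)) := by gcongr
      _ = 11000 * (L + 1) * n ^ 2 * (Φ * n + Φ * (d * P)) := by ring
      _ ≤ 11000 * (L + 1) * n ^ 2 * (Φ * n + Φ * (9 * n)) := by gcongr
      _ = _ := by ring
  -- The steps of the caller itself are charged to the updates, since u is at least 1 / C.
  have e6 : r * M ≤ C * (110000 * Φ * ((L + 1) * n ^ 3)) := by
    calc r * M ≤ r * M * (C * x) := le_mul_of_one_le_right (by positivity) hu
      _ = C * (r * (M * x)) := by ring
      _ ≤ _ := by gcongr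
  have e7 : 0 ≤ Φ * ((L + 1) * n ^ 3) := by positivity
  have e8 : 0 ≤ C * (Φ * ((L + 1) * n ^ 3)) := by positivity
  linarith

end

end Driver

open WordRAM

/-! ### The choice of the shape and the total time -/

/-- Parallel execution of finitely many programs. -/
theorem WordRAM.exists_race_family (c : ℕ) (P : ℕ → Prog) (k : ℕ → ℕ) (J : ℕ) :
    ∃ (P' : Prog) (k' C : ℕ), ∀ (n : ℕ) (w : Fin n → Fin n → WithTop ℤ), GoodInput c n w →
      ∀ t : ℕ → ℕ, (∀ j ≤ J, SolvesIn (P j) (k j) w (t j)) →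
      ∃ t', SolvesIn P' k' w t' ∧ ∀ j ≤ J, t' ≤ C * (t j + n * n) := by
  induction J with
  | zero =>
    refine ⟨P 0, k 0, 1, fun n w _ t h => ⟨t 0, h 0 le_rfl, fun j hj => ?_⟩⟩
    obtain rfl : j = 0 := by omega
    omega
  | succ J ih =>
    obtain ⟨P₁, k₁, C₁, h₁⟩ := ih
    obtain ⟨P₂, k₂, C₂, h₂⟩ := exists_race c P₁ (P (J + 1)) k₁ (k (J + 1))
    refine ⟨P₂, k₂, C₂ * (C₁ + 1), fun n w hw t h => ?_⟩
    obtain ⟨t₁, s₁, l₁⟩ := h₁ n w hw t fun j hj => h j (by omega)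
    obtain ⟨t₂, s₂, l₂⟩ := h₂ n w hw t₁ (t (J + 1)) s₁ (h _ le_rfl)
    refine ⟨t₂, s₂, fun j hj => l₂.trans ?_⟩
    rw [mul_assoc]
    refine Nat.mul_le_mul_left _ ?_
    rw [add_mul, one_mul]
    rcases Nat.le_succ_iff_eq_or_le.1 hj with rfl | hj
    · have := min_le_right t₁ (t (J + 1))
      exact le_add_of_nonneg_of_le (Nat.zero_le _) (Nat.add_le_add_right this _)
    · have h3 := min_le_left t₁ (t (J + 1))
      have h4 := l₁ j hj
      exact Nat.add_le_add (h3.trans h4) (Nat.le_add_left _ _)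

/-- Take the largest shape j for which the query part is small. Either j = K, where the update part
is dominated by the query part, or the query part for j + 1 is too large; as the product of the
update part for j and the query part for j + 1 is bounded, the update part is then small. Two of the
three factors r give the gain r in both parts, and the third pays for the step from j to j + 1. -/
theorem exists_balanced {r x y C δ : ℝ} {K : ℕ} (hr : 1 ≤ r) (hδ : 0 < δ) (hx : δ ≤ x)
    (hxy : x ≤ y) (h : x * y * r ^ 3 ≤ C * r ^ K) :
    ∃ j ≤ K, r * (r ^ (K - j) * x + r ^ j * y) ≤ (2 * (C / δ) + δ) * r ^ K := by
  classical
  have hx0 : 0 < x := hδ.trans_le hx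
  have hy : 0 < y := hx0.trans_le hxy
  have hP : 0 < r ^ K := by positivity
  have hr0 : 0 < r := by linarith
  have hY : 0 < C / δ * r ^ K := by
    rw [div_mul_eq_mul_div]
    exact div_pos ((by positivity : 0 < x * y * r ^ 3).trans_le h) hδ
  -- The shape 0 qualifies because x is bounded away from 0.
  have h₀ : r * (r ^ 0 * y) ≤ C / δ * r ^ K := by
    rw [div_mul_eq_mul_div, le_div_iff₀ hδ, pow_zero, one_mul]
    refine le_trans ?_ h
    calc r * y * δ ≤ r ^ 3 * y * x := by
          gcongr
          exact le_self_pow₀ hr (by norm_num)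
      _ = _ := by ring
  set j := Nat.findGreatest (fun j => r * (r ^ j * y) ≤ C / δ * r ^ K) K with hj
  have hjK : j ≤ K := Nat.findGreatest_le K
  have h₁ : r * (r ^ j * y) ≤ C / δ * r ^ K :=
    Nat.findGreatest_spec (P := fun j => r * (r ^ j * y) ≤ C / δ * r ^ K) (Nat.zero_le K) h₀
  refine ⟨j, hjK, ?_⟩
  rcases hjK.eq_or_lt with hK | hK
  · rw [hK] at h₁ ⊢
    have h₂ : r * x ≤ r * (r ^ K * y) := by
      gcongr
      exact hxy.trans (le_mul_of_one_le_left hy.le (one_le_pow₀ hr))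
    rw [Nat.sub_self, pow_zero, one_mul, mul_add]
    nlinarith
  · have h₂ : C / δ * r ^ K < r * (r ^ (j + 1) * y) := not_le.1 (Nat.findGreatest_is_greatest
      (P := fun j => r * (r ^ j * y) ≤ C / δ * r ^ K) (Nat.lt_succ_self _) hK)
    -- The powers `r ^ (K - j)` and `r ^ j` multiply to `r ^ K` and leave `x * y * r ^ 3`.
    have h₃ : r * (r ^ (K - j) * x) * (r * (r ^ (j + 1) * y)) ≤ δ * r ^ K * (C / δ * r ^ K) := by
      calc r * (r ^ (K - j) * x) * (r * (r ^ (j + 1) * y))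
          = (r ^ (K - j) * r ^ j) * (x * y * r ^ 3) := by ring
        _ = r ^ K * (x * y * r ^ 3) := by rw [← pow_add, Nat.sub_add_cancel hjK]
        _ ≤ r ^ K * (C * r ^ K) := by gcongr
        _ = _ := by field_simp
    have h₄ : r * (r ^ (K - j) * x) ≤ δ * r ^ K := by
      by_contra hlt
      have := mul_lt_mul'' (not_le.1 hlt) h₂ (by positivity) hY.le
      linarith
    nlinarith

/-- Dividing by the root saves a power of `n`. -/
theorem exists_log_mul_le {E : ℕ} (hE : E ≠ 0) : ∃ C : ℝ, 0 ≤ C ∧ ∀ n r L : ℕ, 1 ≤ r →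
    n < (r + 1) ^ E → 1 ≤ n → 2 ^ L < 2 * n →
    (L + 1) * (n : ℝ) ^ 3 ≤ r * (C * (n : ℝ) ^ (3 - 1 / (2 * E) : ℝ)) := by
  -- Half of the exponent 1 / E gained by dividing by r: the other half pays for the logarithmic
  -- factor.
  set η : ℝ := 1 / (2 * E) with hη
  have hE1 : (1 : ℝ) ≤ E := by exact_mod_cast Nat.one_le_iff_ne_zero.2 hE
  have hη0 : 0 < η := by positivity
  have hη1 : η ≤ 1 := by
    rw [hη, div_le_one (by positivity)]; linarith
  have hlog : 0 < Real.log 2 := Real.log_pos (by norm_num)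
  set C : ℝ := 2 / η / Real.log 2 + 1 with hC
  have hC0 : 0 ≤ C := by positivity
  refine ⟨2 * C, by positivity, fun n r L hr hn hn1 hL => ?_⟩
  have hn1' : (1 : ℝ) ≤ n := by exact_mod_cast hn1
  have hn0 : (0 : ℝ) < n := by linarith
  have h1 : (1 : ℝ) ≤ (n : ℝ) ^ η := Real.one_le_rpow hn1' hη0.le
  have h2 : (L : ℝ) + 1 ≤ C * (n : ℝ) ^ η := by
    have h3 : (L : ℝ) * Real.log 2 ≤ Real.log (2 * n) := by
      rw [← Real.log_pow]
      exact Real.log_le_log (by positivity) (by exact_mod_cast hL.le)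
    have h4 := Real.log_le_rpow_div (x := 2 * (n : ℝ)) (by positivity) hη0
    have h5 : (2 * (n : ℝ)) ^ η ≤ 2 * (n : ℝ) ^ η := by
      rw [Real.mul_rpow (by norm_num) hn0.le]
      gcongr
      exact (Real.rpow_le_rpow_of_exponent_le (by norm_num) hη1).trans_eq (Real.rpow_one 2)
    have h6 : (L : ℝ) * Real.log 2 ≤ 2 * (n : ℝ) ^ η / η :=
      h3.trans (h4.trans (div_le_div_of_nonneg_right h5 hη0.le))
    have h7 : (L : ℝ) ≤ 2 * (n : ℝ) ^ η / η / Real.log 2 := (le_div_iff₀ hlog).2 h6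
    rw [hC, add_mul, one_mul]
    refine add_le_add (h7.trans_eq ?_) h1
    ring
  have h3 : (n : ℝ) ^ (2 * η) ≤ 2 * r := by
    have h4 : (n : ℝ) ≤ (2 * r : ℝ) ^ E := by
      have : n ≤ (2 * r) ^ E := hn.le.trans (Nat.pow_le_pow_left (by omega) E)
      exact_mod_cast this
    have h5 : 2 * η = (E : ℝ)⁻¹ := by rw [hη]; field_simp
    rw [h5]
    calc (n : ℝ) ^ (E : ℝ)⁻¹ ≤ ((2 * r : ℝ) ^ E) ^ (E : ℝ)⁻¹ := by gcongr
      _ = 2 * r := Real.pow_rpow_inv_natCast (by positivity) hE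
  have h4 : (n : ℝ) ^ η * (n : ℝ) ^ 3 = (n : ℝ) ^ (3 - η) * (n : ℝ) ^ (2 * η) := by
    rw [← Real.rpow_natCast (n : ℝ) 3, ← Real.rpow_add hn0, ← Real.rpow_add hn0]
    congr 1
    push_cast
    ring
  calc (L + 1) * (n : ℝ) ^ 3 ≤ C * (n : ℝ) ^ η * (n : ℝ) ^ 3 := by gcongr
    _ = C * ((n : ℝ) ^ (3 - η) * (n : ℝ) ^ (2 * η)) := by rw [mul_assoc, h4]
    _ ≤ C * ((n : ℝ) ^ (3 - η) * (2 * r)) := by gcongr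
    _ = _ := by ring

/-- By the choice of K, `r ^ 3` is at most the ε-th power of the number of nodes, so it fits into
the gap between the exponents 1 - ε and 1. -/
theorem mul_rpow_le {ε C x y : ℝ} {r K : ℕ} (hr : 1 ≤ r) (hK : 3 ≤ K * ε) (hC : 0 ≤ C)
    (h : y * x ≤ C * ((16 * r ^ K : ℕ) : ℝ) ^ (1 - ε)) :
    x * y * (r : ℝ) ^ 3 ≤ 16 * C * (r : ℝ) ^ K := by
  have hr1 : (1 : ℝ) ≤ r := by exact_mod_cast hr
  have hr0 : (0 : ℝ) ≤ r := by linarith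
  have hε : 0 ≤ ε := by
    by_contra hε
    nlinarith [mul_nonneg (Nat.cast_nonneg (α := ℝ) K) (by linarith : 0 ≤ -ε)]
  have hN : (0 : ℝ) < (16 * r ^ K : ℕ) := by exact_mod_cast (by positivity : 0 < 16 * r ^ K)
  have h1 : (r : ℝ) ^ 3 ≤ ((16 * r ^ K : ℕ) : ℝ) ^ ε := by
    calc (r : ℝ) ^ 3 = (r : ℝ) ^ (3 : ℝ) := by rw [← Real.rpow_natCast]; norm_num
      _ ≤ (r : ℝ) ^ (K * ε) := Real.rpow_le_rpow_of_exponent_le hr1 hK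
      _ = ((r : ℝ) ^ K) ^ ε := by rw [Real.rpow_mul hr0, Real.rpow_natCast]
      _ ≤ _ := by
        refine Real.rpow_le_rpow (by positivity) ?_ hε
        push_cast
        linarith [pow_nonneg hr0 K]
  calc x * y * (r : ℝ) ^ 3 = y * x * (r : ℝ) ^ 3 := by ring
    _ ≤ C * ((16 * r ^ K : ℕ) : ℝ) ^ (1 - ε) * (r : ℝ) ^ 3 := by gcongr
    _ ≤ C * ((16 * r ^ K : ℕ) : ℝ) ^ (1 - ε) * ((16 * r ^ K : ℕ) : ℝ) ^ ε := by gcongr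
    _ = C * (16 * r ^ K : ℕ) := by
      rw [mul_assoc, ← Real.rpow_add hN, sub_add_cancel, Real.rpow_one]
    _ = _ := by push_cast; ring

namespace Driver

/-- Fast dynamic algorithms yield fast algorithms for all pairs shortest paths. -/
theorem apspSolvableIn_of_dynSolvableIn {p : PlanarProblem} {u q : ℕ → ℝ} {ε C₁ : ℝ}
    (hsolv : DynSolvableIn p u q) (hε : 0 < ε) (huq : ∀ N, u N ≤ q N) (hC₁ : 0 ≤ C₁)
    (hbd : ∀ N : ℕ, 1 ≤ N → q N * u N ≤ C₁ * (N : ℝ) ^ (1 - ε)) :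
    ∃ ε' : ℝ, 0 < ε' ∧ APSPSolvableIn fun n => (n : ℝ) ^ (3 - ε') := by
  obtain ⟨a, hsolv⟩ := hsolv
  -- K ε must be at least 3 to obtain the three factors r needed for the balancing.
  obtain ⟨K, hKε⟩ := exists_nat_ge (3 / ε)
  rw [div_le_iff₀ hε] at hKε
  have hK : K ≠ 0 := by
    rintro rfl
    norm_num at hKε
  -- Since `r ^ E` is at most n, the preprocessing time, of order `r ^ (K * a)`, is O(n).
  set E := K * (a + 1) with hEdef
  have hE : E ≠ 0 := Nat.mul_ne_zero hK (by omega)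
  have hKE : K ≤ E := Nat.le_mul_of_pos_right _ (by omega)
  obtain ⟨C₅, hC₅, hlog⟩ := exists_log_mul_le hE
  have hE1 : (1 : ℝ) ≤ E := by exact_mod_cast Nat.one_le_iff_ne_zero.2 hE
  refine ⟨1 / (2 * E), by positivity, fun c => ?_⟩
  -- K and E do not depend on c; only the program and the constants do, as solvability for every
  -- weight bound permits.
  obtain ⟨D, k, C, hD⟩ := hsolv (weightExp E c)
  replace hD : D.Solves p u q a (weightExp E c) k C := hD
  have hs := fun j => exists_solvesIn (c := c) hD hE hK hKE (min_le_right j K)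
  choose k' C' hs using hs
  obtain ⟨P, k'', C'', hP⟩ := exists_race_family c
    (fun j => program D E K (min j K) c p) k' K
  set Φ : ℝ := 2 * (16 * C₁ / (1 / C)) + 1 / C with hΦ
  set X : ℝ := (1 + 16 ^ a + 200000 * (C + 1) * Φ) * C₅ with hX
  have hX0 : 0 ≤ X := by positivity
  -- The good shape varies with n, so the constants of all shapes are added up.
  refine ⟨P, k'', ⌈C'' * ((∑ j ∈ Finset.range (K + 1), C' j : ℕ) * X + 1)⌉₊,
      fun n hn w hw hw' => ?_⟩
  have good : GoodInput c n w := ⟨hn, hw, hw'⟩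
  set r := root E n with hrdef
  have hr : 1 ≤ r := one_le_root hE hn
  have hrE : r ^ E ≤ n := root_pow_le hE
  have hN : ∀ j ≤ K, nodes r K j = 16 * r ^ K := fun j hj => nodes_eq hr hj
  have hu : 1 ≤ C * u (16 * r ^ K) := by
    rw [← hN 0 (by omega)]
    refine hD.one_le_update (G := Gadget.grid (rows r K 0) (cols r 0))
      (grid_coord_le (by unfold weightExp; omega)) ?_
    unfold Grid.numEdges
    positivity
  have hC : (0 : ℝ) < C := by
    rcases (Nat.cast_nonneg (α := ℝ) C).eq_or_lt with h | h
    · rw [← h, zero_mul] at hu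
      norm_num at hu
    · exact h
  have hu' : 1 / (C : ℝ) ≤ u (16 * r ^ K) := by
    rw [div_le_iff₀ hC]; linarith
  have hu0 : 0 ≤ u (16 * r ^ K) := le_trans (by positivity) hu'
  have hall : ∀ j, ∃ t L, SolvesIn (program D E K (min j K) c p) (k' j) w t ∧ 2 ^ L < 2 * n ∧
      (t : ℝ) ≤ C' j * time u q a n r K (min j K) L := fun j => by
    have e := hN (min j K) (min_le_right _ _)
    exact hs j n w good (by rw [← hrdef, e]; exact hu0)
      (by rw [← hrdef, e]; exact hu0.trans (huq _))
  choose t L ht hL htime using hall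
  obtain ⟨t', ⟨σ, hσ, hσ'⟩, hle⟩ := hP n w good t fun j _ => ht j
  -- Only here is the shape that fits u and q at this number of nodes selected; the race has run
  -- without knowing it.
  obtain ⟨j, hj, hbal⟩ := exists_balanced (r := r) (x := u (16 * r ^ K)) (y := q (16 * r ^ K))
    (C := 16 * C₁) (K := K) (by exact_mod_cast hr) (one_div_pos.2 hC) hu' (huq _)
    (mul_rpow_le hr hKε hC₁ (hbd _ (by have := Nat.one_le_pow K r hr; omega)))
  have hmin : min j K = j := min_eq_left hj
  have h1 := htime j
  rw [hmin] at h1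
  have h2 := time_le (u := u) (q := q) (a := a) (A := a + 1) (C := C) (Φ := Φ) (n := n)
    (L := L j) hr hj hK (by omega) hrE ((Nat.pow_le_pow_right hr hKE).trans hrE)
    (by rw [hN j hj]; exact hu) (by rw [hN j hj]; exact hu0) (huq _)
    (by rw [hN j hj]; exact hbal)
  have h3 := hlog n r (L j) hr (lt_root_succ_pow hE) hn (hL j)
  set T : ℝ := (n : ℝ) ^ (3 - 1 / (2 * E) : ℝ) with hT
  have hr0 : (0 : ℝ) < r := by exact_mod_cast hr
  have h4 : time u q a n r K j (L j) ≤ X * T := by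
    refine le_of_mul_le_mul_left (h2.trans ?_) hr0
    calc _ ≤ (1 + 16 ^ a + 200000 * (C + 1) * Φ) * (r * (C₅ * T)) := by gcongr
      _ = _ := by rw [hX]; ring
  have hn1 : (1 : ℝ) ≤ n := by exact_mod_cast hn
  have h5 : (n : ℝ) * n ≤ T := by
    rw [← sq, ← Real.rpow_natCast]
    refine Real.rpow_le_rpow_of_exponent_le hn1 ?_
    have : 1 / (2 * (E : ℝ)) ≤ 1 := by
      rw [div_le_one (by positivity)]; linarith
    push_cast
    linarith
  have h6 : C' j ≤ ∑ j ∈ Finset.range (K + 1), C' j :=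
    Finset.single_le_sum (f := C') (fun _ _ => Nat.zero_le _) (Finset.mem_range.2 (by omega))
  have h7 : (C' j : ℝ) ≤ (∑ j ∈ Finset.range (K + 1), C' j : ℕ) := by exact_mod_cast h6
  have hT0 : 0 ≤ T := by positivity
  refine ⟨t', σ, hσ, hσ', ?_⟩
  have h8 : (t' : ℝ) ≤ C'' * (t j + n * n) := by exact_mod_cast hle j hj
  calc (t' : ℝ) ≤ C'' * (t j + n * n) := h8
    _ ≤ C'' * ((∑ j ∈ Finset.range (K + 1), C' j : ℕ) * (X * T) + T) := by
      gcongr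
      exact h1.trans ((mul_le_mul_of_nonneg_left h4 (Nat.cast_nonneg _)).trans
        (mul_le_mul_of_nonneg_right h7 (by positivity)))
    _ = C'' * ((∑ j ∈ Finset.range (K + 1), C' j : ℕ) * X + 1) * T := by ring
    _ ≤ _ := mul_le_mul_of_nonneg_right (Nat.le_ceil _) hT0

end Driver

theorem DynSolvableIn.mono {p : PlanarProblem} {u u' q q' : ℕ → ℝ} (h : DynSolvableIn p u q)
    (hu : ∀ N, u N ≤ u' N) (hq : ∀ N, q N ≤ q' N) : DynSolvableIn p u' q' := by
  obtain ⟨a, h⟩ := h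
  refine ⟨a, fun c => ?_⟩
  obtain ⟨D, k, C, h⟩ := h c
  refine ⟨D, k, C, fun N m G hG ops hops => ?_⟩
  obtain ⟨t₀, t, σ, h1, h2, h3⟩ := h N m G hG ops hops
  refine ⟨t₀, t, σ, h1, h2, h3.trans ?_⟩
  have := hu N
  have := hq N
  gcongr

theorem APSPConjecture.not_isBigO (hAPSP : APSPConjecture) {p : PlanarProblem} {u q : ℕ → ℝ}
    (hsolv : DynSolvableIn p u q) {ε : ℝ} (hε : 0 < ε) (huq : ∀ N, u N ≤ q N) :
    ¬ (fun N : ℕ => q N * u N) =O[Filter.atTop] fun N : ℕ => (N : ℝ) ^ (1 - ε) := by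
  intro h
  -- The comparison function does not vanish for positive N, so one constant serves for all of them
  -- and not only for large N.
  obtain ⟨C, hC, h⟩ := Asymptotics.bound_of_isBigO_nat_atTop h
  obtain ⟨ε', hε', h'⟩ := Driver.apspSolvableIn_of_dynSolvableIn hsolv hε huq hC.le
    fun N hN => by
      have hN0 : (0 : ℝ) < N := by exact_mod_cast hN
      have h1 := Real.rpow_pos_of_pos hN0 (1 - ε)
      have h2 := h (x := N) h1.ne'
      rw [Real.norm_of_nonneg h1.le] at h2
      exact (le_abs_self _).trans h2
  exact hAPSP ε' hε' h'

theorem theorem5 (hAPSP : APSPConjecture) (p : PlanarProblem) (u q : ℕ → ℝ)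
    (hsolv : DynSolvableIn p u q) (ε : ℝ) (hε : 0 < ε) :
    ¬ (fun N : ℕ => max (q N) (u N)) =O[Filter.atTop] (fun N : ℕ => (N : ℝ) ^ (1 / 2 - ε)) ∧
    ((∀ᶠ N : ℕ in Filter.atTop, u N ≤ q N) →
      ¬ (fun N : ℕ => q N * u N) =O[Filter.atTop] (fun N : ℕ => (N : ℝ) ^ (1 - ε))) := by
  constructor
  · intro h
    refine hAPSP.not_isBigO (hsolv.mono (u' := fun N => max (q N) (u N))
      (q' := fun N => max (q N) (u N)) (fun _ => le_max_right _ _) fun _ => le_max_left _ _)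
      -- The square of N to the power 1/2 - ε is N to the power 1 - 2ε.
      (ε := 2 * ε) (by linarith) (fun _ => le_rfl) ((h.mul h).congr' .rfl ?_)
    filter_upwards [Filter.eventually_gt_atTop 0] with N hN
    rw [← Real.rpow_add (by exact_mod_cast hN)]
    congr 1
    ring
  · intro huq h
    -- Increasing q to the maximum makes the comparison with u hold everywhere; it changes only
    -- finitely many values.
    refine hAPSP.not_isBigO (hsolv.mono (u' := u) (q' := fun N => max (q N) (u N))
      (fun _ => le_rfl) fun _ => le_max_left _ _) hε (fun _ => le_max_right _ _)
      (h.congr' ?_ .rfl)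
    filter_upwards [huq] with N hN
    rw [max_eq_left hN]
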